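/- **Setup.** Let $Q$ be a finite quiver with vertex set $I$ and edge set $E$ (loops and multiple edges allowed), $q\in\mathbb C^\times$ not a root of unity, and edge weights $t_e\in\mathbb C^\times$ with $|q|<|t_e|<1$ for all $e\in E$. Products over $e=\vec{ij}$ run over all edges from $i$ to $j$. Put $$\zeta_{ij}\Big(\frac zw\Big)=\Big(\frac{zq^{-1}-w}{z-w}\Big)^{\delta_{ij}}\prod_{e=\vec{ij}}\Big(\frac1{t_e}-\frac zw\Big)\prod_{e=\vec{ji}}\Big(1-\frac{wt_e}{zq}\Big),\qquad \varphi_{ij}\Big(\frac zw\Big)=\Big(\frac{z-w}{zq^{-1}-w}\Big)^{\delta_{ij}}\prod_{e=\vec{ij}}\Big(\frac1{t_e}-\frac zw\Big)^{-1}.$$ *Shuffle algebras.* $\mathbb S^Q=\bigoplus_{k\in\mathbb N^I}\mathbb S^Q_k$, where $\mathbb S^Q_k$ is the space of Laurent polynomials in $\{x_{i,r}\}_{i\in I}^{1\le r\le k_i}$ that are symmetric in $x_{i,1},\dots,x_{i,k_i}$ for each $i$, with the product $F\star G=\frac1{k!\,l!}\mathrm{Sym}\big(F(\{x_{i,r}\}_{r\le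 k_i})\,G(\{x_{j,s}\}_{s>k_j})\prod_{i,j}\prod_{r\le k_i,\,s>k_j}\zeta_{ij}(x_{i,r}/x_{j,s})\big)$ for $F\in\mathbb S^Q_k$, $G\in\mathbb S^Q_l$, where $k!=\prod_ik_i!$. Let $\flat_{ij}(\gamma)=\#\{e=\vec{ij}: t_e=\gamma\}+\#\{e=\vec{ji}: q/t_e=\gamma\}$. Let $S^Q\subset\mathbb S^Q$ be the graded subspace of those $F$ such that $F|_{x_{i,2}=qx_{i,1}}$ is divisible by $(x_{j,1}-\gamma x_{i,1})^{\flat_{ij}(\gamma)}$ for all $i,j\in I$ and $\gamma\in\mathbb C^\times$ (for $j=i$ with a third variable $x_{i,3}$ in place of $x_{j,1}$). *Quiver algebras.* For $b^\pm\in\mathbb Z^I$ let $U_Q^{(b^+,b^-)}$ be the $\mathbb C$-algebra generated by the coefficients of $e_i(z)=\sum_{r\in\mathbb Z}e_{i,r}z^{-r}$, $f_i(z)=\sum_{r\in\mathbb Z}f_{i,r}z^{-r}$, $\psi_i^+(z)=\sum_{r\ge-b_i^+}\psi^+_{i,r}z^{-r}$, $\psi_i^-(z)=\sum_{r\ge-b_i^-}\psi^-_{i,-r}z^{r}$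 and by inverses of the leading coefficients $\psi^\pm_{i,\mp b_i^\pm}$, with the relations: all $\psi$'s commute; $$\zeta_{ji}(\tfrac wz)e_i(z)e_j(w)=\zeta_{ij}(\tfrac zw)e_j(w)e_i(z),\qquad \zeta_{ij}(\tfrac zw)f_i(z)f_j(w)=\zeta_{ji}(\tfrac wz)f_j(w)f_i(z),$$ $$\zeta_{ji}(\tfrac wz)\psi_i^\epsilon(z)e_j(w)=\zeta_{ij}(\tfrac zw)e_j(w)\psi_i^\epsilon(z),\qquad \zeta_{ij}(\tfrac zw)\psi_i^\epsilon(z)f_j(w)=\zeta_{ji}(\tfrac wz)f_j(w)\psi_i^\epsilon(z)$$ (after multiplication by $(\frac zw-1)^{\delta_{ij}}$); $[e_i(z),f_j(w)]=\delta_{ij}\delta(\frac zw)(\psi_i^+(z)-\psi_i^-(z))$ with $\delta(x)=\sum_{n\in\mathbb Z}x^n$; and the cubic Serre relations, i.e. every homogeneous cubic relation among the $e_{i,r}$ (resp. the $f_{i,r}$) that becomes true in $\mathbb S^Q$ (resp. $\mathbb S^{Q,\mathrm{op}}$) under $e_{i,r}\mapsto x_{i,1}^r$ (resp. $f_{i,r}\mapsto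 x_{i,1}^r$). Let $U^>_Q$ and $U^<_Q$ be the algebras generated by the $e_{i,r}$, resp. the $f_{i,r}$, with the quadratic and cubic relations among them. *Difference operators.* Fix $a,N\in\mathbb N^I$ and $\mathsf z_{i,r}\in\mathbb C^\times$ $(i\in I,\ 1\le r\le N_i)$. Let $\gamma^+_{ij}=\sum_{e=\vec{ij}}\log_qt_e$, $\gamma^-_{ij}=-\sum_{e=\vec{ji}}\log_qt_e$, $\gamma^0_{ij}=\gamma^+_{ij}+\gamma^-_{ij}$, so that $q^{\gamma^+_{ij}}=\prod_{e=\vec{ij}}t_e$ and $q^{\gamma^-_{ij}}=\prod_{e=\vec{ji}}t_e^{-1}$. Let $\mathcal A^q$ be the $\mathbb C$-algebra generated by $w_{i,r}^{\pm1},D_{i,r}^{\pm1}$ $(i\in I,\ 1\le r\le a_i)$ and invertible formal powers $P^\pm_{ij}=\big(\prod_{s\le a_j}w_{j,s}\big)^{\gamma^\pm_{ij}}$ $(i,j\in I)$, in which the $w$'s and $P$'s commute with each other, the $D$'s commute with each other, and $$D_{i,r}w_{j,s}=q^{-\delta_{ij}\delta_{rs}}w_{j,s}D_{i,r},\qquad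 D_{\iota,s}P^\pm_{ij}=q^{-\delta_{\iota j}\gamma^\pm_{ij}}P^\pm_{ij}D_{\iota,s}.$$ Let $\widetilde{\mathcal A}^q$ be the localization of $\mathcal A^q$ at the elements $w_{i,r}-q^mw_{i,s}$ $(r\ne s,\ m\in\mathbb Z)$, and let $\widetilde{\mathcal A}^q_{\mathrm{ext}}\supset\widetilde{\mathcal A}^q$ be the further localization at the elements $w_{j,s}-t_eq^mw_{i,r}$ $(e=\vec{ij}\in E,\ (i,r)\ne(j,s),\ m\in\mathbb Z)$. Put $\mathsf Z_i(z)=\prod_{r=1}^{N_i}(1-\mathsf z_{i,r}/z)$, $$Y_{i,r}(z)=\prod_{j\ne i}P^+_{ij}\cdot\frac{\mathsf Z_i(z)\prod_{j\ne i}\prod_{s\le a_j}\prod_{e=\vec{ij}}(\frac1{t_e}-\frac z{w_{j,s}})\prod_{s\ne r}\prod_{e=\vec{ii}}(\frac1{t_e}-\frac z{w_{i,s}})}{\prod_{s\ne r}(1-\frac z{w_{i,s}})},$$ $$Y'_{i,r}(z)=\prod_{j\ne i}P^-_{ij}\cdot\frac{\prod_{j\ne i}\prod_{s\le a_j}\prod_{e=\vec{ji}}(1-\frac{w_{j,s}t_e}{zq})\prod_{s\ne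 r}\prod_{e=\vec{ii}}(1-\frac{w_{i,s}t_e}{zq})}{\prod_{s\ne r}(1-\frac{w_{i,s}}{zq})},$$ $$b_i^+=\sum_ja_j\,\#\{e=\vec{ij}\}-a_i,\qquad b_i^-=N_i+\sum_ja_j\,\#\{e=\vec{ji}\}-a_i .$$ **Theorem.** *(GKLO-type homomorphism)* There is a $\mathbb C$-algebra homomorphism $\widetilde\Phi:U_Q^{(b^+,b^-)}\to\widetilde{\mathcal A}^q$ with $$e_i(z)\mapsto\sum_{r\le a_i}\delta\Big(\frac{w_{i,r}}z\Big)Y_{i,r}(w_{i,r})D_{i,r}^{-1},\qquad f_i(z)\mapsto\sum_{r\le a_i}\delta\Big(\frac{w_{i,r}}{qz}\Big)Y'_{i,r}(w_{i,r}q^{-1})D_{i,r},$$ $$\psi_i^\pm(z)\mapsto\frac{q^{-1}-1}{\prod_{e=\vec{ii}}\{(\frac1{t_e}-1)(1-\frac{t_e}q)\}}\prod_{j\ne i}P^+_{ij}P^-_{ij}\left(\mathsf Z_i(z)\frac{\prod_{j}\prod_{s\le a_j}\{\prod_{e=\vec{ij}}(\frac1{t_e}-\frac z{w_{j,s}})\prod_{e=\vec{ji}}(1-\frac{w_{j,s}t_e}{zq})\}}{\prod_{r\le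 a_i}\{(1-\frac z{w_{i,r}})(1-\frac{w_{i,r}}{zq})\}}\right)^{\pm},$$ where $(\cdot)^\pm$ denotes the expansion in $z^{\mp1}$. Moreover: (a) The assignment $$\mathbb S^Q_k\ni F\mapsto\prod_i\prod_{e=\vec{ii}}t_e^{\frac{k_i-k_i^2}2}\sum_{\substack{m^{(i)}_r\in\mathbb N\\ m^{(i)}_1+\dots+m^{(i)}_{a_i}=k_i\ \forall i}}\Bigg\{\prod_i\prod_{r\le a_i}\prod_{p=1}^{m^{(i)}_r}Y_{i,r}(w_{i,r}q^{p-1})\cdot F\Big(\{w_{i,r}q^{p-1}\}_{i\in I,\,r\le a_i}^{1\le p\le m^{(i)}_r}\Big)$$ $$\times\prod_i\prod_{r\le a_i}\prod_{1\le p_1<p_2\le m^{(i)}_r}\Big(\zeta_{ii}^{-1}\Big(\frac{w_{i,r}q^{p_1-1}}{w_{i,r}q^{p_2-1}}\Big)\prod_{e=\vec{ii}}t_e\Big)\prod_{(i,r_1)\ne(j,r_2)}\prod_{p_1\le m^{(i)}_{r_1}}\prod_{p_2\le m^{(j)}_{r_2}}\varphi_{ij}\Big(\frac{w_{i,r_1}q^{p_1-1}}{w_{j,r_2}q^{p_2-1}}\Big)\cdot\prod_i\prod_{r\le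 a_i}D_{i,r}^{-m^{(i)}_r}\Bigg\}$$ gives rise to a $\mathbb C$-algebra homomorphism $\widehat\Phi:\mathbb S^Q\to\widetilde{\mathcal A}^q_{\mathrm{ext}}$, and $\widehat\Phi(S^Q)\subset\widetilde{\mathcal A}^q$. The assignment $e_{i,r}\mapsto x_{i,1}^r$ gives rise to an algebra homomorphism $\Upsilon:U_Q^>\to\mathbb S^Q$ with image in $S^Q$, and $\widehat\Phi\circ\Upsilon$ equals the composition of the natural map $U_Q^>\to U_Q^{(b^+,b^-)}$, $e_{i,r}\mapsto e_{i,r}$, with $\widetilde\Phi$. (b) The assignment $$\mathbb S^{Q,\mathrm{op}}_k\ni F\mapsto\prod_i\prod_{e=\vec{ii}}t_e^{\frac{k_i-k_i^2}2}\sum_{\substack{m^{(i)}_r\in\mathbb N\\ m^{(i)}_1+\dots+m^{(i)}_{a_i}=k_i\ \forall i}}\Bigg\{\prod_i\prod_{r\le a_i}\prod_{p=1}^{m^{(i)}_r}Y'_{i,r}(w_{i,r}q^{-p})\cdot F\Big(\{w_{i,r}q^{-p}\}_{i\in I,\,r\le a_i}^{1\le p\le m^{(i)}_r}\Big)$$ $$\times\prod_i\prod_{r\le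 a_i}\prod_{1\le p_1<p_2\le m^{(i)}_r}\Big(\zeta_{ii}^{-1}\Big(\frac{w_{i,r}q^{-p_2}}{w_{i,r}q^{-p_1}}\Big)\prod_{e=\vec{ii}}t_e\Big)\prod_{(i,r_1)\ne(j,r_2)}\prod_{p_1\le m^{(i)}_{r_1}}\prod_{p_2\le m^{(j)}_{r_2}}\varphi_{ji}\Big(\frac{w_{j,r_2}q^{-p_2}}{w_{i,r_1}q^{-p_1}}\Big)\cdot\prod_i\prod_{r\le a_i}D_{i,r}^{m^{(i)}_r}\Bigg\}$$ gives rise to a $\mathbb C$-algebra homomorphism $\widehat\Phi:\mathbb S^{Q,\mathrm{op}}\to\widetilde{\mathcal A}^q_{\mathrm{ext}}$, and it maps $S^Q$ into $\widetilde{\mathcal A}^q$. The assignment $f_{i,r}\mapsto x_{i,1}^r$ gives rise to an algebra homomorphism $\Upsilon:U_Q^<\to\mathbb S^{Q,\mathrm{op}}$ with image in $S^Q$, and $\widehat\Phi\circ\Upsilon$ equals the composition of the natural map $U_Q^<\to U_Q^{(b^+,b^-)}$, $f_{i,r}\mapsto f_{i,r}$, with $\widetilde\Phi$. -/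

import Mathlib

set_option linter.unusedSectionVars false

noncomputable section

/-- Laurent polynomials over `ℂ` in the variables `x_v`, `v : σ`. -/
abbrev Lau (σ : Type*) := AddMonoidAlgebra ℂ (σ → ℤ)

namespace Lau

/-- The variable `x_v`, as a unit. -/
def gen {σ : Type*} [DecidableEq σ] (v : σ) : (Lau σ)ˣ where
  val := AddMonoidAlgebra.single (Pi.single v 1) 1
  inv := AddMonoidAlgebra.single (Pi.single v (-1)) 1
  val_inv := by
    rw [AddMonoidAlgebra.single_mul_single, ← Pi.single_add]
    simp [AddMonoidAlgebra.one_def]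
  inv_val := by
    rw [AddMonoidAlgebra.single_mul_single, ← Pi.single_add]
    simp [AddMonoidAlgebra.one_def]

/-- Evaluation `x_v ↦ y_v` of Laurent polynomials at units of a commutative `ℂ`-algebra. -/
def eval {σ : Type*} [Fintype σ] {R : Type*} [CommRing R] [Algebra ℂ R] (y : σ → Rˣ) :
    Lau σ →ₐ[ℂ] R :=
  AddMonoidAlgebra.lift ℂ R (σ → ℤ)
    { toFun := fun n => ((∏ v, y v ^ (n.toAdd v) : Rˣ) : R)
      map_one' := by simp
      map_mul' := fun m n => by
        simp [zpow_add, Finset.prod_mul_distrib] }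

theorem eval_single {σ : Type*} [Fintype σ] {R : Type*} [CommRing R] [Algebra ℂ R]
    (y : σ → Rˣ) (n : σ → ℤ) :
    eval y (AddMonoidAlgebra.single n 1) = ((∏ v, y v ^ n v : Rˣ) : R) := by
  simp only [eval, AddMonoidAlgebra.lift_single, one_smul]
  rfl

theorem eval_gen {σ : Type*} [Fintype σ] [DecidableEq σ] {R : Type*} [CommRing R] [Algebra ℂ R]
    (y : σ → Rˣ) (v : σ) : eval y (gen v).val = y v := by
  rw [show (gen v).val = (AddMonoidAlgebra.single (Pi.single v 1) 1 : Lau σ) from rfl, eval_single,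
    Finset.prod_eq_single v] <;> simp +contextual

theorem single_eq_prod {σ : Type*} [Fintype σ] [DecidableEq σ] (n : σ → ℤ) :
    (AddMonoidAlgebra.single n 1 : Lau σ) = ((∏ v, gen v ^ n v : (Lau σ)ˣ) : Lau σ) := by
  let u : Multiplicative (σ → ℤ) →* (Lau σ)ˣ := (AddMonoidAlgebra.of ℂ (σ → ℤ)).toHomUnits
  have hu : ∀ m : σ → ℤ, ((u (Multiplicative.ofAdd m)) : Lau σ) = AddMonoidAlgebra.single m 1 :=
    fun m => rfl
  have hg : ∀ v, u (Multiplicative.ofAdd (Pi.single v 1)) = gen v := fun v => Units.ext (hu _)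
  rw [← hu]
  congr 1
  have hn : n = ∑ v, n v • (Pi.single v 1 : σ → ℤ) := by
    ext w
    simp [Finset.sum_apply, Pi.single_apply]
  conv_lhs => rw [hn]
  rw [ofAdd_sum, map_prod]
  refine Finset.prod_congr rfl fun v _ => ?_
  rw [ofAdd_zsmul, map_zpow, hg]

theorem algHom_ext {σ : Type*} [Fintype σ] [DecidableEq σ] {R : Type*} [CommRing R] [Algebra ℂ R]
    {f g : Lau σ →ₐ[ℂ] R} (h : ∀ v, f (gen v).val = g (gen v).val) : f = g := by
  have hU : ∀ v, Units.map (f : Lau σ →* R) (gen v) = Units.map (g : Lau σ →* R) (gen v) :=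
    fun v => Units.ext (h v)
  apply AddMonoidAlgebra.algHom_ext
  · intro n
    rw [single_eq_prod]
    have h1 := congrArg Units.val (show Units.map (f : Lau σ →* R) (∏ v, gen v ^ n v) =
      Units.map (g : Lau σ →* R) (∏ v, gen v ^ n v) by
        simp only [map_prod, map_zpow, hU])
    exact h1
  · ext

/-- The torus `(ℂ^×)^σ` acts on Laurent polynomials by rescaling the variables, `x_v ↦ c_v x_v`. -/
def torus {σ : Type*} [Fintype σ] [DecidableEq σ] : (σ → ℂˣ) →* (Lau σ ≃ₐ[ℂ] Lau σ) :=
  have key : ∀ c d : σ → ℂˣ,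
      (eval fun v => Units.map (algebraMap ℂ (Lau σ) : ℂ →* Lau σ) (c v) * gen v).comp
        (eval fun v => Units.map (algebraMap ℂ (Lau σ) : ℂ →* Lau σ) (d v) * gen v) =
      eval fun v => Units.map (algebraMap ℂ (Lau σ) : ℂ →* Lau σ) ((c * d) v) * gen v := by
    intro c d
    apply algHom_ext
    intro v
    simp only [AlgHom.comp_apply, eval_gen, Units.val_mul, map_mul, Units.coe_map, Pi.mul_apply,
      MonoidHom.coe_coe, AlgHom.commutes]
    ring
  have key1 : (eval fun v => Units.map (algebraMap ℂ (Lau σ) : ℂ →* Lau σ)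
      ((1 : σ → ℂˣ) v) * gen v) = AlgHom.id ℂ (Lau σ) := by
    apply algHom_ext
    intro v
    simp [eval_gen]
  { toFun := fun c => AlgEquiv.ofAlgHom
      (eval fun v => Units.map (algebraMap ℂ (Lau σ) : ℂ →* Lau σ) (c v) * gen v)
      (eval fun v => Units.map (algebraMap ℂ (Lau σ) : ℂ →* Lau σ) (c⁻¹ v) * gen v)
      (by rw [key, mul_inv_cancel, key1]) (by rw [key, inv_mul_cancel, key1])
    map_one' := by
      apply AlgEquiv.ext
      intro x
      exact congrArg (fun f : Lau σ →ₐ[ℂ] Lau σ => f x) key1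
    map_mul' := fun c d => by
      apply AlgEquiv.ext
      intro x
      exact (congrArg (fun f : Lau σ →ₐ[ℂ] Lau σ => f x) (key c d)).symm }

end Lau

/-- A quiver with vertex set `I` and edge set `E` (multiple edges and loops allowed), a parameter
`q ∈ ℂ^×` and edge weights `t_e ∈ ℂ^×`. -/
structure WeightedQuiver (I E : Type*) where
  src : E → I
  tgt : E → I
  q : ℂˣ
  t : E → ℂˣ

namespace WeightedQuiver

variable {I E : Type*} [Fintype I] [DecidableEq I] [Fintype E] (Q : WeightedQuiver I E)

/-- The edges from `i` to `j`. -/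
def edges (i j : I) : Finset E := Finset.univ.filter fun e => Q.src e = i ∧ Q.tgt e = j

/-- The parameter `q` in a field extension of `ℂ`. -/
abbrev qIn (L : Type*) [Field L] [Algebra ℂ L] : L := algebraMap ℂ L (Q.q : ℂ)

/-- The edge weight `t_e` in a field extension of `ℂ`. -/
abbrev tIn (L : Type*) [Field L] [Algebra ℂ L] (e : E) : L := algebraMap ℂ L (Q.t e : ℂ)

/-- The rational function `ζ_{ij}(z/w)`. -/
def zeta {L : Type*} [Field L] [Algebra ℂ L] (i j : I) (z w : L) : L :=
  (if i = j then (z * (Q.qIn L)⁻¹ - w) / (z - w) else 1) *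
    (∏ e ∈ Q.edges i j, ((Q.tIn L e)⁻¹ - z / w)) *
    ∏ e ∈ Q.edges j i, (1 - w * Q.tIn L e / (z * Q.qIn L))

/-- The rational function `φ_{ij}(z/w)`. -/
def phi {L : Type*} [Field L] [Algebra ℂ L] (i j : I) (z w : L) : L :=
  (if i = j then (z - w) / (z * (Q.qIn L)⁻¹ - w) else 1) *
    ∏ e ∈ Q.edges i j, ((Q.tIn L e)⁻¹ - z / w)⁻¹

/-! ### The big shuffle algebra -/

/-- Functions on finite configurations of `I`-coloured points of `ℂ^×`, points of the same colour
being distinct. -/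
def ConfFun (_Q : WeightedQuiver I E) : Type _ := Finset (I × ℂˣ) → ℂ

namespace ConfFun

/-- A function on configurations. -/
def mk {Q : WeightedQuiver I E} (f : Finset (I × ℂˣ) → ℂ) : Q.ConfFun := f

instance : AddCommGroup Q.ConfFun := inferInstanceAs (AddCommGroup (Finset (I × ℂˣ) → ℂ))
instance : Module ℂ Q.ConfFun := inferInstanceAs (Module ℂ (Finset (I × ℂˣ) → ℂ))

/-- `∏_{a ∈ A, b ∈ B} ζ_{c(a)c(b)}(x_a / x_b)`, where `c` is the colour. -/
def zetaProd (A B : Finset (I × ℂˣ)) : ℂ :=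
  ∏ a ∈ A, ∏ b ∈ B, Q.zeta a.1 b.1 (a.2 : ℂ) (b.2 : ℂ)

/-- The shuffle product: the sum over all ways to distribute the variables between the two factors.
For symmetric functions `F` and `G` of multidegrees `k` and `l` this is
`1/(k! l!) * Sym (F(x_{i,1..k_i}) G(x_{i,k_i+1..k_i+l_i}) ∏ ζ_{ij}(x_{i,r}/x_{j,s}))`, where
`r ≤ k_i` and `s > k_j`. -/
instance : Mul Q.ConfFun :=
  ⟨fun f g => fun S => ∑ A ∈ S.powerset, f A * g (S \ A) * zetaProd Q A (S \ A)⟩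

instance : One Q.ConfFun := ⟨fun S => if S = ∅ then 1 else 0⟩

variable {Q}

theorem mul_apply (f g : Q.ConfFun) (S : Finset (I × ℂˣ)) :
    (f * g) S = ∑ A ∈ S.powerset, f A * g (S \ A) * zetaProd Q A (S \ A) := rfl

theorem mk_apply (f : Finset (I × ℂˣ) → ℂ) (S : Finset (I × ℂˣ)) :
    (mk f : Q.ConfFun) S = f S := rfl

theorem one_apply (S : Finset (I × ℂˣ)) : (1 : Q.ConfFun) S = if S = ∅ then 1 else 0 := rfl

theorem add_apply (f g : Q.ConfFun) (S : Finset (I × ℂˣ)) : (f + g) S = f S + g S := rfl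
theorem zero_apply (S : Finset (I × ℂˣ)) : (0 : Q.ConfFun) S = 0 := rfl
theorem smul_apply (c : ℂ) (f : Q.ConfFun) (S : Finset (I × ℂˣ)) : (c • f) S = c * f S := rfl

@[ext] theorem ext {f g : Q.ConfFun} (h : ∀ S, f S = g S) : f = g := funext h

theorem zetaProd_disjUnion_left {A B : Finset (I × ℂˣ)} (h : Disjoint A B) (C : Finset (I × ℂˣ)) :
    zetaProd Q (A ∪ B) C = zetaProd Q A C * zetaProd Q B C := Finset.prod_union h

theorem zetaProd_disjUnion_right {A B : Finset (I × ℂˣ)} (h : Disjoint A B) (C : Finset (I × ℂˣ)) :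
    zetaProd Q C (A ∪ B) = zetaProd Q C A * zetaProd Q C B := by
  simp only [zetaProd, Finset.prod_union h, Finset.prod_mul_distrib]

protected theorem mul_assoc (f g h : Q.ConfFun) : f * g * h = f * (g * h) := by
  ext S
  simp only [mul_apply, Finset.sum_mul, Finset.mul_sum]
  rw [Finset.sum_sigma', Finset.sum_sigma']
  refine Finset.sum_bij' (fun p _ => ⟨p.2, p.1 \ p.2⟩) (fun p _ => ⟨p.1 ∪ p.2, p.1⟩) ?_ ?_ ?_ ?_ ?_
  · rintro ⟨A, B⟩ hp
    simp only [Finset.mem_sigma, Finset.mem_powerset] at hp ⊢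
    exact ⟨hp.2.trans hp.1, Finset.sdiff_subset_sdiff hp.1 le_rfl⟩
  · rintro ⟨B, C⟩ hp
    simp only [Finset.mem_sigma, Finset.mem_powerset] at hp ⊢
    exact ⟨Finset.union_subset hp.1 (hp.2.trans Finset.sdiff_subset), Finset.subset_union_left⟩
  · rintro ⟨A, B⟩ hp
    simp only [Finset.mem_sigma, Finset.mem_powerset] at hp
    simp [Finset.union_sdiff_of_subset hp.2]
  · rintro ⟨B, C⟩ hp
    simp only [Finset.mem_sigma, Finset.mem_powerset] at hp
    have hd : Disjoint B C := (Finset.disjoint_sdiff.mono_right hp.2)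
    simp [Finset.union_sdiff_cancel_left hd]
  · rintro ⟨A, B⟩ hp
    simp only [Finset.mem_sigma, Finset.mem_powerset] at hp
    obtain ⟨hA, hB⟩ := hp
    have e1 : (S \ B) \ (A \ B) = S \ A := by
      rw [sdiff_sdiff_left, Finset.sup_eq_union, Finset.union_sdiff_of_subset hB]
    have e2 : S \ B = (A \ B) ∪ (S \ A) := by
      ext x
      have := @hA x
      have := @hB x
      simp only [Finset.mem_sdiff, Finset.mem_union]
      tauto
    have d2 : Disjoint (A \ B) (S \ A) :=
      Finset.disjoint_sdiff.mono_left Finset.sdiff_subset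
    have e3 : zetaProd Q A (S \ A) = zetaProd Q B (S \ A) * zetaProd Q (A \ B) (S \ A) := by
      rw [← zetaProd_disjUnion_left Finset.disjoint_sdiff, Finset.union_sdiff_of_subset hB]
    have e4 : zetaProd Q B (S \ B) = zetaProd Q B (A \ B) * zetaProd Q B (S \ A) := by
      rw [e2, zetaProd_disjUnion_right d2]
    simp only [e1, e3, e4]
    ring

protected theorem one_mul (f : Q.ConfFun) : 1 * f = f := by
  ext S
  rw [mul_apply, Finset.sum_eq_single ∅]
  · simp [one_apply, zetaProd]
  · intro A _ hA
    simp [one_apply, hA]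
  · simp

protected theorem mul_one (f : Q.ConfFun) : f * 1 = f := by
  ext S
  rw [mul_apply, Finset.sum_eq_single S]
  · simp [one_apply, zetaProd]
  · intro A hA hAS
    have : S \ A ≠ ∅ := fun h =>
      hAS (Finset.Subset.antisymm (Finset.mem_powerset.1 hA) (Finset.sdiff_eq_empty_iff_subset.1 h))
    simp [one_apply, this]
  · simp

instance : Ring Q.ConfFun :=
  { (inferInstance : AddCommGroup Q.ConfFun), (inferInstance : Mul Q.ConfFun),
    (inferInstance : One Q.ConfFun) with
    left_distrib := fun f g h => by
      ext S
      simp only [mul_apply, add_apply, mul_add, add_mul, Finset.sum_add_distrib]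
    right_distrib := fun f g h => by
      ext S
      simp only [mul_apply, add_apply, add_mul, Finset.sum_add_distrib]
    zero_mul := fun f => by
      ext S
      simp [mul_apply, zero_apply]
    mul_zero := fun f => by
      ext S
      simp [mul_apply, zero_apply]
    mul_assoc := ConfFun.mul_assoc
    one_mul := ConfFun.one_mul
    mul_one := ConfFun.mul_one }

instance : Algebra ℂ Q.ConfFun :=
  Algebra.ofModule
    (fun c f g => by
      ext S
      simp only [mul_apply, smul_apply, Finset.mul_sum, mul_assoc])
    (fun c f g => by
      ext S
      simp only [mul_apply, smul_apply, Finset.mul_sum]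
      exact Finset.sum_congr rfl fun A _ => by ring)

end ConfFun

/-- The variables `x_{i,r}`, `r ≤ k_i`, in multidegree `k`. -/
abbrev Vars (k : I → ℕ) := Σ i, Fin (k i)

/-- Laurent polynomials in `x_{i,r}`, `r ≤ k_i`, symmetric in the variables of each colour. -/
def SymLau (k : I → ℕ) : Submodule ℂ (Lau (Vars k)) where
  carrier := {F | ∀ π : ∀ i, Equiv.Perm (Fin (k i)),
    Lau.eval (fun v : Vars k => Lau.gen (⟨v.1, π v.1 v.2⟩ : Vars k)) F = F}
  add_mem' := fun hF hG π => by rw [map_add, hF, hG]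
  zero_mem' := fun π => map_zero _
  smul_mem' := fun c F hF π => by rw [map_smul, hF]

/-- The configuration with points `x_{i,r}` of colour `i`. -/
def conf {k : I → ℕ} (x : Vars k → ℂˣ) : Finset (I × ℂˣ) :=
  Finset.univ.image fun v : Vars k => (v.1, x v)

/-- Points of the same colour are distinct. -/
def Separated {k : I → ℕ} {R : Type*} (x : Vars k → R) : Prop :=
  ∀ i, Function.Injective fun r => x ⟨i, r⟩

open scoped Classical in
/-- A Laurent polynomial `F` in `x_{i,r}`, `r ≤ k_i`, as a function on configurations: its value at
the configuration of the points `x_{i,r}` is `F(x)`, and it vanishes at all configurations of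
multidegree different from `k`. (For symmetric `F` the labelling of the points is immaterial.) -/
def toConf (k : I → ℕ) : Lau (Vars k) →ₗ[ℂ] Q.ConfFun where
  toFun F := ConfFun.mk fun S => if h : ∃ x : Vars k → ℂˣ, Separated x ∧ conf x = S
    then Lau.eval h.choose F else 0
  map_add' F G := by
    ext S
    simp only [ConfFun.add_apply, ConfFun.mk_apply]
    split_ifs <;> simp
  map_smul' c F := by
    ext S
    simp only [ConfFun.smul_apply, ConfFun.mk_apply, RingHom.id_apply]
    split_ifs <;> simp

end WeightedQuiver
namespace Lau

variable {σ : Type*} [Fintype σ] [DecidableEq σ]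

theorem hom_eval {R S : Type*} [CommRing R] [Algebra ℂ R] [CommRing S]
    [Algebra ℂ S] (g : R →ₐ[ℂ] S) (y : σ → Rˣ) (F : Lau σ) :
    g (eval y F) = eval (fun v => Units.map (g : R →* S) (y v)) F := by
  have : g.comp (eval y) = eval (fun v => Units.map (g : R →* S) (y v)) := by
    apply algHom_ext
    intro v
    simp [eval_gen]
  exact congrArg (fun f : Lau σ →ₐ[ℂ] S => f F) this

theorem eval_eval {τ : Type*} [Fintype τ] [DecidableEq τ] {S : Type*} [CommRing S]
    [Algebra ℂ S] (x : σ → Sˣ) (e : τ → σ) (F : Lau τ) :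
    eval x (eval (fun v => gen (e v)) F) = eval (fun v => x (e v)) F := by
  rw [hom_eval]
  congr 1
  congr 1
  ext v
  simp [eval_gen]

/-- A Laurent polynomial that vanishes on the whole torus is zero. -/
theorem eq_zero_of_eval {p : Lau σ} (h : ∀ x : σ → ℂˣ, eval x p = 0) : p = 0 := by
  let χ : (σ → ℤ) → ((σ → ℂˣ) →* ℂ) := fun n =>
    { toFun := fun x => ((∏ v, x v ^ n v : ℂˣ) : ℂ)
      map_one' := by simp
      map_mul' := fun x y => by simp [mul_zpow, Finset.prod_mul_distrib] }
  have hχ : Function.Injective χ := by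
    intro m n hmn
    ext v
    have h2 : (2 : ℂ) ≠ 0 := two_ne_zero
    have h1 := DFunLike.congr_fun hmn (Function.update (1 : σ → ℂˣ) v (Units.mk0 2 h2))
    have e : ∀ k : σ → ℤ, χ k (Function.update (1 : σ → ℂˣ) v (Units.mk0 2 h2)) = (2 : ℂ) ^ k v := by
      intro k
      change ((∏ w, (Function.update (1 : σ → ℂˣ) v (Units.mk0 2 h2)) w ^ k w : ℂˣ) : ℂ) = _
      rw [Finset.prod_eq_single v]
      · simp
      · intro w _ hw
        simp [Function.update_of_ne hw]
      · simp
    rw [e, e] at h1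
    have h4 : (2 : ℝ) ^ m v = (2 : ℝ) ^ n v := by
      have h3 := congrArg norm h1
      simpa [norm_zpow] using h3
    exact zpow_right_injective₀ (by norm_num) (by norm_num) h4
  have hli := (linearIndependent_monoidHom (σ → ℂˣ) ℂ).comp χ hχ
  rw [linearIndependent_iff] at hli
  have h0 : p.coeff = 0 := by
    apply hli
    ext x
    have hx := h x
    rw [eval, AddMonoidAlgebra.lift_apply] at hx
    rw [Finsupp.linearCombination_apply, Finsupp.sum, Finset.sum_apply]
    exact hx
  ext n
  exact DFunLike.congr_fun h0 n

/-- Specialization `x_c ↦ x_d`. -/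
def merge (c d : σ) : Lau σ →ₐ[ℂ] Lau σ := eval (fun v => gen (if v = c then d else v))

theorem dvd_sub_merge (c d : σ) (p : Lau σ) :
    (gen c).val - (gen d).val ∣ p - merge c d p := by
  rw [← Ideal.mem_span_singleton, ← Ideal.Quotient.mk_eq_mk_iff_sub_mem]
  have : (Ideal.Quotient.mkₐ ℂ (Ideal.span {(gen c).val - (gen d).val})) =
      (Ideal.Quotient.mkₐ ℂ (Ideal.span {(gen c).val - (gen d).val})).comp (merge c d) := by
    apply algHom_ext
    intro v
    simp only [AlgHom.comp_apply, merge, eval_gen]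
    split_ifs with hv
    · subst hv
      exact (Ideal.Quotient.mk_eq_mk_iff_sub_mem _ _).2 (Ideal.mem_span_singleton_self _)
    · rfl
  exact congrArg (fun f : Lau σ →ₐ[ℂ] _ => f p) this

theorem gen_injective : Function.Injective (fun v : σ => (gen v).val) := by
  intro a b hab
  by_contra hne
  have h1 := congrArg (eval (Function.update (1 : σ → ℂˣ) a (Units.mk0 2 two_ne_zero))) hab
  simp only [eval_gen, Function.update_self, Function.update_of_ne (Ne.symm hne)] at h1
  norm_num at h1

theorem prod_dvd {ι : Type*} [DecidableEq ι] (T : Finset ι) (c d : ι → σ)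
    (hne : ∀ p ∈ T, c p ≠ d p)
    (hd : ∀ p ∈ T, ∀ p' ∈ T, p ≠ p' →
      ¬ (c p = c p' ∧ d p = d p') ∧ ¬ (c p = d p' ∧ d p = c p'))
    (P : Lau σ) (h : ∀ p ∈ T, (gen (c p)).val - (gen (d p)).val ∣ P) :
    ∏ p ∈ T, ((gen (c p)).val - (gen (d p)).val) ∣ P := by
  induction T using Finset.induction_on with
  | empty => simp
  | insert a T ha ih =>
    obtain ⟨R, hR⟩ := ih (fun p hp => hne p (Finset.mem_insert_of_mem hp))
      (fun p hp p' hp' => hd p (Finset.mem_insert_of_mem hp) p' (Finset.mem_insert_of_mem hp'))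
      (fun p hp => h p (Finset.mem_insert_of_mem hp))
    have hmd : merge (c a) (d a) ((gen (c a)).val - (gen (d a)).val) = 0 := by
      rw [map_sub, merge, eval_gen, eval_gen]
      simp
    have h0 : merge (c a) (d a) P = 0 := by
      obtain ⟨W, hW⟩ := h a (Finset.mem_insert_self _ _)
      rw [hW, map_mul, hmd, zero_mul]
    have h1 : merge (c a) (d a) (∏ p ∈ T, ((gen (c p)).val - (gen (d p)).val)) ≠ 0 := by
      rw [map_prod, Finset.prod_ne_zero_iff]
      intro p hp
      rw [map_sub, merge, eval_gen, eval_gen, sub_ne_zero]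
      intro heq
      have heq' := gen_injective heq
      have hpa : p ≠ a := fun hpa => ha (hpa ▸ hp)
      have h2 := hd p (Finset.mem_insert_of_mem hp) a (Finset.mem_insert_self _ _) hpa
      have h3 := hne p (Finset.mem_insert_of_mem hp)
      have h4 := hne a (Finset.mem_insert_self _ _)
      split_ifs at heq' with e1 e2 e2
      · exact h3 (e1.trans e2.symm)
      · exact h2.1 ⟨e1, heq'.symm⟩
      · exact h2.2 ⟨heq', e2⟩
      · exact h3 heq'
    rw [hR, map_mul] at h0
    have h5 : merge (c a) (d a) R = 0 := (mul_eq_zero.1 h0).resolve_left h1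
    have h6 := dvd_sub_merge (c a) (d a) R
    rw [h5, sub_zero] at h6
    rw [Finset.prod_insert ha, hR, mul_comm]
    exact mul_dvd_mul_left _ h6

end Lau
namespace WeightedQuiver

variable {I E : Type*} [Fintype I] [DecidableEq I] [Fintype E] (Q : WeightedQuiver I E)

theorem conf_comp {k : I → ℕ} (x : Vars k → ℂˣ) (π : ∀ i, Equiv.Perm (Fin (k i))) :
    conf (fun v : Vars k => x ⟨v.1, π v.1 v.2⟩) = conf x := by
  ext ⟨i, z⟩
  simp only [conf, Finset.mem_image, Finset.mem_univ, true_and, Prod.mk.injEq]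
  constructor
  · rintro ⟨v, rfl, rfl⟩
    exact ⟨⟨v.1, π v.1 v.2⟩, rfl, rfl⟩
  · rintro ⟨⟨j, r⟩, rfl, rfl⟩
    exact ⟨⟨j, (π j).symm r⟩, rfl, by simp⟩

theorem exists_perm {k : I → ℕ} {x y : Vars k → ℂˣ} (hy : Separated y) (h : conf x = conf y) :
    ∃ π : ∀ i, Equiv.Perm (Fin (k i)), y = fun v => x ⟨v.1, π v.1 v.2⟩ := by
  have h1 : ∀ i (r : Fin (k i)), ∃ s : Fin (k i), x ⟨i, s⟩ = y ⟨i, r⟩ := by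
    intro i r
    have : (i, y ⟨i, r⟩) ∈ conf x := by
      rw [h]
      exact Finset.mem_image.2 ⟨⟨i, r⟩, Finset.mem_univ _, rfl⟩
    obtain ⟨⟨j, s⟩, -, hs⟩ := Finset.mem_image.1 this
    simp only [Prod.mk.injEq] at hs
    obtain ⟨rfl, hs⟩ := hs
    exact ⟨s, hs⟩
  choose π hπ using h1
  have hinj : ∀ i, Function.Injective (π i) := fun i r s hrs => hy i (by
    simp only [← hπ, hrs])
  refine ⟨fun i => Equiv.ofBijective (π i) (Finite.injective_iff_bijective.1 (hinj i)), ?_⟩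
  funext v
  exact (hπ v.1 v.2).symm

theorem toConf_conf {k : I → ℕ} {F : Lau (Vars k)} (hF : F ∈ SymLau k) {x : Vars k → ℂˣ}
    (hx : Separated x) : Q.toConf k F (conf x) = Lau.eval x F := by
  have h : ∃ y : Vars k → ℂˣ, Separated y ∧ conf y = conf x := ⟨x, hx, rfl⟩
  have e : Q.toConf k F (conf x) = Lau.eval h.choose F := dif_pos h
  rw [e]
  obtain ⟨π, hπ⟩ := exists_perm h.choose_spec.1 h.choose_spec.2.symm
  rw [hπ, ← Lau.eval_eval x (fun v : Vars k => (⟨v.1, π v.1 v.2⟩ : Vars k)), hF π]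

theorem toConf_of_not {k : I → ℕ} (F : Lau (Vars k)) {S : Finset (I × ℂˣ)}
    (h : ¬ ∃ y : Vars k → ℂˣ, Separated y ∧ conf y = S) : Q.toConf k F S = 0 := dif_neg h

/-- `∏_i ∏_{r < s} (x_{i,s} - x_{i,r})`. -/
def vdm (n : I → ℕ) : Lau (Vars n) :=
  ∏ i, (Matrix.vandermonde fun r : Fin (n i) => (Lau.gen (⟨i, r⟩ : Vars n)).val).det

theorem eval_vdm {n : I → ℕ} (x : Vars n → ℂˣ) :
    Lau.eval x (vdm n) = ∏ i, (Matrix.vandermonde fun r : Fin (n i) => (x ⟨i, r⟩ : ℂ)).det := by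
  simp only [vdm, map_prod, Matrix.det_vandermonde, map_sub, Lau.eval_gen]

theorem eval_vdm_ne_zero {n : I → ℕ} {x : Vars n → ℂˣ} (hx : Separated x) :
    Lau.eval x (vdm n) ≠ 0 := by
  rw [eval_vdm, Finset.prod_ne_zero_iff]
  intro i _
  rw [Matrix.det_vandermonde_ne_zero_iff]
  intro r s h
  exact hx i (Units.ext h)

theorem eq_zero_of_separated {n : I → ℕ} {p : Lau (Vars n)}
    (h : ∀ x : Vars n → ℂˣ, Separated x → Lau.eval x p = 0) : p = 0 := by
  have h1 : p * vdm n = 0 := by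
    apply Lau.eq_zero_of_eval
    intro x
    rw [map_mul]
    by_cases hx : Separated x
    · rw [h x hx, zero_mul]
    · have : Lau.eval x (vdm n) = 0 := by
        rw [eval_vdm]
        simp only [Separated, not_forall] at hx
        obtain ⟨i, hi⟩ := hx
        apply Finset.prod_eq_zero (Finset.mem_univ i)
        by_contra h0
        rw [← ne_eq, Matrix.det_vandermonde_ne_zero_iff] at h0
        exact hi fun r s hrs => h0 (congrArg Units.val hrs)
      rw [this, mul_zero]
  refine (mul_eq_zero.1 h1).resolve_right fun h0 => ?_
  have hx : Separated (fun v : Vars n => Units.mk0 (((v.2 : ℕ) : ℂ) + 1)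
      (Nat.cast_add_one_ne_zero _)) := by
    intro i r s hrs
    have := congrArg Units.val hrs
    simp only [Units.val_mk0, add_left_inj, Nat.cast_inj] at this
    exact Fin.ext this
  exact eval_vdm_ne_zero hx (by rw [h0, map_zero])

theorem merge_swap_aux {n : I → ℕ} (i : I) (r s : Fin (n i)) (v : Vars n) :
    (Lau.gen (if (⟨v.1, (Function.update 1 i (Equiv.swap r s) : ∀ j, Equiv.Perm (Fin (n j))) v.1
        v.2⟩ : Vars n) = ⟨i, s⟩ then (⟨i, r⟩ : Vars n)
      else ⟨v.1, (Function.update 1 i (Equiv.swap r s) : ∀ j, Equiv.Perm (Fin (n j))) v.1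
        v.2⟩) : (Lau (Vars n))ˣ) = Lau.gen (if v = ⟨i, s⟩ then ⟨i, r⟩ else v) := by
  congr 1
  obtain ⟨j, a⟩ := v
  by_cases hj : j = i
  · subst hj
    by_cases h1 : a = s
    · subst h1
      by_cases h2 : r = a
      · subst h2
        simp
      · simp [h2]
    · by_cases h2 : a = r
      · subst h2
        simp [h1]
      · simp [h1, Equiv.swap_apply_of_ne_of_ne h2 h1]
  · have e : ((Function.update 1 i (Equiv.swap r s) : ∀ j, Equiv.Perm (Fin (n j))) j) = 1 :=
      Function.update_of_ne hj _ _
    have h2 : ∀ b : Fin (n j), (⟨j, b⟩ : Vars n) ≠ ⟨i, s⟩ := fun b h => hj (congrArg Sigma.fst h)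
    simp only [e, Equiv.Perm.coe_one, id_eq, h2, if_false]

/-- Laurent polynomials that are antisymmetric in the sense that they are the product of the
Vandermonde determinant with a function of the configuration are divisible by it. -/
theorem vdm_dvd {n : I → ℕ} {P : Lau (Vars n)} {f : Finset (I × ℂˣ) → ℂ}
    (h : ∀ x : Vars n → ℂˣ, Separated x → Lau.eval x P = Lau.eval x (vdm n) * f (conf x)) :
    vdm n ∣ P := by
  have hv : vdm n = ∏ p ∈ (Finset.univ : Finset (Σ i, Fin (n i) × Fin (n i))).filter
      (fun p => p.2.1 < p.2.2),
      ((Lau.gen (⟨p.1, p.2.2⟩ : Vars n)).val - (Lau.gen (⟨p.1, p.2.1⟩ : Vars n)).val) := by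
    rw [vdm, Finset.prod_filter, ← Finset.univ_sigma_univ, Finset.prod_sigma]
    refine Finset.prod_congr rfl fun i _ => ?_
    rw [Matrix.det_vandermonde, ← Finset.univ_product_univ, Finset.prod_product]
    refine Finset.prod_congr rfl fun r _ => ?_
    rw [← Finset.prod_filter]
    refine Finset.prod_congr ?_ fun _ _ => rfl
    ext s
    simp
  rw [hv]
  apply Lau.prod_dvd _ (fun p : Σ i, Fin (n i) × Fin (n i) => (⟨p.1, p.2.2⟩ : Vars n))
    (fun p => (⟨p.1, p.2.1⟩ : Vars n))
  · rintro ⟨i, r, s⟩ hp heq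
    simp only [Finset.mem_filter, Finset.mem_univ, true_and] at hp
    simp only [Sigma.mk.injEq, heq_eq_eq, true_and] at heq
    exact hp.ne heq.symm
  · rintro ⟨i, r, s⟩ hp ⟨j, r', s'⟩ hp' hne
    simp only [Finset.mem_filter, Finset.mem_univ, true_and] at hp hp'
    constructor
    · rintro ⟨h1, h2⟩
      simp only [Sigma.mk.injEq] at h1 h2
      obtain ⟨rfl, h1⟩ := h1
      obtain ⟨-, h2⟩ := h2
      rw [heq_eq_eq] at h1 h2
      subst h1 h2
      exact hne rfl
    · rintro ⟨h1, h2⟩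
      simp only [Sigma.mk.injEq] at h1 h2
      obtain ⟨rfl, h1⟩ := h1
      obtain ⟨-, h2⟩ := h2
      rw [heq_eq_eq] at h1 h2
      subst h1 h2
      exact absurd hp (not_lt.2 hp'.le)
  · rintro ⟨i, r, s⟩ hp
    simp only [Finset.mem_filter, Finset.mem_univ, true_and] at hp
    let π : ∀ j, Equiv.Perm (Fin (n j)) := Function.update 1 i (Equiv.swap r s)
    let ρ : Vars n → Vars n := fun v => ⟨v.1, π v.1 v.2⟩
    have hanti : Lau.eval (fun v => Lau.gen (ρ v)) P = -P := by
      rw [eq_neg_iff_add_eq_zero]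
      apply eq_zero_of_separated
      intro x hx
      have hx' : Separated (fun v => x (ρ v)) := fun j => (hx j).comp (π j).injective
      rw [map_add, Lau.eval_eval, h _ hx', h _ hx, conf_comp, eval_vdm, eval_vdm, ← add_mul]
      convert zero_mul _
      rw [← Finset.mul_prod_erase _ _ (Finset.mem_univ i),
        ← Finset.mul_prod_erase _ (fun i => (Matrix.vandermonde fun r : Fin (n i) =>
          (x ⟨i, r⟩ : ℂ)).det) (Finset.mem_univ i)]
      have e1 : (Matrix.vandermonde fun r : Fin (n i) => (x (ρ ⟨i, r⟩) : ℂ)).det =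
          - (Matrix.vandermonde fun r : Fin (n i) => (x ⟨i, r⟩ : ℂ)).det := by
        have : (Matrix.vandermonde fun r : Fin (n i) => (x (ρ ⟨i, r⟩) : ℂ)) =
            (Matrix.vandermonde fun r : Fin (n i) => (x ⟨i, r⟩ : ℂ)).submatrix
              (Equiv.swap r s) id := by
          ext a b
          simp [Matrix.vandermonde_apply, ρ, π]
        rw [this, Matrix.det_permute, Equiv.Perm.sign_swap hp.ne]
        simp
      have e2 : ∏ j ∈ Finset.univ.erase i,
          (Matrix.vandermonde fun r : Fin (n j) => (x (ρ ⟨j, r⟩) : ℂ)).det =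
          ∏ j ∈ Finset.univ.erase i,
          (Matrix.vandermonde fun r : Fin (n j) => (x ⟨j, r⟩ : ℂ)).det := by
        refine Finset.prod_congr rfl fun j hj => ?_
        have hj' : j ≠ i := (Finset.mem_erase.1 hj).1
        simp [ρ, π, Function.update_of_ne hj']
      rw [e1, e2]
      ring
    have hm : Lau.merge (⟨i, s⟩ : Vars n) ⟨i, r⟩ P = 0 := by
      have h1 : Lau.merge (⟨i, s⟩ : Vars n) ⟨i, r⟩ (Lau.eval (fun v => Lau.gen (ρ v)) P) =
          Lau.merge (⟨i, s⟩ : Vars n) ⟨i, r⟩ P := by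
        rw [Lau.merge, Lau.eval_eval]
        congr 2
        funext v
        rw [merge_swap_aux]
      rw [hanti, map_neg] at h1
      have h2 : (2 : ℂ) • Lau.merge (⟨i, s⟩ : Vars n) ⟨i, r⟩ P = 0 := by
        rw [two_smul]
        nth_rewrite 1 [← h1]
        exact neg_add_cancel _
      exact (smul_eq_zero.1 h2).resolve_left two_ne_zero
    have h6 := Lau.dvd_sub_merge (⟨i, s⟩ : Vars n) ⟨i, r⟩ P
    rw [hm, sub_zero] at h6
    exact h6

end WeightedQuiver
namespace WeightedQuiver

variable {I E : Type*} [Fintype I] [DecidableEq I] [Fintype E] (Q : WeightedQuiver I E)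

theorem vdm_factor_dvd {n : I → ℕ} {a b : Vars n} (h : a.1 = b.1) (hne : a ≠ b) :
    (Lau.gen a).val - (Lau.gen b).val ∣ vdm n := by
  obtain ⟨i, r⟩ := a
  obtain ⟨j, s⟩ := b
  obtain rfl : i = j := h
  have hrs : r ≠ s := fun h => hne (by rw [h])
  refine Dvd.dvd.trans ?_ (Finset.dvd_prod_of_mem _ (Finset.mem_univ i))
  rw [Matrix.det_vandermonde]
  rcases lt_or_gt_of_ne hrs with h | h
  · rw [← neg_sub, neg_dvd]
    refine Dvd.dvd.trans ?_ (Finset.dvd_prod_of_mem _ (Finset.mem_univ r))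
    exact Finset.dvd_prod_of_mem (fun j => (Lau.gen (⟨i, j⟩ : Vars n)).val -
      (Lau.gen (⟨i, r⟩ : Vars n)).val) (Finset.mem_Ioi.2 h)
  · refine Dvd.dvd.trans ?_ (Finset.dvd_prod_of_mem _ (Finset.mem_univ s))
    exact Finset.dvd_prod_of_mem (fun j => (Lau.gen (⟨i, j⟩ : Vars n)).val -
      (Lau.gen (⟨i, s⟩ : Vars n)).val) (Finset.mem_Ioi.2 h)

theorem exists_zeta_lau {n : I → ℕ} (a b : Vars n) : ∃ u : Lau (Vars n), ∀ x : Vars n → ℂˣ,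
    Separated x → a ≠ b →
      Lau.eval x u = (if a.1 = b.1 then (x a : ℂ) - x b else 1) * Q.zeta a.1 b.1 (x a : ℂ) (x b) := by
  let C : ℂ → Lau (Vars n) := algebraMap ℂ (Lau (Vars n))
  refine ⟨(if a.1 = b.1 then (Lau.gen a).val * C (Q.q : ℂ)⁻¹ - (Lau.gen b).val else 1) *
    (∏ e ∈ Q.edges a.1 b.1, (C (Q.t e : ℂ)⁻¹ - (Lau.gen a).val * ((Lau.gen b)⁻¹).val)) *
    (∏ e ∈ Q.edges b.1 a.1,
      (1 - (Lau.gen b).val * C (Q.t e : ℂ) * ((Lau.gen a)⁻¹).val * C (Q.q : ℂ)⁻¹)), ?_⟩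
  intro x hx hne
  have hinv : ∀ v : Vars n, Lau.eval x ((Lau.gen v)⁻¹).val = (x v : ℂ)⁻¹ := by
    intro v
    have h1 : Lau.eval x ((Lau.gen v).val * ((Lau.gen v)⁻¹).val) = 1 := by simp
    rw [map_mul, Lau.eval_gen] at h1
    exact eq_inv_of_mul_eq_one_right h1
  have hC : ∀ c, Lau.eval x (C c) = c := fun c => (Lau.eval x).commutes c
  have hif : Lau.eval x (if a.1 = b.1 then (Lau.gen a).val * C (Q.q : ℂ)⁻¹ - (Lau.gen b).val else 1)
      = if a.1 = b.1 then (x a : ℂ) * (Q.q : ℂ)⁻¹ - x b else 1 := by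
    split_ifs
    · simp only [map_sub, map_mul, Lau.eval_gen, hC]
    · simp
  simp only [map_mul, map_prod, map_sub, map_one, Lau.eval_gen, hinv, hC, hif, zeta, qIn, tIn,
    Algebra.algebraMap_self, RingHom.id_apply]
  have e2 : ∀ e, (1 - (x b : ℂ) * (Q.t e : ℂ) * (x a : ℂ)⁻¹ * (Q.q : ℂ)⁻¹) =
      1 - (x b : ℂ) * (Q.t e : ℂ) / ((x a : ℂ) * (Q.q : ℂ)) := by
    intro e
    rw [div_eq_mul_inv, mul_inv]
    ring
  have e3 : (x a : ℂ) * (x b : ℂ)⁻¹ = x a / x b := (div_eq_mul_inv _ _).symm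
  simp only [e2, e3]
  split_ifs with h
  · have hab : (x a : ℂ) - x b ≠ 0 := by
      rw [sub_ne_zero]
      intro h0
      obtain ⟨i, r⟩ := a
      obtain ⟨j, s⟩ := b
      obtain rfl : i = j := h
      exact hne (by rw [hx i (Units.ext h0)])
    rw [← mul_assoc, ← mul_assoc, mul_div_cancel₀ _ hab]
  · simp only [one_mul]

theorem exists_zetaProd_lau {n : I → ℕ} (A : Finset (Vars n)) : ∃ u : Lau (Vars n),
    ∀ x : Vars n → ℂˣ, Separated x →
      Lau.eval x u = Lau.eval x (vdm n) *
        ∏ a ∈ A, ∏ b ∈ Finset.univ \ A, Q.zeta a.1 b.1 (x a : ℂ) (x b) := by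
  choose z hz using fun a b : Vars n => Q.exists_zeta_lau a b
  let N := (A ×ˢ (Finset.univ \ A)).filter fun p => p.1.1 = p.2.1
  have hN : ∀ p ∈ N, p.1 ∈ A ∧ p.2 ∉ A ∧ p.1.1 = p.2.1 := by
    intro p hp
    simp only [N, Finset.mem_filter, Finset.mem_product, Finset.mem_sdiff, Finset.mem_univ,
      true_and] at hp
    exact ⟨hp.1.1, hp.1.2, hp.2⟩
  have hdvd : ∏ p ∈ N, ((Lau.gen p.1).val - (Lau.gen p.2).val) ∣ vdm n := by
    apply Lau.prod_dvd N (fun p => p.1) (fun p => p.2)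
    · intro p hp h
      exact (hN p hp).2.1 (h ▸ (hN p hp).1)
    · intro p hp p' hp' hne
      refine ⟨fun h => hne (Prod.ext h.1 h.2), fun h => ?_⟩
      exact (hN p' hp').2.1 (h.1 ▸ (hN p hp).1)
    · intro p hp
      exact vdm_factor_dvd (hN p hp).2.2 fun h => (hN p hp).2.1 (h ▸ (hN p hp).1)
  obtain ⟨c, hc⟩ := hdvd
  refine ⟨c * ∏ a ∈ A, ∏ b ∈ Finset.univ \ A, z a b, fun x hx => ?_⟩
  have h1 : Lau.eval x (∏ a ∈ A, ∏ b ∈ Finset.univ \ A, z a b) =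
      Lau.eval x (∏ p ∈ N, ((Lau.gen p.1).val - (Lau.gen p.2).val)) *
        ∏ a ∈ A, ∏ b ∈ Finset.univ \ A, Q.zeta a.1 b.1 (x a : ℂ) (x b) := by
    simp only [map_prod, map_sub, Lau.eval_gen]
    rw [Finset.prod_filter, Finset.prod_product, ← Finset.prod_mul_distrib]
    refine Finset.prod_congr rfl fun a ha => ?_
    rw [← Finset.prod_mul_distrib]
    refine Finset.prod_congr rfl fun b hb => ?_
    rw [hz a b x hx fun h => (Finset.mem_sdiff.1 hb).2 (h ▸ ha)]
  rw [map_mul, h1, hc, map_mul]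
  ring

theorem exists_toConf_lau {n k : I → ℕ} {F : Lau (Vars k)} (hF : F ∈ SymLau k)
    (A : Finset (Vars n)) : ∃ u : Lau (Vars n), ∀ x : Vars n → ℂˣ, Separated x →
      Lau.eval x u = Q.toConf k F (A.image fun v => (v.1, x v)) := by
  classical
  by_cases h : ∃ e : Vars k → Vars n, (∀ v, (e v).1 = v.1) ∧ Function.Injective e ∧
      Finset.univ.image e = A
  · obtain ⟨e, h1, h2, rfl⟩ := h
    refine ⟨Lau.eval (fun v => Lau.gen (e v)) F, fun x hx => ?_⟩
    have hsep : Separated (fun v => x (e v)) := by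
      intro i r s hrs
      have h3 : ∀ a b : Vars n, a.1 = b.1 → x a = x b → a = b := by
        rintro ⟨i, r⟩ ⟨j, s⟩ h h'
        obtain rfl : i = j := h
        rw [hx i h']
      have h4 := h2 (h3 _ _ ((h1 ⟨i, r⟩).trans (h1 ⟨i, s⟩).symm) hrs)
      simpa using h4
    have hc : conf (fun v => x (e v)) = (Finset.univ.image e).image fun v => (v.1, x v) := by
      rw [conf, Finset.image_image]
      congr 1
      funext v
      simp [h1]
    rw [Lau.eval_eval, ← hc, Q.toConf_conf hF hsep]
  · refine ⟨0, fun x hx => ?_⟩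
    rw [map_zero, Q.toConf_of_not]
    rintro ⟨y, hy, hyA⟩
    apply h
    have h1 : ∀ v : Vars k, ∃ a ∈ A, a.1 = v.1 ∧ x a = y v := by
      intro v
      have : (v.1, y v) ∈ conf y := Finset.mem_image.2 ⟨v, Finset.mem_univ _, rfl⟩
      rw [hyA] at this
      obtain ⟨a, ha, hav⟩ := Finset.mem_image.1 this
      simp only [Prod.mk.injEq] at hav
      exact ⟨a, ha, hav⟩
    choose e heA he1 he2 using h1
    refine ⟨e, he1, ?_, ?_⟩
    · intro v w hvw
      have h3 : v.1 = w.1 := by rw [← he1, ← he1, hvw]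
      have h4 : y v = y w := by rw [← he2, ← he2, hvw]
      obtain ⟨i, r⟩ := v
      obtain ⟨j, s⟩ := w
      obtain rfl : i = j := h3
      rw [hy i h4]
    · ext a
      simp only [Finset.mem_image, Finset.mem_univ, true_and]
      constructor
      · rintro ⟨v, rfl⟩
        exact heA v
      · intro ha
        have : (a.1, x a) ∈ conf y := by
          rw [hyA]
          exact Finset.mem_image.2 ⟨a, ha, rfl⟩
        obtain ⟨v, -, hv⟩ := Finset.mem_image.1 this
        simp only [Prod.mk.injEq] at hv
        refine ⟨v, ?_⟩
        have h3 : (e v).1 = a.1 := (he1 v).trans hv.1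
        have h4 : x (e v) = x a := (he2 v).trans hv.2
        generalize e v = b at h3 h4
        obtain ⟨i, r⟩ := a
        obtain ⟨j, s⟩ := b
        obtain rfl : j = i := h3
        rw [hx j h4]

theorem mul_conf {n : I → ℕ} (f g : Q.ConfFun) {x : Vars n → ℂˣ} (hx : Separated x) :
    (f * g) (conf x) = ∑ A ∈ (Finset.univ : Finset (Vars n)).powerset,
      f (A.image fun v => (v.1, x v)) * g ((Finset.univ \ A).image fun v => (v.1, x v)) *
        ∏ a ∈ A, ∏ b ∈ Finset.univ \ A, Q.zeta a.1 b.1 (x a : ℂ) (x b) := by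
  have hinj : Function.Injective fun v : Vars n => (v.1, x v) := by
    rintro ⟨i, r⟩ ⟨j, s⟩ h
    simp only [Prod.mk.injEq] at h
    obtain ⟨rfl, h⟩ := h
    rw [hx i h]
  rw [ConfFun.mul_apply, conf, Finset.powerset_image, Finset.sum_image]
  · refine Finset.sum_congr rfl fun A _ => ?_
    rw [← Finset.image_sdiff _ _ hinj, ConfFun.zetaProd, Finset.prod_image hinj.injOn]
    congr 1
    refine Finset.prod_congr rfl fun a _ => ?_
    rw [Finset.prod_image hinj.injOn]
  · exact (Finset.image_injective hinj).injOn

theorem exists_mul {k l : I → ℕ} {F : Lau (Vars k)} (hF : F ∈ SymLau k) {G : Lau (Vars l)}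
    (hG : G ∈ SymLau l) :
    ∃ H ∈ SymLau (k + l), Q.toConf k F * Q.toConf l G = Q.toConf (k + l) H := by
  choose u hu using fun A : Finset (Vars (k + l)) => Q.exists_toConf_lau hF A
  choose v hv using fun A : Finset (Vars (k + l)) => Q.exists_toConf_lau hG (Finset.univ \ A)
  choose w hw using fun A : Finset (Vars (k + l)) => Q.exists_zetaProd_lau A
  have hP : ∀ x : Vars (k + l) → ℂˣ, Separated x →
      Lau.eval x (∑ A ∈ (Finset.univ : Finset (Vars (k + l))).powerset, u A * v A * w A) =
        Lau.eval x (vdm (k + l)) * (Q.toConf k F * Q.toConf l G) (conf x) := by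
    intro x hx
    rw [Q.mul_conf _ _ hx, map_sum, Finset.mul_sum]
    refine Finset.sum_congr rfl fun A _ => ?_
    rw [map_mul, map_mul, hu A x hx, hv A x hx, hw A x hx]
    ring
  obtain ⟨H, hH⟩ := vdm_dvd hP
  have hH' : ∀ x : Vars (k + l) → ℂˣ, Separated x →
      Lau.eval x H = (Q.toConf k F * Q.toConf l G) (conf x) := by
    intro x hx
    have := hP x hx
    rw [hH, map_mul] at this
    exact mul_left_cancel₀ (eval_vdm_ne_zero hx) this
  have hsym : H ∈ SymLau (k + l) := by
    intro π
    rw [← sub_eq_zero]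
    apply eq_zero_of_separated
    intro x hx
    rw [map_sub, Lau.eval_eval, hH' x hx, hH' (fun v => x ⟨v.1, π v.1 v.2⟩)
      (fun j => (hx j).comp (π j).injective), conf_comp, sub_self]
  refine ⟨H, hsym, ?_⟩
  ext S
  by_cases hS : ∃ x : Vars (k + l) → ℂˣ, Separated x ∧ conf x = S
  · obtain ⟨x, hx, rfl⟩ := hS
    rw [Q.toConf_conf hsym hx, hH' x hx]
  · rw [Q.toConf_of_not H hS, ConfFun.mul_apply]
    refine Finset.sum_eq_zero fun A hA => ?_
    by_cases h1 : ∃ y : Vars k → ℂˣ, Separated y ∧ conf y = A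
    · by_cases h2 : ∃ y : Vars l → ℂˣ, Separated y ∧ conf y = S \ A
      · exfalso
        apply hS
        obtain ⟨y, hy, hyA⟩ := h1
        obtain ⟨z, hz, hzA⟩ := h2
        have hdis : ∀ i r s, y ⟨i, r⟩ ≠ z ⟨i, s⟩ := by
          intro i r s h
          have a1 : (i, y ⟨i, r⟩) ∈ A := hyA ▸ Finset.mem_image.2 ⟨⟨i, r⟩, Finset.mem_univ _, rfl⟩
          have a2 : (i, z ⟨i, s⟩) ∈ S \ A :=
            hzA ▸ Finset.mem_image.2 ⟨⟨i, s⟩, Finset.mem_univ _, rfl⟩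
          rw [h] at a1
          exact (Finset.mem_sdiff.1 a2).2 a1
        refine ⟨fun v => Fin.append (fun r => y ⟨v.1, r⟩) (fun r => z ⟨v.1, r⟩) v.2, ?_, ?_⟩
        · intro i
          exact Fin.append_injective_iff.2 ⟨hy i, hz i, hdis i⟩
        · rw [← Finset.union_sdiff_of_subset (Finset.mem_powerset.1 hA), ← hzA, ← hyA]
          ext ⟨i, p⟩
          simp only [conf, Finset.mem_image, Finset.mem_univ, true_and, Finset.mem_union,
            Prod.mk.injEq]
          constructor
          · rintro ⟨⟨j, r⟩, rfl, rfl⟩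
            induction r using Fin.addCases with
            | left r => exact Or.inl ⟨⟨j, r⟩, rfl, by simp⟩
            | right r => exact Or.inr ⟨⟨j, r⟩, rfl, by simp⟩
          · rintro (⟨⟨j, r⟩, rfl, rfl⟩ | ⟨⟨j, r⟩, rfl, rfl⟩)
            · exact ⟨⟨j, Fin.castAdd (l j) r⟩, rfl, by simp⟩
            · exact ⟨⟨j, Fin.natAdd (k j) r⟩, rfl, by simp⟩
      · rw [Q.toConf_of_not G h2]
        ring
    · rw [Q.toConf_of_not F h1]
      ring

theorem one_eq_toConf : (1 : Q.ConfFun) = Q.toConf 0 1 := by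
  have hF : (1 : Lau (Vars (0 : I → ℕ))) ∈ SymLau 0 := fun π => map_one _
  have key : ∀ x : Vars (0 : I → ℕ) → ℂˣ, conf x = ∅ := by
    intro x
    rw [conf, Finset.image_eq_empty]
    ext ⟨i, r⟩
    exact r.elim0
  ext S
  rw [ConfFun.one_apply]
  split_ifs with h
  · have h1 : Separated (1 : Vars (0 : I → ℕ) → ℂˣ) := fun i r => r.elim0
    have h2 := Q.toConf_conf hF h1
    have h3 : Lau.eval (1 : Vars (0 : I → ℕ) → ℂˣ) (1 : Lau (Vars (0 : I → ℕ))) = 1 := map_one _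
    rw [key, h3] at h2
    rw [h]
    exact h2.symm
  · rw [Q.toConf_of_not]
    rintro ⟨y, -, hy⟩
    exact h (hy ▸ key y)

/-- The big shuffle algebra `𝕊^Q = ⨁_k 𝕊^Q_k` of symmetric Laurent polynomials, with the shuffle
product. -/
def BigShuffle : Subalgebra ℂ Q.ConfFun :=
  Submodule.toSubalgebra (⨆ k : I → ℕ, (SymLau k).map (Q.toConf k))
    (Submodule.mem_iSup_of_mem 0 ⟨1, fun π => map_one _, Q.one_eq_toConf.symm⟩)
    (by
      intro f g hf hg
      have h := Submodule.mul_mem_mul hf hg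
      refine (?_ : (⨆ k : I → ℕ, (SymLau k).map (Q.toConf k)) *
        (⨆ k : I → ℕ, (SymLau k).map (Q.toConf k)) ≤ _) h
      rw [Submodule.iSup_mul]
      refine iSup_le fun k => ?_
      rw [Submodule.mul_iSup]
      refine iSup_le fun l => ?_
      rw [Submodule.mul_le]
      rintro _ ⟨F, hF, rfl⟩ _ ⟨G, hG, rfl⟩
      obtain ⟨H, hH, e⟩ := Q.exists_mul hF hG
      rw [e]
      exact Submodule.mem_iSup_of_mem (k + l) ⟨H, hH, rfl⟩)

/-- The inclusion of the graded component `𝕊^Q_k` of symmetric Laurent polynomials. -/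
def ofSym (k : I → ℕ) : SymLau k →ₗ[ℂ] Q.BigShuffle where
  toFun F := ⟨Q.toConf k F, Submodule.mem_iSup_of_mem k ⟨F, F.2, rfl⟩⟩
  map_add' F G := Subtype.ext (map_add (Q.toConf k) (F : Lau (Vars k)) G)
  map_smul' c F := Subtype.ext (map_smul (Q.toConf k) c (F : Lau (Vars k)))

end WeightedQuiver
namespace WeightedQuiver

variable {I E : Type*} [Fintype I] [DecidableEq I] [Fintype E] (Q : WeightedQuiver I E)

/-! ### Wheel conditions -/

open scoped Classical in
/-- The number `♭_{ij}(γ)` of edges from `i` to `j` of weight `γ` in the double of the quiver, in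
which every edge `e` has a reversed copy of weight `q / t_e`. -/
def doubleMult (i j : I) (γ : ℂˣ) : ℕ :=
  ((Q.edges i j).filter fun e => Q.t e = γ).card +
    ((Q.edges j i).filter fun e => Q.q / Q.t e = γ).card

/-- The substitution `x_v ↦ q x_u`. -/
def wheelSubst {k : I → ℕ} (u v : Vars k) : Lau (Vars k) →ₐ[ℂ] Lau (Vars k) :=
  Lau.eval fun s => if s = v
    then Units.map (algebraMap ℂ (Lau (Vars k)) : ℂ →* Lau (Vars k)) Q.q * Lau.gen u
    else Lau.gen s

/-- The wheel conditions: `F|_{x_{i,2} = q x_{i,1}}` is divisible by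
`(x_{j,1} - γ x_{i,1})^{♭_{ij}(γ)}` for all `i`, `j`, `γ`. Here `x_{i,1}, x_{i,2}, x_{j,1}` are any
three distinct variables of the indicated colours. -/
def Wheel (k : I → ℕ) : Submodule ℂ (SymLau k) where
  carrier := {F | ∀ u v w : Vars k, u ≠ v → u ≠ w → v ≠ w → u.1 = v.1 → ∀ γ : ℂˣ,
    ((Lau.gen w).val - algebraMap ℂ (Lau (Vars k)) (γ : ℂ) * (Lau.gen u).val) ^
      Q.doubleMult u.1 w.1 γ ∣ Q.wheelSubst u v (F : Lau (Vars k))}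
  add_mem' := fun hF hG u v w h1 h2 h3 h4 γ => by
    rw [Submodule.coe_add, map_add]
    exact dvd_add (hF u v w h1 h2 h3 h4 γ) (hG u v w h1 h2 h3 h4 γ)
  zero_mem' := fun u v w _ _ _ _ γ => by
    rw [Submodule.coe_zero, map_zero]
    exact dvd_zero _
  smul_mem' := fun c F hF u v w h1 h2 h3 h4 γ => by
    rw [Submodule.coe_smul, map_smul, Algebra.smul_def]
    exact Dvd.dvd.mul_left (hF u v w h1 h2 h3 h4 γ) _

/-- The small shuffle algebra `S^Q`, as a subspace of `𝕊^Q`. -/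
def SmallShuffle : Submodule ℂ Q.BigShuffle := ⨆ k : I → ℕ, (Q.Wheel k).map (Q.ofSym k)

theorem monomial_mem (k : I → ℕ) (r : ℤ) :
    (AddMonoidAlgebra.single (fun _ => r) 1 : Lau (Vars k)) ∈ SymLau k := by
  intro π
  rw [Lau.eval_single]
  conv_rhs => rw [Lau.single_eq_prod]
  congr 1
  exact Fintype.prod_equiv (Equiv.sigmaCongrRight π) _ _ fun v => rfl

/-- The element `x_{i,1}^r` of multidegree `1_i` of the shuffle algebra. -/
def xPow (i : I) (r : ℤ) : Q.BigShuffle :=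
  Q.ofSym (Pi.single i 1) ⟨AddMonoidAlgebra.single (fun _ => r) 1, monomial_mem _ r⟩

/-! ### Shifted quantum quiver algebras -/

/-- The Laurent polynomial `(x - 1)^{δ_ij} ζ_ij(x)`. -/
def zetaL (i j : I) : LaurentPolynomial ℂ :=
  (if i = j then LaurentPolynomial.C (Q.q : ℂ)⁻¹ * LaurentPolynomial.T 1 - 1 else 1) *
    (∏ e ∈ Q.edges i j, (LaurentPolynomial.C (Q.t e : ℂ)⁻¹ - LaurentPolynomial.T 1)) *
    ∏ e ∈ Q.edges j i, (1 - LaurentPolynomial.C ((Q.t e : ℂ) / Q.q) * LaurentPolynomial.T (-1))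

/-- The Laurent polynomial `(x - 1)^{δ_ij} ζ_ji(x⁻¹)`. -/
def zetaR (i j : I) : LaurentPolynomial ℂ :=
  (if i = j then -LaurentPolynomial.T 1 else 1) * LaurentPolynomial.invert (Q.zetaL j i)

/-- For a series `X(z,w) = ∑ X_{r,s} z^{-r} w^{-s}` and a Laurent polynomial `p`, the coefficient
of `z^{-r} w^{-s}` in `p(z/w) X(z,w)`. -/
def seriesCoeff {A : Type*} [AddCommMonoid A] [Module ℂ A] (p : LaurentPolynomial ℂ)
    (X : ℤ → ℤ → A) (r s : ℤ) : A :=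
  p.coeff.sum fun n c => c • X (r + n) (s - n)

/-- The evaluation `e_{i,r} ↦ x_{i,1}^r`. -/
def shuffleEval : FreeAlgebra ℂ (I × ℤ) →ₐ[ℂ] Q.BigShuffle :=
  FreeAlgebra.lift ℂ fun p => Q.xPow p.1 p.2

/-- The evaluation `f_{i,r} ↦ x_{i,1}^r` in the opposite algebra. -/
def shuffleEvalOp : FreeAlgebra ℂ (I × ℤ) →ₐ[ℂ] (Q.BigShuffle)ᵐᵒᵖ :=
  FreeAlgebra.lift ℂ fun p => MulOpposite.op (Q.xPow p.1 p.2)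

/-- Cubic elements of the free algebra. -/
def cubic (I : Type*) : Submodule ℂ (FreeAlgebra ℂ (I × ℤ)) :=
  Submodule.span ℂ (Set.range fun p : (I × ℤ) × (I × ℤ) × (I × ℤ) =>
    FreeAlgebra.ι ℂ p.1 * FreeAlgebra.ι ℂ p.2.1 * FreeAlgebra.ι ℂ p.2.2)

/-- The relations of the positive half: the quadratic relations
`ζ_ji(w/z) e_i(z) e_j(w) = ζ_ij(z/w) e_j(w) e_i(z)` and the cubic Serre relations, that is, all
cubic relations that hold between the `x_{i,1}^r` in the shuffle algebra. -/
inductive PosRel : FreeAlgebra ℂ (I × ℤ) → FreeAlgebra ℂ (I × ℤ) → Prop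
  | quad (i j : I) (r s : ℤ) : PosRel
      (seriesCoeff (Q.zetaR i j)
        (fun r s => FreeAlgebra.ι ℂ (i, r) * FreeAlgebra.ι ℂ (j, s)) r s)
      (seriesCoeff (Q.zetaL i j)
        (fun r s => FreeAlgebra.ι ℂ (j, s) * FreeAlgebra.ι ℂ (i, r)) r s)
  | serre (x : FreeAlgebra ℂ (I × ℤ)) (hx : x ∈ cubic I) (h : Q.shuffleEval x = 0) : PosRel x 0

/-- The relations of the negative half: the quadratic relations
`ζ_ij(z/w) f_i(z) f_j(w) = ζ_ji(w/z) f_j(w) f_i(z)` and the cubic Serre relations, that is, all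
cubic relations that hold between the `x_{i,1}^r` in the opposite of the shuffle algebra. -/
inductive NegRel : FreeAlgebra ℂ (I × ℤ) → FreeAlgebra ℂ (I × ℤ) → Prop
  | quad (i j : I) (r s : ℤ) : NegRel
      (seriesCoeff (Q.zetaL i j)
        (fun r s => FreeAlgebra.ι ℂ (i, r) * FreeAlgebra.ι ℂ (j, s)) r s)
      (seriesCoeff (Q.zetaR i j)
        (fun r s => FreeAlgebra.ι ℂ (j, s) * FreeAlgebra.ι ℂ (i, r)) r s)
  | serre (x : FreeAlgebra ℂ (I × ℤ)) (hx : x ∈ cubic I) (h : Q.shuffleEvalOp x = 0) : NegRel x 0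

/-- The algebra `U^>_Q`, generated by the `e_{i,r}`. -/
abbrev UPos : Type _ := RingQuot Q.PosRel

/-- The algebra `U^<_Q`, generated by the `f_{i,r}`. -/
abbrev UNeg : Type _ := RingQuot Q.NegRel

/-- The generator `e_{i,r}` of `U^>_Q`. -/
def UPos.e (i : I) (r : ℤ) : Q.UPos := RingQuot.mkAlgHom ℂ Q.PosRel (FreeAlgebra.ι ℂ (i, r))

/-- The generator `f_{i,r}` of `U^<_Q`. -/
def UNeg.f (i : I) (r : ℤ) : Q.UNeg := RingQuot.mkAlgHom ℂ Q.NegRel (FreeAlgebra.ι ℂ (i, r))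

/-- Generators of shifted quantum quiver algebras. Here `psi true i n` and `psi false i n` are the
coefficients of `z^{-n}` in `ψ_i^+(z)` and `ψ_i^-(z)`, and `psiInv` is the inverse of the leading
coefficient of the respective series. -/
inductive Gen (I : Type*)
  | e (i : I) (r : ℤ)
  | f (i : I) (r : ℤ)
  | psi (ε : Bool) (i : I) (n : ℤ)
  | psiInv (ε : Bool) (i : I)

/-- A generator as an element of the free algebra. -/
abbrev Gen.free {I : Type*} (g : Gen I) : FreeAlgebra ℂ (Gen I) := FreeAlgebra.ι ℂ g

/-- The defining relations of the shifted quantum quiver algebra. -/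
inductive ShiftedRel (bp bm : I → ℤ) : FreeAlgebra ℂ (Gen I) → FreeAlgebra ℂ (Gen I) → Prop
  | psi_plus_zero (i : I) (n : ℤ) (h : n < -bp i) : ShiftedRel bp bm (Gen.psi true i n).free 0
  | psi_minus_zero (i : I) (n : ℤ) (h : bm i < n) : ShiftedRel bp bm (Gen.psi false i n).free 0
  | psi_comm (ε ε' : Bool) (i j : I) (m n : ℤ) : ShiftedRel bp bm
      ((Gen.psi ε i m).free * (Gen.psi ε' j n).free) ((Gen.psi ε' j n).free * (Gen.psi ε i m).free)
  | psi_plus_inv (i : I) : ShiftedRel bp bm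
      ((Gen.psi true i (-bp i)).free * (Gen.psiInv true i).free) 1
  | psi_plus_inv_left (i : I) : ShiftedRel bp bm
      ((Gen.psiInv true i).free * (Gen.psi true i (-bp i)).free) 1
  | psi_minus_inv (i : I) : ShiftedRel bp bm
      ((Gen.psi false i (bm i)).free * (Gen.psiInv false i).free) 1
  | psi_minus_inv_left (i : I) : ShiftedRel bp bm
      ((Gen.psiInv false i).free * (Gen.psi false i (bm i)).free) 1
  | pos (x y : FreeAlgebra ℂ (I × ℤ)) (h : Q.PosRel x y) : ShiftedRel bp bm
      (FreeAlgebra.lift ℂ (fun p : I × ℤ => (Gen.e p.1 p.2).free) x)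
      (FreeAlgebra.lift ℂ (fun p : I × ℤ => (Gen.e p.1 p.2).free) y)
  | neg (x y : FreeAlgebra ℂ (I × ℤ)) (h : Q.NegRel x y) : ShiftedRel bp bm
      (FreeAlgebra.lift ℂ (fun p : I × ℤ => (Gen.f p.1 p.2).free) x)
      (FreeAlgebra.lift ℂ (fun p : I × ℤ => (Gen.f p.1 p.2).free) y)
  | psi_e (ε : Bool) (i j : I) (r s : ℤ) : ShiftedRel bp bm
      (seriesCoeff (Q.zetaR i j) (fun r s => (Gen.psi ε i r).free * (Gen.e j s).free) r s)
      (seriesCoeff (Q.zetaL i j) (fun r s => (Gen.e j s).free * (Gen.psi ε i r).free) r s)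
  | psi_f (ε : Bool) (i j : I) (r s : ℤ) : ShiftedRel bp bm
      (seriesCoeff (Q.zetaL i j) (fun r s => (Gen.psi ε i r).free * (Gen.f j s).free) r s)
      (seriesCoeff (Q.zetaR i j) (fun r s => (Gen.f j s).free * (Gen.psi ε i r).free) r s)
  | e_f (i j : I) (r s : ℤ) : ShiftedRel bp bm
      ((Gen.e i r).free * (Gen.f j s).free - (Gen.f j s).free * (Gen.e i r).free)
      (if i = j then (Gen.psi true i (r + s)).free - (Gen.psi false i (r + s)).free else 0)

/-- The shifted quantum quiver algebra with shifts `b^+` and `b^-`. -/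
abbrev Shifted (bp bm : I → ℤ) : Type _ := RingQuot (Q.ShiftedRel bp bm)

/-- The image of a generator in the shifted quantum quiver algebra. -/
def Shifted.of (bp bm : I → ℤ) (g : Gen I) : Q.Shifted bp bm :=
  RingQuot.mkAlgHom ℂ (Q.ShiftedRel bp bm) g.free

/-- The natural map `U^>_Q → U_Q^{(b^+,b^-)}`, `e_{i,r} ↦ e_{i,r}`, onto the positive subalgebra. -/
def posIncl (bp bm : I → ℤ) : Q.UPos →ₐ[ℂ] Q.Shifted bp bm :=
  RingQuot.liftAlgHom ℂ ⟨(RingQuot.mkAlgHom ℂ (Q.ShiftedRel bp bm)).comp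
    (FreeAlgebra.lift ℂ fun p : I × ℤ => (Gen.e p.1 p.2).free),
    fun _ _ h => RingQuot.mkAlgHom_rel ℂ (ShiftedRel.pos _ _ h)⟩

/-- The natural map `U^<_Q → U_Q^{(b^+,b^-)}`, `f_{i,r} ↦ f_{i,r}`, onto the negative subalgebra. -/
def negIncl (bp bm : I → ℤ) : Q.UNeg →ₐ[ℂ] Q.Shifted bp bm :=
  RingQuot.liftAlgHom ℂ ⟨(RingQuot.mkAlgHom ℂ (Q.ShiftedRel bp bm)).comp
    (FreeAlgebra.lift ℂ fun p : I × ℤ => (Gen.f p.1 p.2).free),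
    fun _ _ h => RingQuot.mkAlgHom_rel ℂ (ShiftedRel.neg _ _ h)⟩

/-! ### Difference operators -/

/-- Index of a coefficient variable: `w_{i,r}` with `r ≤ a_i`, or, for a sign `ε` and vertices
`i, j`, the formal power `(∏_s w_{j,s})^{γ^ε_{ij}}`. -/
abbrev Coord (a : I → ℕ) := Vars a ⊕ (Bool × I × I)

/-- Rational functions in the `w_{i,r}` and the formal powers `(∏_s w_{j,s})^{γ^±_{ij}}`. -/
abbrev CoeffField (a : I → ℕ) := FractionRing (Lau (Coord a))

/-- The variable `w_{i,r}`. -/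
def wVar {a : I → ℕ} (v : Vars a) : (CoeffField a)ˣ :=
  Units.map (algebraMap (Lau (Coord a)) (CoeffField a) : Lau (Coord a) →* CoeffField a)
    (Lau.gen (Sum.inl v))

/-- The formal power `(∏_s w_{j,s})^{γ^ε_{ij}}`. -/
def pVar {a : I → ℕ} (ε : Bool) (i j : I) : (CoeffField a)ˣ :=
  Units.map (algebraMap (Lau (Coord a)) (CoeffField a) : Lau (Coord a) →* CoeffField a)
    (Lau.gen (Sum.inr (ε, i, j)))

/-- The variable `w_{i,r}`, as a rational function. -/
abbrev w {a : I → ℕ} (v : Vars a) : CoeffField a := (wVar v : (CoeffField a)ˣ)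

/-- The formal power `(∏_s w_{j,s})^{γ^ε_{ij}}`, as a coefficient. -/
abbrev P {a : I → ℕ} (ε : Bool) (i j : I) : CoeffField a := (pVar ε i j : (CoeffField a)ˣ)

/-- `q^{γ^±_{ij}}`, where `γ^+_{ij} = ∑_{e : i → j} log_q t_e` and
`γ^-_{ij} = -∑_{e : j → i} log_q t_e`. -/
def qGamma (ε : Bool) (i j : I) : ℂˣ :=
  if ε then ∏ e ∈ Q.edges i j, Q.t e else (∏ e ∈ Q.edges j i, Q.t e)⁻¹

/-- The group of monomials `∏ D_{i,r}^{m_{i,r}}` in the shift operators. -/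
def Shift (_Q : WeightedQuiver I E) (a : I → ℕ) : Type _ := Multiplicative (Vars a → ℤ)

instance (a : I → ℕ) : CommGroup (Q.Shift a) :=
  inferInstanceAs (CommGroup (Multiplicative (Vars a → ℤ)))

/-- The monomial `∏ D_{i,r}^{m_{i,r}}`. -/
def dMon {a : I → ℕ} (m : Vars a → ℤ) : Q.Shift a := Multiplicative.ofAdd m

/-- The rescaling of the coefficient variables under conjugation by `∏ D_{i,r}^{m_{i,r}}`, with
`D_{i,r} w_{j,s} = q^{-δ_{(i,r),(j,s)}} w_{j,s} D_{i,r}` and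
`D_{ι,s} (∏_r w_{j,r})^γ = q^{-δ_{ιj} γ} (∏_r w_{j,r})^γ D_{ι,s}`. -/
def shiftChar (a : I → ℕ) : Q.Shift a →* (Coord a → ℂˣ) where
  toFun m := Sum.elim (fun v => Q.q ^ (-(Multiplicative.toAdd m v)))
    fun p => Q.qGamma p.1 p.2.1 p.2.2 ^ (-∑ s : Fin (a p.2.2), Multiplicative.toAdd m ⟨p.2.2, s⟩)
  map_one' := by
    have h : ∀ v, Multiplicative.toAdd (1 : Q.Shift a) v = 0 := fun v => rfl
    funext c
    cases c <;> simp [h]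
  map_mul' m n := by
    have h : ∀ v, Multiplicative.toAdd (m * n : Q.Shift a) v =
      Multiplicative.toAdd m v + Multiplicative.toAdd n v := fun v => rfl
    funext c
    cases c with
    | inl v => simp [h, zpow_add, mul_comm]
    | inr p => simp [h, Finset.sum_add_distrib, zpow_add, mul_comm]

/-- Shift operators act on coefficients. -/
instance (a : I → ℕ) : MulSemiringAction (Q.Shift a) (CoeffField a) :=
  MulSemiringAction.compHom (CoeffField a)
    ((IsFractionRing.fieldEquivOfAlgEquivHom ℂ (CoeffField a)).comp
      (Lau.torus.comp (Q.shiftChar a)) : Q.Shift a →* (CoeffField a ≃ₐ[ℂ] CoeffField a))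

instance (a : I → ℕ) : SMulCommClass (Q.Shift a) ℂ (CoeffField a) :=
  ⟨fun g c x => map_smul (((IsFractionRing.fieldEquivOfAlgEquivHom ℂ (CoeffField a)).comp
      (Lau.torus.comp (Q.shiftChar a)) : Q.Shift a →* (CoeffField a ≃ₐ[ℂ] CoeffField a)) g) c x⟩

/-- Difference operators with rational coefficients: finite sums `∑ c_m ∏ D_{i,r}^{m_{i,r}}`, with
`D c = D(c) D`. -/
abbrev DiffOp (a : I → ℕ) := SkewMonoidAlgebra (CoeffField a) (Q.Shift a)

/-- The operator `c ∏ D_{i,r}^{m_{i,r}}`. -/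
def dOp {a : I → ℕ} (c : CoeffField a) (m : Vars a → ℤ) : Q.DiffOp a :=
  SkewMonoidAlgebra.single (Q.dMon m) c

/-- The algebra `𝒜^q` with the localization at the `w_{i,r} - q^m w_{i,s}`, `r ≠ s`: the algebra
generated by the `w_{i,r}^{±1}`, the formal powers and their inverses, the `D_{i,r}^{±1}`, and the
inverses of the `w_{i,r} - q^m w_{i,s}`. -/
def ATilde (a : I → ℕ) : Subalgebra ℂ (Q.DiffOp a) :=
  Algebra.adjoin ℂ
    ({x | ∃ (v : Vars a) (n : ℤ), x = Q.dOp ((wVar v ^ n : (CoeffField a)ˣ) : CoeffField a) 0} ∪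
     {x | ∃ (ε : Bool) (i j : I) (n : ℤ),
      x = Q.dOp ((pVar ε i j ^ n : (CoeffField a)ˣ) : CoeffField a) 0} ∪
     {x | ∃ (v : Vars a) (n : ℤ), x = Q.dOp 1 (Pi.single v n)} ∪
     {x | ∃ (i : I) (r s : Fin (a i)) (m : ℤ), r ≠ s ∧
      x = Q.dOp (w ⟨i, r⟩ -
        Q.qIn (CoeffField a) ^ m * w ⟨i, s⟩)⁻¹ 0})

/-- The further localization of `ATilde` at the elements `w_{j,s} - t_e q^m w_{i,r}` for edges `e`
from `i` to `j` and `(i,r) ≠ (j,s)`. -/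
def ATildeExt (a : I → ℕ) : Subalgebra ℂ (Q.DiffOp a) :=
  Q.ATilde a ⊔ Algebra.adjoin ℂ
    {x | ∃ (u v : Vars a) (e : E) (m : ℤ), u ≠ v ∧ Q.src e = u.1 ∧ Q.tgt e = v.1 ∧
      x = Q.dOp (w v -
        Q.tIn (CoeffField a) e * Q.qIn (CoeffField a) ^ m * w u)⁻¹ 0}

end WeightedQuiver

/-- The data `a`, `N`, `z` of the GKLO-type homomorphism. -/
structure GKLOData (I : Type*) where
  a : I → ℕ
  N : I → ℕ
  z : ∀ i, Fin (N i) → ℂˣ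

namespace WeightedQuiver

variable {I E : Type*} [Fintype I] [DecidableEq I] [Fintype E] (Q : WeightedQuiver I E)
  (d : GKLOData I)

/-- The shift `b^+`. -/
def bPlus (i : I) : ℤ := (∑ j, (d.a j : ℤ) * (Q.edges i j).card) - d.a i

/-- The shift `b^-`. -/
def bMinus (i : I) : ℤ := d.N i + (∑ j, (d.a j : ℤ) * (Q.edges j i).card) - d.a i

/-- `Z_i(z) = ∏_r (1 - z_{i,r} / z)`. -/
def zFun {L : Type*} [Field L] [Algebra ℂ L] (i : I) (z : L) : L :=
  ∏ r, (1 - algebraMap ℂ L (d.z i r : ℂ) / z)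

/-- The factor `Y_{i,r}(z)`, for `u = (i,r)`. -/
def YPos (u : Vars d.a) (z : CoeffField d.a) : CoeffField d.a :=
  (∏ j ∈ Finset.univ.erase u.1, P true u.1 j) *
    (zFun d u.1 z *
      (∏ j ∈ Finset.univ.erase u.1, ∏ s : Fin (d.a j), ∏ e ∈ Q.edges u.1 j,
        ((Q.tIn (CoeffField d.a) e)⁻¹ - z / w ⟨j, s⟩)) *
      ∏ s ∈ Finset.univ.erase u.2, ∏ e ∈ Q.edges u.1 u.1,
        ((Q.tIn (CoeffField d.a) e)⁻¹ - z / w ⟨u.1, s⟩)) /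
    ∏ s ∈ Finset.univ.erase u.2, (1 - z / w ⟨u.1, s⟩)

/-- The factor `Y'_{i,r}(z)`, for `u = (i,r)`. -/
def YNeg (u : Vars d.a) (z : CoeffField d.a) : CoeffField d.a :=
  (∏ j ∈ Finset.univ.erase u.1, P false u.1 j) *
    ((∏ j ∈ Finset.univ.erase u.1, ∏ s : Fin (d.a j), ∏ e ∈ Q.edges j u.1,
        (1 - w ⟨j, s⟩ * Q.tIn (CoeffField d.a) e / (z * Q.qIn (CoeffField d.a)))) *
      ∏ s ∈ Finset.univ.erase u.2, ∏ e ∈ Q.edges u.1 u.1,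
        (1 - w ⟨u.1, s⟩ * Q.tIn (CoeffField d.a) e / (z * Q.qIn (CoeffField d.a)))) /
    ∏ s ∈ Finset.univ.erase u.2, (1 - w ⟨u.1, s⟩ / (z * Q.qIn (CoeffField d.a)))

/-- The rational function of `z` whose two expansions are the images of `ψ^±_i(z)`. -/
def psiFun (i : I) {L : Type*} [Field L] [Algebra ℂ L] [Algebra (CoeffField d.a) L] (z : L) : L :=
  let wL : Vars d.a → L := fun v => algebraMap (CoeffField d.a) L (w v)
  ((Q.qIn L)⁻¹ - 1) / (∏ e ∈ Q.edges i i, (((Q.tIn L e)⁻¹ - 1) * (1 - Q.tIn L e / Q.qIn L))) *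
    (∏ j ∈ Finset.univ.erase i, algebraMap (CoeffField d.a) L (P true i j * P false i j)) *
    (zFun d i z *
      (∏ j, ∏ s : Fin (d.a j),
        ((∏ e ∈ Q.edges i j, ((Q.tIn L e)⁻¹ - z / wL ⟨j, s⟩)) *
          ∏ e ∈ Q.edges j i, (1 - wL ⟨j, s⟩ * Q.tIn L e / (z * Q.qIn L)))) /
      ∏ r : Fin (d.a i), ((1 - z / wL ⟨i, r⟩) * (1 - wL ⟨i, r⟩ / (z * Q.qIn L))))

/-- The coefficient of `z^{-n}` in the expansion of `psiFun` in powers of `z⁻¹` (for `ε = true`),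
resp. in powers of `z` (for `ε = false`). -/
def psiCoeff (ε : Bool) (i : I) (n : ℤ) : CoeffField d.a :=
  if ε then (Q.psiFun d i (HahnSeries.single (-1) 1 : LaurentSeries (CoeffField d.a))).coeff n
  else (Q.psiFun d i (HahnSeries.single 1 1 : LaurentSeries (CoeffField d.a))).coeff (-n)

/-- The defining property of the GKLO-type homomorphism: its values on generators. With
`δ(w/z) = ∑_r w^r z^{-r}`, the image of `e_i(z)` is `∑_r δ(w_{i,r}/z) Y_{i,r}(w_{i,r}) D_{i,r}^{-1}`
and that of `f_i(z)` is `∑_r δ(w_{i,r}/(qz)) Y'_{i,r}(w_{i,r}/q) D_{i,r}`. -/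
structure IsGKLO (Φ : Q.Shifted (Q.bPlus d) (Q.bMinus d) →ₐ[ℂ] Q.ATilde d.a) : Prop where
  map_e : ∀ (i : I) (n : ℤ), (Φ (Shifted.of Q _ _ (Gen.e i n)) : Q.DiffOp d.a) =
    ∑ r : Fin (d.a i), Q.dOp (w ⟨i, r⟩ ^ n * Q.YPos d ⟨i, r⟩ (w ⟨i, r⟩))
      (-Pi.single ⟨i, r⟩ 1)
  map_f : ∀ (i : I) (n : ℤ), (Φ (Shifted.of Q _ _ (Gen.f i n)) : Q.DiffOp d.a) =
    ∑ r : Fin (d.a i), Q.dOp ((w ⟨i, r⟩ / Q.qIn (CoeffField d.a)) ^ n *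
      Q.YNeg d ⟨i, r⟩ (w ⟨i, r⟩ / Q.qIn (CoeffField d.a))) (Pi.single ⟨i, r⟩ 1)
  map_psi : ∀ (ε : Bool) (i : I) (n : ℤ),
    (Φ (Shifted.of Q _ _ (Gen.psi ε i n)) : Q.DiffOp d.a) = Q.dOp (Q.psiCoeff d ε i n) 0

/-! ### The explicit homomorphisms -/

/-- The tuples `(m^{(i)}_r)` with `m^{(i)}_1 + ... + m^{(i)}_{a_i} = k_i` for all `i`. -/
def splittings (a k : I → ℕ) : Finset (∀ i, Fin (a i) → ℕ) :=
  Fintype.piFinset fun i => Finset.piAntidiag Finset.univ (k i)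

theorem sum_of_mem_splittings {a k : I → ℕ} {m : ∀ i, Fin (a i) → ℕ} (hm : m ∈ splittings a k)
    (i : I) : ∑ r, m i r = k i :=
  (Finset.mem_piAntidiag.1 (Fintype.mem_piFinset.1 hm i)).1

/-- The point `w_{i,r} q^p`. -/
def ptPos {a : I → ℕ} (v : Vars a) (p : ℕ) : (CoeffField a)ˣ :=
  wVar v * Units.map (algebraMap ℂ (CoeffField a) : ℂ →* CoeffField a) Q.q ^ p

/-- The point `w_{i,r} q^{-p-1}`. -/
def ptNeg {a : I → ℕ} (v : Vars a) (p : ℕ) : (CoeffField a)ˣ :=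
  wVar v * (Units.map (algebraMap ℂ (CoeffField a) : ℂ →* CoeffField a) Q.q ^ (p + 1))⁻¹

/-- The value `F({y_{(i,r),p}}_{p < m^{(i)}_r})` of a Laurent polynomial of multidegree `k`: the
`k_i` variables of colour `i` are set to the `y_{(i,r),p}`, `r ≤ a_i`, `p < m^{(i)}_r`. -/
def evalAt {a k : I → ℕ} (m : ∀ i, Fin (a i) → ℕ) (hm : m ∈ splittings a k)
    (y : Vars a → ℕ → (CoeffField a)ˣ) (F : Lau (Vars k)) : CoeffField a :=
  Lau.eval (fun v : Vars k =>
    let rp : Σ r : Fin (a v.1), Fin (m v.1 r) :=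
      finSigmaFinEquiv.symm (Fin.cast (sum_of_mem_splittings hm v.1).symm v.2)
    y ⟨v.1, rp.1⟩ rp.2) F

/-- `∏_{e : i → i} t_e`. -/
def loopProd (i : I) : CoeffField d.a := ∏ e ∈ Q.edges i i, Q.tIn (CoeffField d.a) e

/-- `∏_i ∏_{e : i → i} t_e^{(k_i - k_i²)/2}`. -/
def loopConst (k : I → ℕ) : CoeffField d.a :=
  ∏ i, ∏ e ∈ Q.edges i i, Q.tIn (CoeffField d.a) e ^ (((k i : ℤ) - (k i : ℤ) ^ 2) / 2)

/-- The image of a symmetric Laurent polynomial `F` of multidegree `k` under the explicit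
homomorphism from the big shuffle algebra. The indices `p`, `p₁`, `p₂` start at `0` here. -/
def imagePos (k : I → ℕ) (F : SymLau k) : Q.DiffOp d.a :=
  ∑ m : {m // m ∈ splittings d.a k}, Q.dOp
    (Q.loopConst d k *
      (∏ i, ∏ r, ∏ p ∈ Finset.range (m.1 i r), Q.YPos d ⟨i, r⟩ (Q.ptPos ⟨i, r⟩ p)) *
      evalAt m.1 m.2 Q.ptPos (F : Lau (Vars k)) *
      (∏ i, ∏ r, ∏ p₂ ∈ Finset.range (m.1 i r), ∏ p₁ ∈ Finset.range p₂,
        ((Q.zeta i i (Q.ptPos ⟨i, r⟩ p₁ : CoeffField d.a) (Q.ptPos ⟨i, r⟩ p₂))⁻¹ *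
          Q.loopProd d i)) *
      ∏ u : Vars d.a, ∏ v ∈ Finset.univ.erase u,
        ∏ p₁ ∈ Finset.range (m.1 u.1 u.2), ∏ p₂ ∈ Finset.range (m.1 v.1 v.2),
          Q.phi u.1 v.1 (Q.ptPos u p₁ : CoeffField d.a) (Q.ptPos v p₂))
    (fun v => -(m.1 v.1 v.2 : ℤ))

/-- The image of a symmetric Laurent polynomial `F` of multidegree `k` under the explicit
homomorphism from the opposite of the big shuffle algebra. The indices `p`, `p₁`, `p₂` start at `0`
here. -/
def imageNeg (k : I → ℕ) (F : SymLau k) : Q.DiffOp d.a :=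
  ∑ m : {m // m ∈ splittings d.a k}, Q.dOp
    (Q.loopConst d k *
      (∏ i, ∏ r, ∏ p ∈ Finset.range (m.1 i r), Q.YNeg d ⟨i, r⟩ (Q.ptNeg ⟨i, r⟩ p)) *
      evalAt m.1 m.2 Q.ptNeg (F : Lau (Vars k)) *
      (∏ i, ∏ r, ∏ p₂ ∈ Finset.range (m.1 i r), ∏ p₁ ∈ Finset.range p₂,
        ((Q.zeta i i (Q.ptNeg ⟨i, r⟩ p₂ : CoeffField d.a) (Q.ptNeg ⟨i, r⟩ p₁))⁻¹ *
          Q.loopProd d i)) *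
      ∏ u : Vars d.a, ∏ v ∈ Finset.univ.erase u,
        ∏ p₁ ∈ Finset.range (m.1 u.1 u.2), ∏ p₂ ∈ Finset.range (m.1 v.1 v.2),
          Q.phi v.1 u.1 (Q.ptNeg v p₂ : CoeffField d.a) (Q.ptNeg u p₁))
    (fun v => (m.1 v.1 v.2 : ℤ))

end WeightedQuiver

end

/-! For a tuple m of chain lengths, the corresponding term of the explicit map is the value of F at
the chains w_u, w_u q, ..., w_u q^{m_u-1} (u = (i,r)), times a coefficient depending only on m,
times a monomial in the shift operators.

Multiplicativity. At such chains a shuffle product is a sum over subsets A of the points, weighted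
by ζ over the pairs from A to its complement. Since ζ_ii(z/w) vanishes at z = qw (`zeta_eq_zero`), a
term dies as soon as A contains a point but not its predecessor in the chain. Hence A consists of
initial segments, and the sum runs over the decompositions m + m' of the chain lengths
(`ChainModel.evalChains_shuffle`). The product of difference operators has the same index set, and
conjugation by the first shift moves the second chains exactly past the first ones. What remains is
a cocycle identity for the coefficients, `ChainModel.coef_add`. It factors over pairs of chains,
where it telescopes to a relation between one ζ, two φ and the change of a Y-factor under a shift
(`prod_zeta_phi_phi`). As the shuffle algebra consists of functions on complex configurations, its
products are first rewritten as identities of Laurent polynomials with cleared denominators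
(`discr_mul_eq`), which can then be evaluated in the field of rational functions.

Integrality. The coefficients may have poles along w_v = t_e q^n w_u. The Y-factors remove the poles
of φ at the first point of each chain (`ChainModel.CoeffRing.pair_isMultiple`). The other poles are
removed by the wheel conditions: two consecutive points of one chain and a point of another one form
the specialization that these conditions control. `prod_lin_dvd_chainLau` counts multiplicities; the
bounds |q| < |t_e| < 1 exclude accidental coincidences between the linear forms involved. The wheel
conditions are stable under shuffle products (`wheel_mul`), so the image of Υ satisfies them.

Negative half. Inverting the variables is an anti-homomorphism from the shuffle algebra of Q to that
of the reversed quiver (`toConf_mul_invert`). The second explicit map is therefore the first one for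
the reversed quiver, with points q / w_u (`negModel`).

The quiver algebra. The images of the e's and of the f's factor through the shuffle algebras, so the
quadratic and cubic relations need no computation in difference operators (`lift_genImage_rel`). The
relations of ψ with e and f come from `zeta_mul_psiFun`: shifting one w_u changes a single factor of
ψ, by a ratio of two ζ. The leading coefficients are invertible because ψ is a product and quotient
of linear factors with unit coefficients (`isUnitOver_psiFun`). In [e, f], operators at different
points commute because each Y-factor changes by the same ratio when it passes the other operator. At
one point u, the product Y Y' is ψ without its constant and without the factor of u, and the
difference of the two expansions of ψ is a sum over the poles w_u and w_u / q, where the remaining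
constants are 1 and -1 (`psiCoeff_sub_psiCoeff`). -/

noncomputable section

namespace WeightedQuiver

variable {I E : Type*} [Fintype I] [DecidableEq I] [Fintype E] (Q : WeightedQuiver I E)

/-! ### Base change, homogeneity and inversion for ζ and φ. -/

section Maps

variable {L M : Type*} [Field L] [Algebra ℂ L] [Field M] [Algebra ℂ M]

theorem map_qIn (f : L →ₐ[ℂ] M) : f (Q.qIn L) = Q.qIn M := f.commutes _

theorem map_tIn (f : L →ₐ[ℂ] M) (e : E) : f (Q.tIn L e) = Q.tIn M e := f.commutes _

theorem map_zeta (f : L →ₐ[ℂ] M) (i j : I) (z w : L) :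
    f (Q.zeta i j z w) = Q.zeta i j (f z) (f w) := by
  unfold zeta
  split_ifs <;> simp only [map_mul, map_div₀, map_sub, map_prod, map_inv₀, map_qIn, map_tIn, map_one]

theorem map_phi (f : L →ₐ[ℂ] M) (i j : I) (z w : L) :
    f (Q.phi i j z w) = Q.phi i j (f z) (f w) := by
  unfold phi
  split_ifs <;> simp only [map_mul, map_div₀, map_sub, map_prod, map_inv₀, map_qIn, map_tIn, map_one]

theorem qIn_ne_zero : Q.qIn L ≠ 0 := (map_ne_zero _).2 Q.q.ne_zero

theorem tIn_ne_zero (e : E) : Q.tIn L e ≠ 0 := (map_ne_zero _).2 (Q.t e).ne_zero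

theorem zeta_mul_left (i j : I) (c z w : L) (hc : c ≠ 0) :
    Q.zeta i j (c * z) (c * w) = Q.zeta i j z w := by
  unfold zeta
  have h1 : (c * z * (Q.qIn L)⁻¹ - c * w) / (c * z - c * w) =
      (z * (Q.qIn L)⁻¹ - w) / (z - w) := by
    rw [mul_assoc, ← mul_sub, ← mul_sub, mul_div_mul_left _ _ hc]
  have h2 : c * z / (c * w) = z / w := mul_div_mul_left _ _ hc
  have h3 : ∀ e, c * w * Q.tIn L e / (c * z * Q.qIn L) = w * Q.tIn L e / (z * Q.qIn L) := by
    intro e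
    rw [mul_assoc, mul_assoc, mul_div_mul_left _ _ hc]
  simp only [h1, h2, h3]

/-- Rescaling both arguments by zw exchanges them. Together with `rev_zeta` this is the symmetry
that identifies the negative half with the positive half of the reversed quiver. -/
theorem zeta_inv_inv (i j : I) {z w : L} (hz : z ≠ 0) (hw : w ≠ 0) :
    Q.zeta i j z⁻¹ w⁻¹ = Q.zeta i j w z := by
  rw [← Q.zeta_mul_left i j (z * w) _ _ (mul_ne_zero hz hw)]
  congr 1 <;> field_simp

theorem phi_mul_left (i j : I) (c z w : L) (hc : c ≠ 0) :
    Q.phi i j (c * z) (c * w) = Q.phi i j z w := by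
  unfold phi
  have h1 : (c * z - c * w) / (c * z * (Q.qIn L)⁻¹ - c * w) =
      (z - w) / (z * (Q.qIn L)⁻¹ - w) := by
    rw [mul_assoc, ← mul_sub, ← mul_sub, mul_div_mul_left _ _ hc]
  have h2 : c * z / (c * w) = z / w := mul_div_mul_left _ _ hc
  simp only [h1, h2]

theorem phi_inv_inv (i j : I) {z w : L} (hz : z ≠ 0) (hw : w ≠ 0) :
    Q.phi i j z⁻¹ w⁻¹ = Q.phi i j w z := by
  rw [← Q.phi_mul_left i j (z * w) _ _ (mul_ne_zero hz hw)]
  congr 1 <;> field_simp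

end Maps

/-! ### The reversed quiver -/

/-- The quiver with all edges reversed and the same weights. -/
def rev : WeightedQuiver I E where
  src := Q.tgt
  tgt := Q.src
  q := Q.q
  t := Q.t

theorem rev_edges (i j : I) : Q.rev.edges i j = Q.edges j i := by
  ext e
  simp [edges, rev, and_comm]

theorem rev_zeta {L : Type*} [Field L] [Algebra ℂ L] (i j : I) (z w : L) :
    Q.rev.zeta i j z w = Q.zeta j i z w := by
  simp only [zeta, rev_edges]
  simp only [rev, qIn, tIn, eq_comm (a := i)]

theorem rev_phi {L : Type*} [Field L] [Algebra ℂ L] (i j : I) (z w : L) :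
    Q.rev.phi i j z w = Q.phi j i z w := by
  simp only [phi, rev_edges]
  simp only [rev, qIn, tIn, eq_comm (a := i)]

/-! ### Values of shuffle products at points over a field extension -/

/-- The numerator of `ζ(x_a / x_b)` as a Laurent polynomial. -/
def zetaLau {n : I → ℕ} (a b : Vars n) : Lau (Vars n) :=
  (if a.1 = b.1 then
    (Lau.gen a).val * algebraMap ℂ (Lau (Vars n)) (Q.q : ℂ)⁻¹ - (Lau.gen b).val else 1) *
  (∏ e ∈ Q.edges a.1 b.1,
    (algebraMap ℂ (Lau (Vars n)) (Q.t e : ℂ)⁻¹ - (Lau.gen a).val * ((Lau.gen b)⁻¹).val)) *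
  (∏ e ∈ Q.edges b.1 a.1,
    (1 - (Lau.gen b).val * algebraMap ℂ (Lau (Vars n)) (Q.t e : ℂ) * ((Lau.gen a)⁻¹).val *
      algebraMap ℂ (Lau (Vars n)) (Q.q : ℂ)⁻¹))

/-- The denominator of `ζ(x_a / x_b)`. -/
def diffLau {n : I → ℕ} (a b : Vars n) : Lau (Vars n) :=
  if a.1 = b.1 then (Lau.gen a).val - (Lau.gen b).val else 1

end WeightedQuiver

namespace Lau

variable {σ : Type*} [Fintype σ] [DecidableEq σ]

theorem eval_gen_inv {R : Type*} [CommRing R] [Algebra ℂ R] (x : σ → Rˣ) (v : σ) :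
    eval x ((gen v)⁻¹).val = ((x v)⁻¹ : Rˣ) := by
  have h1 : eval x (gen v).val * eval x ((gen v)⁻¹).val = 1 := by
    rw [← map_mul]
    simp
  rw [eval_gen] at h1
  exact (Units.inv_eq_of_mul_eq_one_right h1).symm

theorem eval_algebraMap {R : Type*} [CommRing R] [Algebra ℂ R] (x : σ → Rˣ) (c : ℂ) :
    eval x (algebraMap ℂ (Lau σ) c) = algebraMap ℂ R c := (eval x).commutes c

end Lau

namespace WeightedQuiver

variable {I E : Type*} [Fintype I] [DecidableEq I] [Fintype E] (Q : WeightedQuiver I E)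

theorem Separated.ne {k : I → ℕ} {R : Type*} {x : Vars k → R} (hx : Separated x) {a b : Vars k}
    (hab : a ≠ b) (h : a.1 = b.1) : x a ≠ x b := by
  obtain ⟨i, r⟩ := a
  obtain ⟨j, s⟩ := b
  obtain rfl : i = j := h
  intro h0
  exact hab (by rw [hx i h0])

theorem eval_diffLau_ne_zero {n : I → ℕ} {L : Type*} [Field L] [Algebra ℂ L] {x : Vars n → Lˣ}
    (hx : Separated x) {a b : Vars n} (hab : a ≠ b) : Lau.eval x (diffLau a b) ≠ 0 := by
  unfold diffLau
  split_ifs with h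
  · rw [map_sub, Lau.eval_gen, Lau.eval_gen, sub_ne_zero]
    exact fun h0 => hx.ne hab h (Units.ext h0)
  · simp

theorem eval_zetaLau {n : I → ℕ} {L : Type*} [Field L] [Algebra ℂ L] {x : Vars n → Lˣ}
    (hx : Separated x) {a b : Vars n} (hab : a ≠ b) :
    Lau.eval x (Q.zetaLau a b) =
      Lau.eval x (diffLau a b) * Q.zeta a.1 b.1 (x a : L) (x b) := by
  have hne := eval_diffLau_ne_zero hx hab
  unfold diffLau at hne ⊢
  have e2 : ∀ e, (1 - (x b : L) * algebraMap ℂ L (Q.t e : ℂ) * (x a : L)⁻¹ *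
      (algebraMap ℂ L (Q.q : ℂ))⁻¹) =
      1 - (x b : L) * algebraMap ℂ L (Q.t e : ℂ) / ((x a : L) * algebraMap ℂ L (Q.q : ℂ)) := by
    intro e
    rw [div_eq_mul_inv, mul_inv]
    ring
  have e3 : (x a : L) * (x b : L)⁻¹ = x a / x b := (div_eq_mul_inv _ _).symm
  unfold zetaLau zeta
  split_ifs at hne ⊢ with h
  · rw [map_sub, Lau.eval_gen, Lau.eval_gen] at hne
    simp only [map_mul, map_prod, map_sub, map_one, Lau.eval_gen, Lau.eval_gen_inv,
      Lau.eval_algebraMap, Units.val_inv_eq_inv_val, map_inv₀, e2, e3, qIn, tIn]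
    rw [← mul_assoc, ← mul_assoc, mul_div_cancel₀ _ hne]
  · simp only [map_mul, map_prod, map_sub, map_one, Lau.eval_gen, Lau.eval_gen_inv,
      Lau.eval_algebraMap, Units.val_inv_eq_inv_val, map_inv₀, e2, e3, qIn, tIn, one_mul]

/-- The common denominator of all shuffle products of multidegree `n`. -/
def discr (n : I → ℕ) : Lau (Vars n) :=
  ∏ p ∈ (Finset.univ : Finset (Vars n × Vars n)).filter fun p => p.1 ≠ p.2, diffLau p.1 p.2

theorem eval_discr_ne_zero {n : I → ℕ} {L : Type*} [Field L] [Algebra ℂ L] {y : Vars n → Lˣ}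
    (hy : Separated y) : Lau.eval y (discr n) ≠ 0 := by
  simp only [discr, map_prod]
  exact Finset.prod_ne_zero_iff.2 fun p hp => eval_diffLau_ne_zero hy (Finset.mem_filter.1 hp).2

/-- Pairs in A × Aᶜ have distinct entries, so their denominators form a subproduct of `discr`. The
cofactor is the same for all evaluations. -/
theorem exists_discr_eq {n : I → ℕ} (A : Finset (Vars n)) :
    ∃ R, discr n = (∏ a ∈ A, ∏ b ∈ Finset.univ \ A, diffLau a b) * R := by
  rw [← Finset.prod_product']
  apply Finset.prod_dvd_prod_of_subset
  rintro ⟨a, b⟩ hp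
  simp only [Finset.mem_product, Finset.mem_sdiff, Finset.mem_univ, true_and] at hp
  simp only [Finset.mem_filter, Finset.mem_univ, true_and]
  rintro rfl
  exact hp.2 hp.1

theorem eval_prod_zetaLau {n : I → ℕ} {A : Finset (Vars n)} {R : Lau (Vars n)}
    (hR : discr n = (∏ a ∈ A, ∏ b ∈ Finset.univ \ A, diffLau a b) * R)
    {L : Type*} [Field L] [Algebra ℂ L] {y : Vars n → Lˣ} (hy : Separated y) :
    Lau.eval y ((∏ a ∈ A, ∏ b ∈ Finset.univ \ A, Q.zetaLau a b) * R) =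
      Lau.eval y (discr n) * ∏ a ∈ A, ∏ b ∈ Finset.univ \ A, Q.zeta a.1 b.1 (y a : L) (y b) := by
  rw [hR]
  simp only [map_mul, map_prod]
  rw [mul_right_comm, ← Finset.prod_mul_distrib]
  congr 1
  refine Finset.prod_congr rfl fun a ha => ?_
  rw [← Finset.prod_mul_distrib]
  refine Finset.prod_congr rfl fun b hb => ?_
  rw [Q.eval_zetaLau hy (show a ≠ b by rintro rfl; exact (Finset.mem_sdiff.1 hb).2 ha)]

/-- The shuffle product as an identity of Laurent polynomials. -/
theorem discr_mul_eq {k l n : I → ℕ} {F : Lau (Vars k)} {G : Lau (Vars l)} {H : Lau (Vars n)}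
    (hH : H ∈ SymLau n) (h : Q.toConf k F * Q.toConf l G = Q.toConf n H)
    {U V R : Finset (Vars n) → Lau (Vars n)}
    (hU : ∀ A (x : Vars n → ℂˣ), Separated x →
      Lau.eval x (U A) = Q.toConf k F (A.image fun v => (v.1, x v)))
    (hV : ∀ A (x : Vars n → ℂˣ), Separated x →
      Lau.eval x (V A) = Q.toConf l G (A.image fun v => (v.1, x v)))
    (hR : ∀ A, discr n = (∏ a ∈ A, ∏ b ∈ Finset.univ \ A, diffLau a b) * R A) :
    discr n * H = ∑ A, U A * V (Finset.univ \ A) *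
      ((∏ a ∈ A, ∏ b ∈ Finset.univ \ A, Q.zetaLau a b) * R A) := by
  rw [← sub_eq_zero]
  -- Separated complex points detect Laurent polynomials, and there the identity is the definition
  -- of the product, multiplied by the discriminant.
  apply eq_zero_of_separated
  intro x hx
  rw [map_sub, map_mul, ← Q.toConf_conf hH hx, ← h, Q.mul_conf _ _ hx, map_sum, Finset.mul_sum,
    sub_eq_zero, Finset.powerset_univ]
  refine Finset.sum_congr rfl fun A _ => ?_
  rw [map_mul, map_mul, hU A x hx, hV _ x hx, Q.eval_prod_zetaLau (hR A) hx]
  ring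

/-- The value of a shuffle product at a configuration of points over a field extension. -/
theorem eval_shuffle {k l n : I → ℕ} {F : Lau (Vars k)} {G : Lau (Vars l)} {H : Lau (Vars n)}
    (hH : H ∈ SymLau n) (h : Q.toConf k F * Q.toConf l G = Q.toConf n H)
    {U V : Finset (Vars n) → Lau (Vars n)}
    (hU : ∀ A (x : Vars n → ℂˣ), Separated x →
      Lau.eval x (U A) = Q.toConf k F (A.image fun v => (v.1, x v)))
    (hV : ∀ A (x : Vars n → ℂˣ), Separated x →
      Lau.eval x (V A) = Q.toConf l G (A.image fun v => (v.1, x v)))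
    {L : Type*} [Field L] [Algebra ℂ L] {y : Vars n → Lˣ} (hy : Separated y) :
      Lau.eval y H = ∑ A, Lau.eval y (U A) * Lau.eval y (V (Finset.univ \ A)) *
        ∏ a ∈ A, ∏ b ∈ Finset.univ \ A, Q.zeta a.1 b.1 (y a : L) (y b) := by
  choose R hR using fun A : Finset (Vars n) => exists_discr_eq A
  -- The cleared identity may be evaluated over any field; at separated points the discriminant is
  -- invertible again.
  apply mul_left_cancel₀ (eval_discr_ne_zero hy)
  rw [← map_mul, Q.discr_mul_eq hH h hU hV hR, map_sum, Finset.mul_sum]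
  refine Finset.sum_congr rfl fun A _ => ?_
  rw [map_mul, map_mul, Q.eval_prod_zetaLau (hR A) hy]
  ring

/-- Evaluation at any enumeration of a set of points. -/
theorem eval_comp_eq_toConf {k n : I → ℕ} {F : Lau (Vars k)} (hF : F ∈ SymLau k)
    {e : Vars k → Vars n} (h1 : ∀ v, (e v).1 = v.1) (h2 : Function.Injective e)
    {x : Vars n → ℂˣ} (hx : Separated x) :
    Lau.eval x (Lau.eval (fun v => Lau.gen (e v)) F) =
      Q.toConf k F ((Finset.univ.image e).image fun v => (v.1, x v)) := by
  have hsep : Separated (fun v => x (e v)) := by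
    intro i r s hrs
    by_contra hne
    refine hx.ne (a := e ⟨i, r⟩) (b := e ⟨i, s⟩) (fun h => hne ?_) ?_ hrs
    · simpa using h2 h
    · rw [h1, h1]
  have hc : conf (fun v => x (e v)) = (Finset.univ.image e).image fun v => (v.1, x v) := by
    rw [conf, Finset.image_image]
    congr 1
    funext v
    simp [h1]
  rw [Lau.eval_eval, ← hc, Q.toConf_conf hF hsep]

/-- The polynomial U is known only through its values at complex points. These determine it, so it
is a renaming of F along any enumeration of A. -/
theorem restriction_eq {k n : I → ℕ} {F : Lau (Vars k)} (hF : F ∈ SymLau k)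
    {U : Lau (Vars n)} {A : Finset (Vars n)} (hU : ∀ (x : Vars n → ℂˣ), Separated x →
      Lau.eval x U = Q.toConf k F (A.image fun v => (v.1, x v)))
    {e : Vars k → Vars n} (h1 : ∀ v, (e v).1 = v.1) (h2 : Function.Injective e)
    (h3 : Finset.univ.image e = A) : U = Lau.eval (fun v => Lau.gen (e v)) F := by
  rw [← sub_eq_zero]
  apply eq_zero_of_separated
  intro x hx
  rw [map_sub, hU x hx, Q.eval_comp_eq_toConf hF h1 h2 hx, h3, sub_self]

/-- A configuration has as many points of colour i as any labelling of it, so a wrong count puts all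
the values of U outside the support of F. -/
theorem restriction_eq_zero {k n : I → ℕ} {F : Lau (Vars k)}
    {U : Lau (Vars n)} {A : Finset (Vars n)} (hU : ∀ (x : Vars n → ℂˣ), Separated x →
      Lau.eval x U = Q.toConf k F (A.image fun v => (v.1, x v)))
    {i : I} (hi : (A.filter fun v => v.1 = i).card ≠ k i) : U = 0 := by
  apply eq_zero_of_separated
  intro x hx
  rw [hU x hx, Q.toConf_of_not]
  rintro ⟨y, hy, hyA⟩
  apply hi
  have e1 : ((conf y).filter fun p => p.1 = i).card = k i := by
    have : (conf y).filter (fun p => p.1 = i) =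
        (Finset.univ : Finset (Fin (k i))).image fun r => (i, y ⟨i, r⟩) := by
      ext ⟨j, z⟩
      simp only [conf, Finset.mem_filter, Finset.mem_image, Finset.mem_univ, true_and,
        Prod.mk.injEq]
      constructor
      · rintro ⟨⟨⟨j', r⟩, rfl, rfl⟩, rfl⟩
        exact ⟨r, rfl, rfl⟩
      · rintro ⟨r, rfl, rfl⟩
        exact ⟨⟨⟨i, r⟩, rfl, rfl⟩, rfl⟩
    rw [this, Finset.card_image_of_injective, Finset.card_univ, Fintype.card_fin]
    intro r s hrs
    exact hy i (congrArg Prod.snd hrs)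
  rw [← e1, hyA, Finset.filter_image, Finset.card_image_of_injOn]
  intro a _ b _ hab
  simp only [Prod.mk.injEq] at hab
  by_contra hne
  exact hx.ne hne hab.1 hab.2

end WeightedQuiver

end

/-! ### Coefficient relations as values of ζ, maps out of the big shuffle algebra, and Υ. -/

noncomputable section

namespace LaurentPolynomial

/-- Evaluation `T ↦ x` of Laurent polynomials at a unit of a commutative algebra. -/
def evalUnit {k R : Type*} [CommRing k] [CommRing R] [Algebra k R] (x : Rˣ) :
    LaurentPolynomial k →ₐ[k] R :=
  AddMonoidAlgebra.lift k R ℤ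
    { toFun := fun n => ((x ^ n.toAdd : Rˣ) : R)
      map_one' := by simp
      map_mul' := fun m n => by simp [zpow_add] }

variable {k R : Type*} [CommRing k] [CommRing R] [Algebra k R] (x : Rˣ)

theorem evalUnit_apply (p : LaurentPolynomial k) :
    evalUnit x p = p.coeff.sum fun n c => c • ((x ^ n : Rˣ) : R) := by
  rw [evalUnit, AddMonoidAlgebra.lift_apply]
  rfl

theorem evalUnit_T (n : ℤ) : evalUnit x (T n : LaurentPolynomial k) = ((x ^ n : Rˣ) : R) := by
  simp only [evalUnit, T, AddMonoidAlgebra.lift_single, one_smul]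
  rfl

theorem evalUnit_C (c : k) : evalUnit x (C c) = algebraMap k R c :=
  (evalUnit x).commutes c

theorem evalUnit_invert (p : LaurentPolynomial k) :
    evalUnit x (invert p) = evalUnit x⁻¹ p := by
  induction p using LaurentPolynomial.induction_on' with
  | add p q hp hq => rw [map_add, map_add, map_add, hp, hq]
  | C_mul_T n a => simp only [map_mul, invert_T, invert_C, evalUnit_T, evalUnit_C, inv_zpow, zpow_neg]

end LaurentPolynomial

namespace WeightedQuiver

variable {I E : Type*} [Fintype I] [DecidableEq I] [Fintype E] (Q : WeightedQuiver I E)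

open LaurentPolynomial in
theorem evalUnit_zetaL {L : Type*} [Field L] [Algebra ℂ L] (i j : I) (x : Lˣ) :
    evalUnit x (Q.zetaL i j) = (if i = j then (Q.qIn L)⁻¹ * x - 1 else 1) *
      (∏ e ∈ Q.edges i j, ((Q.tIn L e)⁻¹ - x)) *
      ∏ e ∈ Q.edges j i, (1 - Q.tIn L e / Q.qIn L * (x : L)⁻¹) := by
  have h : evalUnit x (if i = j then C (Q.q : ℂ)⁻¹ * T 1 - 1 else 1 : LaurentPolynomial ℂ) =
      (if i = j then (Q.qIn L)⁻¹ * x - 1 else 1) := by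
    split_ifs <;> simp [evalUnit_T, evalUnit_C]
  simp only [zetaL, map_mul, h, map_prod, map_sub, evalUnit_T, evalUnit_C, map_one, map_inv₀,
    map_div₀, zpow_one, zpow_neg, Units.val_inv_eq_inv_val]

open LaurentPolynomial in
theorem evalUnit_zetaR {L : Type*} [Field L] [Algebra ℂ L] (i j : I) (x : Lˣ) :
    evalUnit x (Q.zetaR i j) = (if i = j then x - (Q.qIn L)⁻¹ else 1) *
      (∏ e ∈ Q.edges j i, ((Q.tIn L e)⁻¹ - (x : L)⁻¹)) *
      ∏ e ∈ Q.edges i j, (1 - Q.tIn L e / Q.qIn L * x) := by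
  have h : evalUnit x (if i = j then -T 1 else 1 : LaurentPolynomial ℂ) =
      (if i = j then -(x : L) else 1) := by
    split_ifs <;> simp [evalUnit_T]
  rw [zetaR, map_mul, evalUnit_invert, h, evalUnit_zetaL]
  have h2 : (if i = j then -(x : L) else 1) *
      (if j = i then (Q.qIn L)⁻¹ * (x⁻¹ : Lˣ) - 1 else 1) =
      (if i = j then x - (Q.qIn L)⁻¹ else 1) := by
    by_cases hij : i = j
    · simp only [hij, if_true, Units.val_inv_eq_inv_val]
      have := x.ne_zero
      field_simp
      ring
    · simp [hij, Ne.symm hij]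
  rw [← mul_assoc, ← mul_assoc, h2]
  simp only [Units.val_inv_eq_inv_val, inv_inv]

/-- This and `evalUnit_zetaR_eq` carry the same prefactor (z/w - 1)^δ, so the coefficientwise
relations amount to identities between ζ_ij(z/w) and ζ_ji(w/z). -/
theorem evalUnit_zetaL_eq {L : Type*} [Field L] [Algebra ℂ L] (i j : I) (x : Lˣ) (z w : L)
    (hz : z ≠ 0) (hw : w ≠ 0) (hx : (x : L) = z / w) (hne : i = j → z ≠ w) :
    LaurentPolynomial.evalUnit x (Q.zetaL i j) =
      (if i = j then z / w - 1 else 1) * Q.zeta i j z w := by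
  have hq := Q.qIn_ne_zero (L := L)
  rw [evalUnit_zetaL, zeta, hx, ← mul_assoc, ← mul_assoc]
  congr 1
  · congr 1
    split_ifs with h
    · have := sub_ne_zero.2 (hne h)
      field_simp
    · simp
  · refine Finset.prod_congr rfl fun e _ => ?_
    field_simp

theorem evalUnit_zetaR_eq {L : Type*} [Field L] [Algebra ℂ L] (i j : I) (x : Lˣ) (z w : L)
    (hz : z ≠ 0) (hw : w ≠ 0) (hx : (x : L) = z / w) (hne : i = j → z ≠ w) :
    LaurentPolynomial.evalUnit x (Q.zetaR i j) =
      (if i = j then z / w - 1 else 1) * Q.zeta j i w z := by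
  have hq := Q.qIn_ne_zero (L := L)
  rw [evalUnit_zetaR, zeta, hx, ← mul_assoc, ← mul_assoc]
  congr 1
  · congr 1
    · split_ifs with h h' h'
      · have := sub_ne_zero.2 (hne h)
        have := sub_ne_zero.2 (hne h).symm
        field_simp
        ring
      · exact absurd h.symm h'
      · exact absurd h'.symm h
      · simp
    · refine Finset.prod_congr rfl fun e _ => ?_
      field_simp
  · refine Finset.prod_congr rfl fun e _ => ?_
    field_simp

/-! ### Coefficients of products with Laurent polynomials -/

theorem map_seriesCoeff {A B : Type*} [AddCommMonoid A] [Module ℂ A] [AddCommMonoid B] [Module ℂ B]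
    (f : A →ₗ[ℂ] B) (p : LaurentPolynomial ℂ) (X : ℤ → ℤ → A) (r s : ℤ) :
    f (seriesCoeff p X r s) = seriesCoeff p (fun r s => f (X r s)) r s := by
  simp only [seriesCoeff, Finsupp.sum, map_sum, map_smul]

theorem seriesCoeff_sum {A : Type*} [AddCommMonoid A] [Module ℂ A] {ι : Type*} (T : Finset ι)
    (p : LaurentPolynomial ℂ) (X : ι → ℤ → ℤ → A) (r s : ℤ) :
    seriesCoeff p (fun r s => ∑ i ∈ T, X i r s) r s = ∑ i ∈ T, seriesCoeff p (X i) r s := by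
  simp only [seriesCoeff, Finsupp.sum, Finset.smul_sum]
  exact Finset.sum_comm

/-- A family z^r w^s is an eigenvector for multiplication by p(z/w): the index shift (r+n, s-n)
contributes (z/w)^n. -/
theorem seriesCoeff_monomial {L : Type*} [Field L] [Algebra ℂ L] (p : LaurentPolynomial ℂ)
    (z w : Lˣ) (c : L) (r s : ℤ) :
    seriesCoeff p (fun r s => (z : L) ^ r * (w : L) ^ s * c) r s =
      (z : L) ^ r * (w : L) ^ s * c * LaurentPolynomial.evalUnit (z / w) p := by
  rw [LaurentPolynomial.evalUnit_apply, seriesCoeff, Finsupp.sum, Finsupp.sum, Finset.mul_sum]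
  refine Finset.sum_congr rfl fun n _ => ?_
  rw [mul_smul_comm, zpow_add₀ z.ne_zero, zpow_sub₀ w.ne_zero, Units.val_zpow_eq_zpow_val,
    Units.val_div_eq_div_val, div_zpow]
  congr 1
  ring

/-! ### The big shuffle algebra as a direct sum -/

/-- Counting the points of each colour recovers the multidegree from a configuration. -/
theorem toConf_of_conf_ne {k l : I → ℕ} (F : Lau (Vars l)) {x : Vars k → ℂˣ} (hx : Separated x)
    (h : k ≠ l) : Q.toConf l F (conf x) = 0 := by
  apply Q.toConf_of_not
  rintro ⟨y, hy, hyx⟩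
  apply h
  have e1 : ∀ {m : I → ℕ} {y : Vars m → ℂˣ} (_ : Separated y) (i : I),
      ((conf y).filter fun p => p.1 = i).card = m i := by
    intro m y hy i
    have : (conf y).filter (fun p => p.1 = i) =
        (Finset.univ : Finset (Fin (m i))).image fun r => (i, y ⟨i, r⟩) := by
      ext ⟨j, z⟩
      simp only [conf, Finset.mem_filter, Finset.mem_image, Finset.mem_univ, true_and,
        Prod.mk.injEq]
      constructor
      · rintro ⟨⟨⟨j', r⟩, rfl, rfl⟩, rfl⟩
        exact ⟨r, rfl, rfl⟩
      · rintro ⟨r, rfl, rfl⟩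
        exact ⟨⟨⟨i, r⟩, rfl, rfl⟩, rfl⟩
    rw [this, Finset.card_image_of_injective, Finset.card_univ, Fintype.card_fin]
    intro r s hrs
    exact hy i (congrArg Prod.snd hrs)
  funext i
  rw [← e1 hx i, ← e1 hy i, hyx]

/-- The sum of the inclusions of the graded components. -/
def ofSymSum : (Π₀ k : I → ℕ, SymLau k) →ₗ[ℂ] Q.BigShuffle :=
  DFinsupp.lsum ℂ fun k => Q.ofSym k

/-- Evaluation at separated configurations of multidegree k isolates the k-th component, and these
points detect Laurent polynomials. -/
theorem ofSymSum_injective : Function.Injective Q.ofSymSum := by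
  rw [injective_iff_map_eq_zero]
  intro f hf
  ext1 k
  have h1 : ∀ x : Vars k → ℂˣ, Separated x → Lau.eval x (f k : Lau (Vars k)) = 0 := by
    intro x hx
    have h2 : ((Q.ofSymSum f : Q.BigShuffle) : Q.ConfFun) (conf x) = 0 := by
      rw [hf]
      rfl
    classical
    let ev : Q.BigShuffle →ₗ[ℂ] ℂ :=
      { toFun := fun g => (g : Q.ConfFun) (conf x)
        map_add' := fun _ _ => rfl
        map_smul' := fun _ _ => rfl }
    have h3 : ev (Q.ofSymSum f) = Lau.eval x (f k : Lau (Vars k)) := by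
      rw [ofSymSum, DFinsupp.lsum_apply_apply, DFinsupp.sumAddHom_apply, DFinsupp.sum, map_sum,
        Finset.sum_eq_single k]
      · exact Q.toConf_conf (f k).2 hx
      · intro l _ hl
        exact Q.toConf_of_conf_ne _ hx hl.symm
      · intro hk
        rw [DFinsupp.notMem_support_iff.1 hk]
        simp
    rw [← h3]
    exact h2
  exact Subtype.ext (eq_zero_of_separated h1)

theorem ofSymSum_surjective : Function.Surjective Q.ofSymSum := by
  rintro ⟨f, hf⟩
  have hf' : f ∈ (⨆ k : I → ℕ, (SymLau k).map (Q.toConf k)) := hf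
  induction hf' using Submodule.iSup_induction' with
  | mem k g hg =>
    obtain ⟨F, hF, rfl⟩ := hg
    refine ⟨DFinsupp.single k ⟨F, hF⟩, ?_⟩
    rw [ofSymSum, DFinsupp.lsum_single]
    rfl
  | zero => exact ⟨0, map_zero _⟩
  | add g h hg hh ihg ihh =>
    obtain ⟨u, hu⟩ := ihg hg
    obtain ⟨v, hv⟩ := ihh hh
    exact ⟨u + v, by rw [map_add, hu, hv]; rfl⟩

theorem bigShuffle_induction {p : Q.BigShuffle → Prop} (x : Q.BigShuffle)
    (hof : ∀ k F, p (Q.ofSym k F)) (h0 : p 0) (hadd : ∀ x y, p x → p y → p (x + y)) : p x := by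
  obtain ⟨f, rfl⟩ := Q.ofSymSum_surjective x
  induction f using DFinsupp.induction with
  | h0 => rwa [map_zero]
  | ha i b f _ _ ih =>
    rw [map_add]
    refine hadd _ _ ?_ ih
    rw [ofSymSum, DFinsupp.lsum_single]
    exact hof _ _

theorem one_mem_symLau : (1 : Lau (Vars (0 : I → ℕ))) ∈ SymLau 0 := fun _ => map_one _

theorem ofSym_one : Q.ofSym 0 ⟨1, one_mem_symLau⟩ = 1 := Subtype.ext Q.one_eq_toConf.symm

/-- Algebra homomorphisms from the big shuffle algebra are determined by multiplicative families of
linear maps on the graded components. -/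
theorem exists_algHom {M : Type*} [Ring M] [Algebra ℂ M] (φ : ∀ k : I → ℕ, SymLau k →ₗ[ℂ] M)
    (h1 : φ 0 ⟨1, one_mem_symLau⟩ = 1)
    (hmul : ∀ (k l n : I → ℕ) (F : SymLau k) (G : SymLau l) (H : SymLau n), k + l = n →
      Q.toConf k F * Q.toConf l G = Q.toConf n H → φ n H = φ k F * φ l G) :
    ∃ Φ : Q.BigShuffle →ₐ[ℂ] M, ∀ k F, Φ (Q.ofSym k F) = φ k F := by
  let e := LinearEquiv.ofBijective Q.ofSymSum ⟨Q.ofSymSum_injective, Q.ofSymSum_surjective⟩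
  let Ψ : Q.BigShuffle →ₗ[ℂ] M := (DFinsupp.lsum ℂ φ).comp e.symm.toLinearMap
  have hΨ : ∀ k F, Ψ (Q.ofSym k F) = φ k F := by
    intro k F
    have : e.symm (Q.ofSym k F) = DFinsupp.single k F := by
      rw [LinearEquiv.symm_apply_eq]
      change _ = Q.ofSymSum _
      rw [ofSymSum, DFinsupp.lsum_single]
    simp only [Ψ, LinearMap.comp_apply, LinearEquiv.coe_coe, this, DFinsupp.lsum_single]
  have hΨ1 : Ψ 1 = 1 := by rw [← Q.ofSym_one, hΨ, h1]
  have hΨm : ∀ x y, Ψ (x * y) = Ψ x * Ψ y := by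
    intro x y
    induction x using Q.bigShuffle_induction with
    | h0 => simp
    | hadd x x' hx hx' => rw [add_mul, map_add, map_add, hx, hx', add_mul]
    | hof k F =>
      induction y using Q.bigShuffle_induction with
      | h0 => simp
      | hadd x x' hx hx' => rw [mul_add, map_add, map_add, hx, hx', mul_add]
      | hof l G =>
        obtain ⟨H, hH, h⟩ := Q.exists_mul F.2 G.2
        have : Q.ofSym k F * Q.ofSym l G = Q.ofSym (k + l) ⟨H, hH⟩ := Subtype.ext h
        rw [this, hΨ, hΨ, hΨ]
        exact hmul k l _ F G ⟨H, hH⟩ rfl h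
  exact ⟨AlgHom.ofLinearMap Ψ hΨ1 hΨm, hΨ⟩

/-! ### Quadratic relations in the big shuffle algebra -/

theorem xPow_singleton (i : I) (r : ℤ) (z : ℂˣ) :
    (Q.xPow i r : Q.ConfFun) {(i, z)} = (z : ℂ) ^ r := by
  have hx : Separated (fun _ : Vars (Pi.single i 1 : I → ℕ) => z) := by
    intro j r s _
    by_cases hj : j = i
    · subst hj
      have h1 := r.2
      have h2 := s.2
      simp only [Pi.single_eq_same] at h1 h2
      ext
      omega
    · have h1 := r.2
      simp [Pi.single_eq_of_ne hj] at h1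
  have hc : conf (fun _ : Vars (Pi.single i 1 : I → ℕ) => z) = {(i, z)} := by
    ext ⟨j, y⟩
    simp only [conf, Finset.mem_image, Finset.mem_univ, true_and, Prod.mk.injEq,
      Finset.mem_singleton]
    constructor
    · rintro ⟨⟨j', r⟩, rfl, rfl⟩
      refine ⟨?_, rfl⟩
      by_contra hj
      have h1 := r.2
      simp [Pi.single_eq_of_ne hj] at h1
    · rintro ⟨rfl, rfl⟩
      exact ⟨⟨j, ⟨0, by simp⟩⟩, rfl, rfl⟩
  rw [← hc]
  refine (Q.toConf_conf (monomial_mem _ r) hx).trans ?_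
  rw [Lau.eval_single, ← Finset.univ_sigma_univ, Finset.prod_sigma, Finset.prod_eq_single i]
  · simp
  · intro j _ hj
    have : IsEmpty (Fin ((Pi.single i 1 : I → ℕ) j)) := by
      rw [Pi.single_eq_of_ne hj]
      infer_instance
    exact Finset.prod_of_isEmpty _
  · simp

theorem xPow_apply_eq_zero (i : I) (r : ℤ) {S : Finset (I × ℂˣ)} (h : ∀ z, S ≠ {(i, z)}) :
    (Q.xPow i r : Q.ConfFun) S = 0 := by
  apply Q.toConf_of_not
  rintro ⟨y, -, rfl⟩
  refine h (y ⟨i, ⟨0, by simp⟩⟩) ?_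
  ext ⟨j, z⟩
  simp only [conf, Finset.mem_image, Finset.mem_univ, true_and, Prod.mk.injEq,
    Finset.mem_singleton]
  constructor
  · rintro ⟨⟨j', r⟩, rfl, rfl⟩
    have hj : j' = i := by
      by_contra hj
      have h1 := r.2
      simp [Pi.single_eq_of_ne hj] at h1
    subst hj
    refine ⟨rfl, ?_⟩
    congr
    have h1 := r.2
    simp only [Pi.single_eq_same] at h1
    ext
    simp only
    omega
  · rintro ⟨rfl, rfl⟩
    exact ⟨_, rfl, rfl⟩

/-- At a configuration {z, w} the two products, reindexed by complements, differ only in ζ_ij(z/w)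
against ζ_ji(w/z). Each prefactor supplies the missing one, so that both sides contain ζ_ij(z/w)
ζ_ji(w/z). -/
theorem xPow_quadratic (i j : I) (r s : ℤ) :
    seriesCoeff (Q.zetaR i j) (fun r s => Q.xPow i r * Q.xPow j s) r s =
      seriesCoeff (Q.zetaL i j) (fun r s => Q.xPow j s * Q.xPow i r) r s := by
  apply Subtype.ext
  apply ConfFun.ext
  intro S
  let ev : Q.BigShuffle →ₗ[ℂ] ℂ :=
    { toFun := fun g => (g : Q.ConfFun) S
      map_add' := fun _ _ => rfl
      map_smul' := fun _ _ => rfl }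
  change ev _ = ev _
  rw [map_seriesCoeff, map_seriesCoeff]
  have h1 : ∀ r s, ev (Q.xPow i r * Q.xPow j s) = ∑ A ∈ S.powerset,
      (Q.xPow i r : Q.ConfFun) A * (Q.xPow j s : Q.ConfFun) (S \ A) *
        ConfFun.zetaProd Q A (S \ A) := fun r s => rfl
  have h2 : ∀ r s, ev (Q.xPow j s * Q.xPow i r) = ∑ A ∈ S.powerset,
      (Q.xPow i r : Q.ConfFun) A * (Q.xPow j s : Q.ConfFun) (S \ A) *
        ConfFun.zetaProd Q (S \ A) A := by
    intro r s
    have : ev (Q.xPow j s * Q.xPow i r) = ∑ A ∈ S.powerset,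
      (Q.xPow j s : Q.ConfFun) A * (Q.xPow i r : Q.ConfFun) (S \ A) *
        ConfFun.zetaProd Q A (S \ A) := rfl
    rw [this]
    refine Finset.sum_bij' (fun A _ => S \ A) (fun A _ => S \ A) ?_ ?_ ?_ ?_ ?_
    · intro A _
      simp
    · intro A _
      simp
    · intro A hA
      simp [Finset.inter_eq_right.2 (Finset.mem_powerset.1 hA)]
    · intro A hA
      simp [Finset.inter_eq_right.2 (Finset.mem_powerset.1 hA)]
    · intro A hA
      rw [Finset.sdiff_sdiff_eq_self (Finset.mem_powerset.1 hA)]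
      ring
  simp only [h1, h2, seriesCoeff_sum]
  refine Finset.sum_congr rfl fun A _ => ?_
  by_cases hA : ∃ z, A = {(i, z)}
  · obtain ⟨z, hz⟩ := hA
    by_cases hB : ∃ w, S \ A = {(j, w)}
    · obtain ⟨w, hw⟩ := hB
      -- The points come from complementary subsets, hence differ when they have the same colour;
      -- the denominators of ζ then do not vanish.
      have hne : i = j → (z : ℂ) ≠ w := by
        rintro rfl h0
        obtain rfl := Units.ext h0
        have h3 : (i, z) ∈ S \ A := hw ▸ Finset.mem_singleton_self _
        have h4 : (i, z) ∈ A := hz ▸ Finset.mem_singleton_self _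
        exact (Finset.mem_sdiff.1 h3).2 h4
      simp only [hw]
      simp only [hz, Q.xPow_singleton]
      rw [seriesCoeff_monomial, seriesCoeff_monomial,
        Q.evalUnit_zetaR_eq i j (z / w) z w z.ne_zero w.ne_zero (by simp) hne,
        Q.evalUnit_zetaL_eq i j (z / w) z w z.ne_zero w.ne_zero (by simp) hne]
      simp only [ConfFun.zetaProd, Finset.prod_singleton]
      ring
    · push Not at hB
      simp only [fun s => Q.xPow_apply_eq_zero j s hB, mul_zero, zero_mul]
      simp [seriesCoeff]
  · push Not at hA
    simp only [fun s => Q.xPow_apply_eq_zero i s hA, zero_mul]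
    simp [seriesCoeff]

/-- The homomorphism `U^>_Q → 𝕊^Q`, `e_{i,r} ↦ x_{i,1}^r`. -/
def upsilonPos : Q.UPos →ₐ[ℂ] Q.BigShuffle :=
  RingQuot.liftAlgHom ℂ ⟨Q.shuffleEval, by
    intro x y h
    cases h with
    | quad i j r s =>
      have e := Q.xPow_quadratic i j r s
      rw [← AlgHom.toLinearMap_apply, ← AlgHom.toLinearMap_apply, map_seriesCoeff, map_seriesCoeff]
      simpa [shuffleEval] using e
    | serre x hx h => rw [h, map_zero]⟩

theorem upsilonPos_mk (x : FreeAlgebra ℂ (I × ℤ)) :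
    Q.upsilonPos (RingQuot.mkAlgHom ℂ Q.PosRel x) = Q.shuffleEval x :=
  RingQuot.liftAlgHom_mkAlgHom_apply ℂ _ _ x

/-- The homomorphism `U^<_Q → 𝕊^{Q,op}`, `f_{i,r} ↦ x_{i,1}^r`. -/
def upsilonNeg : Q.UNeg →ₐ[ℂ] (Q.BigShuffle)ᵐᵒᵖ :=
  RingQuot.liftAlgHom ℂ ⟨Q.shuffleEvalOp, by
    intro x y h
    cases h with
    | quad i j r s =>
      have e := congrArg (MulOpposite.opLinearEquiv ℂ).toLinearMap (Q.xPow_quadratic i j r s)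
      rw [map_seriesCoeff, map_seriesCoeff] at e
      rw [← AlgHom.toLinearMap_apply, ← AlgHom.toLinearMap_apply, map_seriesCoeff, map_seriesCoeff]
      simpa [shuffleEvalOp] using e.symm
    | serre x hx h => rw [h, map_zero]⟩

theorem upsilonNeg_mk (x : FreeAlgebra ℂ (I × ℤ)) :
    Q.upsilonNeg (RingQuot.mkAlgHom ℂ Q.NegRel x) = Q.shuffleEvalOp x :=
  RingQuot.liftAlgHom_mkAlgHom_apply ℂ _ _ x

end WeightedQuiver

end

/-! ### Admissible parameters, and the identity between ζ, φ and the shift of Y. -/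

noncomputable section

namespace WeightedQuiver

variable {I E : Type*} [Fintype I] [DecidableEq I] [Fintype E] (Q : WeightedQuiver I E)

/-- The standing assumptions on the parameters: `q` is not a root of unity and `|q| < |t_e| < 1`. -/
structure Admissible : Prop where
  pow_ne_one : ∀ n : ℕ, 0 < n → Q.q ^ n ≠ 1
  norm_lt : ∀ e, ‖(Q.q : ℂ)‖ < ‖(Q.t e : ℂ)‖ ∧ ‖(Q.t e : ℂ)‖ < 1

variable {Q}

theorem Admissible.rev (hQ : Q.Admissible) : Q.rev.Admissible := ⟨hQ.1, hQ.2⟩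

theorem Admissible.pow_ne (hQ : Q.Admissible) {n : ℕ} (hn : n ≠ 0) : (Q.q : ℂ) ^ n ≠ 1 := by
  intro h
  exact hQ.1 n (Nat.pos_of_ne_zero hn) (Units.ext (by simpa using h))

/-- The absolute value of q^n is at least 1 for n ≤ 0 and at most |q| for n ≥ 1, so it never lies
strictly between |q| and 1. -/
theorem Admissible.t_ne_pow (hQ : Q.Admissible) (e : E) (n : ℤ) : (Q.t e : ℂ) ≠ (Q.q : ℂ) ^ n := by
  obtain ⟨h1, h2⟩ := hQ.2 e
  have h0 : 0 < ‖(Q.q : ℂ)‖ := norm_pos_iff.2 Q.q.ne_zero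
  have hlt : ‖(Q.q : ℂ)‖ < 1 := h1.trans h2
  intro h
  have h3 : ‖(Q.t e : ℂ)‖ = ‖(Q.q : ℂ)‖ ^ n := by rw [h, norm_zpow]
  rw [h3] at h1 h2
  rcases le_or_gt n 0 with hn | hn
  · exact absurd h2 (not_lt.2 (one_le_zpow_of_nonpos₀ h0 hlt.le hn))
  · have : ‖(Q.q : ℂ)‖ ^ n ≤ ‖(Q.q : ℂ)‖ ^ (1 : ℤ) :=
      zpow_le_zpow_right_of_le_one₀ h0 hlt.le hn
    rw [zpow_one] at this
    exact absurd h1 (not_lt.2 this)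

/-- A vanishing factor would force q^(n+1) = 1, t_e = q^n or t_e = q^(1-n), and the denominator
vanishes only if q^n = 1. Hence the ζ⁻¹ between points of one chain are genuine inverses. -/
theorem Admissible.zeta_ne_zero (hQ : Q.Admissible) (i : I) {n : ℕ} (hn : n ≠ 0) :
    Q.zeta i i (1 : ℂ) ((Q.q : ℂ) ^ n) ≠ 0 := by
  have hq : (Q.q : ℂ) ≠ 0 := Q.q.ne_zero
  obtain ⟨n, rfl⟩ := Nat.exists_eq_succ_of_ne_zero hn
  simp only [zeta, if_true, qIn, tIn, Algebra.algebraMap_self, RingHom.id_apply]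
  refine mul_ne_zero (mul_ne_zero (div_ne_zero ?_ ?_) ?_) ?_
  · rw [one_mul, sub_ne_zero]
    intro h
    refine hQ.pow_ne (n := n + 1 + 1) (by omega) ?_
    rw [pow_succ, ← h, inv_mul_cancel₀ hq]
  · rw [sub_ne_zero]
    exact (hQ.pow_ne (by omega)).symm
  · refine Finset.prod_ne_zero_iff.2 fun e _ => ?_
    rw [sub_ne_zero, one_div, Ne, inv_inj]
    exact_mod_cast hQ.t_ne_pow e (n + 1 : ℕ)
  · refine Finset.prod_ne_zero_iff.2 fun e _ => ?_
    rw [sub_ne_zero]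
    intro h
    apply hQ.t_ne_pow e (-(n : ℤ))
    have hqn := pow_ne_zero n hq
    rw [one_mul, pow_succ, eq_div_iff hq, one_mul] at h
    rw [zpow_neg, zpow_natCast]
    exact eq_inv_of_mul_eq_one_left (mul_right_cancel₀ hq (by linear_combination -h))

variable (Q)

section Field

variable {L : Type*} [Field L] [Algebra ℂ L]

/-- The numerator z/q - w vanishes. This zero is what singles out initial segments of chains in
shuffle products. -/
theorem zeta_eq_zero (i : I) {z w : L} (h : z = w * Q.qIn L) : Q.zeta i i z w = 0 := by
  have hq := Q.qIn_ne_zero (L := L)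
  rw [zeta, if_pos rfl, h, mul_inv_cancel_right₀ hq, sub_self, zero_div, zero_mul, zero_mul]

/-- By homogeneity ζ between two points of one chain depends only on their distance, so it is a
complex constant. -/
theorem zeta_mul_pow (i : I) {z : L} (hz : z ≠ 0) (n : ℕ) :
    Q.zeta i i z (z * Q.qIn L ^ n) = algebraMap ℂ L (Q.zeta i i (1 : ℂ) ((Q.q : ℂ) ^ n)) := by
  have h := Q.map_zeta (Algebra.ofId ℂ L) i i (1 : ℂ) ((Q.q : ℂ) ^ n)
  rw [map_one, map_pow] at h
  refine Eq.trans ?_ h.symm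
  have h2 := Q.zeta_mul_left i i z 1 (Q.qIn L ^ n) hz
  rw [mul_one] at h2
  exact h2

/-- The element `∏_{e : i → i} t_e` of a field extension. -/
def loopProdIn (L : Type*) [Field L] [Algebra ℂ L] (i : I) : L := ∏ e ∈ Q.edges i i, Q.tIn L e

/-- The element `∏_i ∏_{e : i → i} t_e^{(k_i - k_i²)/2}` of a field extension. -/
def loopConstIn (L : Type*) [Field L] [Algebra ℂ L] (k : I → ℕ) : L :=
  ∏ i, ∏ e ∈ Q.edges i i, Q.tIn L e ^ (((k i : ℤ) - (k i : ℤ) ^ 2) / 2)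

/-- Since m - m² is even, the integer divisions are exact, and the statement is the expansion of (k
+ l)². -/
theorem half_sub_sq_add (k l : ℤ) :
    ((k + l) - (k + l) ^ 2) / 2 + k * l = (k - k ^ 2) / 2 + (l - l ^ 2) / 2 := by
  have h : ∀ m : ℤ, ∃ c, m - m ^ 2 = 2 * c := by
    intro m
    obtain ⟨c, hc⟩ := Int.even_mul_succ_self (m - 1)
    exact ⟨-c, by linear_combination -hc⟩
  obtain ⟨a, ha⟩ := h k
  obtain ⟨b, hb⟩ := h l
  have hc : (k + l) - (k + l) ^ 2 = 2 * (a + b - k * l) := by linear_combination ha + hb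
  rw [ha, hb, hc]
  simp

/-- The normalizing constant is a coboundary for the loop factors, of which each pair consisting of
a point of the first factor and a point of the second, of the same colour, produces one. -/
theorem loopConstIn_add (k l : I → ℕ) :
    Q.loopConstIn L (k + l) * ∏ i, Q.loopProdIn L i ^ (k i * l i) =
      Q.loopConstIn L k * Q.loopConstIn L l := by
  simp only [loopConstIn, loopProdIn, ← Finset.prod_pow, ← Finset.prod_mul_distrib]
  refine Finset.prod_congr rfl fun i _ => Finset.prod_congr rfl fun e _ => ?_
  have ht := Q.tIn_ne_zero (L := L) e
  rw [← zpow_natCast, ← zpow_add₀ ht, ← zpow_add₀ ht]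
  congr 1
  have h := half_sub_sq_add (k i : ℤ) (l i)
  rw [Pi.add_apply]
  push_cast
  exact h

/-- The ratio between the factor of `Y_v(z)` at `u` and its shift, where `u` and `v` have colours
`i` and `j`, and `w` is moved to `w q^n`. -/
def chainRatio (i j : I) (n : ℕ) (w z : L) : L :=
  (∏ e ∈ Q.edges j i, (((Q.tIn L e)⁻¹ - z / w) / ((Q.tIn L e)⁻¹ - z / (w * Q.qIn L ^ n)))) *
    if i = j then (1 - z / (w * Q.qIn L ^ n)) / (1 - z / w)
      else (∏ e ∈ Q.edges j i, Q.tIn L e)⁻¹ ^ n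

theorem inv_t_sub_ne_zero {z w : L} (hw : w ≠ 0) (h : ∀ c : ℂ, z ≠ algebraMap ℂ L c * w)
    (e : E) (n : ℕ) : (Q.tIn L e)⁻¹ - z / (w * Q.qIn L ^ n) ≠ 0 := by
  have hq := Q.qIn_ne_zero (L := L)
  intro h0
  rw [sub_eq_zero, eq_div_iff (mul_ne_zero hw (pow_ne_zero _ hq))] at h0
  apply h ((Q.t e : ℂ)⁻¹ * Q.q ^ n)
  rw [map_mul, map_inv₀, map_pow, ← h0]
  ring

theorem one_sub_ne_zero_of_generic {z w : L} (hw : w ≠ 0) (h : ∀ c : ℂ, z ≠ algebraMap ℂ L c * w)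
    (n : ℕ) : 1 - z / (w * Q.qIn L ^ n) ≠ 0 := by
  have hq := Q.qIn_ne_zero (L := L)
  intro h0
  rw [sub_eq_zero, eq_div_iff (mul_ne_zero hw (pow_ne_zero _ hq))] at h0
  apply h (Q.q ^ n)
  rw [map_pow, ← h0]
  ring

/-- The factor φ_ij(a/z) cancels the i → j edges and the diagonal part of ζ_ij(a/z). In the j → i
edges, 1 - z t/(aq) = t (1/t - z/(aq)), whose second factor is the denominator of the shift ratio,
while φ_ji(z/a) cancels its numerator. Only the product of the t_e survives: it cancels against the
shift of the formal power when i ≠ j and is the loop product when i = j. -/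
theorem zeta_mul_phi_mul_phi (i j : I) {z a : L} (ha : a ≠ 0)
    (h : ∀ c : ℂ, z ≠ algebraMap ℂ L c * a) :
    Q.zeta i j a z * Q.phi i j a z * Q.phi j i z a *
      ((∏ e ∈ Q.edges j i, (((Q.tIn L e)⁻¹ - z / a) / ((Q.tIn L e)⁻¹ - z / (a * Q.qIn L)))) *
        if i = j then (1 - z / (a * Q.qIn L)) / (1 - z / a)
          else (∏ e ∈ Q.edges j i, Q.tIn L e)⁻¹) =
      if i = j then Q.loopProdIn L i else 1 := by
  have hq := Q.qIn_ne_zero (L := L)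
  have hz : z ≠ 0 := by
    have := h 0
    rwa [map_zero, zero_mul] at this
  have h' : ∀ c : ℂ, z - algebraMap ℂ L c * a ≠ 0 := fun c => sub_ne_zero.2 (h c)
  have h1 : ∀ e, (Q.tIn L e)⁻¹ - a / z ≠ 0 := by
    intro e h0
    apply h (Q.t e)
    rw [sub_eq_zero] at h0
    have ht := Q.tIn_ne_zero (L := L) e
    field_simp at h0
    rw [h0]
  have h2 : ∀ e, (Q.tIn L e)⁻¹ - z / a ≠ 0 := fun e => by
    simpa using Q.inv_t_sub_ne_zero ha h e 0
  have h3 : ∀ e, (Q.tIn L e)⁻¹ - z / (a * Q.qIn L) ≠ 0 := fun e => by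
    simpa using Q.inv_t_sub_ne_zero ha h e 1
  have p1 : (∏ e ∈ Q.edges i j, ((Q.tIn L e)⁻¹ - a / z)) *
      ∏ e ∈ Q.edges i j, ((Q.tIn L e)⁻¹ - a / z)⁻¹ = 1 := by
    rw [← Finset.prod_mul_distrib]
    exact Finset.prod_eq_one fun e _ => mul_inv_cancel₀ (h1 e)
  have p2 : (∏ e ∈ Q.edges j i, (1 - z * Q.tIn L e / (a * Q.qIn L))) *
      (∏ e ∈ Q.edges j i, ((Q.tIn L e)⁻¹ - z / a)⁻¹) *
      (∏ e ∈ Q.edges j i, (((Q.tIn L e)⁻¹ - z / a) / ((Q.tIn L e)⁻¹ - z / (a * Q.qIn L)))) =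
      ∏ e ∈ Q.edges j i, Q.tIn L e := by
    rw [← Finset.prod_mul_distrib, ← Finset.prod_mul_distrib]
    refine Finset.prod_congr rfl fun e _ => ?_
    have ht := Q.tIn_ne_zero (L := L) e
    have e1 : 1 - z * Q.tIn L e / (a * Q.qIn L) =
        Q.tIn L e * ((Q.tIn L e)⁻¹ - z / (a * Q.qIn L)) := by
      field_simp
    rw [e1]
    have h2 := h2 e
    have h3 := h3 e
    generalize (Q.tIn L e)⁻¹ - z / (a * Q.qIn L) = A at *
    generalize (Q.tIn L e)⁻¹ - z / a = B at *
    field_simp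
  have hp : ∏ e ∈ Q.edges j i, Q.tIn L e ≠ 0 :=
    Finset.prod_ne_zero_iff.2 fun e _ => Q.tIn_ne_zero e
  unfold zeta phi
  by_cases hij : i = j
  · subst hij
    simp only [if_true]
    have d1 : a - z ≠ 0 := by
      have := h' 1
      rw [map_one, one_mul] at this
      rw [← neg_ne_zero, neg_sub]
      exact this
    have d2 : a * (Q.qIn L)⁻¹ - z ≠ 0 := by
      have := h' (Q.q : ℂ)⁻¹
      rw [← neg_ne_zero, neg_sub]
      rwa [map_inv₀, mul_comm] at this
    have d3 : z * (Q.qIn L)⁻¹ - a ≠ 0 := by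
      have := h' (Q.q : ℂ)
      intro h0
      apply this
      have : z = Q.qIn L * (z * (Q.qIn L)⁻¹ - a) + algebraMap ℂ L Q.q * a := by
        field_simp
        ring
      rw [this, h0]
      ring
    have d4 : 1 - z / a ≠ 0 := by
      rw [sub_ne_zero]
      intro h0
      apply d1
      field_simp at h0
      rw [h0, sub_self]
    have q1 : (a * (Q.qIn L)⁻¹ - z) / (a - z) * ((a - z) / (a * (Q.qIn L)⁻¹ - z)) *
        ((z - a) / (z * (Q.qIn L)⁻¹ - a)) * ((1 - z / (a * Q.qIn L)) / (1 - z / a)) = 1 := by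
      have e1 : 1 - z / (a * Q.qIn L) = -(z * (Q.qIn L)⁻¹ - a) / a := by
        field_simp
        ring
      have e2 : 1 - z / a = (a - z) / a := by field_simp
      have e3 : z - a = -(a - z) := by ring
      rw [e1, e2, e3]
      generalize z * (Q.qIn L)⁻¹ - a = A at *
      generalize a * (Q.qIn L)⁻¹ - z = B at *
      generalize a - z = C at *
      field_simp
    calc _ = ((a * (Q.qIn L)⁻¹ - z) / (a - z) * ((a - z) / (a * (Q.qIn L)⁻¹ - z)) *
        ((z - a) / (z * (Q.qIn L)⁻¹ - a)) * ((1 - z / (a * Q.qIn L)) / (1 - z / a))) *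
        ((∏ e ∈ Q.edges i i, ((Q.tIn L e)⁻¹ - a / z)) *
          ∏ e ∈ Q.edges i i, ((Q.tIn L e)⁻¹ - a / z)⁻¹) *
        ((∏ e ∈ Q.edges i i, (1 - z * Q.tIn L e / (a * Q.qIn L))) *
          (∏ e ∈ Q.edges i i, ((Q.tIn L e)⁻¹ - z / a)⁻¹) *
          (∏ e ∈ Q.edges i i,
            (((Q.tIn L e)⁻¹ - z / a) / ((Q.tIn L e)⁻¹ - z / (a * Q.qIn L))))) := by ring
      _ = _ := by rw [q1, p1, p2, one_mul, one_mul, loopProdIn]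
  · simp only [if_neg hij, if_neg (Ne.symm hij), one_mul]
    calc _ = ((∏ e ∈ Q.edges i j, ((Q.tIn L e)⁻¹ - a / z)) *
          ∏ e ∈ Q.edges i j, ((Q.tIn L e)⁻¹ - a / z)⁻¹) *
        ((∏ e ∈ Q.edges j i, (1 - z * Q.tIn L e / (a * Q.qIn L))) *
          (∏ e ∈ Q.edges j i, ((Q.tIn L e)⁻¹ - z / a)⁻¹) *
          (∏ e ∈ Q.edges j i,
            (((Q.tIn L e)⁻¹ - z / a) / ((Q.tIn L e)⁻¹ - z / (a * Q.qIn L))))) *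
          (∏ e ∈ Q.edges j i, Q.tIn L e)⁻¹ := by ring
      _ = _ := by rw [p1, p2, one_mul, mul_inv_cancel₀ hp]

/-- The ratio telescopes: moving w to w q^{n+1} is moving it to w q^n and then one step further. -/
theorem chainRatio_succ (i j : I) (n : ℕ) {z w : L} (hw : w ≠ 0)
    (h : ∀ c : ℂ, z ≠ algebraMap ℂ L c * w) :
    Q.chainRatio i j (n + 1) w z = Q.chainRatio i j n w z *
      ((∏ e ∈ Q.edges j i, (((Q.tIn L e)⁻¹ - z / (w * Q.qIn L ^ n)) /
        ((Q.tIn L e)⁻¹ - z / (w * Q.qIn L ^ n * Q.qIn L)))) *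
        if i = j then (1 - z / (w * Q.qIn L ^ n * Q.qIn L)) / (1 - z / (w * Q.qIn L ^ n))
          else (∏ e ∈ Q.edges j i, Q.tIn L e)⁻¹) := by
  have hq := Q.qIn_ne_zero (L := L)
  have h2 := fun e => Q.inv_t_sub_ne_zero hw h e n
  have h3 := Q.one_sub_ne_zero_of_generic hw h n
  have e1 : w * Q.qIn L ^ (n + 1) = w * Q.qIn L ^ n * Q.qIn L := by ring
  have p : (∏ e ∈ Q.edges j i, (((Q.tIn L e)⁻¹ - z / w) /
        ((Q.tIn L e)⁻¹ - z / (w * Q.qIn L ^ n * Q.qIn L)))) =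
      (∏ e ∈ Q.edges j i, (((Q.tIn L e)⁻¹ - z / w) / ((Q.tIn L e)⁻¹ - z / (w * Q.qIn L ^ n)))) *
      (∏ e ∈ Q.edges j i, (((Q.tIn L e)⁻¹ - z / (w * Q.qIn L ^ n)) /
        ((Q.tIn L e)⁻¹ - z / (w * Q.qIn L ^ n * Q.qIn L)))) := by
    rw [← Finset.prod_mul_distrib]
    exact Finset.prod_congr rfl fun e _ => (div_mul_div_cancel₀ (h2 e)).symm
  simp only [chainRatio, e1, p]
  split_ifs with hij
  · rw [mul_mul_mul_comm]
    congr 1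
    exact (div_mul_div_cancel₀' h3 _ _).symm
  · rw [pow_succ]
    ring

theorem chainRatio_zero (i j : I) {z w : L} (hw : w ≠ 0)
    (h : ∀ c : ℂ, z ≠ algebraMap ℂ L c * w) : Q.chainRatio i j 0 w z = 1 := by
  have h2 : ∀ e, (Q.tIn L e)⁻¹ - z / w ≠ 0 := fun e => by
    simpa using Q.inv_t_sub_ne_zero hw h e 0
  have h3 : 1 - z / w ≠ 0 := by simpa using Q.one_sub_ne_zero_of_generic hw h 0
  simp only [chainRatio, pow_zero, mul_one]
  rw [Finset.prod_eq_one fun e _ => div_self (h2 e), one_mul, div_self h3, ite_self]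

/-- Interaction of one point z with a whole chain starting at w: the one-step identity
`zeta_mul_phi_mul_phi` at each w q^p, multiplied along the telescoping ratio. -/
theorem prod_zeta_phi_phi (i j : I) (n : ℕ) {z w : L} (hw : w ≠ 0)
    (h : ∀ c : ℂ, z ≠ algebraMap ℂ L c * w) :
    (∏ p ∈ Finset.range n, (Q.zeta i j (w * Q.qIn L ^ p) z * Q.phi i j (w * Q.qIn L ^ p) z *
      Q.phi j i z (w * Q.qIn L ^ p))) * Q.chainRatio i j n w z =
      if i = j then Q.loopProdIn L i ^ n else 1 := by
  have hq := Q.qIn_ne_zero (L := L)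
  induction n with
  | zero => simp [Q.chainRatio_zero i j hw h]
  | succ n ih =>
    have ha : w * Q.qIn L ^ n ≠ 0 := mul_ne_zero hw (pow_ne_zero _ hq)
    have h' : ∀ c : ℂ, z ≠ algebraMap ℂ L c * (w * Q.qIn L ^ n) := by
      intro c hc
      apply h (c * Q.q ^ n)
      rw [hc, map_mul, map_pow]
      ring
    rw [Finset.prod_range_succ, Q.chainRatio_succ i j n hw h, mul_mul_mul_comm, ih,
      Q.zeta_mul_phi_mul_phi i j ha h']
    split_ifs
    · rw [pow_succ]
    · rw [one_mul]

end Field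

end WeightedQuiver

end

/-! ### Chains of points, and the cocycle identity for the universal coefficients. -/

noncomputable section

namespace WeightedQuiver

variable {I E : Type*} [Fintype I] [DecidableEq I] [Fintype E]

/-- The data entering the explicit homomorphism from the big shuffle algebra: the points
`w_{i,r} q^p`, moved by a group of shifts, and the values of the factors `Y_{i,r}` at them. -/
structure ChainModel (Q : WeightedQuiver I E) (a : I → ℕ) (L G : Type*) [Field L] [Algebra ℂ L]
    [CommGroup G] [MulSemiringAction G L] [SMulCommClass G ℂ L] where
  shift : (∀ i, Fin (a i) → ℕ) → G
  shift_zero : shift 0 = 1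
  shift_add : ∀ m m', shift (m + m') = shift m * shift m'
  pos : Vars a → Lˣ
  smul_pos : ∀ m v, shift m • (pos v : L) = pos v * Q.qIn L ^ m v.1 v.2
  pos_ne : ∀ u v, u ≠ v → ∀ c : ℂ, (pos u : L) ≠ algebraMap ℂ L c * pos v
  y : Vars a → ℕ → L
  y_shift : ∀ m v p, y v (m v.1 v.2 + p) = shift m • y v p *
    ∏ u ∈ Finset.univ.erase v, Q.chainRatio u.1 v.1 (m u.1 u.2) (pos u : L)
      (pos v * Q.qIn L ^ (m v.1 v.2 + p))

/-- The variables of multidegree `k`, labelled by a chain and a position in it. -/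
def chainEquiv {a k : I → ℕ} {m : ∀ i, Fin (a i) → ℕ} (hm : m ∈ splittings a k) :
    Vars k ≃ Σ u : Vars a, Fin (m u.1 u.2) :=
  (Equiv.sigmaCongrRight fun i =>
    (finCongr (sum_of_mem_splittings hm i).symm).trans finSigmaFinEquiv.symm).trans
  (Equiv.sigmaAssoc fun (i : I) (r : Fin (a i)) => Fin (m i r)).symm

theorem chainEquiv_symm_fst {a k : I → ℕ} {m : ∀ i, Fin (a i) → ℕ} (hm : m ∈ splittings a k)
    (p : Σ u : Vars a, Fin (m u.1 u.2)) : ((chainEquiv hm).symm p).1 = p.1.1 := rfl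

theorem mem_splittings_iff {a k : I → ℕ} {m : ∀ i, Fin (a i) → ℕ} :
    m ∈ splittings a k ↔ ∀ i, ∑ r, m i r = k i := by
  simp [splittings, Fintype.mem_piFinset, Finset.mem_piAntidiag]

/-- The value of a Laurent polynomial of multidegree `k` at the chains of points `y_{u,p}`. -/
def evalChains {L : Type*} [Field L] [Algebra ℂ L] {a k : I → ℕ} {m : ∀ i, Fin (a i) → ℕ}
    (hm : m ∈ splittings a k) (y : Vars a → ℕ → Lˣ) : Lau (Vars k) →ₐ[ℂ] L :=
  Lau.eval fun v => y (chainEquiv hm v).1 (chainEquiv hm v).2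

/-- The inclusion of sub-chains as variables. -/
def subchain {a k n : I → ℕ} {m N : ∀ i, Fin (a i) → ℕ} (hm : m ∈ splittings a k)
    (hN : N ∈ splittings a n) (off : ∀ i, Fin (a i) → ℕ) (hle : off + m ≤ N) (v : Vars k) :
    Vars n :=
  (chainEquiv hN).symm ⟨(chainEquiv hm v).1, ⟨off _ _ + (chainEquiv hm v).2,
    (Nat.add_lt_add_left (chainEquiv hm v).2.2 _).trans_le (hle _ _)⟩⟩

theorem subchain_fst {a k n : I → ℕ} {m N : ∀ i, Fin (a i) → ℕ} (hm : m ∈ splittings a k)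
    (hN : N ∈ splittings a n) (off : ∀ i, Fin (a i) → ℕ) (hle : off + m ≤ N) (v : Vars k) :
    (subchain hm hN off hle v).1 = v.1 := rfl

theorem chainEquiv_subchain {a k n : I → ℕ} {m N : ∀ i, Fin (a i) → ℕ} (hm : m ∈ splittings a k)
    (hN : N ∈ splittings a n) (off : ∀ i, Fin (a i) → ℕ) (hle : off + m ≤ N) (v : Vars k) :
    chainEquiv hN (subchain hm hN off hle v) =
      ⟨(chainEquiv hm v).1, ⟨off _ _ + (chainEquiv hm v).2,
        (Nat.add_lt_add_left (chainEquiv hm v).2.2 _).trans_le (hle _ _)⟩⟩ :=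
  Equiv.apply_symm_apply _ _

theorem chainSigma_ext {a : I → ℕ} {m : ∀ i, Fin (a i) → ℕ}
    {p p' : Σ u : Vars a, Fin (m u.1 u.2)} (h1 : p.1 = p'.1) (h2 : (p.2 : ℕ) = p'.2) : p = p' := by
  obtain ⟨u, p⟩ := p
  obtain ⟨u', p'⟩ := p'
  obtain rfl : u = u' := h1
  obtain rfl : p = p' := Fin.ext h2
  rfl

theorem subchain_injective {a k n : I → ℕ} {m N : ∀ i, Fin (a i) → ℕ} (hm : m ∈ splittings a k)
    (hN : N ∈ splittings a n) (off : ∀ i, Fin (a i) → ℕ) (hle : off + m ≤ N) :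
    Function.Injective (subchain hm hN off hle) := by
  intro v w h
  apply (chainEquiv hm).injective
  have h1 := congrArg (chainEquiv hN) h
  rw [chainEquiv_subchain, chainEquiv_subchain] at h1
  have h2 : (chainEquiv hm v).1 = (chainEquiv hm w).1 :=
    congrArg (fun p : Σ u : Vars a, Fin (N u.1 u.2) => p.1) h1
  have h3 := congrArg (fun p : Σ u : Vars a, Fin (N u.1 u.2) => (p.2 : ℕ)) h1
  have h4 : off (chainEquiv hm v).1.1 (chainEquiv hm v).1.2 =
    off (chainEquiv hm w).1.1 (chainEquiv hm w).1.2 := by rw [h2]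
  dsimp only at h3
  exact chainSigma_ext h2 (by omega)

theorem mem_image_subchain {a k n : I → ℕ} {m N : ∀ i, Fin (a i) → ℕ} (hm : m ∈ splittings a k)
    (hN : N ∈ splittings a n) (off : ∀ i, Fin (a i) → ℕ) (hle : off + m ≤ N) (s : Vars n) :
    s ∈ Finset.univ.image (subchain hm hN off hle) ↔
      off (chainEquiv hN s).1.1 (chainEquiv hN s).1.2 ≤ (chainEquiv hN s).2 ∧
      ((chainEquiv hN s).2 : ℕ) < off (chainEquiv hN s).1.1 (chainEquiv hN s).1.2 +
        m (chainEquiv hN s).1.1 (chainEquiv hN s).1.2 := by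
  simp only [Finset.mem_image, Finset.mem_univ, true_and]
  constructor
  · rintro ⟨v, rfl⟩
    rw [chainEquiv_subchain]
    exact ⟨Nat.le_add_right _ _, Nat.add_lt_add_left (chainEquiv hm v).2.2 _⟩
  · intro h
    let t : Σ u : Vars a, Fin (m u.1 u.2) := ⟨(chainEquiv hN s).1,
      ⟨(chainEquiv hN s).2 - off (chainEquiv hN s).1.1 (chainEquiv hN s).1.2, by omega⟩⟩
    have e := (chainEquiv hm).apply_symm_apply t
    have e1 : (chainEquiv hm ((chainEquiv hm).symm t)).1 = (chainEquiv hN s).1 :=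
      congrArg (fun p : Σ u : Vars a, Fin (m u.1 u.2) => p.1) e
    have e2 : ((chainEquiv hm ((chainEquiv hm).symm t)).2 : ℕ) =
        (chainEquiv hN s).2 - off (chainEquiv hN s).1.1 (chainEquiv hN s).1.2 :=
      congrArg (fun p : Σ u : Vars a, Fin (m u.1 u.2) => (p.2 : ℕ)) e
    refine ⟨(chainEquiv hm).symm t, (chainEquiv hN).injective ?_⟩
    rw [chainEquiv_subchain]
    refine chainSigma_ext e1 ?_
    have e3 : off (chainEquiv hm ((chainEquiv hm).symm t)).1.1
        (chainEquiv hm ((chainEquiv hm).symm t)).1.2 =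
        off (chainEquiv hN s).1.1 (chainEquiv hN s).1.2 := by rw [e1]
    dsimp only
    omega

theorem prod_image_subchain {M : Type*} [CommMonoid M] {a k n : I → ℕ} {m N : ∀ i, Fin (a i) → ℕ}
    (hm : m ∈ splittings a k) (hN : N ∈ splittings a n) (off : ∀ i, Fin (a i) → ℕ)
    (hle : off + m ≤ N) (f : Vars a → ℕ → M) :
    ∏ s ∈ Finset.univ.image (subchain hm hN off hle), f (chainEquiv hN s).1 (chainEquiv hN s).2 =
      ∏ u : Vars a, ∏ p ∈ Finset.range (m u.1 u.2), f u (off u.1 u.2 + p) := by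
  rw [Finset.prod_image (subchain_injective hm hN off hle).injOn]
  rw [Fintype.prod_equiv (chainEquiv hm) _
    (fun p : Σ u : Vars a, Fin (m u.1 u.2) => f p.1 (off p.1.1 p.1.2 + p.2)) fun v =>
      congrArg (fun p : Σ u : Vars a, Fin (N u.1 u.2) => f p.1 p.2)
        (chainEquiv_subchain hm hN off hle v),
    ← Finset.univ_sigma_univ, Finset.prod_sigma]
  exact Finset.prod_congr rfl fun u _ =>
    Fin.prod_univ_eq_prod_range (fun p => f u (off u.1 u.2 + p)) (m u.1 u.2)

/-- A subset of {0, ..., n-1} closed under predecessors is an initial segment; its length is the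
first missing index. -/
theorem eq_lower_of_closed {T : ℕ → Prop} {n : ℕ} (h : ∀ p, p + 1 < n → T (p + 1) → T p) :
    ∃ m ≤ n, ∀ p < n, T p ↔ p < m := by
  classical
  -- The alternative p = n makes the search end when no index below n is missing.
  have hex : ∃ p, p = n ∨ ¬ T p := ⟨n, Or.inl rfl⟩
  refine ⟨Nat.find hex, Nat.find_min' hex (Or.inl rfl), fun p hp => ?_⟩
  constructor
  · intro hT
    by_contra hlt
    push Not at hlt
    have hdown : ∀ d, d ≤ p → T (p - d) := by
      intro d
      induction d with
      | zero => intro _; exact hT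
      | succ d ih =>
        intro hd
        apply h
        · omega
        · have : p - (d + 1) + 1 = p - d := by omega
          rw [this]
          exact ih (by omega)
    rcases Nat.find_spec hex with h1 | h1
    · omega
    · apply h1
      have := hdown (p - Nat.find hex) (by omega)
      rwa [Nat.sub_sub_self hlt] at this
  · intro hlt
    have := Nat.find_min hex hlt
    push Not at this
    exact this.2

namespace ChainModel

variable {Q : WeightedQuiver I E} {a : I → ℕ} {L G : Type*} [Field L] [Algebra ℂ L]
    [CommGroup G] [MulSemiringAction G L] [SMulCommClass G ℂ L] (X : Q.ChainModel a L G)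

/-- The point `w_u q^p`. -/
def pt (u : Vars a) (p : ℕ) : Lˣ :=
  X.pos u * Units.map (algebraMap ℂ L : ℂ →* L) Q.q ^ p

theorem coe_pt (u : Vars a) (p : ℕ) : (X.pt u p : L) = X.pos u * Q.qIn L ^ p := by
  simp [pt]

theorem pt_add (u : Vars a) (p p' : ℕ) :
    (X.pt u (p + p') : L) = X.pt u p * Q.qIn L ^ p' := by
  rw [coe_pt, coe_pt, pow_add, mul_assoc]

/-- Powers of q are constants, so they can be absorbed into c and the genericity of the starting
points applies. -/
theorem pt_ne {u v : Vars a} (huv : u ≠ v) (p p' : ℕ) (c : ℂ) :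
    (X.pt u p : L) ≠ algebraMap ℂ L c * X.pt v p' := by
  intro h
  apply X.pos_ne u v huv (c * Q.q ^ p' / Q.q ^ p)
  rw [coe_pt, coe_pt] at h
  have hq := pow_ne_zero p (Q.qIn_ne_zero (L := L))
  rw [map_div₀, map_mul, map_pow, map_pow, div_mul_eq_mul_div, eq_div_iff hq, h]
  ring

theorem pt_ne_pos {u v : Vars a} (huv : u ≠ v) (p : ℕ) (c : ℂ) :
    (X.pt u p : L) ≠ algebraMap ℂ L c * X.pos v := by
  have := X.pt_ne huv p 0 c
  rwa [coe_pt X v, pow_zero, mul_one] at this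

theorem pt_injective (hQ : Q.Admissible) (u : Vars a) {p p' : ℕ} (h : X.pt u p = X.pt u p') :
    p = p' := by
  wlog hlt : p < p' generalizing p p'
  · rcases Nat.lt_trichotomy p p' with h1 | h1 | h1
    · exact this h h1
    · exact h1
    · exact (this h.symm h1).symm
  exfalso
  have h1 := congrArg Units.val h
  rw [coe_pt, coe_pt] at h1
  have h2 := mul_left_cancel₀ (X.pos u).ne_zero h1
  apply hQ.pow_ne (n := p' - p) (by omega)
  apply (algebraMap ℂ L).injective
  rw [map_one, map_pow]
  apply mul_left_cancel₀ (pow_ne_zero p (Q.qIn_ne_zero (L := L)))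
  rw [mul_one, ← pow_add, Nat.add_sub_cancel' hlt.le]
  exact h2.symm

/-- The action of shifts as algebra homomorphisms. -/
def act (m : ∀ i, Fin (a i) → ℕ) : L →ₐ[ℂ] L := MulSemiringAction.toAlgHom ℂ L (X.shift m)

theorem act_apply (m : ∀ i, Fin (a i) → ℕ) (x : L) : X.act m x = X.shift m • x := rfl

theorem act_pt (m : ∀ i, Fin (a i) → ℕ) (u : Vars a) (p : ℕ) :
    X.act m (X.pt u p) = X.pt u (m u.1 u.2 + p) := by
  rw [coe_pt, coe_pt, map_mul, map_pow, Q.map_qIn, act_apply, X.smul_pos, mul_assoc, pow_add]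

theorem y_shift' (m : ∀ i, Fin (a i) → ℕ) (v : Vars a) (p : ℕ) :
    X.y v (m v.1 v.2 + p) = X.act m (X.y v p) *
      ∏ u ∈ Finset.univ.erase v, Q.chainRatio u.1 v.1 (m u.1 u.2) (X.pos u : L)
        (X.pt v (m v.1 v.2 + p)) := by
  rw [X.y_shift, act_apply, coe_pt]

/-- The universal coefficient of `∏_u D_u^{-m_u}`. -/
def coef (m : ∀ i, Fin (a i) → ℕ) : L :=
  (∏ u : Vars a, ∏ p ∈ Finset.range (m u.1 u.2), X.y u p) *
  (∏ u : Vars a, ∏ p₂ ∈ Finset.range (m u.1 u.2), ∏ p₁ ∈ Finset.range p₂,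
    ((Q.zeta u.1 u.1 (X.pt u p₁ : L) (X.pt u p₂))⁻¹ * Q.loopProdIn L u.1)) *
  ∏ u : Vars a, ∏ v ∈ Finset.univ.erase u,
    ∏ p₁ ∈ Finset.range (m u.1 u.2), ∏ p₂ ∈ Finset.range (m v.1 v.2),
      Q.phi u.1 v.1 (X.pt u p₁ : L) (X.pt v p₂)

theorem zeta_pt_ne_zero (hQ : Q.Admissible) (u : Vars a) {p₁ p₂ : ℕ} (h : p₁ < p₂) :
    Q.zeta u.1 u.1 (X.pt u p₁ : L) (X.pt u p₂) ≠ 0 := by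
  obtain ⟨n, rfl⟩ := Nat.exists_eq_add_of_lt h
  rw [add_assoc, pt_add, Q.zeta_mul_pow _ (X.pt u p₁).ne_zero]
  exact (map_ne_zero _).2 (hQ.zeta_ne_zero _ (by omega))

/-- The product of `ζ` over pairs of points in initial and final parts of the chains. -/
def cross (m m' : ∀ i, Fin (a i) → ℕ) : L :=
  ∏ u : Vars a, ∏ p₁ ∈ Finset.range (m u.1 u.2), ∏ v : Vars a, ∏ p₂ ∈ Finset.range (m' v.1 v.2),
    Q.zeta u.1 v.1 (X.pt u p₁ : L) (X.pt v (m v.1 v.2 + p₂))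

theorem prod_erase_comm {ι M : Type*} [Fintype ι] [DecidableEq ι] [CommMonoid M] (f : ι → ι → M) :
    ∏ u, ∏ v ∈ Finset.univ.erase u, f u v = ∏ v, ∏ u ∈ Finset.univ.erase v, f u v := by
  rw [Finset.prod_sigma', Finset.prod_sigma']
  refine Finset.prod_bij' (fun p _ => ⟨p.2, p.1⟩) (fun p _ => ⟨p.2, p.1⟩) ?_ ?_ ?_ ?_ ?_ <;>
    simp [eq_comm]

/-- Each product defining the coefficient of m + m' is cut at m. The parts within the initial and
within the final segments give the two coefficients on the right, the second one shifted. The mixed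
parts are a ratio from Y, a ζ⁻¹ within each chain and two φ between different chains. Multiplied by
`cross` they cancel up to loop products. -/
theorem coef_add (hQ : Q.Admissible) (m m' : ∀ i, Fin (a i) → ℕ) :
    X.coef (m + m') * X.cross m m' = X.coef m * X.act m (X.coef m') *
      ∏ v : Vars a, ∏ _p ∈ Finset.range (m' v.1 v.2), ∏ u : Vars a,
        (if u.1 = v.1 then Q.loopProdIn L u.1 ^ m u.1 u.2 else 1) := by
  let B : Vars a → ℕ → L := fun v p => X.pt v (m v.1 v.2 + p)
  have hY : (∏ u : Vars a, ∏ p ∈ Finset.range ((m + m') u.1 u.2), X.y u p) =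
      (∏ u : Vars a, ∏ p ∈ Finset.range (m u.1 u.2), X.y u p) *
      (∏ u : Vars a, ∏ p ∈ Finset.range (m' u.1 u.2), X.act m (X.y u p)) *
      ∏ v : Vars a, ∏ p ∈ Finset.range (m' v.1 v.2), ∏ u ∈ Finset.univ.erase v,
        Q.chainRatio u.1 v.1 (m u.1 u.2) (X.pos u : L) (B v p) := by
    simp only [← Finset.prod_mul_distrib]
    refine Finset.prod_congr rfl fun v _ => ?_
    rw [Pi.add_apply, Pi.add_apply, Finset.prod_range_add, mul_assoc]
    congr 1
    rw [← Finset.prod_mul_distrib]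
    exact Finset.prod_congr rfl fun p _ => X.y_shift' m v p
  have hS : (∏ u : Vars a, ∏ p₂ ∈ Finset.range ((m + m') u.1 u.2), ∏ p₁ ∈ Finset.range p₂,
      ((Q.zeta u.1 u.1 (X.pt u p₁ : L) (X.pt u p₂))⁻¹ * Q.loopProdIn L u.1)) =
      (∏ u : Vars a, ∏ p₂ ∈ Finset.range (m u.1 u.2), ∏ p₁ ∈ Finset.range p₂,
        ((Q.zeta u.1 u.1 (X.pt u p₁ : L) (X.pt u p₂))⁻¹ * Q.loopProdIn L u.1)) *
      (∏ u : Vars a, ∏ p₂ ∈ Finset.range (m' u.1 u.2), ∏ p₁ ∈ Finset.range p₂,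
        ((Q.zeta u.1 u.1 (B u p₁) (B u p₂))⁻¹ * Q.loopProdIn L u.1)) *
      ∏ v : Vars a, ∏ p₂ ∈ Finset.range (m' v.1 v.2), ∏ p₁ ∈ Finset.range (m v.1 v.2),
        ((Q.zeta v.1 v.1 (X.pt v p₁ : L) (B v p₂))⁻¹ * Q.loopProdIn L v.1) := by
    simp only [← Finset.prod_mul_distrib]
    refine Finset.prod_congr rfl fun v _ => ?_
    rw [Pi.add_apply, Pi.add_apply, Finset.prod_range_add, mul_assoc]
    congr 1
    rw [← Finset.prod_mul_distrib]
    refine Finset.prod_congr rfl fun p _ => ?_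
    rw [Finset.prod_range_add, mul_comm]
  have hP : (∏ u : Vars a, ∏ v ∈ Finset.univ.erase u,
      ∏ p₁ ∈ Finset.range ((m + m') u.1 u.2), ∏ p₂ ∈ Finset.range ((m + m') v.1 v.2),
        Q.phi u.1 v.1 (X.pt u p₁ : L) (X.pt v p₂)) =
      (∏ u : Vars a, ∏ v ∈ Finset.univ.erase u,
        ∏ p₁ ∈ Finset.range (m u.1 u.2), ∏ p₂ ∈ Finset.range (m v.1 v.2),
          Q.phi u.1 v.1 (X.pt u p₁ : L) (X.pt v p₂)) *
      (∏ u : Vars a, ∏ v ∈ Finset.univ.erase u,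
        ∏ p₁ ∈ Finset.range (m' u.1 u.2), ∏ p₂ ∈ Finset.range (m' v.1 v.2),
          Q.phi u.1 v.1 (B u p₁) (B v p₂)) *
      ((∏ v : Vars a, ∏ p₂ ∈ Finset.range (m' v.1 v.2), ∏ u ∈ Finset.univ.erase v,
        ∏ p₁ ∈ Finset.range (m u.1 u.2), Q.phi u.1 v.1 (X.pt u p₁ : L) (B v p₂)) *
      ∏ v : Vars a, ∏ p₂ ∈ Finset.range (m' v.1 v.2), ∏ u ∈ Finset.univ.erase v,
        ∏ p₁ ∈ Finset.range (m u.1 u.2), Q.phi v.1 u.1 (B v p₂) (X.pt u p₁ : L)) := by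
    have e1 : (∏ v : Vars a, ∏ p₂ ∈ Finset.range (m' v.1 v.2), ∏ u ∈ Finset.univ.erase v,
        ∏ p₁ ∈ Finset.range (m u.1 u.2), Q.phi u.1 v.1 (X.pt u p₁ : L) (B v p₂)) =
        ∏ u : Vars a, ∏ v ∈ Finset.univ.erase u, ∏ p₁ ∈ Finset.range (m u.1 u.2),
          ∏ p₂ ∈ Finset.range (m' v.1 v.2), Q.phi u.1 v.1 (X.pt u p₁ : L) (B v p₂) := by
      rw [prod_erase_comm]
      refine Finset.prod_congr rfl fun v _ => ?_
      rw [Finset.prod_comm]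
      exact Finset.prod_congr rfl fun u _ => Finset.prod_comm
    have e2 : (∏ v : Vars a, ∏ p₂ ∈ Finset.range (m' v.1 v.2), ∏ u ∈ Finset.univ.erase v,
        ∏ p₁ ∈ Finset.range (m u.1 u.2), Q.phi v.1 u.1 (B v p₂) (X.pt u p₁ : L)) =
        ∏ u : Vars a, ∏ v ∈ Finset.univ.erase u, ∏ p₁ ∈ Finset.range (m' u.1 u.2),
          ∏ p₂ ∈ Finset.range (m v.1 v.2), Q.phi u.1 v.1 (B u p₁) (X.pt v p₂ : L) :=
      Finset.prod_congr rfl fun v _ => Finset.prod_comm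
    rw [e1, e2]
    simp only [← Finset.prod_mul_distrib]
    refine Finset.prod_congr rfl fun u _ => Finset.prod_congr rfl fun v _ => ?_
    simp only [Pi.add_apply, Finset.prod_range_add, Finset.prod_mul_distrib, B]
    ring
  have hZ : X.cross m m' = (∏ v : Vars a, ∏ p₂ ∈ Finset.range (m' v.1 v.2),
        ∏ p₁ ∈ Finset.range (m v.1 v.2), Q.zeta v.1 v.1 (X.pt v p₁ : L) (B v p₂)) *
      ∏ v : Vars a, ∏ p₂ ∈ Finset.range (m' v.1 v.2), ∏ u ∈ Finset.univ.erase v,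
        ∏ p₁ ∈ Finset.range (m u.1 u.2), Q.zeta u.1 v.1 (X.pt u p₁ : L) (B v p₂) := by
    have e : X.cross m m' = ∏ v : Vars a, ∏ p₂ ∈ Finset.range (m' v.1 v.2), ∏ u : Vars a,
        ∏ p₁ ∈ Finset.range (m u.1 u.2), Q.zeta u.1 v.1 (X.pt u p₁ : L) (B v p₂) := by
      have : X.cross m m' = ∏ u : Vars a, ∏ v : Vars a, ∏ p₁ ∈ Finset.range (m u.1 u.2),
          ∏ p₂ ∈ Finset.range (m' v.1 v.2), Q.zeta u.1 v.1 (X.pt u p₁ : L) (B v p₂) :=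
        Finset.prod_congr rfl fun u _ => Finset.prod_comm
      rw [this, Finset.prod_comm]
      refine Finset.prod_congr rfl fun v _ => ?_
      rw [Finset.prod_comm]
      exact Finset.prod_congr rfl fun u _ => Finset.prod_comm
    rw [e]
    simp only [← Finset.prod_mul_distrib]
    refine Finset.prod_congr rfl fun v _ => Finset.prod_congr rfl fun p _ => ?_
    exact (Finset.mul_prod_erase _ _ (Finset.mem_univ v)).symm
  have hA : X.act m (X.coef m') =
      (∏ u : Vars a, ∏ p ∈ Finset.range (m' u.1 u.2), X.act m (X.y u p)) *
      (∏ u : Vars a, ∏ p₂ ∈ Finset.range (m' u.1 u.2), ∏ p₁ ∈ Finset.range p₂,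
        ((Q.zeta u.1 u.1 (B u p₁) (B u p₂))⁻¹ * Q.loopProdIn L u.1)) *
      ∏ u : Vars a, ∏ v ∈ Finset.univ.erase u,
        ∏ p₁ ∈ Finset.range (m' u.1 u.2), ∏ p₂ ∈ Finset.range (m' v.1 v.2),
          Q.phi u.1 v.1 (B u p₁) (B v p₂) := by
    simp only [coef, map_mul, map_prod, map_inv₀, Q.map_zeta, Q.map_phi, act_pt, loopProdIn,
      Q.map_tIn, B]
  -- All mixed factors are arranged by a point p₂ of a final segment and the initial segment of a
  -- chain u.
  have hT : (∏ v : Vars a, ∏ p₂ ∈ Finset.range (m' v.1 v.2), ∏ u : Vars a,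
        (if u.1 = v.1 then Q.loopProdIn L u.1 ^ m u.1 u.2 else 1)) =
      ((∏ v : Vars a, ∏ p₂ ∈ Finset.range (m' v.1 v.2), ∏ p₁ ∈ Finset.range (m v.1 v.2),
        ((Q.zeta v.1 v.1 (X.pt v p₁ : L) (B v p₂))⁻¹ * Q.loopProdIn L v.1)) *
      (∏ v : Vars a, ∏ p₂ ∈ Finset.range (m' v.1 v.2),
        ∏ p₁ ∈ Finset.range (m v.1 v.2), Q.zeta v.1 v.1 (X.pt v p₁ : L) (B v p₂))) *
      ((((∏ v : Vars a, ∏ p₂ ∈ Finset.range (m' v.1 v.2), ∏ u ∈ Finset.univ.erase v,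
        ∏ p₁ ∈ Finset.range (m u.1 u.2), Q.zeta u.1 v.1 (X.pt u p₁ : L) (B v p₂)) *
      (∏ v : Vars a, ∏ p₂ ∈ Finset.range (m' v.1 v.2), ∏ u ∈ Finset.univ.erase v,
        ∏ p₁ ∈ Finset.range (m u.1 u.2), Q.phi u.1 v.1 (X.pt u p₁ : L) (B v p₂))) *
      (∏ v : Vars a, ∏ p₂ ∈ Finset.range (m' v.1 v.2), ∏ u ∈ Finset.univ.erase v,
        ∏ p₁ ∈ Finset.range (m u.1 u.2), Q.phi v.1 u.1 (B v p₂) (X.pt u p₁ : L))) *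
      ∏ v : Vars a, ∏ p ∈ Finset.range (m' v.1 v.2), ∏ u ∈ Finset.univ.erase v,
        Q.chainRatio u.1 v.1 (m u.1 u.2) (X.pos u : L) (B v p)) := by
    simp only [← Finset.prod_mul_distrib]
    refine Finset.prod_congr rfl fun v _ => Finset.prod_congr rfl fun p _ => ?_
    -- For u = v the factors ζ and ζ⁻¹ cancel; for u ≠ v this is `prod_zeta_phi_phi`.
    rw [← Finset.mul_prod_erase _ _ (Finset.mem_univ v), if_pos rfl]
    congr 1
    · rw [← Finset.card_range (m v.1 v.2), ← Finset.prod_const, Finset.card_range]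
      refine Finset.prod_congr rfl fun p₁ hp₁ => ?_
      have h0 : Q.zeta v.1 v.1 (X.pt v p₁ : L) (B v p) ≠ 0 :=
        X.zeta_pt_ne_zero hQ v ((Finset.mem_range.1 hp₁).trans_le (Nat.le_add_right _ _))
      field_simp
    · refine Finset.prod_congr rfl fun u hu => ?_
      have := Q.prod_zeta_phi_phi u.1 v.1 (m u.1 u.2) (X.pos u).ne_zero
        (X.pt_ne_pos (Finset.ne_of_mem_erase hu).symm (m v.1 v.2 + p))
      simp only [← coe_pt] at this
      exact this.symm
  rw [hT, hA, hZ]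
  unfold coef
  rw [hY, hS, hP]
  ring

end ChainModel

end WeightedQuiver

end

/-! ### Shuffle products at chains, and multiplicativity of the explicit map. -/

noncomputable section

namespace WeightedQuiver

variable {I E : Type*} [Fintype I] [DecidableEq I] [Fintype E]

theorem card_filter_lower {a k n : I → ℕ} {m N : ∀ i, Fin (a i) → ℕ}
    (hN : N ∈ splittings a n) (hk : ∀ i, ∑ r, m i r = k i) (hle : m ≤ N) (i : I) :
    ((Finset.univ.filter fun s : Vars n =>
      ((chainEquiv hN s).2 : ℕ) < m (chainEquiv hN s).1.1 (chainEquiv hN s).1.2).filter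
        fun s => s.1 = i).card = k i := by
  have hm : m ∈ splittings a k := mem_splittings_iff.2 hk
  have hle' : (0 : ∀ i, Fin (a i) → ℕ) + m ≤ N := by rwa [zero_add]
  have h1 : (Finset.univ.filter fun s : Vars n =>
      ((chainEquiv hN s).2 : ℕ) < m (chainEquiv hN s).1.1 (chainEquiv hN s).1.2) =
      Finset.univ.image (subchain hm hN 0 hle') := by
    ext s
    rw [mem_image_subchain]
    simp
  rw [h1, Finset.filter_image, Finset.card_image_of_injective _ (subchain_injective hm hN 0 hle')]
  have h2 : (Finset.univ.filter fun v : Vars k => (subchain hm hN 0 hle' v).1 = i) =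
      (Finset.univ : Finset (Fin (k i))).image fun r => (⟨i, r⟩ : Vars k) := by
    ext ⟨j, r⟩
    rw [Finset.mem_filter_univ, Finset.mem_image]
    constructor
    · rintro (rfl : j = i)
      exact ⟨r, Finset.mem_univ _, rfl⟩
    · rintro ⟨s, -, hs⟩
      exact (congrArg Sigma.fst hs).symm
  rw [h2, Finset.card_image_of_injective _ sigma_mk_injective, Finset.card_univ, Fintype.card_fin]

theorem lt_chainEquiv_symm {a n : I → ℕ} {m N : ∀ i, Fin (a i) → ℕ} (hN : N ∈ splittings a n)
    (t : Σ u : Vars a, Fin (N u.1 u.2)) :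
    ((chainEquiv hN ((chainEquiv hN).symm t)).2 : ℕ) < m (chainEquiv hN ((chainEquiv hN).symm t)).1.1
      (chainEquiv hN ((chainEquiv hN).symm t)).1.2 ↔ (t.2 : ℕ) < m t.1.1 t.1.2 :=
  Eq.to_iff (congrArg (fun p : Σ u : Vars a, Fin (N u.1 u.2) => (p.2 : ℕ) < m p.1.1 p.1.2)
    ((chainEquiv hN).apply_symm_apply t))

namespace ChainModel

variable {Q : WeightedQuiver I E} {a : I → ℕ} {L G : Type*} [Field L] [Algebra ℂ L]
    [CommGroup G] [MulSemiringAction G L] [SMulCommClass G ℂ L] (X : Q.ChainModel a L G)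

/-- Within a chain the points differ because q is not a root of unity, and points of different
chains are not even proportional by a constant. This permits the use of `eval_shuffle`. -/
theorem separated_chains (hQ : Q.Admissible) {n : I → ℕ} {N : ∀ i, Fin (a i) → ℕ}
    (hN : N ∈ splittings a n) :
    Separated fun s : Vars n => X.pt (chainEquiv hN s).1 (chainEquiv hN s).2 := by
  intro i r s h
  dsimp only at h
  have h1 : (⟨i, r⟩ : Vars n) = ⟨i, s⟩ := by
    apply (chainEquiv hN).injective
    by_cases huv : (chainEquiv hN ⟨i, r⟩).1 = (chainEquiv hN ⟨i, s⟩).1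
    · refine chainSigma_ext huv ?_
      have key : ∀ {u u' : Vars a} {p p' : ℕ}, u = u' → X.pt u p = X.pt u' p' → p = p' := by
        rintro u _ p p' rfl h
        exact X.pt_injective hQ _ h
      exact key huv h
    · exfalso
      refine X.pt_ne huv (chainEquiv hN ⟨i, r⟩).2 (chainEquiv hN ⟨i, s⟩).2 1 ?_
      rw [map_one, one_mul]
      exact congrArg Units.val h
  simpa using h1

/-- The values of a shuffle product at chains of points. -/
theorem evalChains_shuffle (hQ : Q.Admissible) {k l n : I → ℕ} (hn : k + l = n) {F : Lau (Vars k)}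
    {G : Lau (Vars l)} {H : Lau (Vars n)} (hF : F ∈ SymLau k) (hG : G ∈ SymLau l)
    (hH : H ∈ SymLau n) (h : Q.toConf k F * Q.toConf l G = Q.toConf n H)
    {N : ∀ i, Fin (a i) → ℕ} (hN : N ∈ splittings a n) :
    evalChains hN X.pt H = ∑ p : {m // m ∈ splittings a k} × {m // m ∈ splittings a l} with
      p.1.1 + p.2.1 = N, evalChains p.1.2 X.pt F *
        evalChains p.2.2 (fun u q => X.pt u (p.1.1 u.1 u.2 + q)) G * X.cross p.1.1 p.2.1 := by
  choose U hU using fun A : Finset (Vars n) => Q.exists_toConf_lau hF A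
  choose V hV using fun A : Finset (Vars n) => Q.exists_toConf_lau hG A
  let y : Vars n → Lˣ := fun s => X.pt (chainEquiv hN s).1 (chainEquiv hN s).2
  have hy : Separated y := X.separated_chains hQ hN
  -- The union of the initial segments of lengths m. A decomposition N = m + m' corresponds to the
  -- subset `lower m`, and every other subset will contribute zero.
  let lower : (∀ i, Fin (a i) → ℕ) → Finset (Vars n) := fun m =>
    Finset.univ.filter fun s : Vars n =>
      ((chainEquiv hN s).2 : ℕ) < m (chainEquiv hN s).1.1 (chainEquiv hN s).1.2
  have hinj : ∀ m m' : ∀ i, Fin (a i) → ℕ, m ≤ N → m' ≤ N → lower m = lower m' → m ≤ m' := by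
    intro m m' hm hm' h i r
    by_contra hlt
    push Not at hlt
    let s := (chainEquiv hN).symm ⟨⟨i, r⟩, ⟨m' i r, hlt.trans_le (hm i r)⟩⟩
    have hs : s ∈ lower m := by
      simp only [lower, Finset.mem_filter, Finset.mem_univ, true_and, s, lt_chainEquiv_symm]
      exact hlt
    rw [h] at hs
    simp only [lower, Finset.mem_filter, Finset.mem_univ, true_and, s, lt_chainEquiv_symm,
      lt_irrefl] at hs
  rw [show evalChains hN X.pt H = Lau.eval y H from rfl, Q.eval_shuffle hH h hU hV hy]
  symm
  refine Finset.sum_of_injOn (fun p => lower p.1.1) ?_ (fun _ _ => Finset.mem_coe.2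
    (Finset.mem_univ _)) ?_ ?_
  · rintro ⟨⟨m, hm⟩, ⟨m', hm'⟩⟩ hp ⟨⟨M, hM⟩, ⟨M', hM'⟩⟩ hP heq
    simp only [Finset.coe_filter, Finset.mem_univ, true_and, Set.mem_ofPred_eq] at hp hP heq
    have h1 : m ≤ N := hp ▸ le_self_add
    have h2 : M ≤ N := hP ▸ le_self_add
    obtain rfl : m = M := le_antisymm (hinj _ _ h1 h2 heq) (hinj _ _ h2 h1 heq.symm)
    obtain rfl : m' = M' := add_left_cancel (hp.trans hP.symm)
    rfl
  · intro A _ hA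
    by_contra hne
    have hz : ∏ a ∈ A, ∏ b ∈ Finset.univ \ A, Q.zeta a.1 b.1 (y a : L) (y b) ≠ 0 :=
      right_ne_zero_of_mul hne
    -- If position p + 1 lies in A and p does not, the ζ of these two points has ratio q and
    -- vanishes. So A meets every chain in an initial segment.
    have hclosed : ∀ u : Vars a, ∃ m ≤ N u.1 u.2, ∀ p < N u.1 u.2,
        (∃ hp : p < N u.1 u.2, (chainEquiv hN).symm ⟨u, ⟨p, hp⟩⟩ ∈ A) ↔ p < m := by
      intro u
      apply eq_lower_of_closed
      rintro p hp ⟨_, hpA⟩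
      refine ⟨by omega, ?_⟩
      by_contra hpA'
      refine hz (Finset.prod_eq_zero hpA (Finset.prod_eq_zero
        (Finset.mem_sdiff.2 ⟨Finset.mem_univ _, hpA'⟩) ?_))
      rw [chainEquiv_symm_fst, chainEquiv_symm_fst]
      apply Q.zeta_eq_zero
      have hy' : ∀ t, y ((chainEquiv hN).symm t) = X.pt t.1 t.2 := fun t =>
        congrArg (fun p : Σ u : Vars a, Fin (N u.1 u.2) => X.pt p.1 p.2)
          ((chainEquiv hN).apply_symm_apply t)
      rw [hy', hy', X.pt_add, pow_one]
    choose m hmN hm using hclosed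
    have hA' : A = lower fun i r => m ⟨i, r⟩ := by
      ext s
      obtain ⟨⟨u, p⟩, rfl⟩ := (chainEquiv hN).symm.surjective s
      simp only [lower, Finset.mem_filter, Finset.mem_univ, true_and]
      rw [lt_chainEquiv_symm (m := fun i r => m ⟨i, r⟩), ← hm u p p.2]
      exact ⟨fun h => ⟨p.2, h⟩, fun h => h.2⟩
    -- A nonzero restriction of F forces A to have multidegree k, which is the condition on the
    -- lengths m.
    have hU0 : U A ≠ 0 := by
      intro h0
      apply hne
      rw [h0, map_zero, zero_mul, zero_mul]
    have hcard : ∀ i, ∑ r, m ⟨i, r⟩ = k i := by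
      intro i
      by_contra hi
      refine hU0 (Q.restriction_eq_zero (hU A) (i := i) ?_)
      rw [hA', card_filter_lower (k := fun i => ∑ r, m ⟨i, r⟩) hN (fun _ => rfl)
        (fun i r => hmN ⟨i, r⟩)]
      exact hi
    have hle : (fun i r => m ⟨i, r⟩ : ∀ i, Fin (a i) → ℕ) ≤ N := fun i r => hmN ⟨i, r⟩
    have hl : (N - fun i r => m ⟨i, r⟩ : ∀ i, Fin (a i) → ℕ) ∈ splittings a l := by
      rw [mem_splittings_iff]
      intro i
      have e1 := mem_splittings_iff.1 hN i
      have e2 : ∑ r, (N i r - m ⟨i, r⟩) + ∑ r, m ⟨i, r⟩ = ∑ r, N i r := by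
        rw [← Finset.sum_add_distrib]
        exact Finset.sum_congr rfl fun r _ => Nat.sub_add_cancel (hmN ⟨i, r⟩)
      have e3 : k i + l i = n i := congrFun hn i
      simp only [Pi.sub_apply]
      rw [hcard, e1] at e2
      omega
    refine hA ⟨⟨⟨_, mem_splittings_iff.2 hcard⟩, ⟨_, hl⟩⟩, ?_, hA'.symm⟩
    simp only [Finset.coe_filter, Finset.mem_univ, true_and, Set.mem_ofPred_eq]
    exact add_tsub_cancel_of_le hle
  · rintro ⟨⟨m, hm⟩, ⟨m', hm'⟩⟩ hp
    simp only [Finset.mem_filter, Finset.mem_univ, true_and] at hp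
    have hle : (0 : ∀ i, Fin (a i) → ℕ) + m ≤ N := by
      rw [zero_add]
      exact hp ▸ le_self_add
    have hle' : m + m' ≤ N := hp.le
    have h1 : Finset.univ.image (subchain hm hN 0 hle) = lower m := by
      ext s
      rw [mem_image_subchain]
      simp [lower]
    have h2 : Finset.univ.image (subchain hm' hN m hle') = Finset.univ \ lower m := by
      ext s
      rw [mem_image_subchain]
      have h3 := (chainEquiv hN s).2.2
      have h4 : m (chainEquiv hN s).1.1 (chainEquiv hN s).1.2 +
        m' (chainEquiv hN s).1.1 (chainEquiv hN s).1.2 =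
          N (chainEquiv hN s).1.1 (chainEquiv hN s).1.2 :=
        congrFun (congrFun hp _) _
      simp only [lower, Finset.mem_sdiff, Finset.mem_filter, Finset.mem_univ, true_and]
      omega
    have e1 : Lau.eval y (U (lower m)) = evalChains hm X.pt F := by
      rw [Q.restriction_eq hF (hU _) (subchain_fst hm hN 0 hle) (subchain_injective hm hN 0 hle) h1,
        Lau.eval_eval]
      refine congrArg (fun z => Lau.eval z F) (funext fun v => ?_)
      refine (congrArg (fun p : Σ u : Vars a, Fin (N u.1 u.2) => X.pt p.1 p.2)
        (chainEquiv_subchain hm hN 0 hle v)).trans ?_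
      simp
    have e2 : Lau.eval y (V (Finset.univ \ lower m)) =
        evalChains hm' (fun u q => X.pt u (m u.1 u.2 + q)) G := by
      rw [Q.restriction_eq hG (hV _) (subchain_fst hm' hN m hle') (subchain_injective hm' hN m hle')
        h2, Lau.eval_eval]
      refine congrArg (fun z => Lau.eval z G) (funext fun v => ?_)
      exact (congrArg (fun p : Σ u : Vars a, Fin (N u.1 u.2) => X.pt p.1 p.2)
        (chainEquiv_subchain hm' hN m hle' v))
    have e3 : ∏ a ∈ lower m, ∏ b ∈ Finset.univ \ lower m, Q.zeta a.1 b.1 (y a : L) (y b) =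
        X.cross m m' := by
      rw [← h2]
      simp only [cross]
      have e4 : ∀ s : Vars n, ∏ b ∈ Finset.univ.image (subchain hm' hN m hle'),
          Q.zeta s.1 b.1 (y s : L) (y b) = ∏ v : Vars a, ∏ p₂ ∈ Finset.range (m' v.1 v.2),
            Q.zeta s.1 v.1 (y s : L) (X.pt v (m v.1 v.2 + p₂)) := fun s =>
        prod_image_subchain hm' hN m hle' fun v p => Q.zeta s.1 v.1 (y s : L) (X.pt v p)
      simp only [e4]
      rw [← h1]
      refine (prod_image_subchain hm hN 0 hle fun u p => ∏ v : Vars a,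
        ∏ p₂ ∈ Finset.range (m' v.1 v.2),
          Q.zeta u.1 v.1 (X.pt u p : L) (X.pt v (m v.1 v.2 + p₂))).trans ?_
      simp
    dsimp only
    rw [e1, e2, e3]

theorem evalChains_act {l : I → ℕ} {m m' : ∀ i, Fin (a i) → ℕ} (hm' : m' ∈ splittings a l)
    (G : Lau (Vars l)) :
    X.act m (evalChains hm' X.pt G) = evalChains hm' (fun u q => X.pt u (m u.1 u.2 + q)) G := by
  rw [evalChains, Lau.hom_eval, evalChains]
  refine congrArg (fun z => Lau.eval z G) (funext fun v => Units.ext ?_)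
  exact X.act_pt m _ _

/-- The image of a symmetric Laurent polynomial under the explicit homomorphism. -/
def image (k : I → ℕ) : SymLau k →ₗ[ℂ] SkewMonoidAlgebra L G where
  toFun F := ∑ m : {m // m ∈ splittings a k}, SkewMonoidAlgebra.single (X.shift m)
    (Q.loopConstIn L k * X.coef m * evalChains m.2 X.pt (F : Lau (Vars k)))
  map_add' F F' := by
    simp only [Submodule.coe_add, map_add, mul_add, SkewMonoidAlgebra.single_add,
      Finset.sum_add_distrib]
  map_smul' c F := by
    simp only [Submodule.coe_smul, map_smul, mul_smul_comm, RingHom.id_apply, Finset.smul_sum,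
      SkewMonoidAlgebra.smul_single]

theorem image_apply (k : I → ℕ) (F : SymLau k) : X.image k F =
    ∑ m : {m // m ∈ splittings a k}, SkewMonoidAlgebra.single (X.shift m)
      (Q.loopConstIn L k * X.coef m * evalChains m.2 X.pt (F : Lau (Vars k))) := rfl

theorem image_one : X.image 0 ⟨1, one_mem_symLau⟩ = 1 := by
  have h0 : (0 : ∀ i, Fin (a i) → ℕ) ∈ splittings a 0 := by simp [mem_splittings_iff]
  rw [image_apply, Finset.sum_eq_single ⟨0, h0⟩]
  · simp only [map_one, X.shift_zero, SkewMonoidAlgebra.one_def]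
    congr 1
    simp [coef, loopConstIn]
  · rintro ⟨m, hm⟩ _ hne
    exfalso
    apply hne
    rw [Subtype.mk.injEq]
    funext i r
    have := mem_splittings_iff.1 hm i
    simpa using (Finset.sum_eq_zero_iff.1 this) r (Finset.mem_univ r)
  · intro h
    exact absurd (Finset.mem_univ _) h

/-- The factors depend only on colours. Summing the chain lengths of colour i gives k_i for the
first tuple and l_i for the second. -/
theorem prod_loops {k l : I → ℕ} {m m' : ∀ i, Fin (a i) → ℕ} (hm : m ∈ splittings a k)
    (hm' : m' ∈ splittings a l) (f : I → L) :
    (∏ v : Vars a, ∏ _p ∈ Finset.range (m' v.1 v.2), ∏ u : Vars a,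
        (if u.1 = v.1 then f u.1 ^ m u.1 u.2 else 1)) = ∏ i, f i ^ (k i * l i) := by
  have h1 : ∀ v : Vars a, (∏ u : Vars a, (if u.1 = v.1 then f u.1 ^ m u.1 u.2 else 1)) =
      f v.1 ^ k v.1 := by
    intro v
    rw [← Finset.univ_sigma_univ, Finset.prod_sigma, Finset.prod_eq_single v.1]
    · simp only [if_true]
      rw [Finset.prod_pow_eq_pow_sum, mem_splittings_iff.1 hm]
    · intro i _ hi
      exact Finset.prod_eq_one fun r _ => if_neg hi
    · simp
  simp only [h1, Finset.prod_const, Finset.card_range]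
  rw [← Finset.univ_sigma_univ, Finset.prod_sigma]
  refine Finset.prod_congr rfl fun i _ => ?_
  simp only
  rw [Finset.prod_pow_eq_pow_sum, mem_splittings_iff.1 hm', ← pow_mul]

/-- In the skew group algebra the second coefficient is acted on by the shift of the first, which
moves its chains past those of the first term. After grouping by the total lengths N this is the
expansion in `evalChains_shuffle`, and the scalars match by `coef_add` and `loopConstIn_add`. -/
theorem image_mul (hQ : Q.Admissible) {k l n : I → ℕ} (F : SymLau k) (G' : SymLau l) (H : SymLau n)
    (hn : k + l = n) (h : Q.toConf k F * Q.toConf l G' = Q.toConf n H) :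
    X.image n H = X.image k F * X.image l G' := by
  simp only [image_apply, Finset.sum_mul_sum, SkewMonoidAlgebra.single_mul_single]
  rw [← Finset.sum_product']
  have hmaps : ∀ p ∈ (Finset.univ : Finset {m // m ∈ splittings a k}) ×ˢ
      (Finset.univ : Finset {m // m ∈ splittings a l}),
      (⟨p.1.1 + p.2.1, by
        rw [mem_splittings_iff]
        intro i
        simp only [Pi.add_apply, Finset.sum_add_distrib]
        rw [mem_splittings_iff.1 p.1.2, mem_splittings_iff.1 p.2.2, ← hn, Pi.add_apply]⟩ :
        {m // m ∈ splittings a n}) ∈ (Finset.univ : Finset {m // m ∈ splittings a n}) :=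
    fun _ _ => Finset.mem_univ _
  -- Grouping the pairs (m, m') by their sum collects the terms with the same shift.
  rw [← Finset.sum_fiberwise_of_maps_to hmaps]
  refine Finset.sum_congr rfl fun N _ => ?_
  rw [X.evalChains_shuffle hQ hn F.2 G'.2 H.2 h N.2, Finset.mul_sum]
  let single' := fun x : L => SkewMonoidAlgebra.single (X.shift N) x
  have hsum : ∀ (T : Finset ({m // m ∈ splittings a k} × {m // m ∈ splittings a l}))
      (f : {m // m ∈ splittings a k} × {m // m ∈ splittings a l} → L),
      SkewMonoidAlgebra.single (X.shift N) (∑ p ∈ T, f p) =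
        ∑ p ∈ T, SkewMonoidAlgebra.single (X.shift N) (f p) := fun T f =>
    map_sum (AddMonoidHom.mk' (fun x : L => SkewMonoidAlgebra.single (X.shift N) x)
      fun x y => SkewMonoidAlgebra.single_add _ x y) f T
  rw [hsum, Finset.univ_product_univ]
  refine Finset.sum_congr ?_ fun p hp => ?_
  · ext p
    simp only [Finset.mem_filter, Finset.mem_univ, true_and]
    exact ⟨fun h => Subtype.ext h, fun h => congrArg Subtype.val h⟩
  · have hp' : p.1.1 + p.2.1 = N := by
      have := (Finset.mem_filter.1 hp).2
      first | exact this | exact congrArg Subtype.val this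
    rw [← X.shift_add, hp']
    congr 1
    rw [← act_apply, map_mul, map_mul, X.evalChains_act, ← hp']
    have hc := X.coef_add hQ p.1.1 p.2.1
    rw [prod_loops p.1.2 p.2.2 (Q.loopProdIn L)] at hc
    have hl := Q.loopConstIn_add (L := L) k l
    rw [hn] at hl
    have ha : X.act p.1.1 (Q.loopConstIn L l) = Q.loopConstIn L l := by
      simp only [loopConstIn, map_prod, map_zpow₀, Q.map_tIn]
    rw [ha]
    set A := evalChains p.1.2 X.pt (F : Lau (Vars k))
    set B := evalChains p.2.2 (fun u q => X.pt u (p.1.1 u.1 u.2 + q)) (G' : Lau (Vars l))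
    -- The ζ weights of the shuffle product are exactly the factor needed by the cocycle identity,
    -- and the loop products left over pass into the normalizing constants.
    calc _ = Q.loopConstIn L n * (X.coef (p.1.1 + p.2.1) * X.cross p.1.1 p.2.1) * (A * B) := by ring
      _ = (Q.loopConstIn L n * ∏ i, Q.loopProdIn L i ^ (k i * l i)) *
          (X.coef p.1.1 * X.act p.1.1 (X.coef p.2.1)) * (A * B) := by rw [hc]; ring
      _ = _ := by rw [hl]; ring

/-- The explicit homomorphism from the big shuffle algebra. -/
theorem exists_hom (hQ : Q.Admissible) : ∃ Φ : Q.BigShuffle →ₐ[ℂ] SkewMonoidAlgebra L G,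
    ∀ k F, Φ (Q.ofSym k F) = X.image k F :=
  Q.exists_algHom X.image X.image_one fun _ _ _ F G' H hn h => X.image_mul hQ F G' H hn h

end ChainModel

end WeightedQuiver

end

/-! ### Linear forms as primes, and stability of the wheel conditions under products. -/

noncomputable section

namespace Lau

variable {σ : Type*} [Fintype σ] [DecidableEq σ]

/-- The unit `c x_u`. -/
def scaled (c : ℂˣ) (u : σ) : (Lau σ)ˣ :=
  Units.map (algebraMap ℂ (Lau σ) : ℂ →* Lau σ) c * gen u

theorem coe_scaled (c : ℂˣ) (u : σ) :
    (scaled c u : Lau σ) = algebraMap ℂ (Lau σ) (c : ℂ) * (gen u).val := rfl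

theorem scaled_one (u : σ) : scaled 1 u = gen u := by simp [scaled]

theorem scaled_eq_single (c : ℂˣ) (u : σ) :
    (scaled c u : Lau σ) = AddMonoidAlgebra.single (Pi.single u 1) (c : ℂ) := by
  rw [coe_scaled, ← Algebra.smul_def]
  change (c : ℂ) • (AddMonoidAlgebra.single (Pi.single u 1) 1 : Lau σ) = _
  rw [AddMonoidAlgebra.smul_single, smul_eq_mul, mul_one]

theorem scaled_injective {c c' : ℂˣ} {u u' : σ} (h : (scaled c u : Lau σ) = scaled c' u') :
    u = u' ∧ c = c' := by
  rw [scaled_eq_single, scaled_eq_single] at h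
  have h := congrArg AddMonoidAlgebra.coeff h
  rw [AddMonoidAlgebra.coeff_single, AddMonoidAlgebra.coeff_single] at h
  rcases (Finsupp.single_eq_single_iff ..).1 h with ⟨h1, h2⟩ | ⟨h1, -⟩
  · refine ⟨?_, Units.ext h2⟩
    by_contra hne
    have := congrFun h1 u
    simp [Pi.single_eq_of_ne hne] at this
  · exact absurd h1 c.ne_zero

/-- The linear form `x_w - c x_u`. -/
def lin (c : ℂˣ) (w u : σ) : Lau σ := (gen w).val - scaled c u

/-- The specialization `x_w ↦ c x_u`. -/
def spec (c : ℂˣ) (w u : σ) : Lau σ →ₐ[ℂ] Lau σ :=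
  eval fun s => if s = w then scaled c u else gen s

theorem eval_scaled {R : Type*} [CommRing R] [Algebra ℂ R] (y : σ → Rˣ) (c : ℂˣ) (u : σ) :
    eval y (scaled c u).val = algebraMap ℂ R (c : ℂ) * y u := by
  rw [coe_scaled, map_mul, eval_algebraMap, eval_gen]

theorem eval_lin {R : Type*} [CommRing R] [Algebra ℂ R] (y : σ → Rˣ) (c : ℂˣ) (w u : σ) :
    eval y (lin c w u) = y w - algebraMap ℂ R (c : ℂ) * y u := by
  rw [lin, map_sub, eval_gen, eval_scaled]

theorem spec_lin (c : ℂˣ) {w u : σ} (h : w ≠ u) : spec c w u (lin c w u) = 0 := by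
  rw [spec, eval_lin, if_pos rfl, if_neg h.symm, coe_scaled, sub_self]

theorem dvd_sub_spec (c : ℂˣ) (w u : σ) (p : Lau σ) : lin c w u ∣ p - spec c w u p := by
  rw [← Ideal.mem_span_singleton, ← Ideal.Quotient.mk_eq_mk_iff_sub_mem]
  have : (Ideal.Quotient.mkₐ ℂ (Ideal.span {lin c w u})) =
      (Ideal.Quotient.mkₐ ℂ (Ideal.span {lin c w u})).comp (spec c w u) := by
    apply algHom_ext
    intro v
    simp only [AlgHom.comp_apply, spec, eval_gen]
    split_ifs with hv
    · subst hv
      exact (Ideal.Quotient.mk_eq_mk_iff_sub_mem _ _).2 (Ideal.mem_span_singleton_self _)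
    · rfl
  exact congrArg (fun f : Lau σ →ₐ[ℂ] _ => f p) this

theorem lin_dvd_iff (c : ℂˣ) {w u : σ} (h : w ≠ u) (p : Lau σ) :
    lin c w u ∣ p ↔ spec c w u p = 0 := by
  constructor
  · rintro ⟨r, rfl⟩
    rw [map_mul, spec_lin c h, zero_mul]
  · intro h0
    have := dvd_sub_spec c w u p
    rwa [h0, sub_zero] at this

theorem lin_ne_zero (c : ℂˣ) {w u : σ} (h : w ≠ u) : lin c w u ≠ 0 := by
  rw [lin, sub_ne_zero, ← scaled_one]
  exact fun h0 => h (scaled_injective h0).1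

/-- Divisibility by the form is vanishing under a specialization with values in a domain, so it is a
prime condition. -/
theorem prime_lin (c : ℂˣ) {w u : σ} (h : w ≠ u) : Prime (lin c w u) := by
  refine ⟨lin_ne_zero c h, fun hu => ?_, fun a b hab => ?_⟩
  · have := hu.map (spec c w u)
    rw [spec_lin c h] at this
    exact not_isUnit_zero this
  · rw [lin_dvd_iff c h] at hab ⊢
    rw [lin_dvd_iff c h]
    rw [map_mul] at hab
    exact mul_eq_zero.1 hab

end Lau

namespace WeightedQuiver

variable {I E : Type*} [Fintype I] [DecidableEq I] [Fintype E] (Q : WeightedQuiver I E)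

theorem mem_wheel_iff {k : I → ℕ} {F : SymLau k} : F ∈ Q.Wheel k ↔
    ∀ u v w : Vars k, u ≠ v → u ≠ w → v ≠ w → u.1 = v.1 → ∀ γ : ℂˣ,
      Lau.lin γ w u ^ Q.doubleMult u.1 w.1 γ ∣ Q.wheelSubst u v (F : Lau (Vars k)) := Iff.rfl

theorem wheelSubst_eq {k : I → ℕ} (u v : Vars k) :
    Q.wheelSubst u v = Lau.spec Q.q v u := rfl

theorem algebraMap_mul_cancel {R : Type*} [CommRing R] [Algebra ℂ R] {c : ℂ} (hc : c ≠ 0) :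
    algebraMap ℂ R c * algebraMap ℂ R c⁻¹ = 1 := by
  rw [← map_mul, mul_inv_cancel₀ hc, map_one]

/-- The substitution x_v = q x_u kills the numerator x_v / q - x_u of the diagonal factor. -/
theorem wheelSubst_zetaLau_eq_zero {k : I → ℕ} {u v : Vars k} (huv : u ≠ v) (h : u.1 = v.1) :
    Q.wheelSubst u v (Q.zetaLau v u) = 0 := by
  have hq := algebraMap_mul_cancel (R := Lau (Vars k)) Q.q.ne_zero
  rw [zetaLau, map_mul, map_mul, if_pos h.symm, wheelSubst_eq, map_sub, map_mul, Lau.spec,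
    Lau.eval_gen, Lau.eval_gen, if_pos rfl, if_neg huv, Lau.eval_algebraMap, Lau.coe_scaled]
  refine mul_eq_zero_of_left (mul_eq_zero_of_left ?_ _) _
  linear_combination (Lau.gen u).val * hq

theorem pow_dvd_prod_filter {ι R : Type*} [CommRing R] (T : Finset ι) (p : ι → Prop)
    [DecidablePred p] (f : ι → R) (x : R) (h : ∀ i ∈ T, p i → x ∣ f i) :
    x ^ (T.filter p).card ∣ ∏ i ∈ T, f i := by
  rw [← Finset.prod_filter_mul_prod_filter_not T p]
  refine Dvd.dvd.mul_right ?_ _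
  rw [← Finset.prod_const]
  exact Finset.prod_dvd_prod_of_dvd _ _ fun i hi =>
    h i (Finset.mem_filter.1 hi).1 (Finset.mem_filter.1 hi).2

/-- An edge u → w gives a factor proportional to x_w - t_e x_u, and an edge w → u one proportional
to x_w - (q/t_e) x_u. The number of those with coefficient γ is ♭(γ). -/
theorem dvd_eval_zetaLau_left {k : I → ℕ} {u w : Vars k} {R : Type*} [CommRing R] [Algebra ℂ R]
    (y : Vars k → Rˣ) (γ : ℂˣ) :
    ((y w : R) - algebraMap ℂ R γ * y u) ^ Q.doubleMult u.1 w.1 γ ∣ Lau.eval y (Q.zetaLau u w) := by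
  classical
  have hq := algebraMap_mul_cancel (R := R) Q.q.ne_zero
  rw [zetaLau, map_mul, map_mul, mul_assoc, doubleMult, pow_add, map_prod, map_prod]
  refine Dvd.dvd.mul_left (mul_dvd_mul ?_ ?_) _
  · refine pow_dvd_prod_filter _ _ _ _ fun e _ he => ⟨algebraMap ℂ R (Q.t e : ℂ)⁻¹ * ((y w)⁻¹ : Rˣ), ?_⟩
    have ht := algebraMap_mul_cancel (R := R) (Q.t e).ne_zero
    simp only [map_sub, map_mul, Lau.eval_algebraMap, Lau.eval_gen, Lau.eval_gen_inv, ← he]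
    linear_combination (-algebraMap ℂ R (Q.t e : ℂ)⁻¹) * (y w).mul_inv + (y u * ((y w)⁻¹ : Rˣ)) * ht
  · refine pow_dvd_prod_filter _ _ _ _ fun e _ he =>
      ⟨-algebraMap ℂ R (Q.t e : ℂ) * algebraMap ℂ R (Q.q : ℂ)⁻¹ * ((y u)⁻¹ : Rˣ), ?_⟩
    have ht := algebraMap_mul_cancel (R := R) (Q.t e).ne_zero
    have hg : algebraMap ℂ R (γ : ℂ) = algebraMap ℂ R Q.q * algebraMap ℂ R (Q.t e : ℂ)⁻¹ := by
      rw [← he, Units.val_div_eq_div_val, div_eq_mul_inv, map_mul]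
    simp only [map_sub, map_mul, Lau.eval_algebraMap, Lau.eval_gen, Lau.eval_gen_inv, map_one, hg]
    linear_combination (-1 : R) * (y u).mul_inv + (-(y u : R) * ((y u)⁻¹ : Rˣ)) * hq +
      (-(y u : R) * ((y u)⁻¹ : Rˣ) * algebraMap ℂ R Q.q * algebraMap ℂ R (Q.q : ℂ)⁻¹) * ht

/-- Once x_v = q x_u, the factor ζ(x_w/x_v) contains the same forms as ζ(x_u/x_w), with the roles of
the two families of edges exchanged. -/
theorem dvd_eval_zetaLau_right {k : I → ℕ} {u v w : Vars k} (huv : u.1 = v.1)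
    {R : Type*} [CommRing R] [Algebra ℂ R]
    (y : Vars k → Rˣ) (hy : (y v : R) = algebraMap ℂ R Q.q * y u) (γ : ℂˣ) :
    ((y w : R) - algebraMap ℂ R γ * y u) ^ Q.doubleMult u.1 w.1 γ ∣ Lau.eval y (Q.zetaLau w v) := by
  classical
  have hq := algebraMap_mul_cancel (R := R) Q.q.ne_zero
  rw [zetaLau, map_mul, map_mul, mul_assoc, doubleMult, pow_add, map_prod, map_prod, ← huv,
    mul_comm (_ ^ _)]
  refine Dvd.dvd.mul_left (mul_dvd_mul ?_ ?_) _
  · refine pow_dvd_prod_filter _ _ _ _ fun e _ he => ⟨-((y v)⁻¹ : Rˣ), ?_⟩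
    have ht := algebraMap_mul_cancel (R := R) (Q.t e).ne_zero
    have hg : algebraMap ℂ R (γ : ℂ) = algebraMap ℂ R Q.q * algebraMap ℂ R (Q.t e : ℂ)⁻¹ := by
      rw [← he, Units.val_div_eq_div_val, div_eq_mul_inv, map_mul]
    simp only [map_sub, map_mul, Lau.eval_algebraMap, Lau.eval_gen, Lau.eval_gen_inv, hg]
    linear_combination (-algebraMap ℂ R (Q.t e : ℂ)⁻¹) * (y v).mul_inv +
      (algebraMap ℂ R (Q.t e : ℂ)⁻¹ * ((y v)⁻¹ : Rˣ)) * hy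
  · refine pow_dvd_prod_filter _ _ _ _ fun e _ he => ⟨((y w)⁻¹ : Rˣ), ?_⟩
    simp only [map_sub, map_mul, Lau.eval_algebraMap, Lau.eval_gen, Lau.eval_gen_inv, map_one, ← he,
      hy]
    linear_combination (-1 : R) * (y w).mul_inv +
      (- y u * algebraMap ℂ R (Q.t e : ℂ) * ((y w)⁻¹ : Rˣ)) * hq

theorem dvd_wheelSubst_zetaLau_left {k : I → ℕ} {u v w : Vars k} (huv : u ≠ v) (hvw : v ≠ w)
    (γ : ℂˣ) :
    Lau.lin γ w u ^ Q.doubleMult u.1 w.1 γ ∣ Q.wheelSubst u v (Q.zetaLau u w) := by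
  have := Q.dvd_eval_zetaLau_left (u := u) (w := w)
    (fun s => if s = v then Lau.scaled Q.q u else Lau.gen s) γ
  rw [if_neg hvw.symm, if_neg huv] at this
  exact this

theorem dvd_wheelSubst_zetaLau_right {k : I → ℕ} {u v w : Vars k} (huv : u ≠ v) (hvw : v ≠ w)
    (h : u.1 = v.1) (γ : ℂˣ) :
    Lau.lin γ w u ^ Q.doubleMult u.1 w.1 γ ∣ Q.wheelSubst u v (Q.zetaLau w v) := by
  have := Q.dvd_eval_zetaLau_right h (w := w)
    (fun s => if s = v then Lau.scaled Q.q u else Lau.gen s)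
    (by rw [if_pos rfl, if_neg huv, Lau.coe_scaled]) γ
  rw [if_neg hvw.symm, if_neg huv] at this
  exact this

theorem exists_enumeration {k n : I → ℕ} {A : Finset (Vars n)}
    (h : ∀ i, (A.filter fun v => v.1 = i).card = k i) :
    ∃ e : Vars k → Vars n, (∀ v, (e v).1 = v.1) ∧ Function.Injective e ∧
      Finset.univ.image e = A := by
  let ε := fun i => (A.filter fun v => v.1 = i).equivFinOfCardEq (h i)
  let e : Vars k → Vars n := fun v => ((ε v.1).symm v.2).1
  have h1 : ∀ v, (e v).1 = v.1 := fun v =>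
    (Finset.mem_filter.1 ((ε v.1).symm v.2).2).2
  refine ⟨e, h1, ?_, ?_⟩
  · rintro ⟨i, r⟩ ⟨j, s⟩ hrs
    obtain rfl : i = j := (h1 ⟨i, r⟩).symm.trans ((congrArg Sigma.fst hrs).trans (h1 _))
    exact congrArg _ ((ε i).symm.injective (Subtype.ext hrs))
  · ext a
    simp only [Finset.mem_image, Finset.mem_univ, true_and]
    constructor
    · rintro ⟨v, rfl⟩
      exact (Finset.mem_filter.1 ((ε v.1).symm v.2).2).1
    · intro ha
      refine ⟨⟨a.1, ε a.1 ⟨a, Finset.mem_filter.2 ⟨ha, rfl⟩⟩⟩, ?_⟩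
      simp [e]

/-- If A has multidegree k, the restriction is a renaming of F and the renaming is compatible with
the wheel substitution; otherwise the restriction is zero. -/
theorem wheel_restriction {k n : I → ℕ} {F : SymLau k} (hF : F ∈ Q.Wheel k)
    {U : Lau (Vars n)} {A : Finset (Vars n)} (hU : ∀ (x : Vars n → ℂˣ), Separated x →
      Lau.eval x U = Q.toConf k F (A.image fun v => (v.1, x v)))
    {u v w : Vars n} (hu : u ∈ A) (hv : v ∈ A) (hw : w ∈ A)
    (huv : u ≠ v) (huw : u ≠ w) (hvw : v ≠ w) (h : u.1 = v.1) (γ : ℂˣ) :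
    Lau.lin γ w u ^ Q.doubleMult u.1 w.1 γ ∣ Q.wheelSubst u v U := by
  by_cases hc : ∀ i, (A.filter fun v => v.1 = i).card = k i
  · obtain ⟨e, h1, h2, rfl⟩ := exists_enumeration hc
    rw [Q.restriction_eq F.2 hU h1 h2 rfl]
    obtain ⟨u, -, rfl⟩ := Finset.mem_image.1 hu
    obtain ⟨v, -, rfl⟩ := Finset.mem_image.1 hv
    obtain ⟨w, -, rfl⟩ := Finset.mem_image.1 hw
    rw [h1, h1] at h
    have key := map_dvd (Lau.eval fun s => Lau.gen (e s)) (Q.mem_wheel_iff.1 hF u v w (fun h => huv (h ▸ rfl))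
      (fun h => huw (h ▸ rfl)) (fun h => hvw (h ▸ rfl)) h γ)
    rw [map_pow, Lau.eval_lin] at key
    rw [h1, h1]
    refine key.trans (Eq.dvd ?_)
    rw [wheelSubst_eq, wheelSubst_eq, Lau.spec, Lau.spec, Lau.eval_eval, Lau.hom_eval]
    refine congrArg (fun y => Lau.eval y (F : Lau (Vars k))) (funext fun s => Units.ext ?_)
    simp only [h2.eq_iff]
    split_ifs
    · exact (Lau.eval_scaled _ _ _).trans (Lau.coe_scaled _ _).symm
    · exact Lau.eval_gen _ _
  · push Not at hc
    obtain ⟨i, hi⟩ := hc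
    rw [Q.restriction_eq_zero hU hi, map_zero]
    exact dvd_zero _

/-- Neither t_e nor q/t_e is an integral power of q. -/
theorem Admissible.doubleMult_eq_zero {Q : WeightedQuiver I E} (hQ : Q.Admissible) (i j : I)
    {γ : ℂˣ} (h : ∃ n : ℤ, γ = Q.q ^ n) : Q.doubleMult i j γ = 0 := by
  obtain ⟨n, rfl⟩ := h
  rw [doubleMult, Nat.add_eq_zero_iff]
  constructor
  · rw [Finset.card_eq_zero, Finset.filter_eq_empty_iff]
    intro e _ he
    exact hQ.t_ne_pow e n (by rw [he, Units.val_zpow_eq_zpow_val])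
  · rw [Finset.card_eq_zero, Finset.filter_eq_empty_iff]
    intro e _ he
    apply hQ.t_ne_pow e (1 - n)
    rw [← Units.val_zpow_eq_zpow_val, zpow_sub, zpow_one, ← he]
    simp

theorem Admissible.q_ne_one {Q : WeightedQuiver I E} (hQ : Q.Admissible) : Q.q ≠ 1 := by
  simpa using hQ.1 1 one_pos

/-- After x_v = q x_u and x_w = γ x_u, distinct variables become scalar multiples of variables, and
those that share the variable x_u have scalars 1, q, γ. The assumptions keep these distinct, so no
difference vanishes. -/
theorem wheelSubst_discr_not_dvd (hQ : Q.Admissible) {n : I → ℕ} {u v w : Vars n}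
    (huw : u ≠ w) {γ : ℂˣ} (h1 : γ ≠ 1) (h2 : γ ≠ Q.q) :
    ¬ Lau.lin γ w u ∣ Q.wheelSubst u v (discr n) := by
  rw [Lau.lin_dvd_iff γ huw.symm, wheelSubst_eq, discr, map_prod, map_prod]
  refine Finset.prod_ne_zero_iff.2 fun p hp => ?_
  have hp' := (Finset.mem_filter.1 hp).2
  rw [diffLau]
  split_ifs
  · have key : ∀ s, Lau.spec γ w u (Lau.spec Q.q v u (Lau.gen s).val) =
        Lau.scaled (if s = v then Q.q else if s = w then γ else 1)
          (if s = v then u else if s = w then u else s) := by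
      intro s
      rw [Lau.spec, Lau.spec, Lau.eval_gen]
      by_cases hsv : s = v
      · simp only [hsv, if_true]
        rw [Lau.eval_scaled, if_neg huw, Lau.coe_scaled]
      · simp only [hsv, if_false, Lau.eval_gen]
        by_cases hsw : s = w
        · simp [hsw]
        · simp [hsw, Lau.scaled_one]
    rw [map_sub, map_sub, sub_ne_zero, key, key]
    intro h0
    obtain ⟨e1, e2⟩ := Lau.scaled_injective h0
    have hq := hQ.q_ne_one
    apply hp'
    split_ifs at e1 e2 <;> grind
  · simp

/-- Consider how u, v, w are distributed over the two factors. If all three lie together, the wheel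
condition of that factor applies. If v is in the first factor and u in the second, the term vanishes
under the substitution. In every other case ζ(x_u/x_w) or ζ(x_w/x_v) occurs and supplies the
required power. -/
theorem wheel_mul (hQ : Q.Admissible) {k l n : I → ℕ} {F : SymLau k} {G : SymLau l} {H : SymLau n}
    (hF : F ∈ Q.Wheel k) (hG : G ∈ Q.Wheel l)
    (h : Q.toConf k F * Q.toConf l G = Q.toConf n H) : H ∈ Q.Wheel n := by
  rw [mem_wheel_iff]
  intro u v w huv huw hvw huv1 γ
  rcases Nat.eq_zero_or_pos (Q.doubleMult u.1 w.1 γ) with h0 | h0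
  · rw [h0, pow_zero]
    exact one_dvd _
  -- A positive multiplicity excludes that γ is a power of q, in particular 1 or q, where the
  -- discriminant could interfere.
  have h1 : γ ≠ 1 := fun h1 => h0.ne' (hQ.doubleMult_eq_zero _ _ ⟨0, by simpa using h1⟩)
  have h2 : γ ≠ Q.q := fun h1 => h0.ne' (hQ.doubleMult_eq_zero _ _ ⟨1, by simpa using h1⟩)
  choose U hU using fun A : Finset (Vars n) => Q.exists_toConf_lau F.2 A
  choose V hV using fun A : Finset (Vars n) => Q.exists_toConf_lau G.2 A
  choose R hR using fun A : Finset (Vars n) => exists_discr_eq A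
  -- The form is prime and does not divide the specialized discriminant, so it suffices to treat the
  -- product with denominators cleared, term by term.
  apply (Lau.prime_lin γ huw.symm).pow_dvd_of_dvd_mul_left _
    (Q.wheelSubst_discr_not_dvd hQ huw h1 h2)
  rw [← map_mul, Q.discr_mul_eq H.2 h hU hV hR, map_sum]
  refine Finset.dvd_sum fun A _ => ?_
  have hfac : ∀ a ∈ A, ∀ b ∉ A, Q.wheelSubst u v (Q.zetaLau a b) ∣ Q.wheelSubst u v
      (U A * V (Finset.univ \ A) * ((∏ a ∈ A, ∏ b ∈ Finset.univ \ A, Q.zetaLau a b) * R A)) := by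
    intro a ha b hb
    apply map_dvd
    refine Dvd.dvd.mul_left (Dvd.dvd.mul_right ?_ _) _
    exact (Finset.dvd_prod_of_mem (Q.zetaLau a) (by simpa using hb)).trans
      (Finset.dvd_prod_of_mem (fun a => ∏ b ∈ Finset.univ \ A, Q.zetaLau a b) ha)
  by_cases hu : u ∈ A
  · by_cases hw : w ∈ A
    · by_cases hv : v ∈ A
      · rw [map_mul, map_mul]
        exact ((Q.wheel_restriction hF (hU A) hu hv hw huv huw hvw huv1 γ).mul_right _).mul_right _
      · exact (Q.dvd_wheelSubst_zetaLau_right huv hvw huv1 γ).trans (hfac w hw v hv)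
    · exact (Q.dvd_wheelSubst_zetaLau_left huv hvw γ).trans (hfac u hu w hw)
  · by_cases hv : v ∈ A
    · have := hfac v hv u hu
      rw [Q.wheelSubst_zetaLau_eq_zero huv huv1, zero_dvd_iff] at this
      rw [this]
      exact dvd_zero _
    · by_cases hw : w ∈ A
      · exact (Q.dvd_wheelSubst_zetaLau_right huv hvw huv1 γ).trans (hfac w hw v hv)
      · rw [map_mul, map_mul]
        exact ((Q.wheel_restriction hG (hV _) (by simpa using hu) (by simpa using hv)
          (by simpa using hw) huv huw hvw huv1 γ).mul_left _).mul_right _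

theorem ofSym_mem_smallShuffle {k : I → ℕ} {F : SymLau k} (hF : F ∈ Q.Wheel k) :
    Q.ofSym k F ∈ Q.SmallShuffle :=
  Submodule.mem_iSup_of_mem k ⟨F, hF, rfl⟩

/-- The small shuffle algebra as a subalgebra. -/
theorem smallShuffle_induction {p : Q.BigShuffle → Prop} {x : Q.BigShuffle}
    (hx : x ∈ Q.SmallShuffle) (hof : ∀ k, ∀ F ∈ Q.Wheel k, p (Q.ofSym k F)) (h0 : p 0)
    (hadd : ∀ x y, p x → p y → p (x + y)) : p x := by
  refine Submodule.iSup_induction _ (motive := p) hx ?_ h0 hadd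
  rintro k _ ⟨F, hF, rfl⟩
  exact hof k F hF

theorem mul_mem_smallShuffle (hQ : Q.Admissible) {x y : Q.BigShuffle} (hx : x ∈ Q.SmallShuffle)
    (hy : y ∈ Q.SmallShuffle) : x * y ∈ Q.SmallShuffle := by
  refine Q.smallShuffle_induction hx (p := fun x => x * y ∈ Q.SmallShuffle) (fun k F hF => ?_) ?_ ?_
  · refine Q.smallShuffle_induction hy (p := fun y => Q.ofSym k F * y ∈ Q.SmallShuffle)
      (fun l G hG => ?_) ?_ ?_
    · obtain ⟨H, hH, h⟩ := Q.exists_mul F.2 G.2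
      have : Q.ofSym k F * Q.ofSym l G = Q.ofSym (k + l) ⟨H, hH⟩ := Subtype.ext h
      rw [this]
      exact Q.ofSym_mem_smallShuffle (Q.wheel_mul hQ hF hG (H := ⟨H, hH⟩) h)
    · rw [mul_zero]
      exact zero_mem _
    · intro a b ha hb
      rw [mul_add]
      exact add_mem ha hb
  · rw [zero_mul]
    exact zero_mem _
  · intro a b ha hb
    rw [add_mul]
    exact add_mem ha hb

/-- In degree one there are no two distinct variables, so the wheel conditions are empty. -/
theorem xPow_mem_smallShuffle (i : I) (r : ℤ) : Q.xPow i r ∈ Q.SmallShuffle := by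
  apply Q.ofSym_mem_smallShuffle
  rw [mem_wheel_iff]
  rintro ⟨j, a⟩ ⟨j', b⟩ w huv - - h γ
  exfalso
  obtain rfl : j = j' := h
  have ha := a.2
  have hb := b.2
  by_cases hj : j = i
  · subst hj
    simp only [Pi.single_eq_same] at ha hb
    exact huv (by rw [show a = b from Fin.ext (by omega)])
  · simp [Pi.single_eq_of_ne hj] at ha

theorem one_mem_smallShuffle : (1 : Q.BigShuffle) ∈ Q.SmallShuffle := by
  rw [← Q.ofSym_one]
  apply Q.ofSym_mem_smallShuffle
  rw [mem_wheel_iff]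
  rintro ⟨j, a⟩
  exact a.elim0

theorem shuffleEval_mem (hQ : Q.Admissible) (x : FreeAlgebra ℂ (I × ℤ)) :
    Q.shuffleEval x ∈ Q.SmallShuffle := by
  induction x using FreeAlgebra.induction with
  | grade0 c =>
    rw [AlgHom.commutes, Algebra.algebraMap_eq_smul_one]
    exact Submodule.smul_mem _ _ Q.one_mem_smallShuffle
  | grade1 p =>
    rw [shuffleEval, FreeAlgebra.lift_ι_apply]
    exact Q.xPow_mem_smallShuffle _ _
  | mul a b ha hb =>
    rw [map_mul]
    exact Q.mul_mem_smallShuffle hQ ha hb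
  | add a b ha hb =>
    rw [map_add]
    exact add_mem ha hb

theorem shuffleEvalOp_mem (hQ : Q.Admissible) (x : FreeAlgebra ℂ (I × ℤ)) :
    (Q.shuffleEvalOp x).unop ∈ Q.SmallShuffle := by
  induction x using FreeAlgebra.induction with
  | grade0 c =>
    rw [AlgHom.commutes, Algebra.algebraMap_eq_smul_one]
    exact Submodule.smul_mem _ _ Q.one_mem_smallShuffle
  | grade1 p =>
    rw [shuffleEvalOp, FreeAlgebra.lift_ι_apply]
    exact Q.xPow_mem_smallShuffle _ _
  | mul a b ha hb =>
    rw [map_mul]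
    exact Q.mul_mem_smallShuffle hQ hb ha
  | add a b ha hb =>
    rw [map_add]
    exact add_mem ha hb

theorem upsilonPos_mem (hQ : Q.Admissible) (x : Q.UPos) : Q.upsilonPos x ∈ Q.SmallShuffle := by
  obtain ⟨x, rfl⟩ := RingQuot.mkAlgHom_surjective ℂ Q.PosRel x
  rw [upsilonPos_mk]
  exact Q.shuffleEval_mem hQ x

theorem upsilonNeg_mem (hQ : Q.Admissible) (x : Q.UNeg) :
    (Q.upsilonNeg x).unop ∈ Q.SmallShuffle := by
  obtain ⟨x, rfl⟩ := RingQuot.mkAlgHom_surjective ℂ Q.NegRel x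
  rw [upsilonNeg_mk]
  exact Q.shuffleEvalOp_mem hQ x

end WeightedQuiver

end

/-! ### Zeros of functions with wheel conditions at chains of points. -/

noncomputable section

/-- Split off the primes associated to a given one. That prime does not divide the rest of the
product, so its power divides the cofactor. Only the primality of the listed factors is used, not
unique factorization. -/
theorem Finset.prod_dvd_of_pow_card_dvd {ι R : Type*} [CommRing R] [IsDomain R]
    (T : Finset ι) (π : ι → R) (hπ : ∀ i ∈ T, Prime (π i)) [∀ i, DecidablePred fun j => Associated (π j) (π i)]
    (F : R) (h : ∀ i ∈ T, π i ^ (T.filter fun j => Associated (π j) (π i)).card ∣ F) :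
    ∏ i ∈ T, π i ∣ F := by
  classical
  induction T using Finset.strongInduction with
  | H T ih =>
    rcases T.eq_empty_or_nonempty with rfl | ⟨i, hi⟩
    · simp
    · have hlt : T.filter (fun j => ¬ Associated (π j) (π i)) ⊂ T :=
        Finset.filter_ssubset.2 ⟨i, hi, not_not.2 (Associated.refl _)⟩
      obtain ⟨G, hG⟩ := ih _ hlt (fun j hj => hπ j (Finset.mem_filter.1 hj).1) (fun j hj => by
        rw [Finset.filter_filter]
        refine (pow_dvd_pow _ (Finset.card_le_card ?_)).trans (h j (Finset.mem_filter.1 hj).1)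
        exact fun l hl => Finset.mem_filter.2 ⟨(Finset.mem_filter.1 hl).1, (Finset.mem_filter.1 hl).2.2⟩)
      have h1 : ¬ π i ∣ ∏ j ∈ T.filter (fun j => ¬ Associated (π j) (π i)), π j := by
        rw [(hπ i hi).dvd_finsetProd_iff]
        rintro ⟨j, hj, hd⟩
        obtain ⟨hjT, hj⟩ := Finset.mem_filter.1 hj
        exact hj (((hπ i hi).irreducible.associated_of_dvd (hπ j hjT).irreducible hd).symm)
      have h2 := h i hi
      rw [hG] at h2
      have h3 := (hπ i hi).pow_dvd_of_dvd_mul_left _ h1 h2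
      rw [← Finset.prod_filter_mul_prod_filter_not T (fun j => Associated (π j) (π i)), hG, mul_comm]
      refine mul_dvd_mul_left _ (Dvd.dvd.trans ?_ h3)
      rw [← Finset.prod_const]
      exact Finset.prod_dvd_prod_of_dvd _ _ fun j hj => (Finset.mem_filter.1 hj).2.dvd

namespace Lau

variable {σ : Type*} [Fintype σ] [DecidableEq σ]

/-- Divisibility makes the second form vanish under x_w = c x_u; comparing scaled variables leaves
only the same form, or the form with the two variables exchanged and inverse coefficient. -/
theorem eq_or_eq_of_lin_dvd_lin {c c' : ℂˣ} {w u w' u' : σ} (h : w ≠ u) (h' : w' ≠ u')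
    (hd : lin c w u ∣ lin c' w' u') :
    (w' = w ∧ u' = u ∧ c' = c) ∨ (w' = u ∧ u' = w ∧ c' * c = 1) := by
  rw [lin_dvd_iff c h, spec, eval_lin, sub_eq_zero] at hd
  have key : ∀ s, ((if s = w then scaled c u else gen s : (Lau σ)ˣ) : Lau σ) =
      scaled (if s = w then c else 1) (if s = w then u else s) := by
    intro s
    split_ifs
    · rfl
    · rw [scaled_one]
  have key2 : ∀ s, algebraMap ℂ (Lau σ) c' * ((if s = w then scaled c u else gen s : (Lau σ)ˣ) : Lau σ) =
      scaled (c' * (if s = w then c else 1)) (if s = w then u else s) := by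
    intro s
    rw [key, coe_scaled, coe_scaled, Units.val_mul, map_mul, mul_assoc]
  rw [key, key2] at hd
  obtain ⟨e1, e2⟩ := scaled_injective hd
  by_cases h1 : w' = w
  · subst h1
    rw [if_pos rfl] at e1 e2
    rw [if_neg h'.symm] at e1 e2
    rw [mul_one] at e2
    exact Or.inl ⟨rfl, e1.symm, e2.symm⟩
  · rw [if_neg h1] at e1 e2
    by_cases h2 : u' = w
    · rw [if_pos h2] at e1 e2
      exact Or.inr ⟨e1, h2, e2.symm⟩
    · rw [if_neg h2] at e1 e2
      exact absurd e1 h'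

theorem associated_lin_symm {c c' : ℂˣ} (w u : σ) (h : c' * c = 1) :
    Associated (lin c w u) (lin c' u w) := by
  refine ⟨Units.map (algebraMap ℂ (Lau σ) : ℂ →* Lau σ) (-c'), ?_⟩
  have h1 : algebraMap ℂ (Lau σ) (c' : ℂ) * algebraMap ℂ (Lau σ) (c : ℂ) = 1 := by
    rw [← map_mul, ← Units.val_mul, h, Units.val_one, map_one]
  simp only [lin, coe_scaled, Units.coe_map, MonoidHom.coe_coe, Units.val_neg, map_neg]
  linear_combination (gen u).val * h1

end Lau

namespace WeightedQuiver

variable {I E : Type*} [Fintype I] [DecidableEq I] [Fintype E] (Q : WeightedQuiver I E)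

theorem zpow_bound {x : ℂ} {n : ℤ} (h : x = (Q.q : ℂ) ^ n) {a b : ℤ}
    (h1 : ‖(Q.q : ℂ)‖ ^ a < ‖x‖) (h2 : ‖x‖ < ‖(Q.q : ℂ)‖ ^ b) (h3 : ‖(Q.q : ℂ)‖ < 1) :
    b < n ∧ n < a := by
  have h0 : 0 < ‖(Q.q : ℂ)‖ := norm_pos_iff.2 Q.q.ne_zero
  rw [h, norm_zpow] at h1 h2
  exact ⟨(zpow_lt_zpow_iff_right_of_lt_one₀ h0 h3).1 h2,
    (zpow_lt_zpow_iff_right_of_lt_one₀ h0 h3).1 h1⟩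

variable {Q} in
-- The ratio t_e / t_e' has absolute value strictly between |q| and 1/|q|, so it can be a power of q
-- only with exponent zero.
theorem Admissible.eq_of_mul_zpow (hQ : Q.Admissible) {e e' : E} {n n' : ℤ}
    (h : Q.t e * Q.q ^ n = Q.t e' * Q.q ^ n') : Q.t e = Q.t e' ∧ n = n' := by
  have hn : n = n' := by
    have h1 : (Q.t e : ℂ) / Q.t e' = (Q.q : ℂ) ^ (n' - n) := by
      have := congrArg Units.val (show Q.t e / Q.t e' = Q.q ^ (n' - n) by
        rw [zpow_sub, div_eq_iff_eq_mul, mul_right_comm, mul_comm _ (Q.t e'), ← h, mul_assoc,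
          mul_inv_cancel, mul_one])
      simpa using this
    obtain ⟨a1, a2⟩ := hQ.2 e
    obtain ⟨b1, b2⟩ := hQ.2 e'
    have h0 : 0 < ‖(Q.q : ℂ)‖ := norm_pos_iff.2 Q.q.ne_zero
    have hb : 0 < ‖(Q.t e' : ℂ)‖ := h0.trans b1
    have := Q.zpow_bound h1 (a := 1) (b := -1) (by
      rw [norm_div, zpow_one, lt_div_iff₀ hb]
      nlinarith) (by
      rw [norm_div, zpow_neg_one, div_lt_iff₀ hb, ← div_eq_inv_mul, lt_div_iff₀ h0]
      nlinarith) (a1.trans a2)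
    omega
  subst hn
  exact ⟨mul_right_cancel h, rfl⟩

variable {Q} in
-- The product t_e t_e' has absolute value strictly between |q|² and 1, so the only power of q it
-- can equal is q itself.
theorem Admissible.eq_of_mul_mul_zpow (hQ : Q.Admissible) {e e' : E} {n n' : ℤ}
    (h : (Q.t e * Q.q ^ n) * (Q.t e' * Q.q ^ n') = 1) : Q.t e = Q.q / Q.t e' ∧ n + n' = -1 := by
  have h' : Q.t e * Q.t e' = Q.q ^ (-(n + n')) := by
    rw [mul_mul_mul_comm, ← zpow_add] at h
    rw [zpow_neg]
    exact eq_inv_of_mul_eq_one_left h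
  have hn : n + n' = -1 := by
    have h1 : (Q.t e : ℂ) * Q.t e' = (Q.q : ℂ) ^ (-(n + n')) := by
      have := congrArg Units.val h'
      simpa using this
    obtain ⟨a1, a2⟩ := hQ.2 e
    obtain ⟨b1, b2⟩ := hQ.2 e'
    have h0 : 0 < ‖(Q.q : ℂ)‖ := norm_pos_iff.2 Q.q.ne_zero
    have := Q.zpow_bound h1 (a := 2) (b := 0) (by
      rw [norm_mul, zpow_ofNat]
      nlinarith) (by
      rw [norm_mul, zpow_zero]
      nlinarith) (a1.trans a2)
    omega
  refine ⟨?_, hn⟩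
  rw [hn, neg_neg, zpow_one] at h'
  rw [← h', mul_div_cancel_right]

/-- In the doubled quiver, reversing an edge replaces its weight γ by q/γ. -/
theorem doubleMult_div (i j : I) (γ : ℂˣ) : Q.doubleMult i j (Q.q / γ) = Q.doubleMult j i γ := by
  simp only [doubleMult, div_right_inj]
  rw [add_comm]
  congr 3
  ext e
  constructor
  · intro h
    rw [h, div_div_cancel]
  · intro h
    rw [← h, div_div_cancel]

/-! ### Symmetric functions at chains of points -/

section Chains

variable {a k : I → ℕ} {m : ∀ i, Fin (a i) → ℕ} (hm : m ∈ splittings a k)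

/-- The specialization of a Laurent polynomial at chains of points `x_u q^p`. -/
def chainLau : Lau (Vars k) →ₐ[ℂ] Lau (Vars a) :=
  Lau.eval fun s => Lau.scaled (Q.q ^ ((chainEquiv hm s).2 : ℕ)) (chainEquiv hm s).1

/-- Pairs of a position in the chain `o` and a position in the chain `c` other than the last one,
at distance `n`. -/
def chainPairs (m : ∀ i, Fin (a i) → ℕ) (o c : Vars a) (n : ℤ) : Finset (ℕ × ℕ) :=
  (Finset.range (m o.1 o.2) ×ˢ Finset.range (m c.1 c.2 - 1)).filter fun p => (p.2 : ℤ) - p.1 = n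

-- Each pair (po, pc) in `chainPairs` yields a wheel condition with u, v at positions pc, pc + 1 of
-- the chain c and w at position po of the chain o. After full specialization all these forms become
-- proportional to one form, so their multiplicities must be added before that happens.
open scoped Classical in
theorem pow_dvd_chainLau {F : SymLau k} (hF : F ∈ Q.Wheel k) {o c : Vars a} (hoc : o ≠ c) (γ : ℂˣ)
    (n : ℤ) : Lau.lin (γ * Q.q ^ n) o c ^ (Q.doubleMult c.1 o.1 γ * (chainPairs m o c n).card) ∣
      Q.chainLau hm (F : Lau (Vars k)) := by
  -- The specialization is done in two stages. Here g collapses only the chain c, leaving the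
  -- positions of o as independent variables with pairwise non-associated forms; h then collapses
  -- the other chains.
  let g : Lau (Vars k) →ₐ[ℂ] Lau (Vars a ⊕ Vars k) := Lau.eval fun s =>
    if (chainEquiv hm s).1 = c then Lau.scaled (Q.q ^ ((chainEquiv hm s).2 : ℕ)) (Sum.inl c)
      else Lau.gen (Sum.inr s)
  let h : Lau (Vars a ⊕ Vars k) →ₐ[ℂ] Lau (Vars a) := Lau.eval (Sum.elim (fun u => Lau.gen u)
    fun s => Lau.scaled (Q.q ^ ((chainEquiv hm s).2 : ℕ)) (chainEquiv hm s).1)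
  have hsym : ∀ {M : Type _} (f : ∀ u : Vars a, ℕ → M) (t : Σ u : Vars a, Fin (m u.1 u.2)),
      f (chainEquiv hm ((chainEquiv hm).symm t)).1 (chainEquiv hm ((chainEquiv hm).symm t)).2 =
        f t.1 t.2 := fun f t =>
    congrArg (fun p : Σ u : Vars a, Fin (m u.1 u.2) => f p.1 p.2) ((chainEquiv hm).apply_symm_apply t)
  have hhg : h (g (F : Lau (Vars k))) = Q.chainLau hm (F : Lau (Vars k)) := by
    simp only [g, chainLau]
    rw [Lau.hom_eval]
    refine congrArg (fun y => Lau.eval y (F : Lau (Vars k))) (funext fun s => Units.ext ?_)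
    split_ifs with hs
    · refine (Lau.eval_scaled _ _ _).trans ?_
      rw [Lau.coe_scaled]
      exact congrArg (fun x : Vars a => algebraMap ℂ (Lau (Vars a))
        ((Q.q ^ ((chainEquiv hm s).2 : ℕ) : ℂˣ) : ℂ) * (Lau.gen x).val) hs.symm
    · exact Lau.eval_gen _ _
  have hmem : ∀ p ∈ chainPairs m o c n, p.1 < m o.1 o.2 ∧ p.2 + 1 < m c.1 c.2 ∧
      (p.2 : ℤ) - p.1 = n := by
    intro p hp
    simp only [chainPairs, Finset.mem_filter, Finset.mem_product, Finset.mem_range] at hp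
    omega
  let ov : chainPairs m o c n → Vars k := fun p => (chainEquiv hm).symm ⟨o, ⟨p.1.1, (hmem p.1 p.2).1⟩⟩
  have hov : Function.Injective ov := by
    intro p p' hp
    have h1 := (chainEquiv hm).symm.injective hp
    have h2 : p.1.1 = p'.1.1 := by simpa using h1
    have h3 := (hmem p.1 p.2).2.2
    have h4 := (hmem p'.1 p'.2).2.2
    exact Subtype.ext (Prod.ext h2 (by omega))
  let π : chainPairs m o c n × Fin (Q.doubleMult c.1 o.1 γ) → Lau (Vars a ⊕ Vars k) := fun x =>
    Lau.lin (γ * Q.q ^ x.1.1.2) (Sum.inr (ov x.1)) (Sum.inl c)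
  have hvan : ∀ p, Lau.lin (γ * Q.q ^ p.1.2) (Sum.inr (ov p)) (Sum.inl c) ^
      Q.doubleMult c.1 o.1 γ ∣ g (F : Lau (Vars k)) := by
    intro p
    obtain ⟨h1, h2, h3⟩ := hmem p.1 p.2
    let u : Vars k := (chainEquiv hm).symm ⟨c, ⟨p.1.2, by omega⟩⟩
    let v : Vars k := (chainEquiv hm).symm ⟨c, ⟨p.1.2 + 1, h2⟩⟩
    have key := map_dvd g (Q.mem_wheel_iff.1 hF u v (ov p) (by
      intro huv
      have := (chainEquiv hm).symm.injective huv
      simp at this) (by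
      intro huv
      have := congrArg Sigma.fst ((chainEquiv hm).symm.injective huv)
      exact hoc this.symm) (by
      intro huv
      have := congrArg Sigma.fst ((chainEquiv hm).symm.injective huv)
      exact hoc this.symm) rfl γ)
    have gu : ∀ (r : ℕ) (hr : r < m c.1 c.2), (if (chainEquiv hm ((chainEquiv hm).symm ⟨c, ⟨r, hr⟩⟩)).1 = c then
        Lau.scaled (Q.q ^ ((chainEquiv hm ((chainEquiv hm).symm ⟨c, ⟨r, hr⟩⟩)).2 : ℕ)) (Sum.inl c)
        else Lau.gen (Sum.inr ((chainEquiv hm).symm ⟨c, ⟨r, hr⟩⟩)) : (Lau (Vars a ⊕ Vars k))ˣ) =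
        Lau.scaled (Q.q ^ r) (Sum.inl c) := by
      intro r hr
      rw [hsym (fun x y => if x = c then Lau.scaled (Q.q ^ y) (Sum.inl c) else
        (Lau.gen (Sum.inr ((chainEquiv hm).symm ⟨c, ⟨r, hr⟩⟩)) : (Lau (Vars a ⊕ Vars k))ˣ))]
      simp
    -- Consecutive points of a chain already satisfy x_v = q x_u, so the wheel substitution has no
    -- effect after g.
    have e1 : g (Q.wheelSubst u v (F : Lau (Vars k))) = g (F : Lau (Vars k)) := by
      simp only [g, wheelSubst_eq, Lau.spec]
      rw [Lau.hom_eval]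
      refine congrArg (fun y => Lau.eval y (F : Lau (Vars k))) (funext fun s => Units.ext ?_)
      by_cases hs : s = v
      · rw [if_pos hs]
        refine (Lau.eval_scaled _ _ _).trans ?_
        rw [hs, gu, gu, Lau.coe_scaled, Lau.coe_scaled, ← mul_assoc, ← map_mul, ← Units.val_mul,
          ← pow_succ']
      · rw [if_neg hs]
        exact Lau.eval_gen _ _
    rw [e1, map_pow, Lau.eval_lin, gu, if_neg (fun h0 => hoc
      ((congrArg Sigma.fst ((chainEquiv hm).apply_symm_apply _)).symm.trans h0))] at key
    refine Dvd.dvd.trans (Eq.dvd ?_) key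
    congr 1
    rw [Lau.lin, Lau.coe_scaled, Lau.coe_scaled, ← mul_assoc, ← map_mul, ← Units.val_mul]
  have hprod : ∏ x, π x ∣ g (F : Lau (Vars k)) := by
    refine Finset.prod_dvd_of_pow_card_dvd Finset.univ π (fun x _ => Lau.prime_lin _ (by simp)) _
      fun x _ => (pow_dvd_pow _ ?_).trans (hvan x.1)
    -- Forms attached to different pairs involve different variables of o, since at fixed distance n
    -- the position in o determines the pair.
    have hsub : (Finset.univ.filter fun x' => Associated (π x') (π x)) ⊆
        Finset.univ.image fun j => (x.1, j) := by
      intro x' hx'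
      have h1 := (Finset.mem_filter.1 hx').2
      have h2 := Lau.eq_or_eq_of_lin_dvd_lin (by simp) (by simp) h1.dvd
      simp only [Sum.inr.injEq, reduceCtorEq, false_and, or_false] at h2
      exact Finset.mem_image.2 ⟨x'.2, Finset.mem_univ _, Prod.ext (hov h2.1) rfl⟩
    refine (Finset.card_le_card hsub).trans (Finset.card_image_le.trans ?_)
    simp
  have h1 := map_dvd h hprod
  rw [hhg, map_prod] at h1
  refine Dvd.dvd.trans ?_ h1
  have hcard : Q.doubleMult c.1 o.1 γ * (chainPairs m o c n).card =
      (Finset.univ : Finset (chainPairs m o c n × Fin (Q.doubleMult c.1 o.1 γ))).card := by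
    rw [Finset.card_univ, Fintype.card_prod, Fintype.card_coe, Fintype.card_fin, mul_comm]
  rw [hcard, ← Finset.prod_const]
  refine Finset.prod_dvd_prod_of_dvd _ _ fun x _ => ?_
  obtain ⟨h2, h3, h4⟩ := hmem x.1.1 x.1.2
  simp only [π, h]
  rw [Lau.eval_lin]
  simp only [Sum.elim_inr, Sum.elim_inl]
  have hpo : (Lau.scaled (Q.q ^ ((chainEquiv hm (ov x.1)).2 : ℕ)) (chainEquiv hm (ov x.1)).1 :
      (Lau (Vars a))ˣ) = Lau.scaled (Q.q ^ x.1.1.1) o := hsym (fun u p => Lau.scaled (Q.q ^ p) u) _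
  rw [hpo]
  refine ⟨algebraMap ℂ _ ((Q.q ^ x.1.1.1 : ℂˣ) : ℂ), ?_⟩
  -- As pc = po + n, the scalar q^{po} can be factored out of x_o q^{po} - γ q^{pc} x_c.
  have h5 : γ * Q.q ^ x.1.1.2 = γ * Q.q ^ n * Q.q ^ x.1.1.1 := by
    rw [mul_assoc, ← zpow_natCast Q.q x.1.1.1, ← zpow_add, ← zpow_natCast Q.q x.1.1.2]
    congr 2
    omega
  rw [h5, Units.val_mul _ (Q.q ^ x.1.1.1), map_mul, Lau.lin, Lau.coe_scaled, Lau.coe_scaled]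
  ring

/-- The product of the linear forms at which the coefficients of the explicit homomorphism may have
poles divides symmetric Laurent polynomials satisfying the wheel conditions. -/
theorem prod_lin_dvd_chainLau (hQ : Q.Admissible) {F : SymLau k} (hF : F ∈ Q.Wheel k) :
    (∏ o : Vars a, ∏ c ∈ Finset.univ.erase o, ∏ e ∈ Q.edges o.1 c.1,
      ∏ po ∈ Finset.range (m o.1 o.2), ∏ pc ∈ Finset.range (m c.1 c.2 - 1),
        Lau.lin (Q.t e * Q.q ^ ((po : ℤ) - pc - 1)) c o) ∣ Q.chainLau hm (F : Lau (Vars k)) := by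
  classical
  simp only [Finset.prod_sigma']
  refine Finset.prod_dvd_of_pow_card_dvd _ _ ?_ _ ?_
  · rintro ⟨o, c, e, po, pc⟩ hx
    simp only [Finset.mem_sigma, Finset.mem_univ, true_and, Finset.mem_erase, and_true] at hx
    exact Lau.prime_lin _ hx.1
  · rintro ⟨o, c, e, po, pc⟩ hx
    simp only [Finset.mem_sigma, Finset.mem_univ, true_and, Finset.mem_erase, and_true] at hx
    obtain ⟨hco, he, hpo, hpc⟩ := hx
    dsimp only
    set κ : ℤ := (pc : ℤ) - po with hκ
    have hc : Q.t e * Q.q ^ ((po : ℤ) - pc - 1) = Q.t e * Q.q ^ (-1 - κ) := by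
      congr 2
      omega
    rw [hc]
    -- Edges whose form can be associated to the given one: those in the same direction with weight
    -- t_e, and those in the opposite direction with weight q/t_e.
    let E1 := (Q.edges o.1 c.1).filter fun e' => Q.t e' = Q.t e
    let E2 := (Q.edges c.1 o.1).filter fun e' => Q.q / Q.t e' = Q.t e
    have hE : Q.doubleMult o.1 c.1 (Q.t e) = E1.card + E2.card := rfl
    let N1 := chainPairs m o c κ
    let N2 := chainPairs m c o (-1 - κ)
    have d1 : Lau.lin (Q.t e * Q.q ^ (-1 - κ)) c o ^ ((E1.card + E2.card) * N1.card) ∣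
        Q.chainLau hm (F : Lau (Vars k)) := by
      have := Q.pow_dvd_chainLau hm hF hco.symm (Q.q / Q.t e) κ
      rw [Q.doubleMult_div, hE] at this
      refine Dvd.dvd.trans (Associated.pow_pow ?_).dvd this
      apply Lau.associated_lin_symm
      rw [mul_mul_mul_comm, ← zpow_add, div_mul_cancel, add_sub_cancel, zpow_neg_one, mul_inv_cancel]
    have d2 : Lau.lin (Q.t e * Q.q ^ (-1 - κ)) c o ^ ((E1.card + E2.card) * N2.card) ∣
        Q.chainLau hm (F : Lau (Vars k)) := by
      have := Q.pow_dvd_chainLau hm hF hco (Q.t e) (-1 - κ)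
      rwa [hE] at this
    -- The multiplicity to be matched: an associated form comes from E1 with positions in N1 or from
    -- E2 with positions in N2, by the two rigidity statements on t_e q^n.
    have hcount : ∀ T : Finset (Σ _ : Vars a, Σ _ : Vars a, Σ _ : E, Σ _ : ℕ, ℕ),
        (∀ x ∈ T, x.2.1 ≠ x.1 ∧ x.2.2.1 ∈ Q.edges x.1.1 x.2.1.1 ∧
          x.2.2.2.1 < m x.1.1 x.1.2 ∧ x.2.2.2.2 < m x.2.1.1 x.2.1.2 - 1 ∧
          Associated (Lau.lin (Q.t x.2.2.1 * Q.q ^ ((x.2.2.2.1 : ℤ) - x.2.2.2.2 - 1)) x.2.1 x.1)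
            (Lau.lin (Q.t e * Q.q ^ (-1 - κ)) c o)) →
        T.card ≤ E1.card * N1.card + E2.card * N2.card := by
      intro T hT
      have hsub : T ⊆ ((E1 ×ˢ N1).image fun y => ⟨o, c, y.1, y.2.1, y.2.2⟩) ∪
          ((E2 ×ˢ N2).image fun y => ⟨c, o, y.1, y.2.1, y.2.2⟩) := by
        rintro ⟨o', c', e', po', pc'⟩ hx
        obtain ⟨h1, h2, h3, h4, h5⟩ := hT _ hx
        dsimp only at h1 h2 h3 h4 h5
        rw [Finset.mem_union]
        rcases Lau.eq_or_eq_of_lin_dvd_lin h1 hco h5.dvd with ⟨h6, h7, h8⟩ | ⟨h6, h7, h8⟩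
        · left
          subst h6 h7
          obtain ⟨h9, h10⟩ := hQ.eq_of_mul_zpow h8
          refine Finset.mem_image.2 ⟨(e', po', pc'), ?_, rfl⟩
          refine Finset.mem_product.2 ⟨Finset.mem_filter.2 ⟨h2, h9.symm⟩, ?_⟩
          refine Finset.mem_filter.2 ⟨Finset.mem_product.2 ⟨Finset.mem_range.2 h3,
            Finset.mem_range.2 h4⟩, ?_⟩
          dsimp only
          omega
        · right
          subst h6 h7
          obtain ⟨h9, h10⟩ := hQ.eq_of_mul_mul_zpow h8
          refine Finset.mem_image.2 ⟨(e', po', pc'), ?_, rfl⟩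
          refine Finset.mem_product.2 ⟨Finset.mem_filter.2 ⟨h2, h9.symm⟩, ?_⟩
          refine Finset.mem_filter.2 ⟨Finset.mem_product.2 ⟨Finset.mem_range.2 h3,
            Finset.mem_range.2 h4⟩, ?_⟩
          dsimp only
          omega
      refine (Finset.card_le_card hsub).trans ((Finset.card_union_le _ _).trans ?_)
      refine (Nat.add_le_add Finset.card_image_le Finset.card_image_le).trans ?_
      rw [Finset.card_product, Finset.card_product]
    refine (pow_dvd_pow _ (hcount _ fun x hx => ?_)).trans ?_
    · obtain ⟨h1, h2⟩ := Finset.mem_filter.1 hx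
      simp only [Finset.mem_sigma, Finset.mem_univ, true_and, Finset.mem_erase, and_true,
        Finset.mem_range] at h1
      exact ⟨h1.1, h1.2.1, h1.2.2.1, h1.2.2.2, h2⟩
    -- The wheel conditions provide both exponents (|E1| + |E2|)|N1| and (|E1| + |E2|)|N2|. The
    -- larger one dominates |E1||N1| + |E2||N2|.
    rcases le_total N1.card N2.card with h | h
    · refine (pow_dvd_pow _ ?_).trans d2
      rw [add_mul]
      exact Nat.add_le_add_right (Nat.mul_le_mul_left _ h) _
    · refine (pow_dvd_pow _ ?_).trans d1
      rw [add_mul]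
      exact Nat.add_le_add_left (Nat.mul_le_mul_left _ h) _

end Chains

end WeightedQuiver

end

/-! ### Poles of the universal coefficients. -/

noncomputable section

namespace WeightedQuiver

/-- `x` is a multiple of `y` by an element of the subalgebra `S`. -/
def IsMultiple {L : Type*} [Field L] [Algebra ℂ L] (S : Subalgebra ℂ L) (x y : L) : Prop :=
  ∃ s ∈ S, x = s * y

namespace IsMultiple

variable {L : Type*} [Field L] [Algebra ℂ L] {S : Subalgebra ℂ L}

theorem refl (x : L) : IsMultiple S x x := ⟨1, one_mem S, (one_mul x).symm⟩

theorem of_mem {x : L} (h : x ∈ S) : IsMultiple S x 1 := ⟨x, h, (mul_one x).symm⟩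

theorem mem {x y : L} (h : IsMultiple S x y) (hy : y ∈ S) : x ∈ S := by
  obtain ⟨s, hs, rfl⟩ := h
  exact mul_mem hs hy

theorem mul {x y x' y' : L} (h : IsMultiple S x y) (h' : IsMultiple S x' y') :
    IsMultiple S (x * x') (y * y') := by
  obtain ⟨s, hs, rfl⟩ := h
  obtain ⟨s', hs', rfl⟩ := h'
  exact ⟨s * s', mul_mem hs hs', mul_mul_mul_comm _ _ _ _⟩

theorem mul_of_mem {x y z : L} (h : IsMultiple S x y) (hz : z ∈ S) : IsMultiple S (z * x) y := by
  obtain ⟨s, hs, rfl⟩ := h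
  exact ⟨z * s, mul_mem hz hs, (mul_assoc _ _ _).symm⟩

theorem prod {ι : Type*} {T : Finset ι} {f g : ι → L} (h : ∀ i ∈ T, IsMultiple S (f i) (g i)) :
    IsMultiple S (∏ i ∈ T, f i) (∏ i ∈ T, g i) := by
  classical
  induction T using Finset.induction_on with
  | empty => exact refl _
  | insert a T ha ih =>
    rw [Finset.prod_insert ha, Finset.prod_insert ha]
    exact (h a (Finset.mem_insert_self _ _)).mul
      (ih fun i hi => h i (Finset.mem_insert_of_mem hi))

end IsMultiple

variable {I E : Type*} [Fintype I] [DecidableEq I] [Fintype E]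

theorem qIn_zpow_mem {Q : WeightedQuiver I E} {L : Type*} [Field L] [Algebra ℂ L]
    (S : Subalgebra ℂ L) (n : ℤ) : Q.qIn L ^ n ∈ S := by
  rw [qIn, ← map_zpow₀]
  exact S.algebraMap_mem _

theorem qIn_pow_mem {Q : WeightedQuiver I E} {L : Type*} [Field L] [Algebra ℂ L]
    (S : Subalgebra ℂ L) (n : ℕ) : Q.qIn L ^ n ∈ S := by
  rw [qIn, ← map_pow]
  exact S.algebraMap_mem _

namespace ChainModel

variable {Q : WeightedQuiver I E} {a : I → ℕ} {L G : Type*} [Field L] [Algebra ℂ L]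
    [CommGroup G] [MulSemiringAction G L] [SMulCommClass G ℂ L] (X : Q.ChainModel a L G)

/-- The subalgebra `S` contains the coordinates of the points, the inverses of the differences of
points of the same colour in different chains, and the part of the factors `Y` not involving
edges. -/
structure CoeffRing (S : Subalgebra ℂ L) : Prop where
  pos_mem : ∀ u, (X.pos u : L) ∈ S
  pos_inv_mem : ∀ u, (X.pos u : L)⁻¹ ∈ S
  inv_sub_mem : ∀ u v, u ≠ v → u.1 = v.1 → ∀ n : ℤ, (X.pos u - Q.qIn L ^ n * X.pos v : L)⁻¹ ∈ S
  y_mem : ∀ u p, IsMultiple S (X.y u p) (∏ v ∈ Finset.univ.erase u, ∏ e ∈ Q.edges u.1 v.1,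
    ((Q.tIn L e)⁻¹ - X.pt u p / X.pos v))

variable {X} {S : Subalgebra ℂ L} (hS : X.CoeffRing S)

include hS

theorem CoeffRing.pt_mem (u : Vars a) (p : ℕ) : (X.pt u p : L) ∈ S := by
  rw [X.coe_pt]
  exact mul_mem (hS.pos_mem u) (qIn_pow_mem S p)

theorem CoeffRing.pt_inv_mem (u : Vars a) (p : ℕ) : (X.pt u p : L)⁻¹ ∈ S := by
  rw [X.coe_pt, mul_inv, ← zpow_natCast, ← zpow_neg]
  exact mul_mem (hS.pos_inv_mem u) (qIn_zpow_mem S _)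

theorem CoeffRing.diff_mem {u v : Vars a} (huv : u ≠ v) (h : u.1 = v.1) (p₁ p₂ : ℕ) :
    ((X.pt u p₁ - X.pt v p₂) / (X.pt u p₁ * (Q.qIn L)⁻¹ - X.pt v p₂) : L) ∈ S := by
  have hq := Q.qIn_ne_zero (L := L)
  have h1 : (X.pt u p₁ * (Q.qIn L)⁻¹ - X.pt v p₂ : L) =
      Q.qIn L ^ ((p₁ : ℤ) - 1) * (X.pos u - Q.qIn L ^ ((p₂ : ℤ) - p₁ + 1) * X.pos v) := by
    rw [X.coe_pt, X.coe_pt, mul_sub, ← mul_assoc, ← zpow_add₀ hq, zpow_sub_one₀ hq, zpow_natCast,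
      show (p₁ : ℤ) - 1 + (p₂ - p₁ + 1) = p₂ by ring, zpow_natCast]
    ring
  rw [h1, div_eq_mul_inv, mul_inv, ← zpow_neg]
  exact mul_mem (sub_mem (hS.pt_mem _ _) (hS.pt_mem _ _))
    (mul_mem (qIn_zpow_mem S _) (hS.inv_sub_mem u v huv h _))

theorem CoeffRing.edge_mem (u v : Vars a) (e : E) (p₁ p₂ : ℕ) :
    ((Q.tIn L e)⁻¹ - X.pt u p₁ / X.pt v p₂ : L) ∈ S := by
  refine sub_mem ?_ ?_
  · rw [tIn, ← map_inv₀]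
    exact S.algebraMap_mem _
  · rw [div_eq_mul_inv]
    exact mul_mem (hS.pt_mem _ _) (hS.pt_inv_mem _ _)

theorem CoeffRing.edge_inv (u v : Vars a) (e : E) (p₁ p₂ : ℕ) :
    IsMultiple S ((Q.tIn L e)⁻¹ - X.pt u p₁ / X.pt v (p₂ + 1) : L)⁻¹
      (X.pos v - Q.tIn L e * Q.qIn L ^ ((p₁ : ℤ) - p₂ - 1) * X.pos u : L)⁻¹ := by
  have hq := Q.qIn_ne_zero (L := L)
  have ht := Q.tIn_ne_zero (L := L) e
  have hv := (X.pos v).ne_zero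
  refine ⟨Q.tIn L e * X.pos v, mul_mem (S.algebraMap_mem _) (hS.pos_mem v), ?_⟩
  rw [← inv_inv (Q.tIn L e * _), ← mul_inv]
  congr 1
  rw [X.coe_pt, X.coe_pt, sub_sub, zpow_sub₀ hq, zpow_natCast]
  have : Q.qIn L ^ ((p₂ : ℤ) + 1) = Q.qIn L ^ (p₂ + 1) := zpow_natCast (Q.qIn L) (p₂ + 1)
  rw [this]
  field_simp

/-- The edge factors of Y cancel those of φ at the first point of the chain v. Poles remain only at
the later points, which is why the index p₂ runs over n - 1 values and the exponent contains a
further -1. -/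
theorem CoeffRing.pair_isMultiple {u v : Vars a} (huv : u ≠ v) (M n : ℕ) :
    IsMultiple S ((∏ p ∈ Finset.range M, ∏ e ∈ Q.edges u.1 v.1,
        ((Q.tIn L e)⁻¹ - X.pt u p / X.pos v : L)) *
      ∏ p₁ ∈ Finset.range M, ∏ p₂ ∈ Finset.range n, Q.phi u.1 v.1 (X.pt u p₁ : L) (X.pt v p₂))
      (∏ e ∈ Q.edges u.1 v.1, ∏ p₁ ∈ Finset.range M, ∏ p₂ ∈ Finset.range (n - 1),
        (X.pos v - Q.tIn L e * Q.qIn L ^ ((p₁ : ℤ) - p₂ - 1) * X.pos u : L)⁻¹) := by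
  have h0 : (X.pos v : L) = X.pt v 0 := by rw [X.coe_pt, pow_zero, mul_one]
  rw [← Finset.prod_mul_distrib, Finset.prod_comm (s := Q.edges u.1 v.1)]
  refine IsMultiple.prod fun p _ => ?_
  -- If the chain v is empty, there is no φ to cancel, and the edge factors of Y lie in S
  -- themselves.
  cases n with
  | zero =>
    simp only [Finset.range_zero, Finset.prod_empty, Finset.prod_const_one, mul_one, zero_tsub]
    rw [h0]
    exact IsMultiple.of_mem (prod_mem fun e _ => hS.edge_mem u v e p 0)
  | succ n =>
    have hφ : ∀ p₂, Q.phi u.1 v.1 (X.pt u p : L) (X.pt v p₂) =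
        (if u.1 = v.1 then (X.pt u p - X.pt v p₂) / (X.pt u p * (Q.qIn L)⁻¹ - X.pt v p₂) else 1) *
          ∏ e ∈ Q.edges u.1 v.1, ((Q.tIn L e)⁻¹ - X.pt u p / X.pt v p₂ : L)⁻¹ := fun _ => rfl
    have hg : ∀ p₂, (if u.1 = v.1 then (X.pt u p - X.pt v p₂) /
        (X.pt u p * (Q.qIn L)⁻¹ - X.pt v p₂) else 1 : L) ∈ S := by
      intro p₂
      split_ifs with h
      · exact hS.diff_mem huv h p p₂
      · exact one_mem S
    rw [Finset.prod_range_succ', hφ 0, Nat.add_sub_cancel, Finset.prod_comm (s := Q.edges u.1 v.1),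
      ← h0]
    have hcan : (∏ e ∈ Q.edges u.1 v.1, ((Q.tIn L e)⁻¹ - X.pt u p / X.pos v : L)) *
        ∏ e ∈ Q.edges u.1 v.1, ((Q.tIn L e)⁻¹ - X.pt u p / X.pos v : L)⁻¹ = 1 := by
      rw [← Finset.prod_mul_distrib]
      refine Finset.prod_eq_one fun e _ => mul_inv_cancel₀ ?_
      have := Q.inv_t_sub_ne_zero (X.pos v).ne_zero (X.pt_ne_pos huv p) e 0
      rwa [pow_zero, mul_one] at this
    have hrest : IsMultiple S (∏ p₂ ∈ Finset.range n, Q.phi u.1 v.1 (X.pt u p : L) (X.pt v (p₂ + 1)))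
        (∏ p₂ ∈ Finset.range n, ∏ e ∈ Q.edges u.1 v.1,
          (X.pos v - Q.tIn L e * Q.qIn L ^ ((p : ℤ) - p₂ - 1) * X.pos u : L)⁻¹) := by
      refine IsMultiple.prod fun p₂ _ => ?_
      rw [hφ]
      exact (IsMultiple.prod fun e _ => hS.edge_inv u v e p p₂).mul_of_mem (hg _)
    obtain ⟨s, hs, hs'⟩ := hrest
    refine ⟨s * _, mul_mem hs (hg 0), ?_⟩
    rw [hs', h0]
    rw [h0] at hcan
    linear_combination (s * (∏ p₂ ∈ Finset.range n, ∏ e ∈ Q.edges u.1 v.1,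
          (X.pt v 0 - Q.tIn L e * Q.qIn L ^ ((p : ℤ) - p₂ - 1) * X.pos u : L)⁻¹) *
      (if u.1 = v.1 then (X.pt u p - X.pt v 0) /
        (X.pt u p * (Q.qIn L)⁻¹ - X.pt v 0) else 1 : L)) * hcan

/-- The possible poles of the universal coefficients. -/
theorem CoeffRing.coef_isMultiple (m : ∀ i, Fin (a i) → ℕ) : IsMultiple S (X.coef m)
    (∏ u : Vars a, ∏ v ∈ Finset.univ.erase u, ∏ e ∈ Q.edges u.1 v.1,
      ∏ p₁ ∈ Finset.range (m u.1 u.2), ∏ p₂ ∈ Finset.range (m v.1 v.2 - 1),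
        (X.pos v - Q.tIn L e * Q.qIn L ^ ((p₁ : ℤ) - p₂ - 1) * X.pos u : L)⁻¹) := by
  have hown : (∏ u : Vars a, ∏ p₂ ∈ Finset.range (m u.1 u.2), ∏ p₁ ∈ Finset.range p₂,
      ((Q.zeta u.1 u.1 (X.pt u p₁ : L) (X.pt u p₂))⁻¹ * Q.loopProdIn L u.1)) ∈ S := by
    refine prod_mem fun u _ => prod_mem fun p₂ _ => prod_mem fun p₁ hp => mul_mem ?_
      (prod_mem fun e _ => S.algebraMap_mem _)
    -- Inside a chain ζ is a complex constant, so these factors have no poles.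
    obtain ⟨n, rfl⟩ := Nat.exists_eq_add_of_lt (Finset.mem_range.1 hp)
    rw [add_assoc, X.pt_add, Q.zeta_mul_pow _ (X.pt u p₁).ne_zero, ← map_inv₀]
    exact S.algebraMap_mem _
  have hy : IsMultiple S (∏ u : Vars a, ∏ p ∈ Finset.range (m u.1 u.2), X.y u p)
      (∏ u : Vars a, ∏ v ∈ Finset.univ.erase u, ∏ p ∈ Finset.range (m u.1 u.2),
        ∏ e ∈ Q.edges u.1 v.1, ((Q.tIn L e)⁻¹ - X.pt u p / X.pos v)) := by
    refine IsMultiple.prod fun u _ => ?_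
    rw [Finset.prod_comm]
    exact IsMultiple.prod fun p _ => hS.y_mem u p
  have h := (hy.mul (IsMultiple.of_mem hown)).mul (IsMultiple.refl (S := S)
    (∏ u : Vars a, ∏ v ∈ Finset.univ.erase u, ∏ p₁ ∈ Finset.range (m u.1 u.2),
      ∏ p₂ ∈ Finset.range (m v.1 v.2), Q.phi u.1 v.1 (X.pt u p₁ : L) (X.pt v p₂)))
  rw [mul_one] at h
  obtain ⟨s, hs, hs'⟩ := h
  obtain ⟨s', h1, h2⟩ := IsMultiple.prod (S := S) (T := Finset.univ)
    fun u _ => IsMultiple.prod (S := S) (T := Finset.univ.erase u) fun v hv =>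
      hS.pair_isMultiple (Finset.ne_of_mem_erase hv).symm (m u.1 u.2) (m v.1 v.2)
  refine ⟨s * s', mul_mem hs h1, ?_⟩
  rw [mul_assoc s s', ← h2, coef, hs']
  simp only [Finset.prod_mul_distrib]

theorem CoeffRing.eval_mem (p : Lau (Vars a)) : Lau.eval X.pos p ∈ S := by
  rw [Lau.eval, AddMonoidAlgebra.lift_apply]
  refine sum_mem fun n _ => S.smul_mem ?_ _
  change ((∏ v, X.pos v ^ n v : Lˣ) : L) ∈ S
  rw [Units.coe_prod]
  refine prod_mem fun v _ => ?_
  rcases Int.eq_nat_or_neg (n v) with ⟨l, h | h⟩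
  · rw [h, zpow_natCast, Units.val_pow_eq_pow_val]
    exact pow_mem (hS.pos_mem v) l
  · rw [h, zpow_neg, zpow_natCast, ← inv_pow, Units.val_pow_eq_pow_val, Units.val_inv_eq_inv_val]
    exact pow_mem (hS.pos_inv_mem v) l

theorem CoeffRing.evalChains_eq {k : I → ℕ} {m : ∀ i, Fin (a i) → ℕ} (hm : m ∈ splittings a k)
    (F : Lau (Vars k)) : evalChains hm X.pt F = Lau.eval X.pos (Q.chainLau hm F) := by
  rw [evalChains, chainLau, Lau.hom_eval]
  refine congrArg (fun y => Lau.eval y F) (funext fun s => Units.ext ?_)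
  refine Eq.trans ?_ (Lau.eval_scaled _ _ _).symm
  rw [X.coe_pt, mul_comm, qIn, ← map_pow, Units.val_pow_eq_pow_val]

theorem CoeffRing.loopConstIn_mem (k : I → ℕ) : Q.loopConstIn L k ∈ S := by
  refine prod_mem fun i _ => prod_mem fun e _ => ?_
  rw [tIn, ← map_zpow₀]
  exact S.algebraMap_mem _

/-- The possible denominator of the coefficient is the value of the product of linear forms that
divides F along the chains, so the two cancel. -/
theorem CoeffRing.coeff_mem (hQ : Q.Admissible) {k : I → ℕ} {m : ∀ i, Fin (a i) → ℕ}
    (hm : m ∈ splittings a k) {F : SymLau k} (hF : F ∈ Q.Wheel k) :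
    Q.loopConstIn L k * X.coef m * evalChains hm X.pt (F : Lau (Vars k)) ∈ S := by
  obtain ⟨R, hR⟩ := Q.prod_lin_dvd_chainLau hm hQ hF
  obtain ⟨s, hs, hs'⟩ := hS.coef_isMultiple m
  rw [hS.evalChains_eq, hR, hs', map_mul]
  simp only [map_prod, Lau.eval_lin, Units.val_mul, Units.val_zpow_eq_zpow_val, map_mul, map_zpow₀]
  set D := ∏ u : Vars a, ∏ v ∈ Finset.univ.erase u, ∏ e ∈ Q.edges u.1 v.1,
      ∏ p₁ ∈ Finset.range (m u.1 u.2), ∏ p₂ ∈ Finset.range (m v.1 v.2 - 1),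
        (X.pos v - Q.tIn L e * Q.qIn L ^ ((p₁ : ℤ) - p₂ - 1) * X.pos u : L) with hD
  -- Every factor is nonzero because the starting points of different chains are not proportional
  -- over ℂ.
  have hD0 : D ≠ 0 := by
    refine Finset.prod_ne_zero_iff.2 fun u _ => Finset.prod_ne_zero_iff.2 fun v hv =>
      Finset.prod_ne_zero_iff.2 fun e _ => Finset.prod_ne_zero_iff.2 fun p₁ _ =>
      Finset.prod_ne_zero_iff.2 fun p₂ _ => sub_ne_zero.2 ?_
    rw [tIn, qIn, ← map_zpow₀, ← map_mul]
    exact X.pos_ne v u (Finset.ne_of_mem_erase hv) _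
  simp only [Finset.prod_inv_distrib]
  rw [← hD]
  have e : Q.loopConstIn L k * (s * D⁻¹) * (D * Lau.eval X.pos R) =
      Q.loopConstIn L k * s * Lau.eval X.pos R := by
    field_simp
  rw [e]
  exact mul_mem (mul_mem (hS.loopConstIn_mem k) hs) (hS.eval_mem R)

/-- Without wheel conditions the poles remain, but all of them are of the form inverted in the
larger localization. -/
theorem CoeffRing.coeff_mem_of_inv_mem (hinv : ∀ u v e, u ≠ v → Q.src e = u.1 → Q.tgt e = v.1 →
    ∀ n : ℤ, (X.pos v - Q.tIn L e * Q.qIn L ^ n * X.pos u : L)⁻¹ ∈ S)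
    {k : I → ℕ} {m : ∀ i, Fin (a i) → ℕ} (hm : m ∈ splittings a k) (F : Lau (Vars k)) :
    Q.loopConstIn L k * X.coef m * evalChains hm X.pt F ∈ S := by
  rw [hS.evalChains_eq]
  refine mul_mem (mul_mem (hS.loopConstIn_mem k) ((hS.coef_isMultiple m).mem ?_)) (hS.eval_mem _)
  refine prod_mem fun u _ => prod_mem fun v hv => prod_mem fun e he => prod_mem fun p₁ _ =>
    prod_mem fun p₂ _ => ?_
  obtain ⟨-, h1, h2⟩ := Finset.mem_filter.1 he
  exact hinv u v e (Finset.ne_of_mem_erase hv).symm h1 h2 _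

end ChainModel

end WeightedQuiver

end

/-! ### Coefficients of difference operators, and models built from factors. -/

noncomputable section

namespace WeightedQuiver

variable {I E : Type*} [Fintype I] [DecidableEq I] [Fintype E] (Q : WeightedQuiver I E)

/-! ### Coefficients of difference operators -/

section Operators

variable {a : I → ℕ}

theorem shift_smul_gen (g : Q.Shift a) (c : Coord a) :
    g • (algebraMap (Lau (Coord a)) (CoeffField a) (Lau.gen c).val) =
      algebraMap ℂ (CoeffField a) (Q.shiftChar a g c : ℂ) *
        algebraMap (Lau (Coord a)) (CoeffField a) (Lau.gen c).val := by
  have h : g • (algebraMap (Lau (Coord a)) (CoeffField a) (Lau.gen c).val) =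
    algebraMap (Lau (Coord a)) (CoeffField a) (Lau.torus (Q.shiftChar a g) (Lau.gen c).val) :=
    IsFractionRing.fieldEquivOfAlgEquiv_algebraMap _ _ _ _ _
  have h2 : Lau.torus (Q.shiftChar a g) (Lau.gen c).val =
      algebraMap ℂ (Lau (Coord a)) (Q.shiftChar a g c : ℂ) * (Lau.gen c).val := Lau.eval_gen _ _
  rw [h, h2, map_mul, ← IsScalarTower.algebraMap_apply]

theorem shift_smul_w (m : Vars a → ℤ) (v : Vars a) :
    Q.dMon m • (w v : CoeffField a) = w v * Q.qIn (CoeffField a) ^ (-m v) := by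
  refine (Q.shift_smul_gen _ _).trans ?_
  rw [mul_comm]
  congr 1
  rw [qIn, ← map_zpow₀]
  congr 1
  exact Units.val_zpow_eq_zpow_val _ _

theorem shift_smul_P (m : Vars a → ℤ) (ε : Bool) (i j : I) :
    Q.dMon m • (P ε i j : CoeffField a) =
      P ε i j * algebraMap ℂ (CoeffField a) (Q.qGamma ε i j : ℂ) ^ (-∑ s, m ⟨j, s⟩) := by
  refine (Q.shift_smul_gen _ _).trans ?_
  rw [mul_comm]
  congr 1
  rw [← map_zpow₀]
  congr 1
  exact Units.val_zpow_eq_zpow_val _ _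

theorem algebraMap_coeffField_injective :
    Function.Injective (algebraMap (Lau (Coord a)) (CoeffField a)) :=
  IsFractionRing.injective _ _

theorem w_ne {u v : Vars a} (huv : u ≠ v) (c : ℂ) :
    (w u : CoeffField a) ≠ algebraMap ℂ (CoeffField a) c * w v := by
  by_cases hc : c = 0
  · rw [hc, map_zero, zero_mul]
    exact (wVar u).ne_zero
  · intro h
    have h1 : algebraMap (Lau (Coord a)) (CoeffField a) (Lau.scaled 1 (Sum.inl u)).val =
        algebraMap (Lau (Coord a)) (CoeffField a) (Lau.scaled (Units.mk0 c hc) (Sum.inl v)).val := by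
      rw [Lau.scaled_one, Lau.coe_scaled, map_mul, ← IsScalarTower.algebraMap_apply]
      exact h
    exact huv (Sum.inl_injective (Lau.scaled_injective (algebraMap_coeffField_injective h1)).1)

/-- The embedding of coefficients. -/
def coeffHom : CoeffField a →ₐ[ℂ] Q.DiffOp a where
  toRingHom := SkewMonoidAlgebra.singleOneRingHom
  commutes' _ := rfl

theorem dOp_mul (c c' : CoeffField a) (m m' : Vars a → ℤ) :
    Q.dOp c m * Q.dOp c' m' = Q.dOp (c * Q.dMon m • c') (m + m') :=
  SkewMonoidAlgebra.single_mul_single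

theorem dMon_zero : Q.dMon (0 : Vars a → ℤ) = 1 := rfl

theorem dMon_add (m m' : Vars a → ℤ) : Q.dMon (m + m') = Q.dMon m * Q.dMon m' := rfl

theorem dOp_sum {ι : Type*} (T : Finset ι) (c : ι → CoeffField a) (m : Vars a → ℤ) :
    Q.dOp (∑ i ∈ T, c i) m = ∑ i ∈ T, Q.dOp (c i) m :=
  map_sum (AddMonoidHom.mk' (fun x : CoeffField a => Q.dOp x m)
    fun x y => SkewMonoidAlgebra.single_add _ x y) c T

theorem dOp_one_mem (m : Vars a → ℤ) : Q.dOp 1 m ∈ Q.ATilde a := by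
  have h0 : ∀ T : Finset (Vars a), Q.dOp 1 (∑ v ∈ T, Pi.single v (m v)) ∈ Q.ATilde a := by
    intro T
    induction T using Finset.induction_on with
    | empty => exact one_mem _
    | insert v T hv ih =>
      rw [Finset.sum_insert hv]
      have h1 : Q.dOp 1 (Pi.single v (m v)) ∈ Q.ATilde a :=
        Algebra.subset_adjoin (Or.inl (Or.inr ⟨v, m v, rfl⟩))
      have := mul_mem h1 ih
      rwa [dOp_mul, smul_one, one_mul] at this
  have := h0 Finset.univ
  rwa [Finset.univ_sum_single] at this

/-- The coefficients of a subalgebra of difference operators. -/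
def coeffRing (A : Subalgebra ℂ (Q.DiffOp a)) : Subalgebra ℂ (CoeffField a) := A.comap Q.coeffHom

theorem mem_coeffRing {A : Subalgebra ℂ (Q.DiffOp a)} {c : CoeffField a} :
    c ∈ Q.coeffRing A ↔ Q.dOp c 0 ∈ A := Iff.rfl

theorem coeffRing_mono {A B : Subalgebra ℂ (Q.DiffOp a)} (h : A ≤ B) :
    Q.coeffRing A ≤ Q.coeffRing B := fun _ hc => h hc

/-- Since c D^m is the product of c and D^m, membership of an operator reduces to membership of its
coefficient. -/
theorem dOp_mem {A : Subalgebra ℂ (Q.DiffOp a)} (hA : Q.ATilde a ≤ A) {c : CoeffField a}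
    (hc : c ∈ Q.coeffRing A) (m : Vars a → ℤ) : Q.dOp c m ∈ A := by
  have := mul_mem (Q.mem_coeffRing.1 hc) (hA (Q.dOp_one_mem m))
  rwa [dOp_mul, smul_one, mul_one, zero_add] at this

theorem ATilde_le_ext : Q.ATilde a ≤ Q.ATildeExt a := le_sup_left

theorem w_zpow_mem (v : Vars a) (n : ℤ) : (w v : CoeffField a) ^ n ∈ Q.coeffRing (Q.ATilde a) := by
  rw [mem_coeffRing, ← Units.val_zpow_eq_zpow_val]
  exact Algebra.subset_adjoin (Or.inl (Or.inl (Or.inl ⟨v, n, rfl⟩)))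

theorem w_mem (v : Vars a) : (w v : CoeffField a) ∈ Q.coeffRing (Q.ATilde a) := by
  simpa using Q.w_zpow_mem v 1

theorem w_inv_mem (v : Vars a) : (w v : CoeffField a)⁻¹ ∈ Q.coeffRing (Q.ATilde a) := by
  simpa using Q.w_zpow_mem v (-1)

theorem P_zpow_mem (ε : Bool) (i j : I) (n : ℤ) :
    (P ε i j : CoeffField a) ^ n ∈ Q.coeffRing (Q.ATilde a) := by
  rw [mem_coeffRing, ← Units.val_zpow_eq_zpow_val]
  exact Algebra.subset_adjoin (Or.inl (Or.inl (Or.inr ⟨ε, i, j, n, rfl⟩)))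

theorem P_mem (ε : Bool) (i j : I) : (P ε i j : CoeffField a) ∈ Q.coeffRing (Q.ATilde a) := by
  simpa using Q.P_zpow_mem ε i j 1

theorem P_inv_mem (ε : Bool) (i j : I) : (P ε i j : CoeffField a)⁻¹ ∈ Q.coeffRing (Q.ATilde a) := by
  simpa using Q.P_zpow_mem ε i j (-1)

theorem inv_sub_mem {u v : Vars a} (huv : u ≠ v) (h : u.1 = v.1) (n : ℤ) :
    (w u - Q.qIn (CoeffField a) ^ n * w v : CoeffField a)⁻¹ ∈ Q.coeffRing (Q.ATilde a) := by
  obtain ⟨i, r⟩ := u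
  obtain ⟨j, s⟩ := v
  obtain rfl : i = j := h
  exact Algebra.subset_adjoin (Or.inr ⟨i, r, s, n, fun h => huv (by rw [h]), rfl⟩)

theorem inv_sub_mem_ext {u v : Vars a} (huv : u ≠ v) {e : E} (hs : Q.src e = u.1)
    (ht : Q.tgt e = v.1) (n : ℤ) :
    (w v - Q.tIn (CoeffField a) e * Q.qIn (CoeffField a) ^ n * w u : CoeffField a)⁻¹ ∈
      Q.coeffRing (Q.ATildeExt a) :=
  (le_sup_right : _ ≤ Q.ATildeExt a) (Algebra.subset_adjoin ⟨u, v, e, n, huv, hs, ht, rfl⟩)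

end Operators

/-! ### Models from factorizations of the `Y`-factors -/

section Factor

variable {L : Type*} [Field L] [Algebra ℂ L]

/-- The contribution of a point `w` of colour `j` to the factor `Y(z)` of colour `i`. -/
def edgeFactor (i j : I) (z w : L) : L :=
  (∏ e ∈ Q.edges i j, ((Q.tIn L e)⁻¹ - z / w)) / if i = j then 1 - z / w else 1

/-- Moving w to w q^n multiplies the factor by the inverse of `chainRatio`, up to the power of ∏ t_e
that the ratio contains when i ≠ j. In a model this power is absorbed by the shift of the formal
powers. -/
theorem edgeFactor_eq (i j : I) (n : ℕ) {z w : L} (hw : w ≠ 0)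
    (h : ∀ c : ℂ, z ≠ algebraMap ℂ L c * w) :
    Q.edgeFactor i j z w = (if i = j then 1 else (∏ e ∈ Q.edges i j, Q.tIn L e) ^ n) *
      Q.edgeFactor i j z (w * Q.qIn L ^ n) * Q.chainRatio j i n w z := by
  have h1 := fun e => Q.inv_t_sub_ne_zero hw h e n
  have h2 := Q.one_sub_ne_zero_of_generic hw h n
  have hp : ∏ e ∈ Q.edges i j, Q.tIn L e ≠ 0 := Finset.prod_ne_zero_iff.2 fun e _ => Q.tIn_ne_zero e
  have hE : (∏ e ∈ Q.edges i j, ((Q.tIn L e)⁻¹ - z / w)) =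
      (∏ e ∈ Q.edges i j, ((Q.tIn L e)⁻¹ - z / (w * Q.qIn L ^ n))) *
      ∏ e ∈ Q.edges i j, (((Q.tIn L e)⁻¹ - z / w) / ((Q.tIn L e)⁻¹ - z / (w * Q.qIn L ^ n))) := by
    rw [← Finset.prod_mul_distrib]
    exact Finset.prod_congr rfl fun e _ => (mul_div_cancel₀ _ (h1 e)).symm
  rw [edgeFactor, edgeFactor, chainRatio, hE]
  clear hE
  generalize (∏ e ∈ Q.edges i j, ((Q.tIn L e)⁻¹ - z / (w * Q.qIn L ^ n)) : L) = X
  generalize (∏ e ∈ Q.edges i j,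
    (((Q.tIn L e)⁻¹ - z / w) / ((Q.tIn L e)⁻¹ - z / (w * Q.qIn L ^ n))) : L) = Y
  by_cases hij : i = j
  · simp only [hij, if_true]
    generalize (1 - z / (w * Q.qIn L ^ n) : L) = A at *
    generalize (1 - z / w : L) = A'
    field_simp
  · simp only [hij, Ne.symm hij, if_false, inv_pow, div_one]
    linear_combination (-X * Y) * mul_inv_cancel₀ (pow_ne_zero n hp)

theorem map_edgeFactor {M : Type*} [Field M] [Algebra ℂ M] (f : L →ₐ[ℂ] M) (i j : I) (z w : L) :
    f (Q.edgeFactor i j z w) = Q.edgeFactor i j (f z) (f w) := by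
  unfold edgeFactor
  split_ifs <;> simp only [map_div₀, map_prod, map_sub, map_inv₀, map_tIn, map_one]

end Factor

variable {Q} in
/-- A model all of whose factors `Y` are given by products over the other chains. -/
def ChainModel.ofFactors {a : I → ℕ} {L G : Type*} [Field L] [Algebra ℂ L]
    [CommGroup G] [MulSemiringAction G L] [SMulCommClass G ℂ L]
    (shift : (∀ i, Fin (a i) → ℕ) → G) (shift_zero : shift 0 = 1)
    (shift_add : ∀ m m', shift (m + m') = shift m * shift m') (pos : Vars a → Lˣ)
    (smul_pos : ∀ m v, shift m • (pos v : L) = pos v * Q.qIn L ^ m v.1 v.2)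
    (pos_ne : ∀ u v, u ≠ v → ∀ c : ℂ, (pos u : L) ≠ algebraMap ℂ L c * pos v)
    (C : Vars a → L) (smul_C : ∀ m v, shift m • C v = C v * ∏ u ∈ Finset.univ.erase v,
      if v.1 = u.1 then 1 else (∏ e ∈ Q.edges v.1 u.1, Q.tIn L e) ^ m u.1 u.2)
    (B : Vars a → L → L) (smul_B : ∀ m v z, shift m • B v z = B v (shift m • z)) :
    Q.ChainModel a L G where
  shift := shift
  shift_zero := shift_zero
  shift_add := shift_add
  pos := pos
  smul_pos := smul_pos
  pos_ne := pos_ne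
  y v p := C v * B v (pos v * Q.qIn L ^ p) * ∏ u ∈ Finset.univ.erase v,
    Q.edgeFactor v.1 u.1 (pos v * Q.qIn L ^ p) (pos u)
  y_shift m v p := by
    have hq : ∀ x : L, shift m • x = MulSemiringAction.toAlgHom ℂ L (shift m) x := fun _ => rfl
    have hpt : shift m • (pos v * Q.qIn L ^ p : L) = pos v * Q.qIn L ^ (m v.1 v.2 + p) := by
      rw [hq, map_mul, map_pow, Q.map_qIn, ← hq, smul_pos, mul_assoc, pow_add]
    have h1 : shift m • (C v * B v (pos v * Q.qIn L ^ p) * ∏ u ∈ Finset.univ.erase v,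
        Q.edgeFactor v.1 u.1 (pos v * Q.qIn L ^ p) (pos u)) =
        (C v * ∏ u ∈ Finset.univ.erase v,
          if v.1 = u.1 then 1 else (∏ e ∈ Q.edges v.1 u.1, Q.tIn L e) ^ m u.1 u.2) *
        B v (pos v * Q.qIn L ^ (m v.1 v.2 + p)) * ∏ u ∈ Finset.univ.erase v,
        Q.edgeFactor v.1 u.1 (pos v * Q.qIn L ^ (m v.1 v.2 + p)) (pos u * Q.qIn L ^ m u.1 u.2) := by
      rw [hq, map_mul, map_mul, map_prod, ← hq, ← hq, smul_C, smul_B, hpt]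
      congr 1
      refine Finset.prod_congr rfl fun u _ => ?_
      rw [map_edgeFactor, ← hq, ← hq, hpt, smul_pos]
    rw [h1]
    have h2 : ∏ u ∈ Finset.univ.erase v,
        Q.edgeFactor v.1 u.1 (pos v * Q.qIn L ^ (m v.1 v.2 + p)) (pos u : L) =
        ∏ u ∈ Finset.univ.erase v, ((if v.1 = u.1 then 1 else
          (∏ e ∈ Q.edges v.1 u.1, Q.tIn L e) ^ m u.1 u.2) *
          Q.edgeFactor v.1 u.1 (pos v * Q.qIn L ^ (m v.1 v.2 + p)) (pos u * Q.qIn L ^ m u.1 u.2) *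
          Q.chainRatio u.1 v.1 (m u.1 u.2) (pos u : L) (pos v * Q.qIn L ^ (m v.1 v.2 + p))) := by
      refine Finset.prod_congr rfl fun u hu => ?_
      apply Q.edgeFactor_eq _ _ _ (pos u).ne_zero
      intro c hc
      apply pos_ne v u (Finset.ne_of_mem_erase hu).symm (c / Q.q ^ (m v.1 v.2 + p))
      rw [map_div₀, map_pow, div_mul_eq_mul_div, ← hc, mul_div_assoc, div_self, mul_one]
      exact pow_ne_zero _ Q.qIn_ne_zero
    rw [h2, Finset.prod_mul_distrib, Finset.prod_mul_distrib]
    ring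

theorem prod_erase_sigma {a : I → ℕ} {M : Type*} [CommMonoid M] (v : Vars a) (f : Vars a → M) :
    ∏ u ∈ Finset.univ.erase v, f u = (∏ j ∈ Finset.univ.erase v.1, ∏ s : Fin (a j), f ⟨j, s⟩) *
      ∏ s ∈ Finset.univ.erase v.2, f ⟨v.1, s⟩ := by
  obtain ⟨i, r⟩ := v
  have h : (Finset.univ.erase (⟨i, r⟩ : Vars a)) =
      (((Finset.univ.erase i).sigma fun j => (Finset.univ : Finset (Fin (a j))))).disjUnion
        ((Finset.univ.erase r).map (Function.Embedding.sigmaMk (β := fun i => Fin (a i)) i)) (by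
      rw [Finset.disjoint_left]
      intro x hx hx'
      obtain ⟨s, -, rfl⟩ := Finset.mem_map.1 hx'
      simp at hx) := by
    ext ⟨j, s⟩
    simp only [Finset.mem_erase, Finset.mem_univ, and_true, Finset.mem_disjUnion, Finset.mem_sigma,
      Finset.mem_map, Function.Embedding.sigmaMk_apply]
    constructor
    · intro h
      by_cases hj : j = i
      · subst hj
        exact Or.inr ⟨s, fun h' => h (by rw [h']), rfl⟩
      · exact Or.inl hj
    · rintro (h | ⟨s', h, h'⟩) h0
      · exact h (congrArg Sigma.fst h0)
      · rw [← h'] at h0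
        exact h (by simpa using h0)
  rw [h, Finset.prod_disjUnion, Finset.prod_sigma, Finset.prod_map]
  rfl

theorem prod_if_ne_pow {a : I → ℕ} {M : Type*} [CommMonoid M] (v : Vars a) (f : I → M)
    (m : ∀ i, Fin (a i) → ℕ) :
    (∏ u ∈ Finset.univ.erase v, if v.1 = u.1 then 1 else f u.1 ^ m u.1 u.2) =
      ∏ j ∈ Finset.univ.erase v.1, f j ^ ∑ s, m j s := by
  rw [prod_erase_sigma]
  simp only [if_true, Finset.prod_const_one, mul_one]
  refine Finset.prod_congr rfl fun j hj => ?_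
  simp only [if_neg (Finset.ne_of_mem_erase hj).symm]
  exact Finset.prod_pow_eq_pow_sum _ _ _

end WeightedQuiver

end

/-! ### The positive model for Q and the negative model for the reversed quiver. -/

noncomputable section

namespace WeightedQuiver

variable {I E : Type*} [Fintype I] [DecidableEq I] [Fintype E] (Q : WeightedQuiver I E)

/-- The only denominators are the 1 - z/w for points of equal colour, and these are units times w_u
- q^n w_v, which is invertible in S. -/
theorem ChainModel.coeffRing_ofFactors {a : I → ℕ} {L G : Type*} [Field L] [Algebra ℂ L]
    [CommGroup G] [MulSemiringAction G L] [SMulCommClass G ℂ L]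
    {shift : (∀ i, Fin (a i) → ℕ) → G} {shift_zero shift_add} {pos : Vars a → Lˣ}
    {smul_pos pos_ne} {C : Vars a → L} {smul_C} {B : Vars a → L → L} {smul_B} {S : Subalgebra ℂ L}
    (h1 : ∀ u, (pos u : L) ∈ S) (h2 : ∀ u, (pos u : L)⁻¹ ∈ S)
    (h3 : ∀ u v, u ≠ v → u.1 = v.1 → ∀ n : ℤ, (pos u - Q.qIn L ^ n * pos v : L)⁻¹ ∈ S)
    (h4 : ∀ u, C u ∈ S) (h5 : ∀ u p, B u (pos u * Q.qIn L ^ p) ∈ S) :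
    (ChainModel.ofFactors (Q := Q) (G := G) shift shift_zero shift_add pos smul_pos pos_ne C smul_C B
      smul_B).CoeffRing S where
  pos_mem := h1
  pos_inv_mem := h2
  inv_sub_mem := h3
  y_mem u p := by
    refine IsMultiple.mul_of_mem (IsMultiple.prod fun v hv => ?_) (mul_mem (h4 u) (h5 u p))
    rw [edgeFactor, div_eq_inv_mul, ChainModel.coe_pt]
    refine IsMultiple.mul_of_mem (IsMultiple.refl _) ?_
    split_ifs with h
    · have e : (1 - (pos u : L) * Q.qIn L ^ p / pos v)⁻¹ =
          -(pos v : L) * Q.qIn L ^ (-(p : ℤ)) * (pos u - Q.qIn L ^ (-(p : ℤ)) * pos v)⁻¹ := by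
        have hv := (pos v).ne_zero
        have hq := Q.qIn_ne_zero (L := L)
        rw [← inv_inv (-(pos v : L) * _), ← mul_inv, zpow_neg, zpow_natCast]
        congr 1
        field_simp
        ring
      rw [e]
      exact mul_mem (mul_mem (neg_mem (h1 v)) (qIn_zpow_mem S _))
        (h3 u v (Finset.ne_of_mem_erase hv).symm h _)
    · rw [inv_one]
      exact one_mem S

variable (d : GKLOData I)

/-! ### The positive half -/

theorem map_zFun {L M : Type*} [Field L] [Algebra ℂ L] [Field M] [Algebra ℂ M] (f : L →ₐ[ℂ] M)
    (i : I) (z : L) : f (zFun d i z) = zFun d i (f z) := by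
  simp only [zFun, map_prod, map_sub, map_one, map_div₀, AlgHom.commutes]

/-- The chain model of the positive half. -/
def posModel : Q.ChainModel d.a (CoeffField d.a) (Q.Shift d.a) :=
  ChainModel.ofFactors (fun m => Q.dMon fun v => -(m v.1 v.2 : ℤ))
    (by simp only [Pi.zero_apply, Nat.cast_zero, neg_zero]; rfl)
    (fun m m' => by
      rw [← dMon_add]
      congr 1
      funext v
      simp only [Pi.add_apply, Nat.cast_add, neg_add])
    wVar
    (fun m v => by rw [shift_smul_w, neg_neg, zpow_natCast])
    (fun u v huv c => w_ne huv c)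
    (fun v => ∏ j ∈ Finset.univ.erase v.1, P true v.1 j)
    (fun m v => by
      rw [prod_if_ne_pow v (fun j => ∏ e ∈ Q.edges v.1 j, Q.tIn (CoeffField d.a) e) m,
        ← MulSemiringAction.toAlgHom_apply ℂ, map_prod, ← Finset.prod_mul_distrib]
      refine Finset.prod_congr rfl fun j _ => ?_
      rw [MulSemiringAction.toAlgHom_apply, shift_smul_P, qGamma, if_pos rfl, Finset.sum_neg_distrib,
        neg_neg, Units.coe_prod, map_prod, ← Nat.cast_sum, zpow_natCast])
    (fun v z => zFun d v.1 z)
    (fun m v z => map_zFun d (MulSemiringAction.toAlgHom ℂ (CoeffField d.a)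
      (Q.dMon fun v => -(m v.1 v.2 : ℤ))) v.1 z)

theorem posModel_pt (v : Vars d.a) (p : ℕ) : (Q.posModel d).pt v p = Q.ptPos v p := rfl

/-- Y is rewritten as a product over all other points, so that a shift of a single point affects a
single factor. -/
theorem YPos_eq (v : Vars d.a) (z : CoeffField d.a) : Q.YPos d v z =
    (∏ j ∈ Finset.univ.erase v.1, P true v.1 j) * zFun d v.1 z * ∏ u ∈ Finset.univ.erase v,
      Q.edgeFactor v.1 u.1 z (w u) := by
  rw [prod_erase_sigma, YPos]
  have h1 : ∏ j ∈ Finset.univ.erase v.1, ∏ s : Fin (d.a j), Q.edgeFactor v.1 j z (w ⟨j, s⟩) =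
      ∏ j ∈ Finset.univ.erase v.1, ∏ s : Fin (d.a j), ∏ e ∈ Q.edges v.1 j,
        ((Q.tIn (CoeffField d.a) e)⁻¹ - z / w ⟨j, s⟩) := by
    refine Finset.prod_congr rfl fun j hj => Finset.prod_congr rfl fun s _ => ?_
    rw [edgeFactor, if_neg (Finset.ne_of_mem_erase hj).symm, div_one]
  have h2 : ∏ s ∈ Finset.univ.erase v.2, Q.edgeFactor v.1 v.1 z (w ⟨v.1, s⟩) =
      (∏ s ∈ Finset.univ.erase v.2, ∏ e ∈ Q.edges v.1 v.1,
        ((Q.tIn (CoeffField d.a) e)⁻¹ - z / w ⟨v.1, s⟩)) /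
        ∏ s ∈ Finset.univ.erase v.2, (1 - z / w ⟨v.1, s⟩) := by
    rw [← Finset.prod_div_distrib]
    refine Finset.prod_congr rfl fun s _ => ?_
    rw [edgeFactor, if_pos rfl]
  rw [h1, h2]
  ring

theorem posModel_y (v : Vars d.a) (p : ℕ) : (Q.posModel d).y v p = Q.YPos d v (Q.ptPos v p) := by
  rw [YPos_eq, ← posModel_pt, ChainModel.coe_pt]
  rfl

theorem posModel_image (k : I → ℕ) (F : SymLau k) : (Q.posModel d).image k F = Q.imagePos d k F := by
  rw [ChainModel.image_apply, imagePos]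
  refine Finset.sum_congr rfl fun m _ => ?_
  refine congrArg (fun c => Q.dOp c fun v => -(m.1 v.1 v.2 : ℤ)) ?_
  have h1 : evalChains m.2 (Q.posModel d).pt (F : Lau (Vars k)) =
    evalAt m.1 m.2 Q.ptPos (F : Lau (Vars k)) := rfl
  have h2 : Q.loopConstIn (CoeffField d.a) k = Q.loopConst d k := rfl
  rw [h1, h2, ChainModel.coef]
  simp only [posModel_y, posModel_pt, loopProdIn, loopProd]
  simp only [← Fintype.prod_sigma']
  ring

theorem zFun_mem {L : Type*} [Field L] [Algebra ℂ L] {S : Subalgebra ℂ L} (i : I) {z : L}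
    (hz : z⁻¹ ∈ S) : zFun d i z ∈ S := by
  refine prod_mem fun r _ => sub_mem (one_mem S) ?_
  rw [div_eq_mul_inv]
  exact mul_mem (S.algebraMap_mem _) hz

theorem w_mul_inv_mem (v : Vars d.a) (p : ℕ) :
    (w v * Q.qIn (CoeffField d.a) ^ p)⁻¹ ∈ Q.coeffRing (Q.ATilde d.a) := by
  rw [mul_inv, ← zpow_natCast, ← zpow_neg]
  exact mul_mem (Q.w_inv_mem v) (qIn_zpow_mem _ _)

theorem posModel_coeffRing {A : Subalgebra ℂ (Q.DiffOp d.a)} (hA : Q.ATilde d.a ≤ A) :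
    (Q.posModel d).CoeffRing (Q.coeffRing A) :=
  ChainModel.coeffRing_ofFactors Q (fun u => Q.coeffRing_mono hA (Q.w_mem u))
    (fun u => Q.coeffRing_mono hA (Q.w_inv_mem u))
    (fun _ _ huv h n => Q.coeffRing_mono hA (Q.inv_sub_mem huv h n))
    (fun _ => prod_mem fun _ _ => Q.coeffRing_mono hA (Q.P_mem _ _ _))
    (fun u p => zFun_mem d _ (Q.coeffRing_mono hA (Q.w_mul_inv_mem d u p)))

theorem imagePos_mem_ext (k : I → ℕ) (F : SymLau k) : Q.imagePos d k F ∈ Q.ATildeExt d.a := by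
  rw [← posModel_image, ChainModel.image_apply]
  refine sum_mem fun m _ => Q.dOp_mem Q.ATilde_le_ext
    ((Q.posModel_coeffRing d Q.ATilde_le_ext).coeff_mem_of_inv_mem ?_ m.2 _) _
  exact fun u v e huv hs ht n => Q.inv_sub_mem_ext huv hs ht n

theorem imagePos_mem (hQ : Q.Admissible) {k : I → ℕ} {F : SymLau k} (hF : F ∈ Q.Wheel k) :
    Q.imagePos d k F ∈ Q.ATilde d.a := by
  rw [← posModel_image, ChainModel.image_apply]
  exact sum_mem fun m _ => Q.dOp_mem le_rfl ((Q.posModel_coeffRing d le_rfl).coeff_mem hQ m.2 hF) _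

/-! ### The negative half -/

/-- The chain model of the negative half. -/
def negModel : Q.rev.ChainModel d.a (CoeffField d.a) (Q.Shift d.a) :=
  ChainModel.ofFactors (fun m => Q.dMon fun v => (m v.1 v.2 : ℤ))
    (by simp only [Pi.zero_apply, Nat.cast_zero]; rfl)
    (fun m m' => by
      rw [← dMon_add]
      exact congrArg Q.dMon (funext fun v => Nat.cast_add _ _))
    -- The starting point is q/w. The operator D multiplies it by q, as a model requires, and (q/w)
    -- q^p is the inverse of w q^{-p-1}.
    (fun v => Units.map (algebraMap ℂ (CoeffField d.a) : ℂ →* CoeffField d.a) Q.q * (wVar v)⁻¹)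
    (fun m v => by
      have hw := Q.shift_smul_w (fun v => (m v.1 v.2 : ℤ)) v
      rw [← MulSemiringAction.toAlgHom_apply ℂ] at hw ⊢
      rw [Units.val_mul, map_mul, Units.val_inv_eq_inv_val, map_inv₀, hw, mul_inv, ← zpow_neg,
        neg_neg, zpow_natCast, ← mul_assoc]
      exact congrArg (fun x => x * _ * _) (AlgHom.commutes _ _))
    (fun u v huv c h => by
      have hq : Q.qIn (CoeffField d.a) ≠ 0 := Q.qIn_ne_zero
      refine w_ne huv.symm c ?_
      simp only [Units.val_mul, Units.val_inv_eq_inv_val, Units.coe_map, MonoidHom.coe_coe] at h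
      rw [mul_left_comm, ← div_eq_mul_inv, ← div_eq_mul_inv, mul_div_assoc'] at h
      rw [div_eq_div_iff (wVar u).ne_zero (wVar v).ne_zero, mul_assoc] at h
      exact mul_left_cancel₀ hq h)
    (fun v => ∏ j ∈ Finset.univ.erase v.1, P false v.1 j)
    (fun m v => by
      rw [prod_if_ne_pow v (fun j => ∏ e ∈ Q.rev.edges v.1 j, Q.rev.tIn (CoeffField d.a) e) m,
        ← MulSemiringAction.toAlgHom_apply ℂ, map_prod, ← Finset.prod_mul_distrib]
      refine Finset.prod_congr rfl fun j _ => ?_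
      rw [MulSemiringAction.toAlgHom_apply, shift_smul_P, qGamma, if_neg (by simp),
        Units.val_inv_eq_inv_val, map_inv₀, inv_zpow', neg_neg, Units.coe_prod, map_prod,
        ← Nat.cast_sum, zpow_natCast, rev_edges]
      rfl)
    -- These constants come from extracting t_e in 1 - w t_e/(zq) = t_e (1/t_e - z⁻¹/(q/w)).
    (fun v _ => ∏ u ∈ Finset.univ.erase v, ∏ e ∈ Q.edges u.1 v.1, Q.tIn (CoeffField d.a) e)
    (fun m v _ => by
      rw [← MulSemiringAction.toAlgHom_apply ℂ]
      simp only [map_prod, map_tIn])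

theorem negModel_pt (v : Vars d.a) (p : ℕ) : (Q.negModel d).pt v p = (Q.ptNeg v p)⁻¹ := by
  rw [ptNeg, mul_inv_rev, inv_inv, pow_succ, mul_assoc]
  rw [ChainModel.pt, mul_comm]
  rfl

theorem negModel_pos (v : Vars d.a) :
    ((Q.negModel d).pos v : CoeffField d.a) = Q.qIn (CoeffField d.a) / w v := by
  rw [div_eq_mul_inv]
  exact (Units.val_mul _ _).trans (by rw [Units.val_inv_eq_inv_val]; rfl)

/-- In terms of z⁻¹ and q/w, the factors of Y' are those of Y for the reversed quiver, up to the
constants t_e. -/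
theorem YNeg_eq (v : Vars d.a) (z : CoeffField d.a) : Q.YNeg d v z⁻¹ =
    (∏ j ∈ Finset.univ.erase v.1, P false v.1 j) *
      (∏ u ∈ Finset.univ.erase v, ∏ e ∈ Q.edges u.1 v.1, Q.tIn (CoeffField d.a) e) *
      ∏ u ∈ Finset.univ.erase v,
        Q.rev.edgeFactor v.1 u.1 z (Q.qIn (CoeffField d.a) / w u) := by
  have hq : Q.qIn (CoeffField d.a) ≠ 0 := Q.qIn_ne_zero
  have key : ∀ (u : Vars d.a) (e : E), Q.tIn (CoeffField d.a) e *
      ((Q.tIn (CoeffField d.a) e)⁻¹ - z / (Q.qIn (CoeffField d.a) / w u)) =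
      1 - w u * Q.tIn (CoeffField d.a) e / (z⁻¹ * Q.qIn (CoeffField d.a)) := by
    intro u e
    have ht := Q.tIn_ne_zero (L := CoeffField d.a) e
    have hw := (wVar u).ne_zero
    field_simp
  have key2 : ∀ u : Vars d.a, 1 - z / (Q.qIn (CoeffField d.a) / w u) =
      1 - w u / (z⁻¹ * Q.qIn (CoeffField d.a)) := by
    intro u
    have hw := (wVar u).ne_zero
    field_simp
  have h0 : ∀ u : Vars d.a, (∏ e ∈ Q.edges u.1 v.1, Q.tIn (CoeffField d.a) e) *
      Q.rev.edgeFactor v.1 u.1 z (Q.qIn (CoeffField d.a) / w u) =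
      (∏ e ∈ Q.edges u.1 v.1,
        (1 - w u * Q.tIn (CoeffField d.a) e / (z⁻¹ * Q.qIn (CoeffField d.a)))) /
        if v.1 = u.1 then 1 - w u / (z⁻¹ * Q.qIn (CoeffField d.a)) else 1 := by
    intro u
    rw [edgeFactor, key2, rev_edges, ← mul_div_assoc, ← Finset.prod_mul_distrib]
    congr 1
    exact Finset.prod_congr rfl fun e _ => key u e
  rw [mul_assoc, ← Finset.prod_mul_distrib, Finset.prod_congr rfl fun u _ => h0 u,
    prod_erase_sigma, YNeg]
  have h1 : ∏ j ∈ Finset.univ.erase v.1, ∏ s : Fin (d.a j), ((∏ e ∈ Q.edges j v.1,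
        (1 - w ⟨j, s⟩ * Q.tIn (CoeffField d.a) e / (z⁻¹ * Q.qIn (CoeffField d.a)))) /
        if v.1 = j then 1 - w ⟨j, s⟩ / (z⁻¹ * Q.qIn (CoeffField d.a)) else 1) =
      ∏ j ∈ Finset.univ.erase v.1, ∏ s : Fin (d.a j), ∏ e ∈ Q.edges j v.1,
        (1 - w ⟨j, s⟩ * Q.tIn (CoeffField d.a) e / (z⁻¹ * Q.qIn (CoeffField d.a))) := by
    refine Finset.prod_congr rfl fun j hj => Finset.prod_congr rfl fun s _ => ?_
    rw [if_neg (Finset.ne_of_mem_erase hj).symm, div_one]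
  rw [h1]
  simp only [if_true, Finset.prod_div_distrib]
  ring

theorem negModel_y (v : Vars d.a) (p : ℕ) : (Q.negModel d).y v p = Q.YNeg d v (Q.ptNeg v p) := by
  have h : (Q.ptNeg v p : CoeffField d.a) = ((Q.negModel d).pt v p : CoeffField d.a)⁻¹ := by
    rw [negModel_pt, ← Units.val_inv_eq_inv_val, inv_inv]
  rw [h, YNeg_eq, ChainModel.coe_pt]
  simp only [← negModel_pos]
  rfl

end WeightedQuiver

namespace Lau

variable {σ : Type*} [Fintype σ] [DecidableEq σ]

/-- The inversion of all variables. -/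
def invert : Lau σ →ₐ[ℂ] Lau σ := eval fun v => (gen v)⁻¹

theorem invert_gen (v : σ) : invert (gen v).val = ((gen v)⁻¹ : (Lau σ)ˣ) := eval_gen _ _

theorem eval_invert {R : Type*} [CommRing R] [Algebra ℂ R] (y : σ → Rˣ) (F : Lau σ) :
    eval y (invert F) = eval (fun v => (y v)⁻¹) F := by
  rw [invert, hom_eval]
  refine congrArg (fun z => eval z F) (funext fun v => Units.ext ?_)
  exact eval_gen_inv y v

end Lau

namespace WeightedQuiver

variable {I E : Type*} [Fintype I] [DecidableEq I] [Fintype E] (Q : WeightedQuiver I E)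

theorem invert_mem {k : I → ℕ} {F : Lau (Vars k)} (hF : F ∈ SymLau k) : Lau.invert F ∈ SymLau k := by
  intro π
  refine Eq.trans ?_ (congrArg Lau.invert (hF π))
  rw [Lau.eval_invert, Lau.hom_eval (Lau.invert (σ := Vars k))]
  refine congrArg (fun z : Vars k → (Lau (Vars k))ˣ => Lau.eval z F)
    (funext fun v => Units.ext ?_)
  exact (Lau.invert_gen _).symm

/-- The inversion of all variables in symmetric Laurent polynomials. -/
def symInvert (k : I → ℕ) : SymLau k →ₗ[ℂ] SymLau k :=
  (Lau.invert.toLinearMap.restrict fun _ hF => invert_mem hF)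

theorem coe_symInvert {k : I → ℕ} (F : SymLau k) :
    (symInvert k F : Lau (Vars k)) = Lau.invert (F : Lau (Vars k)) := rfl

theorem toConf_invert {k : I → ℕ} {F : Lau (Vars k)} (hF : F ∈ SymLau k) (S : Finset (I × ℂˣ)) :
    Q.rev.toConf k (Lau.invert F) S = Q.toConf k F (S.image fun p => (p.1, p.2⁻¹)) := by
  have hι : ∀ x : Vars k → ℂˣ, (conf x).image (fun p => (p.1, p.2⁻¹)) = conf fun v => (x v)⁻¹ := by
    intro x
    rw [conf, Finset.image_image]
    rfl
  by_cases h : ∃ x : Vars k → ℂˣ, Separated x ∧ conf x = S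
  · obtain ⟨x, hx, rfl⟩ := h
    have hx' : Separated fun v => (x v)⁻¹ := fun i => inv_injective.comp (hx i)
    rw [Q.rev.toConf_conf (invert_mem hF) hx, hι, Q.toConf_conf hF hx', Lau.eval_invert]
  · rw [Q.rev.toConf_of_not _ h, Q.toConf_of_not]
    rintro ⟨y, hy, hyS⟩
    refine h ⟨fun v => (y v)⁻¹, fun i => inv_injective.comp (hy i), ?_⟩
    rw [← hι, hyS, Finset.image_image]
    have : ((fun p : I × ℂˣ => (p.1, p.2⁻¹)) ∘ fun p => (p.1, p.2⁻¹)) = id :=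
      funext fun p => Prod.ext rfl (inv_inv _)
    rw [this, Finset.image_id]

theorem zetaProd_invert (A B : Finset (I × ℂˣ)) :
    ConfFun.zetaProd Q.rev B A = ConfFun.zetaProd Q (A.image fun p => (p.1, p.2⁻¹))
      (B.image fun p => (p.1, p.2⁻¹)) := by
  have hinj : Function.Injective fun p : I × ℂˣ => (p.1, p.2⁻¹) := by
    rintro ⟨i, x⟩ ⟨j, y⟩ h
    simpa using h
  rw [ConfFun.zetaProd, ConfFun.zetaProd, Finset.prod_image hinj.injOn, Finset.prod_comm]
  refine Finset.prod_congr rfl fun a _ => ?_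
  rw [Finset.prod_image hinj.injOn]
  refine Finset.prod_congr rfl fun b _ => ?_
  rw [rev_zeta, Units.val_inv_eq_inv_val, Units.val_inv_eq_inv_val,
    Q.zeta_inv_inv _ _ a.2.ne_zero b.2.ne_zero]

/-- Inversion of the points and reversal of the edges exchange the two arguments of ζ
(`zetaProd_invert`). Passing to complementary subsets therefore reverses the order of the factors.
-/
theorem toConf_mul_invert {k l n : I → ℕ} (F : SymLau k) (G : SymLau l) (H : SymLau n)
    (h : Q.toConf k F * Q.toConf l G = Q.toConf n H) :
    Q.rev.toConf l (symInvert l G) * Q.rev.toConf k (symInvert k F) =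
      Q.rev.toConf n (symInvert n H) := by
  have hinj : Function.Injective fun p : I × ℂˣ => (p.1, p.2⁻¹) := by
    rintro ⟨i, x⟩ ⟨j, y⟩ h
    simpa using h
  ext S
  rw [coe_symInvert, coe_symInvert, coe_symInvert, Q.toConf_invert H.2, ← h, ConfFun.mul_apply,
    ConfFun.mul_apply, Finset.powerset_image, Finset.sum_image (Finset.image_injective hinj).injOn]
  refine Finset.sum_bij' (fun A _ => S \ A) (fun A _ => S \ A) ?_ ?_ ?_ ?_ ?_
  · intro A _
    simp
  · intro A _
    simp
  · intro A hA
    simp [Finset.inter_eq_right.2 (Finset.mem_powerset.1 hA)]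
  · intro A hA
    simp [Finset.inter_eq_right.2 (Finset.mem_powerset.1 hA)]
  · intro A hA
    rw [Q.toConf_invert F.2, Q.toConf_invert G.2, Q.zetaProd_invert, ← Finset.image_sdiff _ _ hinj,
      Finset.sdiff_sdiff_eq_self (Finset.mem_powerset.1 hA)]
    ring

/-- Inversion turns x_v = q x_u into the relation with u and v exchanged, and the form with
coefficient q/γ at v into a unit times x_w - γ x_u. The multiplicities agree by `doubleMult_div`. -/
theorem symInvert_mem_wheel {k : I → ℕ} {F : SymLau k} (hF : F ∈ Q.Wheel k) :
    symInvert k F ∈ Q.rev.Wheel k := by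
  rw [mem_wheel_iff]
  intro u v x huv hux hvx h γ
  let θ : Lau (Vars k) →ₐ[ℂ] Lau (Vars k) :=
    Lau.eval fun s => if s = v then (Lau.scaled Q.q u)⁻¹ else (Lau.gen s)⁻¹
  have key := map_dvd θ (Q.mem_wheel_iff.1 hF v u x huv.symm hvx hux h.symm (Q.q / γ))
  have hm : Q.rev.doubleMult u.1 x.1 γ = Q.doubleMult v.1 x.1 (Q.q / γ) := by
    rw [doubleMult_div, ← h]
    simp only [doubleMult, rev_edges]
    rfl
  have e1 : θ (Q.wheelSubst v u (F : Lau (Vars k))) =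
      Q.rev.wheelSubst u v (symInvert k F : Lau (Vars k)) := by
    rw [wheelSubst_eq, wheelSubst_eq, Lau.spec, Lau.spec, Lau.hom_eval, coe_symInvert,
      Lau.eval_invert]
    refine congrArg (fun z => Lau.eval z (F : Lau (Vars k))) (funext fun s => Units.ext ?_)
    by_cases hsu : s = u
    · subst hsu
      rw [if_pos rfl, if_neg huv]
      refine (Lau.eval_scaled _ _ _).trans ?_
      rw [if_pos rfl, Lau.scaled, mul_inv, Units.val_mul, ← mul_assoc, ← map_inv, Units.coe_map,
        MonoidHom.coe_coe, ← map_mul, Units.mul_inv, map_one, one_mul]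
    · rw [if_neg hsu]
      refine (Lau.eval_gen _ _).trans ?_
      split_ifs <;> rfl
  rw [e1, map_pow, Lau.eval_lin, if_pos rfl, if_neg hvx.symm] at key
  rw [hm]
  refine (pow_dvd_pow_of_dvd ?_ _).trans key
  refine ⟨-algebraMap ℂ _ (γ⁻¹ : ℂˣ) * ((Lau.gen x)⁻¹ : (Lau (Vars k))ˣ) *
    ((Lau.gen u)⁻¹ : (Lau (Vars k))ˣ), ?_⟩
  have h1 := (Lau.gen x).mul_inv
  have h2 := (Lau.gen u).mul_inv
  have h3 : algebraMap ℂ (Lau (Vars k)) γ * algebraMap ℂ _ (γ⁻¹ : ℂˣ) = 1 := by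
    rw [← map_mul, Units.mul_inv, map_one]
  have h4 : algebraMap ℂ (Lau (Vars k)) (Q.q / γ : ℂˣ) *
      ((Lau.scaled Q.q u)⁻¹ : (Lau (Vars k))ˣ) =
      algebraMap ℂ _ (γ⁻¹ : ℂˣ) * ((Lau.gen u)⁻¹ : (Lau (Vars k))ˣ) := by
    rw [Lau.scaled, mul_inv, Units.val_mul, ← mul_assoc, ← map_inv, Units.coe_map,
        MonoidHom.coe_coe, ← map_mul, ← Units.val_mul]
    congr 4
    rw [div_eq_mul_inv, mul_right_comm, mul_inv_cancel, one_mul]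
  rw [h4, Lau.lin, Lau.coe_scaled]
  linear_combination (algebraMap ℂ (Lau (Vars k)) (γ⁻¹ : ℂˣ) * ((Lau.gen u)⁻¹ : (Lau (Vars k))ˣ)) * h1
    - ((Lau.gen x)⁻¹ : (Lau (Vars k))ˣ) * h2 * (1 : Lau (Vars k)) -
      (Lau.gen u).val * ((Lau.gen u)⁻¹ : (Lau (Vars k))ˣ) * ((Lau.gen x)⁻¹ : (Lau (Vars k))ˣ) * h3

end WeightedQuiver

end

/-! ### The explicit homomorphisms and their integrality. -/

noncomputable section

namespace WeightedQuiver

variable {I E : Type*} [Fintype I] [DecidableEq I] [Fintype E] (Q : WeightedQuiver I E)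
  (d : GKLOData I)

theorem negModel_image (k : I → ℕ) (F : SymLau k) :
    (Q.negModel d).image k (symInvert k F) = Q.imageNeg d k F := by
  rw [ChainModel.image_apply, imageNeg]
  refine Finset.sum_congr rfl fun m _ => ?_
  refine congrArg (fun c => Q.dOp c fun v => (m.1 v.1 v.2 : ℤ)) ?_
  have h1 : evalChains m.2 (Q.negModel d).pt (symInvert k F : Lau (Vars k)) =
      evalAt m.1 m.2 Q.ptNeg (F : Lau (Vars k)) := by
    rw [evalChains, coe_symInvert, Lau.eval_invert]
    simp only [negModel_pt, inv_inv]
    rfl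
  have h2 : Q.rev.loopConstIn (CoeffField d.a) k = Q.loopConst d k := by
    simp only [loopConstIn, loopConst, rev_edges]
    rfl
  have h3 : ∀ i, Q.rev.loopProdIn (CoeffField d.a) i = Q.loopProd d i := fun i => by
    simp only [loopProdIn, loopProd, rev_edges]
    rfl
  have hne : ∀ (u : Vars d.a) (p : ℕ), (Q.ptNeg u p : CoeffField d.a) ≠ 0 :=
    fun u p => (Q.ptNeg u p).ne_zero
  rw [h1, h2, ChainModel.coef]
  simp only [negModel_y, negModel_pt, rev_zeta, rev_phi, Units.val_inv_eq_inv_val, h3,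
    Q.zeta_inv_inv _ _ (hne _ _) (hne _ _), Q.phi_inv_inv _ _ (hne _ _) (hne _ _)]
  simp only [← Fintype.prod_sigma']
  ring

theorem negModel_coeffRing {A : Subalgebra ℂ (Q.DiffOp d.a)} (hA : Q.ATilde d.a ≤ A) :
    (Q.negModel d).CoeffRing (Q.coeffRing A) := by
  have hq : Q.qIn (CoeffField d.a) ≠ 0 := Q.qIn_ne_zero
  have hC : ∀ c : ℂ, algebraMap ℂ (CoeffField d.a) c ∈ Q.coeffRing A := Subalgebra.algebraMap_mem _
  have hqi : (Q.qIn (CoeffField d.a))⁻¹ ∈ Q.coeffRing A := by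
    rw [qIn, ← map_inv₀]
    exact hC _
  refine ChainModel.coeffRing_ofFactors Q.rev (fun u => ?_) (fun u => ?_) (fun u v huv h n => ?_)
    (fun u => prod_mem fun j _ => Q.coeffRing_mono hA (Q.P_mem _ _ _))
    (fun u p => prod_mem fun v _ => prod_mem fun e _ => hC _)
  · rw [Units.val_mul, Units.val_inv_eq_inv_val]
    exact mul_mem (hC _) (Q.coeffRing_mono hA (Q.w_inv_mem u))
  · rw [Units.val_mul, Units.val_inv_eq_inv_val, mul_inv, inv_inv]
    exact mul_mem hqi (Q.coeffRing_mono hA (Q.w_mem u))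
  · have e : ((Units.map (algebraMap ℂ (CoeffField d.a) : ℂ →* CoeffField d.a) Q.q *
          (wVar u)⁻¹ : (CoeffField d.a)ˣ) - Q.rev.qIn (CoeffField d.a) ^ n *
          (Units.map (algebraMap ℂ (CoeffField d.a) : ℂ →* CoeffField d.a) Q.q *
          (wVar v)⁻¹ : (CoeffField d.a)ˣ) : CoeffField d.a)⁻¹ =
        (Q.qIn (CoeffField d.a))⁻¹ * w u * w v *
          (w v - Q.qIn (CoeffField d.a) ^ n * w u)⁻¹ := by
      have hu := (wVar u).ne_zero
      have hv := (wVar v).ne_zero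
      rw [← inv_inv ((Q.qIn (CoeffField d.a))⁻¹ * _ * _), ← mul_inv]
      congr 1
      rw [Units.val_mul, Units.val_mul, Units.val_inv_eq_inv_val, Units.val_inv_eq_inv_val]
      change Q.qIn _ * _ - Q.qIn _ ^ n * (Q.qIn _ * _) = _
      field_simp
    rw [e]
    exact mul_mem (mul_mem (mul_mem hqi (Q.coeffRing_mono hA (Q.w_mem u)))
      (Q.coeffRing_mono hA (Q.w_mem v)))
      (Q.coeffRing_mono hA (Q.inv_sub_mem huv.symm h.symm n))

theorem imageNeg_mem_ext (k : I → ℕ) (F : SymLau k) : Q.imageNeg d k F ∈ Q.ATildeExt d.a := by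
  rw [← negModel_image, ChainModel.image_apply]
  refine sum_mem fun m _ => Q.dOp_mem Q.ATilde_le_ext
    ((Q.negModel_coeffRing d Q.ATilde_le_ext).coeff_mem_of_inv_mem ?_ m.2 _) _
  intro u v e huv hs ht n
  have hq : Q.qIn (CoeffField d.a) ≠ 0 := Q.qIn_ne_zero
  have e : ((Q.negModel d).pos v - Q.rev.tIn (CoeffField d.a) e * Q.rev.qIn (CoeffField d.a) ^ n *
      (Q.negModel d).pos u : CoeffField d.a)⁻¹ =
        (Q.qIn (CoeffField d.a))⁻¹ * w u * w v *
          (w u - Q.tIn (CoeffField d.a) e * Q.qIn (CoeffField d.a) ^ n * w v)⁻¹ := by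
    have hu := (wVar u).ne_zero
    have hv := (wVar v).ne_zero
    rw [← inv_inv ((Q.qIn (CoeffField d.a))⁻¹ * _ * _), ← mul_inv, negModel_pos, negModel_pos]
    congr 1
    change _ - Q.tIn _ e * Q.qIn _ ^ n * _ = _
    field_simp
  rw [e]
  refine mul_mem (mul_mem (mul_mem ?_ (Q.coeffRing_mono Q.ATilde_le_ext (Q.w_mem u)))
      (Q.coeffRing_mono Q.ATilde_le_ext (Q.w_mem v))) (Q.inv_sub_mem_ext huv.symm ht hs n)
  rw [qIn, ← map_inv₀]
  exact Subalgebra.algebraMap_mem _ _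

theorem imageNeg_mem (hQ : Q.Admissible) {k : I → ℕ} {F : SymLau k} (hF : F ∈ Q.Wheel k) :
    Q.imageNeg d k F ∈ Q.ATilde d.a := by
  rw [← negModel_image, ChainModel.image_apply]
  exact sum_mem fun m _ => Q.dOp_mem le_rfl
    ((Q.negModel_coeffRing d le_rfl).coeff_mem hQ.rev m.2 (Q.symInvert_mem_wheel hF)) _

/-! ### The explicit homomorphisms -/

theorem exists_phiPos (hQ : Q.Admissible) : ∃ Φ : Q.BigShuffle →ₐ[ℂ] Q.ATildeExt d.a,
    (∀ k F, (Φ (Q.ofSym k F) : Q.DiffOp d.a) = Q.imagePos d k F) ∧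
      ∀ x ∈ Q.SmallShuffle, (Φ x : Q.DiffOp d.a) ∈ Q.ATilde d.a := by
  obtain ⟨Φ, hΦ⟩ := (Q.posModel d).exists_hom hQ
  have hmem : ∀ x, Φ x ∈ Q.ATildeExt d.a := fun x => by
    refine Q.bigShuffle_induction (p := fun x => Φ x ∈ Q.ATildeExt d.a) x (fun k F => ?_) ?_
      fun x y hx hy => ?_
    · rw [hΦ, posModel_image]
      exact Q.imagePos_mem_ext d k F
    · rw [map_zero]
      exact zero_mem _
    · rw [map_add]
      exact add_mem hx hy
  refine ⟨Φ.codRestrict _ hmem, fun k F => (hΦ k F).trans (Q.posModel_image d k F), fun x hx => ?_⟩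
  change Φ x ∈ _
  refine Q.smallShuffle_induction (p := fun x => Φ x ∈ Q.ATilde d.a) hx (fun k F hF => ?_) ?_
    fun x y hx hy => ?_
  · rw [hΦ, posModel_image]
    exact Q.imagePos_mem d hQ hF
  · rw [map_zero]
    exact zero_mem _
  · rw [map_add]
    exact add_mem hx hy

/-- Composing the model of the reversed quiver with inversion reverses products, so it is an algebra
map from the shuffle algebra to the opposite of the difference operators; opposites are then taken
on both sides. -/
theorem exists_phiNeg (hQ : Q.Admissible) : ∃ Φ : (Q.BigShuffle)ᵐᵒᵖ →ₐ[ℂ] Q.ATildeExt d.a,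
    (∀ k F, (Φ (MulOpposite.op (Q.ofSym k F)) : Q.DiffOp d.a) = Q.imageNeg d k F) ∧
      ∀ x ∈ Q.SmallShuffle, (Φ (MulOpposite.op x) : Q.DiffOp d.a) ∈ Q.ATilde d.a := by
  obtain ⟨Ψ, hΨ⟩ := Q.exists_algHom (M := (Q.DiffOp d.a)ᵐᵒᵖ)
    (fun k => (MulOpposite.opLinearEquiv ℂ).toLinearMap ∘ₗ (Q.negModel d).image k ∘ₗ symInvert k)
    (by
      have : symInvert (0 : I → ℕ) ⟨1, one_mem_symLau⟩ = ⟨1, one_mem_symLau⟩ :=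
        Subtype.ext (map_one Lau.invert)
      change MulOpposite.op ((Q.negModel d).image 0 (symInvert 0 _)) = 1
      rw [this, ChainModel.image_one, MulOpposite.op_one])
    (fun k l n F G H hn h => by
      change MulOpposite.op ((Q.negModel d).image n (symInvert n H)) =
        MulOpposite.op ((Q.negModel d).image k (symInvert k F)) *
          MulOpposite.op ((Q.negModel d).image l (symInvert l G))
      rw [← MulOpposite.op_mul, (Q.negModel d).image_mul hQ.rev _ _ _ ((add_comm l k).trans hn)
        (Q.toConf_mul_invert F G H h)])
  let Φ : (Q.BigShuffle)ᵐᵒᵖ →ₐ[ℂ] Q.DiffOp d.a := AlgHom.opComm Ψ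
  have hΦ : ∀ k F, Φ (MulOpposite.op (Q.ofSym k F)) = Q.imageNeg d k F := fun k F => by
    rw [← negModel_image]
    exact congrArg MulOpposite.unop (hΨ k F)
  have hmem : ∀ x, Φ (MulOpposite.op x) ∈ Q.ATildeExt d.a := fun x => by
    refine Q.bigShuffle_induction (p := fun x => Φ (MulOpposite.op x) ∈ Q.ATildeExt d.a) x
      (fun k F => ?_) ?_ fun x y hx hy => ?_
    · rw [hΦ]
      exact Q.imageNeg_mem_ext d k F
    · rw [MulOpposite.op_zero, map_zero]
      exact zero_mem _
    · rw [MulOpposite.op_add, map_add]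
      exact add_mem hx hy
  refine ⟨Φ.codRestrict _ fun x => hmem x.unop, hΦ, fun x hx => ?_⟩
  change Φ (MulOpposite.op x) ∈ _
  refine Q.smallShuffle_induction (p := fun x => Φ (MulOpposite.op x) ∈ Q.ATilde d.a) hx
    (fun k F hF => ?_) ?_ fun x y hx hy => ?_
  · rw [hΦ]
    exact Q.imageNeg_mem d hQ hF
  · rw [MulOpposite.op_zero, map_zero]
    exact zero_mem _
  · rw [MulOpposite.op_add, map_add]
    exact add_mem hx hy

end WeightedQuiver

end

/-! ### Degree one: the images of the generators e and f. -/

noncomputable section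

namespace WeightedQuiver

variable {I E : Type*} [Fintype I] [DecidableEq I] [Fintype E]

/-! ### Images of the generators `x_{i,1}^n` -/

/-- The splitting consisting of a single point. -/
def unitSplit {a : I → ℕ} (u : Vars a) : ∀ i, Fin (a i) → ℕ := fun i r => if ⟨i, r⟩ = u then 1 else 0

theorem unitSplit_self {a : I → ℕ} (u : Vars a) : unitSplit u u.1 u.2 = 1 := if_pos rfl

theorem unitSplit_of_ne {a : I → ℕ} {u v : Vars a} (h : v ≠ u) : unitSplit u v.1 v.2 = 0 := if_neg h

theorem unitSplit_mem {a : I → ℕ} (i : I) (r : Fin (a i)) :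
    unitSplit ⟨i, r⟩ ∈ splittings a (Pi.single i 1) := by
  rw [mem_splittings_iff]
  intro j
  by_cases h : j = i
  · subst h
    rw [Pi.single_eq_same]
    exact (Finset.sum_eq_single r (fun s _ hs => if_neg fun h' => hs (by simpa using h'))
      (fun h => absurd (Finset.mem_univ _) h)).trans (if_pos rfl)
  · rw [Pi.single_eq_of_ne h]
    exact Finset.sum_eq_zero fun s _ => if_neg fun h' => h (congrArg Sigma.fst h')

/-- A splitting of total degree 1_i puts a single point on a single chain of colour i. -/
theorem sum_splittings_single {a : I → ℕ} (i : I) {M : Type*} [AddCommMonoid M]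
    (f : {m // m ∈ splittings a (Pi.single i 1)} → M) :
    ∑ m, f m = ∑ r, f ⟨unitSplit ⟨i, r⟩, unitSplit_mem i r⟩ := by
  symm
  refine Fintype.sum_bijective (fun r => ⟨unitSplit ⟨i, r⟩, unitSplit_mem i r⟩) ⟨?_, ?_⟩ _ _
    fun _ => rfl
  · intro r s h
    by_contra hne
    have h1 : unitSplit (⟨i, r⟩ : Vars a) i r = unitSplit ⟨i, s⟩ i r :=
      congrFun (congrFun (congrArg Subtype.val h) i) r
    rw [unitSplit, if_pos rfl, unitSplit, if_neg (by simpa using hne)] at h1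
    exact one_ne_zero h1
  · rintro ⟨m, hm⟩
    have hi := mem_splittings_iff.1 hm i
    rw [Pi.single_eq_same] at hi
    obtain ⟨r, -, hr⟩ := Finset.exists_ne_zero_of_sum_ne_zero (hi.trans_ne one_ne_zero)
    have h1 := Finset.add_sum_erase Finset.univ (fun s => m i s) (Finset.mem_univ r)
    rw [hi] at h1
    have h2 : m i r = 1 := by omega
    have h3 : ∑ s ∈ Finset.univ.erase r, m i s = 0 := by omega
    refine ⟨r, Subtype.ext (funext fun j => funext fun s => ?_)⟩
    change unitSplit ⟨i, r⟩ j s = m j s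
    by_cases hj : j = i
    · subst hj
      by_cases hs : s = r
      · subst hs
        rw [h2]
        exact if_pos rfl
      · rw [Finset.sum_eq_zero_iff.1 h3 s (Finset.mem_erase.2 ⟨hs, Finset.mem_univ _⟩)]
        exact if_neg (by simpa using hs)
    · have h4 := mem_splittings_iff.1 hm j
      rw [Pi.single_eq_of_ne hj] at h4
      rw [Finset.sum_eq_zero_iff.1 h4 s (Finset.mem_univ _)]
      exact if_neg fun h => hj (congrArg Sigma.fst h)

theorem card_vars_single (i : I) : Fintype.card (Vars (Pi.single i 1 : I → ℕ)) = 1 := by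
  rw [Fintype.card_sigma]
  simp

theorem eval_const_monomial (i : I) {R : Type*} [CommRing R] [Algebra ℂ R] (x : Rˣ) (n : ℤ) :
    Lau.eval (fun _ => x) (AddMonoidAlgebra.single (fun _ => n) 1 : Lau (Vars (Pi.single i 1 : I → ℕ)))
      = ((x ^ n : Rˣ) : R) := by
  rw [Lau.eval_single, Finset.prod_const, Finset.card_univ, card_vars_single, pow_one]

namespace ChainModel

variable {Q : WeightedQuiver I E} {a : I → ℕ} {L G : Type*} [Field L] [Algebra ℂ L]
    [CommGroup G] [MulSemiringAction G L] [SMulCommClass G ℂ L] (X : Q.ChainModel a L G)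

/-- With only one point there are no pairs, so the products of ζ⁻¹ and φ are empty. -/
theorem coef_unitSplit (u : Vars a) : X.coef (unitSplit u) = X.y u 0 := by
  have h1 : ∀ v : Vars a, v ≠ u → Finset.range (unitSplit u v.1 v.2) = ∅ := fun v hv => by
    rw [unitSplit_of_ne hv, Finset.range_zero]
  rw [coef, Finset.prod_eq_single u, unitSplit_self, Finset.prod_range_one]
  · rw [Finset.prod_eq_one, Finset.prod_eq_one, mul_one, mul_one]
    · intro v _
      refine Finset.prod_eq_one fun v' hv' => ?_
      by_cases hv : v = u
      · have : v' ≠ u := hv ▸ Finset.ne_of_mem_erase hv'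
        rw [h1 v' this]
        exact Finset.prod_eq_one fun _ _ => Finset.prod_empty
      · rw [h1 v hv, Finset.prod_empty]
    · intro v _
      by_cases hv : v = u
      · rw [hv, unitSplit_self, Finset.prod_range_one, Finset.range_zero, Finset.prod_empty]
      · rw [h1 v hv, Finset.prod_empty]
  · intro v _ hv
    rw [h1 v hv, Finset.prod_empty]
  · intro h
    exact absurd (Finset.mem_univ _) h

theorem evalChains_unitSplit (i : I) (r : Fin (a i)) (F : Lau (Vars (Pi.single i 1 : I → ℕ))) :
    evalChains (unitSplit_mem i r) X.pt F = Lau.eval (fun _ => X.pos ⟨i, r⟩) F := by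
  refine congrArg (fun z => Lau.eval z F) (funext fun v => Units.ext ?_)
  generalize chainEquiv (unitSplit_mem i r) v = t
  obtain ⟨u, p, hp⟩ := t
  have hu : u = ⟨i, r⟩ := by
    by_contra h
    rw [unitSplit_of_ne h] at hp
    exact absurd hp (Nat.not_lt_zero _)
  subst hu
  rw [unitSplit_self ⟨i, r⟩] at hp
  obtain rfl : p = 0 := by omega
  rw [X.coe_pt, pow_zero, mul_one]

theorem image_single (i : I) (F : SymLau (Pi.single i 1 : I → ℕ)) : X.image (Pi.single i 1) F =
    ∑ r : Fin (a i), SkewMonoidAlgebra.single (X.shift (unitSplit ⟨i, r⟩))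
      (X.y ⟨i, r⟩ 0 * Lau.eval (fun _ => X.pos ⟨i, r⟩) (F : Lau (Vars (Pi.single i 1 : I → ℕ)))) := by
  have h : Q.loopConstIn L (Pi.single i 1) = 1 := by
    refine Finset.prod_eq_one fun j _ => Finset.prod_eq_one fun e _ => ?_
    by_cases hj : j = i
    · subst hj
      simp
    · simp [Pi.single_eq_of_ne hj]
  rw [image_apply, sum_splittings_single]
  refine Finset.sum_congr rfl fun r _ => ?_
  rw [h, one_mul, coef_unitSplit, evalChains_unitSplit]

end ChainModel

variable (Q : WeightedQuiver I E) (d : GKLOData I)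

/-- The image of `e_{i,n}`. -/
def eImage (i : I) (n : ℤ) : Q.DiffOp d.a :=
  ∑ r : Fin (d.a i), Q.dOp (w ⟨i, r⟩ ^ n * Q.YPos d ⟨i, r⟩ (w ⟨i, r⟩)) (-Pi.single ⟨i, r⟩ 1)

/-- The image of `f_{i,n}`. -/
def fImage (i : I) (n : ℤ) : Q.DiffOp d.a :=
  ∑ r : Fin (d.a i), Q.dOp ((w ⟨i, r⟩ / Q.qIn (CoeffField d.a)) ^ n *
      Q.YNeg d ⟨i, r⟩ (w ⟨i, r⟩ / Q.qIn (CoeffField d.a))) (Pi.single ⟨i, r⟩ 1)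

theorem coe_unitSplit {a : I → ℕ} (u : Vars a) :
    (fun v : Vars a => (unitSplit u v.1 v.2 : ℤ)) = Pi.single u 1 := by
  funext v
  by_cases h : v = u
  · subst h
    rw [unitSplit_self, Pi.single_eq_same, Nat.cast_one]
  · rw [unitSplit_of_ne h, Pi.single_eq_of_ne h, Nat.cast_zero]

theorem imagePos_monomial (i : I) (n : ℤ) : Q.imagePos d (Pi.single i 1)
    ⟨AddMonoidAlgebra.single (fun _ => n) 1, monomial_mem _ n⟩ = Q.eImage d i n := by
  rw [← posModel_image, ChainModel.image_single, eImage]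
  refine Finset.sum_congr rfl fun r _ => ?_
  have h1 : (Q.posModel d).shift (unitSplit ⟨i, r⟩) = Q.dMon (-Pi.single ⟨i, r⟩ 1) := by
    rw [← coe_unitSplit]
    rfl
  have h2 : (Q.ptPos ⟨i, r⟩ 0 : CoeffField d.a) = w ⟨i, r⟩ := by
    rw [ptPos, pow_zero, mul_one]
  rw [h1, posModel_y, h2, eval_const_monomial, mul_comm, Units.val_zpow_eq_zpow_val]
  rfl

theorem imageNeg_monomial (i : I) (n : ℤ) : Q.imageNeg d (Pi.single i 1)
    ⟨AddMonoidAlgebra.single (fun _ => n) 1, monomial_mem _ n⟩ = Q.fImage d i n := by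
  rw [← negModel_image, ChainModel.image_single, fImage]
  refine Finset.sum_congr rfl fun r _ => ?_
  have h1 : (Q.negModel d).shift (unitSplit ⟨i, r⟩) = Q.dMon (Pi.single ⟨i, r⟩ 1) := by
    rw [← coe_unitSplit]
    rfl
  have h2 : (Q.ptNeg ⟨i, r⟩ 0 : CoeffField d.a) = w ⟨i, r⟩ / Q.qIn (CoeffField d.a) := by
    rw [ptNeg, zero_add, pow_one, div_eq_mul_inv, Units.val_mul, Units.val_inv_eq_inv_val]
    rfl
  rw [h1, negModel_y, h2, coe_symInvert, Lau.eval_invert, eval_const_monomial, mul_comm,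
    Units.val_zpow_eq_zpow_val, Units.val_inv_eq_inv_val, negModel_pos, inv_div]
  rfl

end WeightedQuiver

end

/-! ### Laurent series with unit leading coefficient, and partial fractions. -/

noncomputable section

namespace LaurentSeries

variable {K : Type*} [Field K]

/-! ### Laurent series with coefficients in a subring -/

theorem algebraMap_eq_C (c : K) : algebraMap K (LaurentSeries K) c = HahnSeries.C c := by
  rw [HahnSeries.algebraMap_apply', PowerSeries.algebraMap_apply, HahnSeries.ofPowerSeries_C]
  rfl

theorem algebraMap_complex [Algebra ℂ K] (c : ℂ) :
    algebraMap ℂ (LaurentSeries K) c = HahnSeries.C (algebraMap ℂ K c) := by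
  rw [HahnSeries.algebraMap_apply', PowerSeries.algebraMap_apply, HahnSeries.ofPowerSeries_C]

/-- The monomial with exponent `s`, as a unit. -/
def monomialUnit (K : Type*) [Field K] (s : ℤ) : (LaurentSeries K)ˣ where
  val := HahnSeries.single s 1
  inv := HahnSeries.single (-s) 1
  val_inv := by rw [HahnSeries.single_mul_single, add_neg_cancel, mul_one]; rfl
  inv_val := by rw [HahnSeries.single_mul_single, neg_add_cancel, mul_one]; rfl

theorem coe_monomialUnit (s : ℤ) :
    (monomialUnit K s : LaurentSeries K) = HahnSeries.single s 1 := rfl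

theorem monomialUnit_add (s t : ℤ) :
    monomialUnit K (s + t) = monomialUnit K s * monomialUnit K t := by
  ext1
  rw [Units.val_mul, coe_monomialUnit, coe_monomialUnit, coe_monomialUnit,
    HahnSeries.single_mul_single, mul_one]

theorem monomialUnit_zpow (s n : ℤ) : monomialUnit K s ^ n = monomialUnit K (s * n) := by
  let f : Multiplicative ℤ →* (LaurentSeries K)ˣ :=
    MonoidHom.mk' (fun m => monomialUnit K m.toAdd) fun a b => monomialUnit_add _ _
  have := map_zpow f (Multiplicative.ofAdd s) n
  rw [← ofAdd_zsmul, smul_eq_mul, mul_comm] at this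
  exact this.symm

theorem inv_monomial (s : ℤ) :
    (HahnSeries.single s (1 : K))⁻¹ = HahnSeries.single (-s) (1 : K) := by
  rw [← coe_monomialUnit, ← Units.val_inv_eq_inv_val]
  rfl

/-- The coefficientwise extension of a ring endomorphism. -/
def mapCoeff [Algebra ℂ K] (σ : K →ₐ[ℂ] K) : LaurentSeries K →ₐ[ℂ] LaurentSeries K where
  toFun f := HahnSeries.map f σ
  map_one' := by
    ext n
    simp [HahnSeries.coeff_one, apply_ite σ]
  map_zero' := by
    ext n
    simp
  map_add' f g := by
    ext n
    simp
  map_mul' f g := by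
    -- A homomorphism of fields is injective, so it preserves supports; the two convolution sums
    -- then run over the same index set.
    have hs : ∀ h : LaurentSeries K, (HahnSeries.map h σ).support = h.support := fun h => by
      ext n
      simp
    ext n
    simp only [HahnSeries.map_coeff, HahnSeries.coeff_mul, map_sum, map_mul, hs]
  commutes' c := by
    rw [algebraMap_complex]
    ext n
    simp only [HahnSeries.C_apply, HahnSeries.map_coeff, HahnSeries.coeff_single]
    split_ifs <;> simp

theorem coeff_mapCoeff [Algebra ℂ K] (σ : K →ₐ[ℂ] K) (f : LaurentSeries K) (n : ℤ) :
    (mapCoeff σ f).coeff n = σ (f.coeff n) := rfl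

theorem mapCoeff_C [Algebra ℂ K] (σ : K →ₐ[ℂ] K) (c : K) :
    mapCoeff σ (HahnSeries.C c) = HahnSeries.C (σ c) := by
  ext n
  simp only [coeff_mapCoeff, HahnSeries.C_apply, HahnSeries.coeff_single]
  split_ifs <;> simp

theorem mapCoeff_monomial [Algebra ℂ K] (σ : K →ₐ[ℂ] K) (s : ℤ) :
    mapCoeff σ (HahnSeries.single s 1) = HahnSeries.single s 1 := by
  ext n
  simp only [coeff_mapCoeff, HahnSeries.coeff_single]
  split_ifs <;> simp

/-- The series `f` is `x^k` times an invertible power series over the subring `S`. -/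
def IsUnitOver [Algebra ℂ K] (S : Subalgebra ℂ K) (k : ℤ) (f : LaurentSeries K) : Prop :=
  ∃ g : (PowerSeries S)ˣ, f = HahnSeries.single k 1 *
    HahnSeries.ofPowerSeries ℤ K (PowerSeries.map (S.val : S →+* K) g)

/-- Invertible elements of a subring of a field. -/
def IsUnitIn [Algebra ℂ K] (S : Subalgebra ℂ K) (c : K) : Prop := c ≠ 0 ∧ c ∈ S ∧ c⁻¹ ∈ S

section

variable [Algebra ℂ K] {S : Subalgebra ℂ K}

theorem IsUnitIn.mul {c c' : K} (h : IsUnitIn S c) (h' : IsUnitIn S c') : IsUnitIn S (c * c') :=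
  ⟨mul_ne_zero h.1 h'.1, mul_mem h.2.1 h'.2.1, by rw [mul_inv]; exact mul_mem h.2.2 h'.2.2⟩

theorem IsUnitIn.inv {c : K} (h : IsUnitIn S c) : IsUnitIn S c⁻¹ :=
  ⟨inv_ne_zero h.1, h.2.2, by rw [inv_inv]; exact h.2.1⟩

theorem IsUnitIn.const {c : ℂ} (h : c ≠ 0) : IsUnitIn S (algebraMap ℂ K c) :=
  ⟨(map_ne_zero _).2 h, S.algebraMap_mem c, by rw [← map_inv₀]; exact S.algebraMap_mem _⟩

theorem IsUnitIn.one : IsUnitIn S (1 : K) := ⟨one_ne_zero, one_mem S, by rw [inv_one]; exact one_mem S⟩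

theorem IsUnitIn.prod {ι : Type*} {T : Finset ι} {c : ι → K} (h : ∀ i ∈ T, IsUnitIn S (c i)) :
    IsUnitIn S (∏ i ∈ T, c i) := by
  classical
  induction T using Finset.induction_on with
  | empty => exact IsUnitIn.one
  | insert a T ha ih =>
    rw [Finset.prod_insert ha]
    exact (h a (Finset.mem_insert_self _ _)).mul (ih fun i hi => h i (Finset.mem_insert_of_mem hi))

/-- An invertible element of a subring, as a unit of the subring. -/
def IsUnitIn.unit {c : K} (h : IsUnitIn S c) : Sˣ where
  val := ⟨c, h.2.1⟩
  inv := ⟨c⁻¹, h.2.2⟩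
  val_inv := Subtype.ext (mul_inv_cancel₀ h.1)
  inv_val := Subtype.ext (inv_mul_cancel₀ h.1)

namespace IsUnitOver

theorem mul {k l : ℤ} {f g : LaurentSeries K} (hf : IsUnitOver S k f) (hg : IsUnitOver S l g) :
    IsUnitOver S (k + l) (f * g) := by
  obtain ⟨x, rfl⟩ := hf
  obtain ⟨y, rfl⟩ := hg
  refine ⟨x * y, ?_⟩
  rw [Units.val_mul, map_mul, map_mul, mul_mul_mul_comm, HahnSeries.single_mul_single, one_mul]

theorem inv {k : ℤ} {f : LaurentSeries K} (hf : IsUnitOver S k f) : IsUnitOver S (-k) f⁻¹ := by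
  obtain ⟨x, rfl⟩ := hf
  refine ⟨x⁻¹, ?_⟩
  rw [mul_inv, inv_monomial]
  congr 1
  apply inv_eq_of_mul_eq_one_left
  rw [← map_mul, ← map_mul, Units.inv_mul, map_one, map_one]

theorem div {k l : ℤ} {f g : LaurentSeries K} (hf : IsUnitOver S k f) (hg : IsUnitOver S l g) :
    IsUnitOver S (k - l) (f / g) := by
  rw [div_eq_mul_inv, sub_eq_add_neg]
  exact hf.mul hg.inv

theorem C {c : K} (h : IsUnitIn S c) : IsUnitOver S 0 (HahnSeries.C c) := by
  refine ⟨Units.map (PowerSeries.C : S →+* PowerSeries S).toMonoidHom h.unit, ?_⟩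
  have : PowerSeries.map (S.val : S →+* K)
      (Units.map (PowerSeries.C : S →+* PowerSeries S).toMonoidHom h.unit : (PowerSeries S)ˣ) =
      PowerSeries.C c := PowerSeries.map_C _ _
  rw [this, HahnSeries.ofPowerSeries_C]
  exact (one_mul _).symm

theorem one : IsUnitOver S 0 (1 : LaurentSeries K) := by
  have := C (S := S) IsUnitIn.one
  rwa [map_one] at this

theorem prod {ι : Type*} {T : Finset ι} {k : ι → ℤ} {f : ι → LaurentSeries K}
    (h : ∀ i ∈ T, IsUnitOver S (k i) (f i)) : IsUnitOver S (∑ i ∈ T, k i) (∏ i ∈ T, f i) := by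
  classical
  induction T using Finset.induction_on with
  | empty => exact one
  | insert a T ha ih =>
    rw [Finset.prod_insert ha, Finset.sum_insert ha]
    exact (h a (Finset.mem_insert_self _ _)).mul (ih fun i hi => h i (Finset.mem_insert_of_mem hi))

theorem powerSeries {p : PowerSeries S} (hp : IsUnit p) :
    IsUnitOver S 0 (HahnSeries.ofPowerSeries ℤ K (PowerSeries.map (S.val : S →+* K) p)) := by
  obtain ⟨g, rfl⟩ := hp
  exact ⟨g, (one_mul _).symm⟩

/-- For exponent 1 this is a power series with unit constant term. For exponent -1, a - b x⁻¹ = -(b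
- a x) x⁻¹ reduces to that case and lowers the order by one. -/
theorem linear {s : ℤ} (hs : s = 1 ∨ s = -1) {a b : K} (ha : IsUnitIn S a) (hb : IsUnitIn S b) :
    IsUnitOver S (min 0 s) (HahnSeries.C a - HahnSeries.C b * HahnSeries.single s 1) := by
  have key : ∀ {a b : K} (ha : IsUnitIn S a) (_ : IsUnitIn S b),
      IsUnitOver S 0 (HahnSeries.C a - HahnSeries.C b * HahnSeries.single 1 1) := by
    intro a b ha hb
    have h := powerSeries (K := K) (p := PowerSeries.C ha.unit.val -
      PowerSeries.C hb.unit.val * PowerSeries.X) (by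
        rw [PowerSeries.isUnit_iff_constantCoeff]
        simp)
    simp only [map_sub, map_mul, PowerSeries.map_C, PowerSeries.map_X, HahnSeries.ofPowerSeries_C,
      HahnSeries.ofPowerSeries_X] at h
    exact h
  rcases hs with rfl | rfl
  · exact key ha hb
  · have h := ((key hb ha).mul (C (IsUnitIn.const (S := S) (c := -1) (by norm_num)))).mul
      (⟨1, by rw [Units.val_one, map_one (PowerSeries.map _), map_one (HahnSeries.ofPowerSeries ℤ K),
          mul_one]⟩ :
        IsUnitOver S (-1) (HahnSeries.single (-1) (1 : K)))
    have e : HahnSeries.single 1 (1 : K) * HahnSeries.single (-1) 1 = 1 := by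
      rw [HahnSeries.single_mul_single, add_neg_cancel, mul_one]
      rfl
    have e' : (HahnSeries.C a - HahnSeries.C b * HahnSeries.single (-1) 1 : LaurentSeries K) =
        (HahnSeries.C b - HahnSeries.C a * HahnSeries.single 1 1) *
          HahnSeries.C (algebraMap ℂ K (-1)) * HahnSeries.single (-1) 1 := by
      have e1 : (HahnSeries.C (algebraMap ℂ K (-1)) : LaurentSeries K) = -1 := by
        rw [map_neg, map_one (algebraMap ℂ K), map_neg, map_one HahnSeries.C]
      rw [e1]
      linear_combination (-HahnSeries.C a : LaurentSeries K) * e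
    rw [e']
    exact h

variable {k : ℤ} {f : LaurentSeries K} (hf : IsUnitOver S k f)

include hf

theorem coeff_eq_zero {n : ℤ} (hn : n < k) : f.coeff n = 0 := by
  obtain ⟨g, rfl⟩ := hf
  rw [HahnSeries.coeff_single_mul, one_mul, HahnSeries.ofPowerSeries_apply]
  apply HahnSeries.embDomain_of_notMem_range
  rintro ⟨m, hm⟩
  have : (m : ℤ) = n - k := hm
  omega

theorem exists_coeff_eq : ∃ g : (PowerSeries S)ˣ,
    ∀ m : ℕ, f.coeff (k + m) = (PowerSeries.coeff m (g : PowerSeries S) : S) := by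
  obtain ⟨g, rfl⟩ := hf
  refine ⟨g, fun m => ?_⟩
  rw [HahnSeries.coeff_single_mul, one_mul, add_sub_cancel_left,
    HahnSeries.ofPowerSeries_apply_coeff, PowerSeries.coeff_map]
  rfl

theorem coeff_mem (n : ℤ) : f.coeff n ∈ S := by
  rcases lt_or_ge n k with h | h
  · rw [hf.coeff_eq_zero h]
    exact zero_mem S
  · obtain ⟨m, rfl⟩ := Int.le.dest h
    obtain ⟨g, hg⟩ := hf.exists_coeff_eq
    rw [hg]
    exact Subtype.property _

theorem isUnitIn_coeff : IsUnitIn S (f.coeff k) := by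
  obtain ⟨g, hg⟩ := hf.exists_coeff_eq
  have h0 := hg 0
  rw [Nat.cast_zero, add_zero, PowerSeries.coeff_zero_eq_constantCoeff] at h0
  obtain ⟨u, hu⟩ := (PowerSeries.isUnit_iff_constantCoeff.1 g.isUnit)
  rw [← hu] at h0
  have h1 : f.coeff k * ((u⁻¹ : Sˣ) : S) = 1 := by
    rw [h0, ← Subalgebra.coe_mul, Units.mul_inv, Subalgebra.coe_one]
  refine ⟨left_ne_zero_of_mul_eq_one h1, hf.coeff_mem k, ?_⟩
  rw [inv_eq_of_mul_eq_one_right h1]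
  exact Subtype.property _

end IsUnitOver

end

/-! ### Differences of expansions -/

/-- The coefficient of `z^{-n}` in the difference of the expansions in `z⁻¹` and in `z` of the
rational function `p(z) / (z - c)`. -/
theorem coeff_sub_coeff (p : LaurentPolynomial K) (c : Kˣ) (n : ℤ) :
    (LaurentPolynomial.evalUnit (monomialUnit K (-1)) p *
        ((monomialUnit K (-1) : LaurentSeries K) - HahnSeries.C (c : K))⁻¹).coeff n -
      (LaurentPolynomial.evalUnit (monomialUnit K 1) p *
        ((monomialUnit K 1 : LaurentSeries K) - HahnSeries.C (c : K))⁻¹).coeff (-n) =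
      (c : K) ^ (n - 1) * LaurentPolynomial.evalUnit c p := by
  -- Expansion of 1/(z - c) in powers of z: minus the series of 1/(c - z).
  have hm : ((monomialUnit K 1 : LaurentSeries K) - HahnSeries.C (c : K))⁻¹ =
      -HahnSeries.ofPowerSeries ℤ K (PowerSeries.invUnitsSub c) := by
    apply inv_eq_of_mul_eq_one_left
    have h := congrArg (HahnSeries.ofPowerSeries ℤ K) (PowerSeries.invUnitsSub_mul_sub c)
    rw [map_mul, map_sub, map_one, HahnSeries.ofPowerSeries_C, HahnSeries.ofPowerSeries_X] at h
    rw [coe_monomialUnit]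
    linear_combination h
  -- Expansion in x = z⁻¹: 1/(z - c) = (x/c) · 1/(c⁻¹ - x).
  have hp : ((monomialUnit K (-1) : LaurentSeries K) - HahnSeries.C (c : K))⁻¹ =
      HahnSeries.single 1 ((c⁻¹ : Kˣ) : K) *
        HahnSeries.ofPowerSeries ℤ K (PowerSeries.invUnitsSub c⁻¹) := by
    apply inv_eq_of_mul_eq_one_left
    have h := congrArg (HahnSeries.ofPowerSeries ℤ K) (PowerSeries.invUnitsSub_mul_sub c⁻¹)
    rw [map_mul, map_sub, map_one, HahnSeries.ofPowerSeries_C, HahnSeries.ofPowerSeries_X] at h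
    have h1 : (HahnSeries.single 1 ((c⁻¹ : Kˣ) : K) : LaurentSeries K) * HahnSeries.single (-1) 1 =
        HahnSeries.C ((c⁻¹ : Kˣ) : K) := by
      rw [HahnSeries.single_mul_single, add_neg_cancel, mul_one]
      rfl
    have h2 : (HahnSeries.single 1 ((c⁻¹ : Kˣ) : K) : LaurentSeries K) * HahnSeries.C (c : K) =
        HahnSeries.single 1 1 := by
      rw [HahnSeries.C_apply, HahnSeries.single_mul_single, add_zero, Units.inv_mul]
    rw [coe_monomialUnit]
    linear_combination h + HahnSeries.ofPowerSeries ℤ K (PowerSeries.invUnitsSub c⁻¹) * (h1 - h2)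
  have hcoeff : ∀ (u : Kˣ) (m : ℤ),
      (HahnSeries.ofPowerSeries ℤ K (PowerSeries.invUnitsSub u)).coeff m =
        if 0 ≤ m then (u : K) ^ (-m - 1) else 0 := by
    intro u m
    split_ifs with h
    · obtain ⟨l, rfl⟩ := Int.eq_ofNat_of_zero_le h
      rw [HahnSeries.ofPowerSeries_apply_coeff, PowerSeries.coeff_invUnitsSub, one_divp,
        ← zpow_natCast, ← zpow_neg, Units.val_zpow_eq_zpow_val]
      congr 1
      push_cast
      ring
    · rw [HahnSeries.ofPowerSeries_apply]
      apply HahnSeries.embDomain_of_notMem_range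
      rintro ⟨l, hl⟩
      have : (l : ℤ) = m := hl
      omega
  rw [hm, hp]
  induction p using LaurentPolynomial.induction_on' with
  | add p r hp hr =>
    rw [map_add, map_add, map_add, add_mul, add_mul, mul_add, ← hp, ← hr, HahnSeries.coeff_add,
      HahnSeries.coeff_add]
    ring
  | C_mul_T k b =>
    simp only [map_mul, LaurentPolynomial.evalUnit_C, LaurentPolynomial.evalUnit_T,
      monomialUnit_zpow, coe_monomialUnit, algebraMap_eq_C, HahnSeries.C_apply]
    rw [HahnSeries.single_mul_single, HahnSeries.single_mul_single, ← mul_assoc,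
      HahnSeries.single_mul_single, mul_neg, HahnSeries.coeff_neg, HahnSeries.coeff_single_mul,
      HahnSeries.coeff_single_mul, hcoeff, hcoeff, Algebra.algebraMap_self_apply,
      Units.val_inv_eq_inv_val, Units.val_zpow_eq_zpow_val]
    have hc := c.ne_zero
    -- For a monomial numerator exactly one of the two expansions contributes to a given
    -- coefficient, and both give the same power of c.
    by_cases h : 0 ≤ n - (0 + -1 * k + 1)
    · rw [if_pos h, if_neg (by omega), mul_zero, neg_zero, sub_zero, mul_one, inv_zpow', mul_assoc,
        ← zpow_neg_one, ← zpow_add₀ hc, mul_left_comm, ← zpow_add₀ hc]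
      congr 2
      ring
    · rw [if_neg h, if_pos (by omega), mul_zero, zero_sub, neg_neg, mul_one, mul_left_comm,
        ← zpow_add₀ hc]
      congr 2
      ring

/-- The partial fraction expansion of `p(z) / ∏ (z - c_i)`. -/
theorem coeff_sub_coeff_prod {ι : Type*} [Fintype ι] [DecidableEq ι] (p : LaurentPolynomial K)
    (c : ι → Kˣ) (hc : Function.Injective c) (n : ℤ) :
    (LaurentPolynomial.evalUnit (monomialUnit K (-1)) p /
        ∏ i, ((monomialUnit K (-1) : LaurentSeries K) - HahnSeries.C (c i : K))).coeff n -
      (LaurentPolynomial.evalUnit (monomialUnit K 1) p /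
        ∏ i, ((monomialUnit K 1 : LaurentSeries K) - HahnSeries.C (c i : K))).coeff (-n) =
      ∑ i, (c i : K) ^ (n - 1) * LaurentPolynomial.evalUnit (c i) p /
        ∏ j ∈ Finset.univ.erase i, (c i - c j : K) := by
  -- Lagrange interpolation needs a node. Without poles, the one-pole case is applied to p(z)(z -
  -- 1)/(z - 1), whose contribution at 1 is zero.
  rcases isEmpty_or_nonempty ι with hι | hι
  · have h := coeff_sub_coeff (p * (LaurentPolynomial.T 1 - 1)) (1 : Kˣ) n
    have e : ∀ s : ℤ, s ≠ 0 → LaurentPolynomial.evalUnit (monomialUnit K s)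
        (p * (LaurentPolynomial.T 1 - 1)) *
        ((monomialUnit K s : LaurentSeries K) - HahnSeries.C ((1 : Kˣ) : K))⁻¹ =
        LaurentPolynomial.evalUnit (monomialUnit K s) p := by
      intro s hs
      rw [map_mul, map_sub, map_one, LaurentPolynomial.evalUnit_T, zpow_one, Units.val_one,
        map_one, mul_assoc, mul_inv_cancel₀, mul_one]
      rw [sub_ne_zero]
      intro h
      have := congrArg (fun f : LaurentSeries K => f.coeff s) h
      simp [coe_monomialUnit, HahnSeries.coeff_one, hs] at this
    rw [e _ (by norm_num), e _ one_ne_zero, map_mul, map_sub, map_one, LaurentPolynomial.evalUnit_T,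
      zpow_one, Units.val_one, sub_self, mul_zero, mul_zero] at h
    simpa using h
  -- Interpolating the constant 1 at the nodes c_i and evaluating at x gives the partial fractions
  -- of 1/∏(x - c_i).
  have key : ∀ x : LaurentSeries K, (∀ i, x ≠ HahnSeries.C (c i : K)) →
      (∏ i, (x - HahnSeries.C (c i : K)))⁻¹ =
        ∑ i, HahnSeries.C (∏ j ∈ Finset.univ.erase i, (c i - c j : K))⁻¹ *
          (x - HahnSeries.C (c i : K))⁻¹ := by
    intro x hx
    have h := Lagrange.eval_interpolate_not_at_node (s := Finset.univ)
      (v := fun i => (HahnSeries.C (c i : K) : LaurentSeries K)) (fun _ => 1) (fun i _ => hx i)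
    have hinj : Function.Injective fun i => (HahnSeries.C (c i : K) : LaurentSeries K) :=
      HahnSeries.C_injective.comp (Units.val_injective.comp hc)
    have h1 : Lagrange.interpolate Finset.univ
        (fun i => (HahnSeries.C (c i : K) : LaurentSeries K)) (fun _ => 1) = 1 :=
      Lagrange.interpolate_one hinj.injOn Finset.univ_nonempty
    rw [h1, Polynomial.eval_one, Lagrange.eval_nodal] at h
    rw [inv_eq_of_mul_eq_one_right h.symm]
    refine Finset.sum_congr rfl fun i _ => ?_
    rw [mul_one, Lagrange.nodalWeight, map_inv₀, map_prod, ← Finset.prod_inv_distrib]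
    simp only [map_sub]
  have hne : ∀ s : ℤ, s ≠ 0 → ∀ i, (monomialUnit K s : LaurentSeries K) ≠ HahnSeries.C (c i : K) := by
    intro s hs i h
    have := congrArg (fun f : LaurentSeries K => f.coeff s) h
    simp only [coe_monomialUnit, HahnSeries.coeff_single_same, HahnSeries.C_apply,
      HahnSeries.coeff_single_of_ne hs] at this
    exact one_ne_zero this
  rw [div_eq_mul_inv, div_eq_mul_inv, key _ (hne _ (by norm_num)), key _ (hne _ one_ne_zero),
    Finset.mul_sum, Finset.mul_sum, HahnSeries.coeff_sum, HahnSeries.coeff_sum,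
    ← Finset.sum_sub_distrib]
  refine Finset.sum_congr rfl fun i _ => ?_
  rw [mul_left_comm _ (HahnSeries.C _), mul_left_comm _ (HahnSeries.C _), HahnSeries.C_mul_eq_smul, HahnSeries.C_mul_eq_smul,
    HahnSeries.coeff_smul, HahnSeries.coeff_smul, ← smul_sub, coeff_sub_coeff, smul_eq_mul,
    div_eq_inv_mul]

end LaurentSeries

end

/-! ### The factors of ψ and their behaviour under a shift. -/

noncomputable section

namespace WeightedQuiver

variable {I E : Type*} [Fintype I] [DecidableEq I] [Fintype E] (Q : WeightedQuiver I E)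

/-! ### The series `ψ` -/

section Factor

variable {L : Type*} [Field L] [Algebra ℂ L]

/-- The contribution of a point `w` of colour `j` to the image of `ψ_i(z)`. -/
def psiFactor (i j : I) (z w : L) : L :=
  (∏ e ∈ Q.edges i j, ((Q.tIn L e)⁻¹ - z / w)) *
    (∏ e ∈ Q.edges j i, (1 - w * Q.tIn L e / (z * Q.qIn L))) /
    if i = j then (1 - z / w) * (1 - w / (z * Q.qIn L)) else 1

theorem map_psiFactor {M : Type*} [Field M] [Algebra ℂ M] (f : L →ₐ[ℂ] M) (i j : I) (z w : L) :
    f (Q.psiFactor i j z w) = Q.psiFactor i j (f z) (f w) := by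
  unfold psiFactor
  split_ifs <;> simp only [map_div₀, map_mul, map_prod, map_sub, map_inv₀, map_tIn, map_qIn, map_one]

/-- The constant factor of the image of `ψ_i(z)`. -/
def psiConst (L : Type*) [Field L] [Algebra ℂ L] (i : I) : L :=
  ((Q.qIn L)⁻¹ - 1) / (∏ e ∈ Q.edges i i, (((Q.tIn L e)⁻¹ - 1) * (1 - Q.tIn L e / Q.qIn L)))

theorem psiConst_eq (i : I) : Q.psiConst L i = algebraMap ℂ L (Q.psiConst ℂ i) := by
  have h := fun e => Q.map_tIn (Algebra.ofId ℂ L) e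
  simp only [Algebra.ofId_apply] at h
  have h' := Q.map_qIn (Algebra.ofId ℂ L)
  simp only [Algebra.ofId_apply] at h'
  simp only [psiConst, map_div₀, map_sub, map_inv₀, map_one, map_prod, map_mul, h, h']

/-- For i ≠ j the factor of ψ at w is ζ_ij(z/w), and the one at qw is ζ_ji(w/z) up to products of
the t_e, which are the shift of the formal powers. For i = j the same holds for the edge parts,
where the constants cancel, and the diagonal parts are compared directly. -/
theorem zeta_mul_psiFactor (i j : I) {z w : L} (hz : z ≠ 0) (hw : w ≠ 0)
    (h : ∀ c : ℂ, z ≠ algebraMap ℂ L c * w) :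
    Q.zeta j i w z * Q.psiFactor i j z w = Q.zeta i j z w * Q.psiFactor i j z (w * Q.qIn L) *
      if i = j then 1 else algebraMap ℂ L (Q.qGamma true i j * Q.qGamma false i j : ℂˣ) := by
  have hq := Q.qIn_ne_zero (L := L)
  have ht := fun e => Q.tIn_ne_zero (L := L) e
  have hD : ∏ e ∈ Q.edges i j, (1 - z * Q.tIn L e / (w * Q.qIn L)) = (∏ e ∈ Q.edges i j, Q.tIn L e) *
      ∏ e ∈ Q.edges i j, ((Q.tIn L e)⁻¹ - z / (w * Q.qIn L)) := by
    rw [← Finset.prod_mul_distrib]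
    refine Finset.prod_congr rfl fun e _ => ?_
    have := ht e
    field_simp
  have hB : ∏ e ∈ Q.edges j i, (1 - w * Q.qIn L * Q.tIn L e / (z * Q.qIn L)) =
      (∏ e ∈ Q.edges j i, Q.tIn L e) * ∏ e ∈ Q.edges j i, ((Q.tIn L e)⁻¹ - w / z) := by
    rw [← Finset.prod_mul_distrib]
    refine Finset.prod_congr rfl fun e _ => ?_
    have := ht e
    field_simp
  rw [psiFactor, psiFactor, zeta, zeta, hD, hB]
  by_cases hij : i = j
  · subst hij
    simp only [if_true]
    generalize (∏ e ∈ Q.edges i i, ((Q.tIn L e)⁻¹ - z / w) : L) = A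
    generalize (∏ e ∈ Q.edges i i, (1 - w * Q.tIn L e / (z * Q.qIn L)) : L) = B
    generalize (∏ e ∈ Q.edges i i, ((Q.tIn L e)⁻¹ - z / (w * Q.qIn L)) : L) = A'
    generalize (∏ e ∈ Q.edges i i, ((Q.tIn L e)⁻¹ - w / z) : L) = C
    have h1 : z - w ≠ 0 := sub_ne_zero.2 (by simpa using h 1)
    have h1' : w - z ≠ 0 := by rwa [← neg_sub, neg_ne_zero]
    have h2 : w * Q.qIn L - z ≠ 0 := sub_ne_zero.2 fun h' => h Q.q (by rw [← h', mul_comm])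
    have h3 : z * Q.qIn L - w ≠ 0 := sub_ne_zero.2 fun h' => h (Q.q : ℂ)⁻¹ (by
      rw [← h', map_inv₀]
      field_simp)
    have e1 : 1 - z / w = (w - z) / w := by field_simp
    have e2 : 1 - w / (z * Q.qIn L) = (z * Q.qIn L - w) / (z * Q.qIn L) := by field_simp
    have e3 : 1 - z / (w * Q.qIn L) = (w * Q.qIn L - z) / (w * Q.qIn L) := by field_simp
    have e4 : 1 - w * Q.qIn L / (z * Q.qIn L) = (z - w) / z := by field_simp
    have e5 : w * (Q.qIn L)⁻¹ - z = (w - z * Q.qIn L) / Q.qIn L := by field_simp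
    have e6 : z * (Q.qIn L)⁻¹ - w = (z - w * Q.qIn L) / Q.qIn L := by field_simp
    rw [e1, e2, e3, e4, e5, e6]
    field_simp
    ring
  · simp only [if_neg hij, if_neg (Ne.symm hij), div_one, one_mul]
    have e : algebraMap ℂ L (Q.qGamma true i j * Q.qGamma false i j : ℂˣ) =
        (∏ e ∈ Q.edges i j, Q.tIn L e) * (∏ e ∈ Q.edges j i, Q.tIn L e)⁻¹ := by
      simp only [qGamma, if_true, Bool.false_eq_true, if_false, Units.val_mul,
        Units.val_inv_eq_inv_val, Units.coe_prod, map_mul, map_inv₀, map_prod]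
    rw [e]
    have h1 : (∏ e ∈ Q.edges j i, Q.tIn L e : L) * (∏ e ∈ Q.edges j i, Q.tIn L e)⁻¹ = 1 :=
      mul_inv_cancel₀ (Finset.prod_ne_zero_iff.2 fun e _ => ht e)
    generalize (∏ e ∈ Q.edges i j, ((Q.tIn L e)⁻¹ - z / w) : L) = A
    generalize (∏ e ∈ Q.edges j i, (1 - w * Q.tIn L e / (z * Q.qIn L)) : L) = B
    generalize (∏ e ∈ Q.edges i j, ((Q.tIn L e)⁻¹ - z / (w * Q.qIn L)) : L) = A'
    generalize (∏ e ∈ Q.edges j i, ((Q.tIn L e)⁻¹ - w / z) : L) = C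
    generalize (∏ e ∈ Q.edges j i, Q.tIn L e : L) = T at *
    generalize (T⁻¹ : L) = T' at *
    linear_combination (-C * (∏ e ∈ Q.edges i j, Q.tIn L e) * A' * A * B) * h1

end Factor

variable (d : GKLOData I)

theorem prod_if_eq {a : I → ℕ} {M : Type*} [CommMonoid M] (i : I) (f : Vars a → M) :
    (∏ v : Vars a, if i = v.1 then f v else 1) = ∏ r, f ⟨i, r⟩ := by
  rw [Fintype.prod_sigma, Finset.prod_eq_single i]
  · simp only [if_true]
  · intro j _ hj
    exact Finset.prod_eq_one fun s _ => if_neg hj.symm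
  · intro h
    exact absurd (Finset.mem_univ _) h

theorem psiFun_eq (i : I) {L : Type*} [Field L] [Algebra ℂ L] [Algebra (CoeffField d.a) L] (z : L) :
    Q.psiFun d i z = Q.psiConst L i *
      (∏ j ∈ Finset.univ.erase i, algebraMap (CoeffField d.a) L (P true i j * P false i j)) *
      (zFun d i z * ∏ v : Vars d.a, Q.psiFactor i v.1 z (algebraMap (CoeffField d.a) L (w v))) := by
  simp only [psiFactor, Finset.prod_div_distrib]
  rw [prod_if_eq i fun v : Vars d.a => (1 - z / algebraMap (CoeffField d.a) L (w v)) *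
    (1 - algebraMap (CoeffField d.a) L (w v) / (z * Q.qIn L)), Fintype.prod_sigma, psiFun, psiConst,
    mul_div_assoc]

section Series

open LaurentSeries

/-- The sign of the exponent of `z⁻¹` in the two expansions. -/
def expSign (ε : Bool) : ℤ := if ε then 1 else -1

/-- The variable `z` in the two expansions. -/
def zSeries (a : I → ℕ) (ε : Bool) : (LaurentSeries (CoeffField a))ˣ :=
  monomialUnit (CoeffField a) (-expSign ε)

theorem psiCoeff_eq (ε : Bool) (i : I) (n : ℤ) : Q.psiCoeff d ε i n =
    (Q.psiFun d i (zSeries d.a ε : LaurentSeries (CoeffField d.a))).coeff (expSign ε * n) := by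
  cases ε with
  | false => rw [psiCoeff, if_neg (by simp), expSign, if_neg (by simp), neg_one_mul]; rfl
  | true => rw [psiCoeff, if_pos rfl, expSign, if_pos rfl, one_mul]; rfl

theorem zSeries_ne {a : I → ℕ} (ε : Bool) (x : CoeffField a) :
    (zSeries a ε : LaurentSeries (CoeffField a)) ≠ HahnSeries.C x := by
  intro h
  have h0 : -expSign ε ≠ 0 := by cases ε <;> simp [expSign]
  have := congrArg (fun f : LaurentSeries (CoeffField a) => f.coeff (-expSign ε)) h
  simp only [zSeries, coe_monomialUnit, HahnSeries.coeff_single_same, HahnSeries.C_apply,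
    HahnSeries.coeff_single_of_ne h0] at this
  exact one_ne_zero this

/-- Conjugation by a monomial in the shift operators. -/
def shiftHom {a : I → ℕ} (m : Vars a → ℤ) : CoeffField a →ₐ[ℂ] CoeffField a :=
  MulSemiringAction.toAlgHom ℂ (CoeffField a) (Q.dMon m)

theorem shiftHom_apply {a : I → ℕ} (m : Vars a → ℤ) (c : CoeffField a) :
    Q.shiftHom m c = Q.dMon m • c := rfl

theorem shiftHom_neg {a : I → ℕ} (m : Vars a → ℤ) (c : CoeffField a) :
    Q.shiftHom m (Q.shiftHom (-m) c) = c := by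
  rw [shiftHom_apply, shiftHom_apply, smul_smul, ← dMon_add, add_neg_cancel, dMon_zero, one_smul]

/-- Conjugation by D_u⁻¹ moves only w_u and the formal powers of its colour, so only one factor of
the product changes and `zeta_mul_psiFactor` applies to it. -/
theorem zeta_mul_psiFun (ε : Bool) (i : I) (u : Vars d.a) :
    Q.zeta u.1 i (HahnSeries.C (w u)) (zSeries d.a ε : LaurentSeries (CoeffField d.a)) *
      Q.psiFun d i (zSeries d.a ε : LaurentSeries (CoeffField d.a)) =
    Q.zeta i u.1 (zSeries d.a ε : LaurentSeries (CoeffField d.a)) (HahnSeries.C (w u)) *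
      mapCoeff (Q.shiftHom (-Pi.single u 1)) (Q.psiFun d i (zSeries d.a ε)) := by
  have hz : mapCoeff (Q.shiftHom (-Pi.single u 1))
      (zSeries d.a ε : LaurentSeries (CoeffField d.a)) = zSeries d.a ε := mapCoeff_monomial _ _
  have hw : ∀ v : Vars d.a, mapCoeff (Q.shiftHom (-Pi.single u 1)) (HahnSeries.C (w v)) =
      HahnSeries.C (w v) * if v = u then Q.qIn (LaurentSeries (CoeffField d.a)) else 1 := by
    intro v
    rw [mapCoeff_C, shiftHom_apply, shift_smul_w, map_mul]
    congr 1
    rw [Pi.neg_apply, neg_neg]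
    by_cases h : v = u
    · rw [h, Pi.single_eq_same, zpow_one, if_pos rfl, qIn, qIn, algebraMap_complex]
    · rw [Pi.single_eq_of_ne h, zpow_zero, if_neg h, map_one]
  have hP : ∀ j, mapCoeff (Q.shiftHom (-Pi.single u 1)) (HahnSeries.C (P true i j * P false i j)) =
      HahnSeries.C (P true i j * P false i j) * if j = u.1 then
        algebraMap ℂ (LaurentSeries (CoeffField d.a)) (Q.qGamma true i j * Q.qGamma false i j : ℂˣ)
        else 1 := by
    intro j
    have hs : -∑ s : Fin (d.a j), (-Pi.single u 1 : Vars d.a → ℤ) ⟨j, s⟩ = if j = u.1 then 1 else 0 := by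
      obtain ⟨k, r⟩ := u
      simp only [Pi.neg_apply, Finset.sum_neg_distrib, neg_neg]
      by_cases h : j = k
      · subst h
        rw [if_pos rfl, Finset.sum_eq_single r, Pi.single_eq_same]
        · intro s _ hs
          exact Pi.single_eq_of_ne (by simpa using hs) _
        · intro h
          exact absurd (Finset.mem_univ _) h
      · rw [if_neg h]
        exact Finset.sum_eq_zero fun s _ => Pi.single_eq_of_ne (fun h' => h (congrArg Sigma.fst h')) _
    rw [mapCoeff_C, map_mul, shiftHom_apply, shiftHom_apply, shift_smul_P, shift_smul_P, hs]
    split_ifs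
    · rw [zpow_one, zpow_one, algebraMap_complex, Units.val_mul, map_mul (algebraMap ℂ _),
        ← map_mul HahnSeries.C, mul_mul_mul_comm]
    · rw [zpow_zero, zpow_zero, mul_one, mul_one, mul_one]
  -- ψ_i contains no formal power of its own colour, so no constant arises when u has colour i.
  have hpr : (∏ j ∈ Finset.univ.erase i, (if j = u.1 then
        algebraMap ℂ (LaurentSeries (CoeffField d.a)) (Q.qGamma true i j * Q.qGamma false i j : ℂˣ)
        else 1)) = if i = u.1 then 1 else algebraMap ℂ (LaurentSeries (CoeffField d.a))
          (Q.qGamma true i u.1 * Q.qGamma false i u.1 : ℂˣ) := by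
    rw [Finset.prod_ite_eq' (Finset.univ.erase i) u.1 fun j => algebraMap ℂ
      (LaurentSeries (CoeffField d.a)) (Q.qGamma true i j * Q.qGamma false i j : ℂˣ)]
    simp only [Finset.mem_erase, Finset.mem_univ, and_true]
    split_ifs <;> simp_all
  have hu : HahnSeries.C (w u) ≠ (0 : LaurentSeries (CoeffField d.a)) :=
    HahnSeries.C_ne_zero (wVar u).ne_zero
  have hne : ∀ c : ℂ, (zSeries d.a ε : LaurentSeries (CoeffField d.a)) ≠
      algebraMap ℂ (LaurentSeries (CoeffField d.a)) c * HahnSeries.C (w u) := fun c => by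
    rw [algebraMap_complex (K := CoeffField d.a), ← map_mul HahnSeries.C]
    exact zSeries_ne ε _
  have key := Q.zeta_mul_psiFactor (L := LaurentSeries (CoeffField d.a)) i u.1 (zSeries d.a ε).ne_zero hu hne
  rw [psiFun_eq, map_mul, map_mul, map_mul, map_prod, map_prod, map_zFun, hz, psiConst_eq,
    AlgHom.commutes]
  simp only [algebraMap_eq_C, map_psiFactor, hP, hw, hz, Finset.prod_mul_distrib, hpr]
  rw [← Finset.mul_prod_erase _ _ (Finset.mem_univ u), ← Finset.mul_prod_erase Finset.univ
    (fun v : Vars d.a => Q.psiFactor i v.1 (zSeries d.a ε : LaurentSeries (CoeffField d.a))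
      (HahnSeries.C (w v) * if v = u then Q.qIn (LaurentSeries (CoeffField d.a)) else 1))
      (Finset.mem_univ u)]
  have h1 : ∏ v ∈ Finset.univ.erase u, Q.psiFactor i v.1
      (zSeries d.a ε : LaurentSeries (CoeffField d.a))
      (HahnSeries.C (w v) * if v = u then Q.qIn (LaurentSeries (CoeffField d.a)) else 1) =
      ∏ v ∈ Finset.univ.erase u, Q.psiFactor i v.1
        (zSeries d.a ε : LaurentSeries (CoeffField d.a)) (HahnSeries.C (w v)) :=
    Finset.prod_congr rfl fun v hv => by rw [if_neg (Finset.ne_of_mem_erase hv), mul_one]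
  rw [h1]
  simp only [if_true]
  linear_combination (algebraMap ℂ (LaurentSeries (CoeffField d.a)) (Q.psiConst ℂ i) *
    (∏ j ∈ Finset.univ.erase i, HahnSeries.C (P true i j * P false i j)) *
    zFun d i (zSeries d.a ε : LaurentSeries (CoeffField d.a)) *
    ∏ v ∈ Finset.univ.erase u, Q.psiFactor i v.1
        (zSeries d.a ε : LaurentSeries (CoeffField d.a)) (HahnSeries.C (w v))) * key

end Series

end WeightedQuiver

end

/-! ### Invertibility of the leading coefficients, and the relations of ψ with e and f. -/

noncomputable section

namespace WeightedQuiver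

open LaurentSeries

variable {I E : Type*} [Fintype I] [DecidableEq I] [Fintype E] (Q : WeightedQuiver I E)
  (d : GKLOData I)

/-! ### Leading coefficients of the series `ψ` -/

theorem loop_factor_ne_zero (hQ : Q.Admissible) (e : E) :
    (((Q.t e : ℂ)⁻¹ - 1) * (1 - (Q.t e : ℂ) / Q.q)) ≠ 0 := by
  have hq := Q.q.ne_zero
  refine mul_ne_zero (sub_ne_zero.2 fun h => ?_) (sub_ne_zero.2 fun h => ?_)
  · refine hQ.t_ne_pow e 0 ?_
    rw [zpow_zero]
    exact inv_eq_one.1 h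
  · refine hQ.t_ne_pow e 1 ?_
    rw [zpow_one]
    exact ((div_eq_one_iff_eq hq).1 h.symm)

theorem inv_q_sub_one_ne_zero (hQ : Q.Admissible) : ((Q.q : ℂ)⁻¹ - 1) ≠ 0 := by
  rw [sub_ne_zero, Ne, inv_eq_one]
  simpa using hQ.pow_ne one_ne_zero

theorem psiConst_ne_zero (hQ : Q.Admissible) (i : I) : Q.psiConst ℂ i ≠ 0 :=
  div_ne_zero (Q.inv_q_sub_one_ne_zero hQ)
    (Finset.prod_ne_zero_iff.2 fun e _ => Q.loop_factor_ne_zero hQ e)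

theorem expSign_cases (ε : Bool) : expSign ε = 1 ∨ expSign ε = -1 := by cases ε <;> simp [expSign]

theorem isUnitOver_sub_div {a : I → ℕ} {S : Subalgebra ℂ (CoeffField a)} (ε : Bool)
    {x y : CoeffField a} (hx : IsUnitIn S x) (hy : IsUnitIn S y) :
    IsUnitOver S (min 0 (-expSign ε))
      (HahnSeries.C x - (zSeries a ε : LaurentSeries (CoeffField a)) / HahnSeries.C y) := by
  have h := IsUnitOver.linear (s := -expSign ε) ((expSign_cases ε).symm.imp (by omega) (by omega))
    hx hy.inv
  rwa [map_inv₀, mul_comm, ← div_eq_mul_inv] at h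

theorem isUnitOver_sub_div' {a : I → ℕ} {S : Subalgebra ℂ (CoeffField a)} (ε : Bool)
    {x y : CoeffField a} (hx : IsUnitIn S x) (hy : IsUnitIn S y) :
    IsUnitOver S (min 0 (expSign ε))
      (HahnSeries.C x - HahnSeries.C y / (zSeries a ε : LaurentSeries (CoeffField a))) := by
  have h := IsUnitOver.linear (s := expSign ε) (expSign_cases ε) hx hy
  rwa [← neg_neg (expSign ε), ← inv_monomial, ← div_eq_mul_inv, neg_neg] at h

theorem isUnitIn_w {a : I → ℕ} (v : Vars a) : IsUnitIn (Q.coeffRing (Q.ATilde a)) (w v) :=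
  ⟨(wVar v).ne_zero, Q.w_mem v, Q.w_inv_mem v⟩

theorem isUnitIn_P {a : I → ℕ} (ε : Bool) (i j : I) :
    IsUnitIn (Q.coeffRing (Q.ATilde a)) (P ε i j) :=
  ⟨(pVar ε i j).ne_zero, Q.P_mem ε i j, Q.P_inv_mem ε i j⟩

theorem mul_div_mul_eq_mul_inv_div {L : Type*} [Field L] (x y z p : L) :
    x * y / (z * p) = x * y * p⁻¹ / z := by
  rw [div_eq_mul_inv, mul_inv, div_eq_mul_inv]
  ring

theorem isUnitOver_psiFactor {a : I → ℕ} (ε : Bool) (i j : I) {y : CoeffField a}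
    {S : Subalgebra ℂ (CoeffField a)} (hy : IsUnitIn S y) :
    IsUnitOver S ((∑ _e ∈ Q.edges i j, min 0 (-expSign ε)) + (∑ _e ∈ Q.edges j i, min 0 (expSign ε)) -
        if i = j then min 0 (-expSign ε) + min 0 (expSign ε) else 0)
      (Q.psiFactor i j (zSeries a ε : LaurentSeries (CoeffField a)) (HahnSeries.C y)) := by
  have hc : ∀ c : ℂˣ, IsUnitIn S (algebraMap ℂ (CoeffField a) c) := fun c => IsUnitIn.const c.ne_zero
  have h2 : ∀ c : ℂˣ, IsUnitOver S (min 0 (expSign ε)) (1 - HahnSeries.C y *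
      algebraMap ℂ (LaurentSeries (CoeffField a)) c /
        ((zSeries a ε : LaurentSeries (CoeffField a)) * Q.qIn (LaurentSeries (CoeffField a)))) := by
    intro c
    have := isUnitOver_sub_div' ε (IsUnitIn.one (S := S)) ((hy.mul (hc c)).mul (hc Q.q).inv)
    rw [map_one, map_mul, map_mul, map_inv₀] at this
    rw [qIn, algebraMap_complex, algebraMap_complex]
    convert this using 2
    exact mul_div_mul_eq_mul_inv_div (L := LaurentSeries (CoeffField a)) _ _ _ _
  refine IsUnitOver.div (IsUnitOver.mul (IsUnitOver.prod fun e _ => ?_)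
    (IsUnitOver.prod fun e _ => h2 (Q.t e))) ?_
  · rw [tIn, algebraMap_complex, ← map_inv₀]
    exact isUnitOver_sub_div ε (hc (Q.t e)).inv hy
  · split_ifs
    · refine IsUnitOver.mul ?_ ?_
      · have := isUnitOver_sub_div ε (IsUnitIn.one (S := S)) hy
        rwa [map_one] at this
      · have := h2 1
        rwa [Units.val_one, map_one, mul_one] at this
    · exact IsUnitOver.one

theorem sum_if_eq {a : I → ℕ} {M : Type*} [AddCommMonoid M] (i : I) (f : Vars a → M) :
    (∑ v : Vars a, if i = v.1 then f v else 0) = ∑ r, f ⟨i, r⟩ := by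
  rw [Fintype.sum_sigma, Finset.sum_eq_single i]
  · simp only [if_true]
  · intro j _ hj
    exact Finset.sum_eq_zero fun s _ => if_neg hj.symm
  · intro h
    exact absurd (Finset.mem_univ _) h

/-- Every linear factor is a unit series of order 0 or -1, depending on the direction of expansion.
The orders add up, and the coefficients lie in the coefficient ring because the w, the formal powers
and the nonzero constants are units there. -/
theorem isUnitOver_psiFun (hQ : Q.Admissible) (ε : Bool) (i : I) :
    IsUnitOver (Q.coeffRing (Q.ATilde d.a)) (d.N i * min 0 (expSign ε) +
      ∑ j, (d.a j : ℤ) * (((Q.edges i j).card : ℤ) * min 0 (-expSign ε) +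
        ((Q.edges j i).card : ℤ) * min 0 (expSign ε)) + d.a i)
      (Q.psiFun d i (zSeries d.a ε : LaurentSeries (CoeffField d.a))) := by
  have h1 : IsUnitOver (Q.coeffRing (Q.ATilde d.a)) 0
      (Q.psiConst (LaurentSeries (CoeffField d.a)) i) := by
    rw [psiConst_eq, algebraMap_complex]
    exact IsUnitOver.C (IsUnitIn.const (Q.psiConst_ne_zero hQ i))
  have h2 : IsUnitOver (Q.coeffRing (Q.ATilde d.a)) 0 (∏ j ∈ Finset.univ.erase i,
      algebraMap (CoeffField d.a) (LaurentSeries (CoeffField d.a)) (P true i j * P false i j)) := by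
    rw [← map_prod, algebraMap_eq_C]
    exact IsUnitOver.C (IsUnitIn.prod fun j _ => (Q.isUnitIn_P _ _ _).mul (Q.isUnitIn_P _ _ _))
  have h3 : IsUnitOver (Q.coeffRing (Q.ATilde d.a)) (∑ _r : Fin (d.N i), min 0 (expSign ε))
      (zFun d i (zSeries d.a ε : LaurentSeries (CoeffField d.a))) := by
    refine IsUnitOver.prod fun r _ => ?_
    have := isUnitOver_sub_div' ε (IsUnitIn.one (S := Q.coeffRing (Q.ATilde d.a)))
      (IsUnitIn.const (d.z i r).ne_zero)
    rwa [map_one, ← algebraMap_complex] at this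
  have h4 := IsUnitOver.prod (T := Finset.univ) fun (v : Vars d.a) _ =>
    Q.isUnitOver_psiFactor ε i v.1 (Q.isUnitIn_w v)
  have h := (h1.mul h2).mul (h3.mul h4)
  rw [psiFun_eq]
  simp only [algebraMap_eq_C] at h ⊢
  convert h using 1
  -- In either expansion exactly one of the two denominators attached to a point of colour i has
  -- order -1. This is the origin of the summand a_i.
  have hs : min 0 (-expSign ε) + min 0 (expSign ε) = -1 := by cases ε <;> simp [expSign]
  rw [hs, zero_add, zero_add, add_assoc]
  simp only [Finset.sum_const, nsmul_eq_mul, Finset.card_univ, Fintype.card_fin]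
  congr 1
  rw [Finset.sum_sub_distrib, sum_if_eq i fun _ => (-1 : ℤ), Fintype.sum_sigma]
  simp only [Finset.sum_const, nsmul_eq_mul, Finset.card_univ, Fintype.card_fin, mul_neg, mul_one,
    sub_neg_eq_add]

theorem isUnitOver_psiFun_true (hQ : Q.Admissible) (i : I) :
    IsUnitOver (Q.coeffRing (Q.ATilde d.a)) (-Q.bPlus d i)
      (Q.psiFun d i (zSeries d.a true : LaurentSeries (CoeffField d.a))) := by
  convert Q.isUnitOver_psiFun d hQ true i using 1
  simp [bPlus, expSign]
  ring

theorem isUnitOver_psiFun_false (hQ : Q.Admissible) (i : I) :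
    IsUnitOver (Q.coeffRing (Q.ATilde d.a)) (-Q.bMinus d i)
      (Q.psiFun d i (zSeries d.a false : LaurentSeries (CoeffField d.a))) := by
  convert Q.isUnitOver_psiFun d hQ false i using 1
  simp [bMinus, expSign]
  ring

theorem psiCoeff_mem (hQ : Q.Admissible) (ε : Bool) (i : I) (n : ℤ) :
    Q.psiCoeff d ε i n ∈ Q.coeffRing (Q.ATilde d.a) := by
  rw [psiCoeff_eq]
  exact (Q.isUnitOver_psiFun d hQ ε i).coeff_mem _

theorem psiCoeff_true_eq_zero (hQ : Q.Admissible) {i : I} {n : ℤ} (h : n < -Q.bPlus d i) :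
    Q.psiCoeff d true i n = 0 := by
  rw [psiCoeff_eq]
  exact (Q.isUnitOver_psiFun_true d hQ i).coeff_eq_zero (by simpa [expSign] using h)

theorem psiCoeff_false_eq_zero (hQ : Q.Admissible) {i : I} {n : ℤ} (h : Q.bMinus d i < n) :
    Q.psiCoeff d false i n = 0 := by
  rw [psiCoeff_eq]
  exact (Q.isUnitOver_psiFun_false d hQ i).coeff_eq_zero (by simpa [expSign] using h)

/-- The exponent of the leading coefficient of `ψ`. -/
def leadIndex (ε : Bool) (i : I) : ℤ := if ε then -Q.bPlus d i else Q.bMinus d i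

theorem isUnitIn_psiCoeff (hQ : Q.Admissible) (ε : Bool) (i : I) :
    IsUnitIn (Q.coeffRing (Q.ATilde d.a)) (Q.psiCoeff d ε i (Q.leadIndex d ε i)) := by
  rw [psiCoeff_eq]
  cases ε with
  | true =>
    have := (Q.isUnitOver_psiFun_true d hQ i).isUnitIn_coeff
    simpa [expSign, leadIndex] using this
  | false =>
    have := (Q.isUnitOver_psiFun_false d hQ i).isUnitIn_coeff
    simpa [expSign, leadIndex] using this

/-! ### The relations between `ψ` and the generators `e`, `f` -/

/-- A constant Laurent series, as a unit. -/
def constUnit {K : Type*} [Field K] (y : Kˣ) : (LaurentSeries K)ˣ :=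
  Units.map (HahnSeries.C : K →+* LaurentSeries K).toMonoidHom y

theorem coe_div {K : Type*} [Field K] (x y : (LaurentSeries K)ˣ) :
    ((x / y : (LaurentSeries K)ˣ) : LaurentSeries K) = x / y := Units.val_div_eq_div_val _ _

theorem coe_monomialUnit_div_constUnit_zpow {K : Type*} [Field K] (s n : ℤ) (y : Kˣ) :
    (((monomialUnit K s / constUnit y) ^ n : (LaurentSeries K)ˣ) : LaurentSeries K) =
      HahnSeries.single (s * n) ((y : K) ^ (-n)) := by
  rw [constUnit, div_zpow, ← map_zpow, div_eq_mul_inv, ← map_inv, monomialUnit_zpow,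
    Units.val_mul, coe_monomialUnit, ← zpow_neg]
  change HahnSeries.single _ 1 * HahnSeries.C ((y ^ (-n) : Kˣ) : K) = _
  rw [HahnSeries.C_apply, HahnSeries.single_mul_single, one_mul, add_zero,
    Units.val_zpow_eq_zpow_val]

/-- The analogue of `seriesCoeff_monomial` when one variable is a formal expansion parameter: the
shift of both indices is multiplication by p(z/y). -/
theorem seriesCoeff_monomial_coeff {K : Type*} [Field K] [Algebra ℂ K] (σ : ℤ)
    (p : LaurentPolynomial ℂ) (f : LaurentSeries K) (y : Kˣ) (c : K) (r s : ℤ) :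
    seriesCoeff p (fun r s => f.coeff (σ * r) * ((y : K) ^ s * c)) r s =
      (LaurentPolynomial.evalUnit (monomialUnit K (-σ) / constUnit y) p *
        f).coeff (σ * r) * ((y : K) ^ s * c) := by
  rw [LaurentPolynomial.evalUnit_apply, seriesCoeff, Finsupp.sum, Finsupp.sum, Finset.sum_mul,
    HahnSeries.coeff_sum, Finset.sum_mul]
  refine Finset.sum_congr rfl fun n _ => ?_
  rw [coe_monomialUnit_div_constUnit_zpow, Algebra.smul_def (A := LaurentSeries K),
    algebraMap_complex, HahnSeries.C_apply, HahnSeries.single_mul_single,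
    HahnSeries.coeff_single_mul, Algebra.smul_def, zero_add, zpow_neg, zpow_sub₀ y.ne_zero,
    show σ * r - -σ * n = σ * (r + n) by ring]
  ring

theorem seriesCoeff_coeff {a : I → ℕ} (ε : Bool) (p : LaurentPolynomial ℂ)
    (f : LaurentSeries (CoeffField a)) (y : (CoeffField a)ˣ) (c : CoeffField a) (r s : ℤ) :
    seriesCoeff p (fun r s => f.coeff (expSign ε * r) * ((y : CoeffField a) ^ s * c)) r s =
      (LaurentPolynomial.evalUnit (zSeries a ε / constUnit y) p *
        f).coeff (expSign ε * r) * ((y : CoeffField a) ^ s * c) :=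
  seriesCoeff_monomial_coeff _ p f y c r s

/-- The operators with a given shift, as functions of the coefficient. -/
def dOpLinear {a : I → ℕ} (m : Vars a → ℤ) : CoeffField a →ₗ[ℂ] Q.DiffOp a where
  toFun c := Q.dOp c m
  map_add' _ _ := SkewMonoidAlgebra.single_add _ _ _
  map_smul' _ _ := (SkewMonoidAlgebra.smul_single _ _ _).symm

/-- Both sides are coefficients of a product of a Laurent polynomial with ψ or its shift, and the
two products coincide by `zeta_mul_psiFun`. -/
theorem psi_e_component (ε : Bool) (i : I) (u : Vars d.a) (c : CoeffField d.a) (r s : ℤ) :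
    seriesCoeff (Q.zetaR i u.1) (fun r s => Q.psiCoeff d ε i r * (w u ^ s * c)) r s =
      seriesCoeff (Q.zetaL i u.1) (fun r s => w u ^ s * c *
        Q.shiftHom (-Pi.single u 1) (Q.psiCoeff d ε i r)) r s := by
  have hz := (zSeries d.a ε).ne_zero
  have hw : HahnSeries.C (w u) ≠ (0 : LaurentSeries (CoeffField d.a)) :=
    HahnSeries.C_ne_zero (wVar u).ne_zero
  have hx : ((zSeries d.a ε / constUnit (wVar u) :
      (LaurentSeries (CoeffField d.a))ˣ) : LaurentSeries (CoeffField d.a)) =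
      (zSeries d.a ε : LaurentSeries (CoeffField d.a)) / HahnSeries.C (w u) := coe_div _ _
  have hne := zSeries_ne ε (w u)
  simp only [psiCoeff_eq]
  simp only [← coeff_mapCoeff, mul_comm _ ((mapCoeff _ _).coeff _)]
  rw [seriesCoeff_coeff, seriesCoeff_coeff,
    Q.evalUnit_zetaR_eq i u.1 _ _ _ hz hw hx (fun _ => hne),
    Q.evalUnit_zetaL_eq i u.1 _ _ _ hz hw hx (fun _ => hne), mul_assoc, mul_assoc,
    zeta_mul_psiFun]

/-- Applying D_u to the identity used for e replaces w_u by w_u/q and undoes the shift by D_u⁻¹ on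
the other side. -/
theorem psi_f_component (ε : Bool) (i : I) (u : Vars d.a) (c : CoeffField d.a) (r s : ℤ) :
    seriesCoeff (Q.zetaL i u.1) (fun r s => Q.psiCoeff d ε i r *
        ((w u / Q.qIn (CoeffField d.a)) ^ s * c)) r s =
      seriesCoeff (Q.zetaR i u.1) (fun r s => (w u / Q.qIn (CoeffField d.a)) ^ s * c *
        Q.shiftHom (Pi.single u 1) (Q.psiCoeff d ε i r)) r s := by
  have hq : Q.qIn (CoeffField d.a) ≠ 0 := Q.qIn_ne_zero
  let y : (CoeffField d.a)ˣ := Units.mk0 (w u / Q.qIn (CoeffField d.a))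
    (div_ne_zero (wVar u).ne_zero hq)
  have hy : w u / Q.qIn (CoeffField d.a) = (y : CoeffField d.a) := rfl
  have hz := (zSeries d.a ε).ne_zero
  have hw : HahnSeries.C (y : CoeffField d.a) ≠ (0 : LaurentSeries (CoeffField d.a)) :=
    HahnSeries.C_ne_zero y.ne_zero
  have hx : ((zSeries d.a ε / constUnit y :
      (LaurentSeries (CoeffField d.a))ˣ) : LaurentSeries (CoeffField d.a)) =
      (zSeries d.a ε : LaurentSeries (CoeffField d.a)) / HahnSeries.C (y : CoeffField d.a) :=
    coe_div _ _
  have hne := zSeries_ne ε (y : CoeffField d.a)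
  have key := congrArg (mapCoeff (Q.shiftHom (Pi.single u 1))) (Q.zeta_mul_psiFun d ε i u)
  have h1 : mapCoeff (Q.shiftHom (Pi.single u 1))
      (zSeries d.a ε : LaurentSeries (CoeffField d.a)) = zSeries d.a ε := mapCoeff_monomial _ _
  have h2 : mapCoeff (Q.shiftHom (Pi.single u 1)) (HahnSeries.C (w u)) =
      HahnSeries.C (y : CoeffField d.a) := by
    rw [mapCoeff_C, shiftHom_apply, shift_smul_w, Pi.single_eq_same, zpow_neg_one, ← div_eq_mul_inv, hy]
  have h3 : mapCoeff (Q.shiftHom (Pi.single u 1)) (mapCoeff (Q.shiftHom (-Pi.single u 1))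
      (Q.psiFun d i (zSeries d.a ε : LaurentSeries (CoeffField d.a)))) =
      Q.psiFun d i (zSeries d.a ε : LaurentSeries (CoeffField d.a)) := by
    ext n
    rw [coeff_mapCoeff, coeff_mapCoeff, shiftHom_neg]
  rw [map_mul, map_mul, map_zeta, map_zeta, h1, h2, h3] at key
  simp only [psiCoeff_eq, hy]
  simp only [← coeff_mapCoeff, mul_comm _ ((mapCoeff _ _).coeff _)]
  rw [seriesCoeff_coeff, seriesCoeff_coeff,
    Q.evalUnit_zetaR_eq i u.1 _ _ _ hz hw hx (fun _ => hne),
    Q.evalUnit_zetaL_eq i u.1 _ _ _ hz hw hx (fun _ => hne), mul_assoc, mul_assoc, key]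

theorem psi_e_relation (ε : Bool) (i j : I) (r s : ℤ) :
    seriesCoeff (Q.zetaR i j) (fun r s => Q.dOp (Q.psiCoeff d ε i r) 0 * Q.eImage d j s) r s =
      seriesCoeff (Q.zetaL i j) (fun r s => Q.eImage d j s * Q.dOp (Q.psiCoeff d ε i r) 0) r s := by
  simp only [eImage, Finset.mul_sum, Finset.sum_mul, dOp_mul, zero_add, add_zero, dMon_zero, one_smul]
  rw [seriesCoeff_sum, seriesCoeff_sum]
  refine Finset.sum_congr rfl fun x _ => ?_
  have h := congrArg (Q.dOpLinear (-Pi.single ⟨j, x⟩ 1))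
    (Q.psi_e_component d ε i ⟨j, x⟩ (Q.YPos d ⟨j, x⟩ (w ⟨j, x⟩)) r s)
  rw [map_seriesCoeff, map_seriesCoeff] at h
  exact h

theorem psi_f_relation (ε : Bool) (i j : I) (r s : ℤ) :
    seriesCoeff (Q.zetaL i j) (fun r s => Q.dOp (Q.psiCoeff d ε i r) 0 * Q.fImage d j s) r s =
      seriesCoeff (Q.zetaR i j) (fun r s => Q.fImage d j s * Q.dOp (Q.psiCoeff d ε i r) 0) r s := by
  simp only [fImage, Finset.mul_sum, Finset.sum_mul, dOp_mul, zero_add, add_zero, dMon_zero, one_smul]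
  rw [seriesCoeff_sum, seriesCoeff_sum]
  refine Finset.sum_congr rfl fun x _ => ?_
  have h := congrArg (Q.dOpLinear (Pi.single ⟨j, x⟩ 1)) (Q.psi_f_component d ε i ⟨j, x⟩
    (Q.YNeg d ⟨j, x⟩ (w ⟨j, x⟩ / Q.qIn (CoeffField d.a))) r s)
  rw [map_seriesCoeff, map_seriesCoeff] at h
  exact h

end WeightedQuiver

end

/-! ### Shifts of Y and Y', and ψ as a quotient with simple poles. -/

noncomputable section

namespace WeightedQuiver

variable {I E : Type*} [Fintype I] [DecidableEq I] [Fintype E] (Q : WeightedQuiver I E)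

/-! ### Commutation of distinct chains -/

theorem rev_chainRatio {L : Type*} [Field L] [Algebra ℂ L] (i j : I) (n : ℕ) {w z w' z' : L}
    (h : z / w = z' / w') : Q.rev.chainRatio i j n w z = Q.chainRatio j i n w' z' := by
  have e : ∀ (W Z : L), Z / (W * Q.qIn L ^ n) = Z / W / Q.qIn L ^ n := fun W Z => by rw [div_div]
  have e' : ∀ (W Z : L), Z / (W * Q.rev.qIn L ^ n) = Z / W / Q.qIn L ^ n := e
  simp only [chainRatio, rev_edges, e, e', h, eq_comm (a := j)]
  rfl

/-- The case of a single step of one other chain: in the general shift formula only the ratio of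
that chain is nontrivial. -/
theorem ChainModel.y_eq_shift_smul {Q : WeightedQuiver I E} {a : I → ℕ} {L G : Type*} [Field L]
    [Algebra ℂ L] [CommGroup G] [MulSemiringAction G L] [SMulCommClass G ℂ L]
    (X : Q.ChainModel a L G) {u v : Vars a} (huv : u ≠ v) :
    X.y u 0 = X.shift (unitSplit v) • X.y u 0 * Q.chainRatio v.1 u.1 1 (X.pos v : L) (X.pos u) := by
  have h := X.y_shift (unitSplit v) u 0
  rw [unitSplit_of_ne huv, zero_add, pow_zero, mul_one,
    Finset.prod_eq_single v, unitSplit_self] at h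
  · exact h
  · intro x hx hxv
    rw [unitSplit_of_ne hxv]
    exact Q.chainRatio_zero _ _ (X.pos x).ne_zero (X.pos_ne u x (Finset.ne_of_mem_erase hx).symm)
  · intro hv
    exact absurd (Finset.mem_erase.2 ⟨huv.symm, Finset.mem_univ _⟩) hv

theorem map_chainRatio {L M : Type*} [Field L] [Algebra ℂ L] [Field M] [Algebra ℂ M] (f : L →ₐ[ℂ] M)
    (i j : I) (n : ℕ) (w z : L) : f (Q.chainRatio i j n w z) = Q.chainRatio i j n (f w) (f z) := by
  unfold chainRatio
  split_ifs <;> simp only [map_div₀, map_mul, map_prod, map_sub, map_inv₀, map_tIn, map_qIn, map_one,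
    map_pow]

variable (d : GKLOData I)

theorem shiftHom_w {a : I → ℕ} (m : Vars a → ℤ) (v : Vars a) :
    Q.shiftHom m (w v) = w v * Q.qIn (CoeffField a) ^ (-m v) := Q.shift_smul_w m v

theorem shiftHom_w_of_ne {a : I → ℕ} {u v : Vars a} (h : v ≠ u) (c : ℤ) :
    Q.shiftHom (Pi.single u c) (w v) = w v := by
  rw [shiftHom_w, Pi.single_eq_of_ne h, neg_zero, zpow_zero, mul_one]

theorem shiftHom_w_neg {a : I → ℕ} (u : Vars a) :
    Q.shiftHom (-Pi.single u 1) (w u) = w u * Q.qIn (CoeffField a) := by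
  rw [shiftHom_w, Pi.neg_apply, Pi.single_eq_same, neg_neg, zpow_one]

theorem shiftHom_w_pos {a : I → ℕ} (u : Vars a) :
    Q.shiftHom (Pi.single u 1) (w u) = w u / Q.qIn (CoeffField a) := by
  rw [shiftHom_w, Pi.single_eq_same, zpow_neg_one, div_eq_mul_inv]

theorem shiftHom_P_of_ne {a : I → ℕ} {u : Vars a} {j : I} (h : j ≠ u.1) (c : ℤ) (ε : Bool) (i : I) :
    Q.shiftHom (Pi.single u c) (P ε i j) = P ε i j := by
  rw [shiftHom_apply, shift_smul_P, Finset.sum_eq_zero, neg_zero, zpow_zero, mul_one]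
  exact fun s _ => Pi.single_eq_of_ne (fun h' => h (congrArg Sigma.fst h')) _

theorem shiftHom_YPos_of_ne {u v : Vars d.a} (huv : u ≠ v) :
    Q.shiftHom (Pi.single v 1) (Q.YPos d u (w u)) = Q.YPos d u (w u) *
      Q.chainRatio v.1 u.1 1 (w v / Q.qIn (CoeffField d.a)) (w u) := by
  have h := (Q.posModel d).y_eq_shift_smul huv
  have h1 : (Q.posModel d).shift (unitSplit v) = Q.dMon (-Pi.single v 1) := by
    rw [← coe_unitSplit]
    rfl
  have h2 : (Q.ptPos u 0 : CoeffField d.a) = w u := by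
    rw [ptPos, pow_zero, mul_one]
  have hp : ∀ x, ((Q.posModel d).pos x : CoeffField d.a) = w x := fun _ => rfl
  rw [h1, posModel_y, h2, hp, hp, ← shiftHom_apply] at h
  have h3 := congrArg (Q.shiftHom (Pi.single v 1)) h
  rwa [map_mul, shiftHom_neg, map_chainRatio, shiftHom_w_pos, Q.shiftHom_w_of_ne huv] at h3

/-- The ratio is the one of `shiftHom_YPos_of_ne`; this coincidence makes e and f at different
points commute. -/
theorem shiftHom_YNeg_of_ne {u v : Vars d.a} (huv : u ≠ v) :
    Q.shiftHom (-Pi.single u 1) (Q.YNeg d v (w v / Q.qIn (CoeffField d.a))) =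
      Q.YNeg d v (w v / Q.qIn (CoeffField d.a)) *
      Q.chainRatio v.1 u.1 1 (w v / Q.qIn (CoeffField d.a)) (w u) := by
  have hq : Q.qIn (CoeffField d.a) ≠ 0 := Q.qIn_ne_zero
  have hu := (wVar u).ne_zero
  have hv := (wVar v).ne_zero
  have h := (Q.negModel d).y_eq_shift_smul huv.symm
  have h1 : (Q.negModel d).shift (unitSplit u) = Q.dMon (Pi.single u 1) := by
    rw [← coe_unitSplit]
    rfl
  have h2 : (Q.ptNeg v 0 : CoeffField d.a) = w v / Q.qIn (CoeffField d.a) := by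
    rw [ptNeg, zero_add, pow_one, div_eq_mul_inv, Units.val_mul, Units.val_inv_eq_inv_val]
    rfl
  rw [h1, negModel_y, h2, ← shiftHom_apply] at h
  have h3 := congrArg (Q.shiftHom (-Pi.single u 1)) h
  have h4 := Q.shiftHom_neg (-Pi.single u 1) (Q.YNeg d v (w v / Q.qIn (CoeffField d.a)))
  rw [neg_neg] at h4
  rw [map_mul, h4, map_chainRatio] at h3
  rw [h3]
  congr 1
  apply Q.rev_chainRatio
  rw [negModel_pos, negModel_pos, map_div₀, map_div₀, map_qIn, shiftHom_w_neg, ← Pi.single_neg,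
    Q.shiftHom_w_of_ne huv.symm]
  field_simp

/-- Apart from its argument, Y_u involves neither w_u nor formal powers of its own colour. -/
theorem shiftHom_YPos (u : Vars d.a) (c : ℤ) (z : CoeffField d.a) :
    Q.shiftHom (Pi.single u c) (Q.YPos d u z) = Q.YPos d u (Q.shiftHom (Pi.single u c) z) := by
  rw [YPos_eq, YPos_eq, map_mul, map_mul, map_prod, map_prod, map_zFun,
    Finset.prod_congr rfl fun j hj => Q.shiftHom_P_of_ne (Finset.ne_of_mem_erase hj) c _ _]
  congr 1
  refine Finset.prod_congr rfl fun v hv => ?_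
  rw [map_edgeFactor, Q.shiftHom_w_of_ne (Finset.ne_of_mem_erase hv)]

theorem shiftHom_YNeg (u : Vars d.a) (c : ℤ) (z : CoeffField d.a) :
    Q.shiftHom (Pi.single u c) (Q.YNeg d u z) = Q.YNeg d u (Q.shiftHom (Pi.single u c) z) := by
  rw [← inv_inv z, YNeg_eq, map_inv₀, YNeg_eq, map_mul, map_mul, map_prod, map_prod, map_prod,
    Finset.prod_congr rfl fun j hj => Q.shiftHom_P_of_ne (Finset.ne_of_mem_erase hj) c _ _]
  simp only [map_prod, map_tIn]
  congr 1
  refine Finset.prod_congr rfl fun v hv => ?_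
  rw [map_edgeFactor, map_div₀, map_qIn, Q.shiftHom_w_of_ne (Finset.ne_of_mem_erase hv)]

/-! ### The residues of `ψ` -/

section Numerator

variable {L : Type*} [Field L] [Algebra ℂ L]

/-- The numerator of `psiFactor`. -/
def psiNumer (i j : I) (z w : L) : L :=
  (∏ e ∈ Q.edges i j, ((Q.tIn L e)⁻¹ - z / w)) *
    (∏ e ∈ Q.edges j i, (1 - w * Q.tIn L e / (z * Q.qIn L))) * if i = j then -(w * z) else 1

theorem psiFactor_eq_div (i j : I) {z w : L} (hz : z ≠ 0) (hw : w ≠ 0) :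
    Q.psiFactor i j z w =
      Q.psiNumer i j z w / if i = j then (z - w) * (z - w / Q.qIn L) else 1 := by
  have hq := Q.qIn_ne_zero (L := L)
  rw [psiFactor, psiNumer]
  split_ifs
  · have e : (1 - z / w) * (1 - w / (z * Q.qIn L)) = (z - w) * (z - w / Q.qIn L) / -(w * z) := by
      field_simp
      ring
    rw [e, div_div_eq_mul_div]
  · rw [mul_one]

end Numerator

/-- Each other point contributes its i → j edges through Y and its j → i edges through Y', which
together form its factor of ψ. So the product is ψ without its constant and without the factor of u.
-/
theorem YPos_mul_YNeg (u : Vars d.a) {z : CoeffField d.a} (hz : z ≠ 0) :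
    Q.YPos d u z * Q.YNeg d u z = (∏ j ∈ Finset.univ.erase u.1, (P true u.1 j * P false u.1 j)) *
      zFun d u.1 z * ∏ v ∈ Finset.univ.erase u, Q.psiFactor u.1 v.1 z (w v) := by
  have hq : Q.qIn (CoeffField d.a) ≠ 0 := Q.qIn_ne_zero
  have key : ∀ v : Vars d.a, Q.psiFactor u.1 v.1 z (w v) = Q.edgeFactor u.1 v.1 z (w v) *
      ((∏ e ∈ Q.edges v.1 u.1, Q.tIn (CoeffField d.a) e) *
        Q.rev.edgeFactor u.1 v.1 z⁻¹ (Q.qIn (CoeffField d.a) / w v)) := by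
    intro v
    have hw := (wVar v).ne_zero
    have h1 : ∏ e ∈ Q.edges v.1 u.1,
        (1 - w v * Q.tIn (CoeffField d.a) e / (z * Q.qIn (CoeffField d.a))) =
        (∏ e ∈ Q.edges v.1 u.1, Q.tIn (CoeffField d.a) e) * ∏ e ∈ Q.edges v.1 u.1,
          ((Q.tIn (CoeffField d.a) e)⁻¹ - z⁻¹ / (Q.qIn (CoeffField d.a) / w v)) := by
      rw [← Finset.prod_mul_distrib]
      refine Finset.prod_congr rfl fun e _ => ?_
      have := Q.tIn_ne_zero (L := CoeffField d.a) e
      field_simp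
    have h2 : 1 - z⁻¹ / (Q.qIn (CoeffField d.a) / w v) = 1 - w v / (z * Q.qIn (CoeffField d.a)) := by
      field_simp
    rw [psiFactor, edgeFactor, edgeFactor, rev_edges, h1, h2]
    change _ = _ * (_ * ((∏ e ∈ Q.edges v.1 u.1,
          ((Q.tIn (CoeffField d.a) e)⁻¹ - z⁻¹ / (Q.qIn (CoeffField d.a) / w v))) / _))
    split_ifs
    · rw [← mul_div_assoc, div_mul_div_comm]
    · rw [div_one, div_one, div_one]
  have h : Q.YNeg d u z = Q.YNeg d u z⁻¹⁻¹ := by rw [inv_inv]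
  rw [h, YPos_eq, YNeg_eq, Finset.prod_congr rfl fun v _ => key v, Finset.prod_mul_distrib,
    Finset.prod_mul_distrib, Finset.prod_mul_distrib]
  ring

/-- The poles of `ψ_i(z)`. -/
def psiPole {a : I → ℕ} (i : I) (p : Fin (a i) × Bool) : (CoeffField a)ˣ :=
  wVar ⟨i, p.1⟩ * if p.2 then 1 else
    (Units.map (algebraMap ℂ (CoeffField a) : ℂ →* CoeffField a) Q.q)⁻¹

theorem psiPole_true {a : I → ℕ} (i : I) (r : Fin (a i)) :
    (Q.psiPole i (r, true) : CoeffField a) = w ⟨i, r⟩ := by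
  rw [psiPole, if_pos rfl, mul_one]

theorem psiPole_false {a : I → ℕ} (i : I) (r : Fin (a i)) :
    (Q.psiPole i (r, false) : CoeffField a) = w ⟨i, r⟩ / Q.qIn (CoeffField a) := by
  rw [psiPole, if_neg (by simp), div_eq_mul_inv, Units.val_mul, Units.val_inv_eq_inv_val]
  rfl

theorem qIn_ne_one (hQ : Q.Admissible) (L : Type*) [Field L] [Algebra ℂ L] : Q.qIn L ≠ 1 := by
  intro h
  refine Q.inv_q_sub_one_ne_zero hQ ?_
  rw [sub_eq_zero, inv_eq_one]
  exact (algebraMap ℂ L).injective (h.trans (map_one _).symm)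

/-- Different w's are not proportional by constants, and w ≠ w/q because q ≠ 1. So all poles are
simple. -/
theorem psiPole_injective (hQ : Q.Admissible) {a : I → ℕ} (i : I) :
    Function.Injective (Q.psiPole (a := a) i) := by
  have hc : ∀ p : Fin (a i) × Bool, ∃ c : ℂ, c ≠ 0 ∧
      (Q.psiPole i p : CoeffField a) = w ⟨i, p.1⟩ * algebraMap ℂ (CoeffField a) c := by
    rintro ⟨r, _ | _⟩
    · refine ⟨(Q.q : ℂ)⁻¹, inv_ne_zero Q.q.ne_zero, ?_⟩
      rw [psiPole_false, map_inv₀, div_eq_mul_inv]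
    · exact ⟨1, one_ne_zero, by rw [psiPole_true, map_one, mul_one]⟩
  intro p p' h
  have h' := congrArg (fun x : (CoeffField a)ˣ => (x : CoeffField a)) h
  have hr : p.1 = p'.1 := by
    by_contra hne
    obtain ⟨c', -, hc'⟩ := hc p'
    obtain ⟨c, hc0, hc⟩ := hc p
    simp only [hc, hc'] at h'
    refine w_ne (u := ⟨i, p.1⟩) (v := ⟨i, p'.1⟩) (by simpa using hne) (c' / c) ?_
    have := (map_ne_zero (algebraMap ℂ (CoeffField a))).2 hc0
    rw [map_div₀]
    field_simp
    linear_combination h'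
  obtain ⟨r, b⟩ := p
  obtain ⟨r', b'⟩ := p'
  obtain rfl : r = r' := hr
  have hne : (w ⟨i, r⟩ : CoeffField a) / Q.qIn (CoeffField a) ≠ w ⟨i, r⟩ := fun h0 =>
    Q.qIn_ne_one hQ (CoeffField a) (mul_left_cancel₀ (wVar ⟨i, r⟩).ne_zero (by
      rw [mul_one]
      exact ((div_eq_iff Q.qIn_ne_zero).1 h0).symm))
  cases b <;> cases b'
  · rfl
  · simp only [psiPole_true, psiPole_false] at h'
    exact absurd h' hne
  · simp only [psiPole_true, psiPole_false] at h'
    exact absurd h'.symm hne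
  · rfl

section NumeratorPolynomial

open LaurentPolynomial

/-- The numerator of `ψ_i(z)` as a Laurent polynomial in `z`. -/
def psiNumerPoly (i : I) : LaurentPolynomial (CoeffField d.a) :=
  C (Q.psiConst (CoeffField d.a) i * ∏ j ∈ Finset.univ.erase i, (P true i j * P false i j)) *
    ((∏ r, (1 - C (algebraMap ℂ (CoeffField d.a) (d.z i r)) * T (-1))) *
      ∏ v : Vars d.a,
        ((∏ e ∈ Q.edges i v.1, (C (Q.tIn (CoeffField d.a) e)⁻¹ - C (w v)⁻¹ * T 1)) *
          (∏ e ∈ Q.edges v.1 i,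
            (1 - C (w v * Q.tIn (CoeffField d.a) e / Q.qIn (CoeffField d.a)) * T (-1))) *
          if i = v.1 then -(C (w v) * T 1) else 1))

theorem evalUnit_psiNumerPoly {L : Type*} [Field L] [Algebra ℂ L] [Algebra (CoeffField d.a) L]
    [IsScalarTower ℂ (CoeffField d.a) L] (i : I) (x : Lˣ) :
    evalUnit x (Q.psiNumerPoly d i) = Q.psiConst L i *
      (∏ j ∈ Finset.univ.erase i, algebraMap (CoeffField d.a) L (P true i j * P false i j)) *
      (zFun d i (x : L) * ∏ v : Vars d.a,
        Q.psiNumer i v.1 (x : L) (algebraMap (CoeffField d.a) L (w v))) := by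
  have hs : ∀ c : ℂ, algebraMap (CoeffField d.a) L (algebraMap ℂ (CoeffField d.a) c) =
      algebraMap ℂ L c := fun c => (IsScalarTower.algebraMap_apply ℂ (CoeffField d.a) L c).symm
  rw [psiNumerPoly, map_mul, evalUnit_C, map_mul, map_prod, psiConst_eq, hs, ← psiConst_eq]
  congr 1
  rw [map_mul, map_prod, map_prod]
  congr 1
  · refine Finset.prod_congr rfl fun r _ => ?_
    rw [map_sub, map_one, map_mul, evalUnit_C, evalUnit_T, hs, zpow_neg_one,
      Units.val_inv_eq_inv_val, ← div_eq_mul_inv]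
  · refine Finset.prod_congr rfl fun v _ => ?_
    rw [psiNumer, map_mul, map_mul, map_prod, map_prod]
    refine congrArg₂ _ (congrArg₂ _ ?_ ?_) ?_
    · refine Finset.prod_congr rfl fun e _ => ?_
      rw [map_sub, map_mul, evalUnit_C, evalUnit_C, evalUnit_T, zpow_one, map_inv₀, map_inv₀, tIn,
        hs, div_eq_inv_mul]
    · refine Finset.prod_congr rfl fun e _ => ?_
      rw [map_sub, map_one, map_mul, evalUnit_C, evalUnit_T, zpow_neg_one,
        Units.val_inv_eq_inv_val, map_div₀, map_mul, tIn, qIn, hs, hs, ← div_eq_mul_inv, div_div,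
        mul_comm (x : L)]
    · split_ifs
      · rw [map_neg, map_mul, evalUnit_C, evalUnit_T, zpow_one]
      · rw [map_one]

theorem prod_sub_psiPole {a : I → ℕ} {L : Type*} [Field L] [Algebra ℂ L] [Algebra (CoeffField a) L]
    [IsScalarTower ℂ (CoeffField a) L] (i : I) (x : L) :
    ∏ p : Fin (a i) × Bool, (x - algebraMap (CoeffField a) L (Q.psiPole i p : CoeffField a)) = ∏ v : Vars a,
      if i = v.1 then (x - algebraMap (CoeffField a) L (w v)) *
        (x - algebraMap (CoeffField a) L (w v) / Q.qIn L) else 1 := by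
  rw [prod_if_eq i fun v : Vars a => (x - algebraMap (CoeffField a) L (w v)) *
    (x - algebraMap (CoeffField a) L (w v) / Q.qIn L), Fintype.prod_prod_type]
  refine Finset.prod_congr rfl fun r _ => ?_
  rw [Fintype.prod_bool, psiPole_true, psiPole_false, map_div₀, qIn,
    ← IsScalarTower.algebraMap_apply]

theorem psiFun_eq_div {L : Type*} [Field L] [Algebra ℂ L] [Algebra (CoeffField d.a) L]
    [IsScalarTower ℂ (CoeffField d.a) L] (i : I) (x : Lˣ) :
    Q.psiFun d i (x : L) = evalUnit x (Q.psiNumerPoly d i) /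
      ∏ p : Fin (d.a i) × Bool, ((x : L) - algebraMap (CoeffField d.a) L (Q.psiPole i p : CoeffField d.a)) := by
  rw [psiFun_eq, evalUnit_psiNumerPoly, prod_sub_psiPole, mul_div_assoc, mul_div_assoc,
    ← Finset.prod_div_distrib]
  congr 2
  refine Finset.prod_congr rfl fun v _ => ?_
  exact Q.psiFactor_eq_div _ _ x.ne_zero ((map_ne_zero _).2 (wVar v).ne_zero)

end NumeratorPolynomial

end WeightedQuiver

end

/-! ### Contributions of the poles of ψ, and the commutator of e and f. -/

noncomputable section

namespace WeightedQuiver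

variable {I E : Type*} [Fintype I] [DecidableEq I] [Fintype E] (Q : WeightedQuiver I E)
  (d : GKLOData I)

/-- At z = w the loop factors become (1/t_e - 1)(1 - t_e/q). The constant of ψ is chosen to cancel
these and the diagonal part. -/
theorem inv_mul_psiConst_mul_psiNumer (hQ : Q.Admissible) {L : Type*} [Field L] [Algebra ℂ L] (i : I)
    {w : L} (hw : w ≠ 0) :
    w⁻¹ * (Q.psiConst L i * Q.psiNumer i i w w) / (w - w / Q.qIn L) = 1 := by
  have hq := Q.qIn_ne_zero (L := L)
  have hq1 := Q.qIn_ne_one hQ L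
  have h0 : (∏ e ∈ Q.edges i i, (((Q.tIn L e)⁻¹ - 1) * (1 - Q.tIn L e / Q.qIn L))) ≠ 0 := by
    refine Finset.prod_ne_zero_iff.2 fun e _ => ?_
    have := (map_ne_zero (algebraMap ℂ L)).2 (Q.loop_factor_ne_zero hQ e)
    simpa only [map_mul, map_sub, map_one, map_inv₀, map_div₀] using this
  have h1 : (∏ e ∈ Q.edges i i, ((Q.tIn L e)⁻¹ - w / w)) *
      (∏ e ∈ Q.edges i i, (1 - w * Q.tIn L e / (w * Q.qIn L))) =
      ∏ e ∈ Q.edges i i, (((Q.tIn L e)⁻¹ - 1) * (1 - Q.tIn L e / Q.qIn L)) := by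
    rw [← Finset.prod_mul_distrib]
    refine Finset.prod_congr rfl fun e _ => ?_
    rw [div_self hw, mul_div_mul_left _ _ hw]
  rw [psiConst, psiNumer, h1, if_pos rfl]
  generalize (∏ e ∈ Q.edges i i, (((Q.tIn L e)⁻¹ - 1) * (1 - Q.tIn L e / Q.qIn L)) : L) = A at *
  have h2 : Q.qIn L - 1 ≠ 0 := sub_ne_zero.2 hq1
  have e1 : w - w / Q.qIn L = w * (Q.qIn L - 1) / Q.qIn L := by field_simp
  rw [e1]
  field_simp
  ring

/-- At z = w/q the two loop products become those at z = w with their roles exchanged, so the same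
constant appears. Only the sign of the difference of the two poles changes. -/
theorem inv_mul_psiConst_mul_psiNumer_div (hQ : Q.Admissible) {L : Type*} [Field L] [Algebra ℂ L]
    (i : I) {w : L} (hw : w ≠ 0) :
    (w / Q.qIn L)⁻¹ * (Q.psiConst L i * Q.psiNumer i i (w / Q.qIn L) w) / (w / Q.qIn L - w) = -1 := by
  have hq := Q.qIn_ne_zero (L := L)
  have hq1 := Q.qIn_ne_one hQ L
  have h0 : (∏ e ∈ Q.edges i i, (((Q.tIn L e)⁻¹ - 1) * (1 - Q.tIn L e / Q.qIn L))) ≠ 0 := by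
    refine Finset.prod_ne_zero_iff.2 fun e _ => ?_
    have := (map_ne_zero (algebraMap ℂ L)).2 (Q.loop_factor_ne_zero hQ e)
    simpa only [map_mul, map_sub, map_one, map_inv₀, map_div₀] using this
  have h1 : (∏ e ∈ Q.edges i i, ((Q.tIn L e)⁻¹ - w / Q.qIn L / w)) *
      (∏ e ∈ Q.edges i i, (1 - w * Q.tIn L e / (w / Q.qIn L * Q.qIn L))) =
      ∏ e ∈ Q.edges i i, (((Q.tIn L e)⁻¹ - 1) * (1 - Q.tIn L e / Q.qIn L)) := by
    rw [← Finset.prod_mul_distrib]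
    refine Finset.prod_congr rfl fun e _ => ?_
    have := Q.tIn_ne_zero (L := L) e
    field_simp
  rw [psiConst, psiNumer, h1, if_pos rfl]
  generalize (∏ e ∈ Q.edges i i, (((Q.tIn L e)⁻¹ - 1) * (1 - Q.tIn L e / Q.qIn L)) : L) = A at *
  have h2 : Q.qIn L - 1 ≠ 0 := sub_ne_zero.2 hq1
  have e1 : w / Q.qIn L - w = -(w * (Q.qIn L - 1) / Q.qIn L) := by
    field_simp
    ring
  rw [e1]
  field_simp
  ring

theorem erase_prod_bool {ι M : Type*} [Fintype ι] [DecidableEq ι] [CommMonoid M] (r : ι) (b : Bool)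
    (f : ι × Bool → M) : ∏ p ∈ Finset.univ.erase (r, b), f p =
      f (r, !b) * ∏ s ∈ Finset.univ.erase r, (f (s, true) * f (s, false)) := by
  have h : (Finset.univ.erase (r, b) : Finset (ι × Bool)) =
      insert (r, !b) ((Finset.univ.erase r) ×ˢ Finset.univ) := by
    ext ⟨s, c⟩
    by_cases hs : s = r <;> cases b <;> cases c <;> simp [hs]
  rw [h, Finset.prod_insert (by simp), Finset.prod_product]
  congr 1
  exact Finset.prod_congr rfl fun s _ => Fintype.prod_bool _

/-- The residues of `ψ_i(z)` away from the constant factor. -/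
theorem residue_psiFun (u : Vars d.a) (b : Bool) (n : ℤ) :
    (Q.psiPole u.1 (u.2, b) : CoeffField d.a) ^ (n - 1) *
      LaurentPolynomial.evalUnit (Q.psiPole u.1 (u.2, b)) (Q.psiNumerPoly d u.1) /
        ∏ p ∈ Finset.univ.erase (u.2, b),
          ((Q.psiPole u.1 (u.2, b) : CoeffField d.a) - Q.psiPole u.1 p) =
    (Q.psiPole u.1 (u.2, b) : CoeffField d.a) ^ n *
      (Q.YPos d u (Q.psiPole u.1 (u.2, b)) * Q.YNeg d u (Q.psiPole u.1 (u.2, b))) *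
      ((Q.psiPole u.1 (u.2, b) : CoeffField d.a)⁻¹ * (Q.psiConst (CoeffField d.a) u.1 *
        Q.psiNumer u.1 u.1 (Q.psiPole u.1 (u.2, b) : CoeffField d.a) (w u)) /
        ((Q.psiPole u.1 (u.2, b) : CoeffField d.a) - Q.psiPole u.1 (u.2, !b))) := by
  set x := Q.psiPole (a := d.a) u.1 (u.2, b) with hx
  have hx0 := x.ne_zero
  have hprod : ∏ s ∈ Finset.univ.erase u.2, ((x - Q.psiPole u.1 (s, true) : CoeffField d.a) *
      (x - Q.psiPole u.1 (s, false))) = ∏ v ∈ Finset.univ.erase u, if u.1 = v.1 then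
        ((x : CoeffField d.a) - w v) * (x - w v / Q.qIn (CoeffField d.a)) else 1 := by
    rw [prod_erase_sigma]
    have h1 : ∏ j ∈ Finset.univ.erase u.1, ∏ s : Fin (d.a j), (if u.1 = j then
        ((x : CoeffField d.a) - w ⟨j, s⟩) * (x - w ⟨j, s⟩ / Q.qIn (CoeffField d.a)) else 1) = 1 :=
      Finset.prod_eq_one fun j hj => Finset.prod_eq_one fun s _ =>
        if_neg (Finset.ne_of_mem_erase hj).symm
    rw [h1, one_mul]
    refine Finset.prod_congr rfl fun s _ => ?_
    rw [if_pos rfl, psiPole_true, psiPole_false]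
  rw [erase_prod_bool u.2 b fun p => (x : CoeffField d.a) - Q.psiPole u.1 p, hprod,
    evalUnit_psiNumerPoly, YPos_mul_YNeg _ _ _ hx0]
  simp only [Algebra.algebraMap_self_apply]
  rw [← Finset.mul_prod_erase _ _ (Finset.mem_univ u), Finset.prod_congr rfl fun v _ =>
    Q.psiFactor_eq_div u.1 v.1 hx0 (wVar v).ne_zero, Finset.prod_div_distrib, zpow_sub_one₀ hx0]
  simp only [div_eq_mul_inv, mul_inv]
  ring

theorem isScalarTower_laurentSeries (K : Type*) [Field K] [Algebra ℂ K] :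
    @IsScalarTower ℂ K (LaurentSeries K) Algebra.toSMul Algebra.toSMul Algebra.toSMul :=
  IsScalarTower.of_algebraMap_eq (R := ℂ) (S := K) (A := LaurentSeries K) fun c => by
    rw [LaurentSeries.algebraMap_eq_C, LaurentSeries.algebraMap_complex]

/-- Partial fractions: the two expansions differ by a sum over the poles w and w/q, where the own
factor of the point contributes 1 and -1. -/
theorem psiCoeff_sub_psiCoeff (hQ : Q.Admissible) (i : I) (n : ℤ) :
    Q.psiCoeff d true i n - Q.psiCoeff d false i n = ∑ r : Fin (d.a i),
      (w ⟨i, r⟩ ^ n * (Q.YPos d ⟨i, r⟩ (w ⟨i, r⟩) * Q.YNeg d ⟨i, r⟩ (w ⟨i, r⟩)) -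
        (w ⟨i, r⟩ / Q.qIn (CoeffField d.a)) ^ n *
          (Q.YPos d ⟨i, r⟩ (w ⟨i, r⟩ / Q.qIn (CoeffField d.a)) *
            Q.YNeg d ⟨i, r⟩ (w ⟨i, r⟩ / Q.qIn (CoeffField d.a)))) := by
  have h := LaurentSeries.coeff_sub_coeff_prod (Q.psiNumerPoly d i) (Q.psiPole i)
    (Q.psiPole_injective hQ i) n
  have h1 : ∀ s : ℤ, LaurentPolynomial.evalUnit (LaurentSeries.monomialUnit (CoeffField d.a) s)
      (Q.psiNumerPoly d i) / ∏ p : Fin (d.a i) × Bool, ((LaurentSeries.monomialUnit (CoeffField d.a) s :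
        LaurentSeries (CoeffField d.a)) - HahnSeries.C (Q.psiPole i p : CoeffField d.a)) =
      Q.psiFun d i (HahnSeries.single s 1 : LaurentSeries (CoeffField d.a)) := by
    intro s
    have := isScalarTower_laurentSeries (CoeffField d.a)
    have := Q.psiFun_eq_div d i (LaurentSeries.monomialUnit (CoeffField d.a) s)
    simp only [LaurentSeries.algebraMap_eq_C] at this
    exact this.symm
  rw [h1, h1] at h
  rw [psiCoeff, psiCoeff, if_pos rfl, if_neg (by simp), h, Fintype.sum_prod_type]
  refine Finset.sum_congr rfl fun r _ => ?_
  rw [Fintype.sum_bool, Q.residue_psiFun d ⟨i, r⟩ true, Q.residue_psiFun d ⟨i, r⟩ false]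
  simp only [Bool.not_true, Bool.not_false, psiPole_true, psiPole_false]
  rw [Q.inv_mul_psiConst_mul_psiNumer hQ i (wVar ⟨i, r⟩).ne_zero,
    Q.inv_mul_psiConst_mul_psiNumer_div hQ i (wVar ⟨i, r⟩).ne_zero]
  ring

/-! ### The commutator of `e` and `f` -/

theorem dOp_sub {a : I → ℕ} (c c' : CoeffField a) (m : Vars a → ℤ) :
    Q.dOp (c - c') m = Q.dOp c m - Q.dOp c' m :=
  (Q.dOpLinear m).map_sub c c'

/-- Passing D_u⁻¹ to the right of the coefficient of f moves its argument from w_u/q to w_u, and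
passing D_u to the right of that of e moves it from w_u to w_u/q. So the two orders give YY' at the
two poles. -/
theorem e_f_diagonal (u : Vars d.a) (r s : ℤ) :
    Q.dOp (w u ^ r * Q.YPos d u (w u)) (-Pi.single u 1) *
        Q.dOp ((w u / Q.qIn (CoeffField d.a)) ^ s * Q.YNeg d u (w u / Q.qIn (CoeffField d.a)))
          (Pi.single u 1) -
      Q.dOp ((w u / Q.qIn (CoeffField d.a)) ^ s * Q.YNeg d u (w u / Q.qIn (CoeffField d.a)))
          (Pi.single u 1) * Q.dOp (w u ^ r * Q.YPos d u (w u)) (-Pi.single u 1) =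
      Q.dOp (w u ^ (r + s) * (Q.YPos d u (w u) * Q.YNeg d u (w u)) -
        (w u / Q.qIn (CoeffField d.a)) ^ (r + s) * (Q.YPos d u (w u / Q.qIn (CoeffField d.a)) *
            Q.YNeg d u (w u / Q.qIn (CoeffField d.a)))) 0 := by
  have hq : Q.qIn (CoeffField d.a) ≠ 0 := Q.qIn_ne_zero
  have hw := (wVar u).ne_zero
  have h1 : Q.shiftHom (-Pi.single u 1) (w u / Q.qIn (CoeffField d.a)) = w u := by
    rw [map_div₀, map_qIn, shiftHom_w_neg, mul_div_cancel_right₀ _ hq]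
  have h2 : Q.shiftHom (-Pi.single u 1) (Q.YNeg d u (w u / Q.qIn (CoeffField d.a))) =
      Q.YNeg d u (w u) := by
    rw [← Pi.single_neg, shiftHom_YNeg, Pi.single_neg, h1]
  rw [dOp_mul, dOp_mul, ← shiftHom_apply, ← shiftHom_apply, neg_add_cancel, add_neg_cancel,
    ← dOp_sub, map_mul, map_mul, map_zpow₀, map_zpow₀, h1, h2, shiftHom_YPos, shiftHom_w_pos,
    zpow_add₀ hw, zpow_add₀ (div_ne_zero hw hq)]
  refine congrArg (fun c => Q.dOp c 0) ?_
  ring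

/-- In each order one of the two coefficients is multiplied by the same ratio, so the products
agree. -/
theorem e_f_offDiagonal {u v : Vars d.a} (huv : u ≠ v) (r s : ℤ) :
    Q.dOp (w u ^ r * Q.YPos d u (w u)) (-Pi.single u 1) *
        Q.dOp ((w v / Q.qIn (CoeffField d.a)) ^ s * Q.YNeg d v (w v / Q.qIn (CoeffField d.a)))
          (Pi.single v 1) =
      Q.dOp ((w v / Q.qIn (CoeffField d.a)) ^ s * Q.YNeg d v (w v / Q.qIn (CoeffField d.a)))
          (Pi.single v 1) * Q.dOp (w u ^ r * Q.YPos d u (w u)) (-Pi.single u 1) := by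
  have h1 : Q.shiftHom (-Pi.single u 1) (w v / Q.qIn (CoeffField d.a)) =
      w v / Q.qIn (CoeffField d.a) := by
    rw [map_div₀, map_qIn, ← Pi.single_neg, Q.shiftHom_w_of_ne huv.symm]
  rw [dOp_mul, dOp_mul, ← shiftHom_apply, ← shiftHom_apply, add_comm, map_mul, map_mul, map_zpow₀,
    map_zpow₀, h1, Q.shiftHom_w_of_ne huv, shiftHom_YPos_of_ne _ _ huv, shiftHom_YNeg_of_ne _ _ huv]
  refine congrArg (fun c => Q.dOp c _) ?_
  ring

theorem e_f_relation (hQ : Q.Admissible) (i j : I) (r s : ℤ) :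
    Q.eImage d i r * Q.fImage d j s - Q.fImage d j s * Q.eImage d i r =
      if i = j then Q.dOp (Q.psiCoeff d true i (r + s)) 0 - Q.dOp (Q.psiCoeff d false i (r + s)) 0
      else 0 := by
  rw [eImage, fImage, Finset.sum_mul_sum, Finset.sum_mul_sum, Finset.sum_comm (s := Finset.univ (α := Fin (d.a j))),
    ← Finset.sum_sub_distrib]
  simp only [← Finset.sum_sub_distrib]
  split_ifs with hij
  · subst hij
    rw [← dOp_sub, psiCoeff_sub_psiCoeff _ _ hQ, dOp_sum]
    refine Finset.sum_congr rfl fun x _ => ?_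
    rw [Finset.sum_eq_single x, e_f_diagonal]
    · intro y _ hy
      exact sub_eq_zero.2 (Q.e_f_offDiagonal d (by simpa using hy.symm) r s)
    · intro h
      exact absurd (Finset.mem_univ _) h
  · refine Finset.sum_eq_zero fun x _ => Finset.sum_eq_zero fun y _ => ?_
    exact sub_eq_zero.2 (Q.e_f_offDiagonal d (fun h => hij (congrArg Sigma.fst h)) r s)

end WeightedQuiver

end

/-! ### The homomorphism from the shifted algebra and its compatibility with Υ. -/

noncomputable section

namespace WeightedQuiver

variable {I E : Type*} [Fintype I] [DecidableEq I] [Fintype E] (Q : WeightedQuiver I E)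
  (d : GKLOData I)

/-! ### The homomorphism from the shifted quantum quiver algebra -/

/-- The images of the generators. -/
def genImage : Gen I → Q.DiffOp d.a
  | Gen.e i n => Q.eImage d i n
  | Gen.f i n => Q.fImage d i n
  | Gen.psi ε i n => Q.dOp (Q.psiCoeff d ε i n) 0
  | Gen.psiInv ε i => Q.dOp (Q.psiCoeff d ε i (Q.leadIndex d ε i))⁻¹ 0

theorem dOp_zero_mul {a : I → ℕ} (c c' : CoeffField a) :
    Q.dOp c 0 * Q.dOp c' 0 = Q.dOp (c * c') 0 := (map_mul Q.coeffHom c c').symm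

theorem eImage_eq {Φ : Q.BigShuffle →ₐ[ℂ] Q.ATildeExt d.a}
    (hΦ : ∀ k F, (Φ (Q.ofSym k F) : Q.DiffOp d.a) = Q.imagePos d k F) (i : I) (n : ℤ) :
    (Φ (Q.xPow i n) : Q.DiffOp d.a) = Q.eImage d i n :=
  (hΦ _ _).trans (Q.imagePos_monomial d i n)

theorem fImage_eq {Φ : (Q.BigShuffle)ᵐᵒᵖ →ₐ[ℂ] Q.ATildeExt d.a}
    (hΦ : ∀ k F, (Φ (MulOpposite.op (Q.ofSym k F)) : Q.DiffOp d.a) = Q.imageNeg d k F)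
    (i : I) (n : ℤ) : (Φ (MulOpposite.op (Q.xPow i n)) : Q.DiffOp d.a) = Q.fImage d i n :=
  (hΦ _ _).trans (Q.imageNeg_monomial d i n)

theorem genImage_mem (hQ : Q.Admissible) (g : Gen I) : Q.genImage d g ∈ Q.ATilde d.a := by
  cases g with
  | e i n =>
    obtain ⟨Φ, h1, h2⟩ := Q.exists_phiPos d hQ
    have := h2 _ (Q.xPow_mem_smallShuffle i n)
    rwa [Q.eImage_eq d h1] at this
  | f i n =>
    obtain ⟨Φ, h1, h2⟩ := Q.exists_phiNeg d hQ
    have := h2 _ (Q.xPow_mem_smallShuffle i n)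
    rwa [Q.fImage_eq d h1] at this
  | psi ε i n => exact Q.dOp_mem le_rfl (Q.psiCoeff_mem d hQ ε i n) 0
  | psiInv ε i => exact Q.dOp_mem le_rfl (Q.isUnitIn_psiCoeff d hQ ε i).2.2 0

/-- Both sides are algebra maps on the free algebra that agree on generators. Hence any relation
between the x_{i,1}^r in the shuffle algebra holds for the operators. -/
theorem lift_genImage_e {Φ : Q.BigShuffle →ₐ[ℂ] Q.ATildeExt d.a}
    (hΦ : ∀ k F, (Φ (Q.ofSym k F) : Q.DiffOp d.a) = Q.imagePos d k F)
    (x : FreeAlgebra ℂ (I × ℤ)) :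
    FreeAlgebra.lift ℂ (Q.genImage d)
        (FreeAlgebra.lift ℂ (fun p : I × ℤ => (Gen.e p.1 p.2).free) x) =
      (Φ (Q.shuffleEval x) : Q.DiffOp d.a) := by
  have h : (FreeAlgebra.lift ℂ (Q.genImage d)).comp
      (FreeAlgebra.lift ℂ (fun p : I × ℤ => (Gen.e p.1 p.2).free)) =
      (((Q.ATildeExt d.a).val.comp Φ).comp Q.shuffleEval) := by
    refine FreeAlgebra.hom_ext (funext fun p => ?_)
    have e1 : FreeAlgebra.lift ℂ (Q.genImage d) (FreeAlgebra.lift ℂ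
      (fun p : I × ℤ => (Gen.e p.1 p.2).free) (FreeAlgebra.ι ℂ p)) = Q.eImage d p.1 p.2 := by
      rw [FreeAlgebra.lift_ι_apply, FreeAlgebra.lift_ι_apply, genImage]
    have e2 : (Φ (Q.shuffleEval (FreeAlgebra.ι ℂ p)) : Q.DiffOp d.a) = Q.eImage d p.1 p.2 := by
      rw [shuffleEval, FreeAlgebra.lift_ι_apply, Q.eImage_eq d hΦ]
    exact e1.trans e2.symm
  exact congrArg (fun f : FreeAlgebra ℂ (I × ℤ) →ₐ[ℂ] Q.DiffOp d.a => f x) h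

theorem lift_genImage_f {Φ : (Q.BigShuffle)ᵐᵒᵖ →ₐ[ℂ] Q.ATildeExt d.a}
    (hΦ : ∀ k F, (Φ (MulOpposite.op (Q.ofSym k F)) : Q.DiffOp d.a) = Q.imageNeg d k F)
    (x : FreeAlgebra ℂ (I × ℤ)) :
    FreeAlgebra.lift ℂ (Q.genImage d)
        (FreeAlgebra.lift ℂ (fun p : I × ℤ => (Gen.f p.1 p.2).free) x) =
      (Φ (Q.shuffleEvalOp x) : Q.DiffOp d.a) := by
  have h : (FreeAlgebra.lift ℂ (Q.genImage d)).comp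
      (FreeAlgebra.lift ℂ (fun p : I × ℤ => (Gen.f p.1 p.2).free)) =
      (((Q.ATildeExt d.a).val.comp Φ).comp Q.shuffleEvalOp) := by
    refine FreeAlgebra.hom_ext (funext fun p => ?_)
    have e1 : FreeAlgebra.lift ℂ (Q.genImage d) (FreeAlgebra.lift ℂ
      (fun p : I × ℤ => (Gen.f p.1 p.2).free) (FreeAlgebra.ι ℂ p)) = Q.fImage d p.1 p.2 := by
      rw [FreeAlgebra.lift_ι_apply, FreeAlgebra.lift_ι_apply, genImage]
    have e2 : (Φ (Q.shuffleEvalOp (FreeAlgebra.ι ℂ p)) : Q.DiffOp d.a) = Q.fImage d p.1 p.2 := by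
      rw [shuffleEvalOp, FreeAlgebra.lift_ι_apply, Q.fImage_eq d hΦ]
    exact e1.trans e2.symm
  exact congrArg (fun f : FreeAlgebra ℂ (I × ℤ) →ₐ[ℂ] Q.DiffOp d.a => f x) h

theorem shuffleEval_eq_of_rel {x y : FreeAlgebra ℂ (I × ℤ)} (h : Q.PosRel x y) :
    Q.shuffleEval x = Q.shuffleEval y := by
  rw [← upsilonPos_mk, ← upsilonPos_mk, RingQuot.mkAlgHom_rel ℂ h]

theorem shuffleEvalOp_eq_of_rel {x y : FreeAlgebra ℂ (I × ℤ)} (h : Q.NegRel x y) :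
    Q.shuffleEvalOp x = Q.shuffleEvalOp y := by
  rw [← upsilonNeg_mk, ← upsilonNeg_mk, RingQuot.mkAlgHom_rel ℂ h]

theorem dOp_lead_mul_inv (hQ : Q.Admissible) (ε : Bool) (i : I) :
    Q.dOp (Q.psiCoeff d ε i (Q.leadIndex d ε i)) 0 *
      Q.dOp (Q.psiCoeff d ε i (Q.leadIndex d ε i))⁻¹ 0 = 1 := by
  rw [dOp_zero_mul, mul_inv_cancel₀ (Q.isUnitIn_psiCoeff d hQ ε i).1]
  rfl

theorem dOp_inv_lead_mul (hQ : Q.Admissible) (ε : Bool) (i : I) :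
    Q.dOp (Q.psiCoeff d ε i (Q.leadIndex d ε i))⁻¹ 0 *
      Q.dOp (Q.psiCoeff d ε i (Q.leadIndex d ε i)) 0 = 1 := by
  rw [dOp_zero_mul, inv_mul_cancel₀ (Q.isUnitIn_psiCoeff d hQ ε i).1]
  rfl

theorem dOp_zero {a : I → ℕ} (m : Vars a → ℤ) : Q.dOp (0 : CoeffField a) m = 0 :=
  (Q.dOpLinear m).map_zero

/-- The quadratic and cubic relations hold in the shuffle algebras, and the images of e and f factor
through these. Only the relations involving ψ and the commutator of e and f need the explicit
series. -/
theorem lift_genImage_rel (hQ : Q.Admissible) {x y : FreeAlgebra ℂ (Gen I)}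
    (h : Q.ShiftedRel (Q.bPlus d) (Q.bMinus d) x y) :
    FreeAlgebra.lift ℂ (Q.genImage d) x = FreeAlgebra.lift ℂ (Q.genImage d) y := by
  have hι : ∀ g : Gen I, FreeAlgebra.lift ℂ (Q.genImage d) g.free = Q.genImage d g :=
    fun g => FreeAlgebra.lift_ι_apply _ _
  have hs : ∀ (p : LaurentPolynomial ℂ) (X : ℤ → ℤ → FreeAlgebra ℂ (Gen I)) (r s : ℤ),
      FreeAlgebra.lift ℂ (Q.genImage d) (seriesCoeff p X r s) =
        seriesCoeff p (fun r s => FreeAlgebra.lift ℂ (Q.genImage d) (X r s)) r s := fun p X r s =>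
    map_seriesCoeff (FreeAlgebra.lift ℂ (Q.genImage d)).toLinearMap p X r s
  cases h with
  | psi_plus_zero i n h => rw [hι, map_zero, genImage, Q.psiCoeff_true_eq_zero d hQ h, dOp_zero]
  | psi_minus_zero i n h => rw [hι, map_zero, genImage, Q.psiCoeff_false_eq_zero d hQ h, dOp_zero]
  | psi_comm ε ε' i j m n =>
    rw [map_mul, map_mul, hι, hι, genImage, genImage, dOp_zero_mul, dOp_zero_mul, mul_comm]
  | psi_plus_inv i =>
    rw [map_mul, map_one, hι, hι]
    exact Q.dOp_lead_mul_inv d hQ true i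
  | psi_plus_inv_left i =>
    rw [map_mul, map_one, hι, hι]
    exact Q.dOp_inv_lead_mul d hQ true i
  | psi_minus_inv i =>
    rw [map_mul, map_one, hι, hι]
    exact Q.dOp_lead_mul_inv d hQ false i
  | psi_minus_inv_left i =>
    rw [map_mul, map_one, hι, hι]
    exact Q.dOp_inv_lead_mul d hQ false i
  | pos x y h =>
    obtain ⟨Φ, hΦ, -⟩ := Q.exists_phiPos d hQ
    rw [Q.lift_genImage_e d hΦ, Q.lift_genImage_e d hΦ, Q.shuffleEval_eq_of_rel h]
  | neg x y h =>
    obtain ⟨Φ, hΦ, -⟩ := Q.exists_phiNeg d hQ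
    rw [Q.lift_genImage_f d hΦ, Q.lift_genImage_f d hΦ, Q.shuffleEvalOp_eq_of_rel h]
  | psi_e ε i j r s =>
    rw [hs, hs]
    simp only [map_mul, hι, genImage]
    exact Q.psi_e_relation d ε i j r s
  | psi_f ε i j r s =>
    rw [hs, hs]
    simp only [map_mul, hι, genImage]
    exact Q.psi_f_relation d ε i j r s
  | e_f i j r s =>
    rw [map_sub, map_mul, map_mul, apply_ite (FreeAlgebra.lift ℂ (Q.genImage d)), map_sub, map_zero]
    simp only [hι, genImage]
    exact Q.e_f_relation d hQ i j r s

/-- The GKLO-type homomorphism. -/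
def gklo (hQ : Q.Admissible) : Q.Shifted (Q.bPlus d) (Q.bMinus d) →ₐ[ℂ] Q.ATilde d.a :=
  (RingQuot.liftAlgHom ℂ ⟨FreeAlgebra.lift ℂ (Q.genImage d),
      fun _ _ h => Q.lift_genImage_rel d hQ h⟩).codRestrict (Q.ATilde d.a) fun x => by
    obtain ⟨x, rfl⟩ := RingQuot.mkAlgHom_surjective ℂ _ x
    rw [RingQuot.liftAlgHom_mkAlgHom_apply]
    induction x using FreeAlgebra.induction with
    | grade0 c =>
      rw [AlgHom.commutes]
      exact (Q.ATilde d.a).algebraMap_mem c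
    | grade1 g =>
      rw [FreeAlgebra.lift_ι_apply]
      exact Q.genImage_mem d hQ g
    | mul x y hx hy =>
      rw [map_mul]
      exact mul_mem hx hy
    | add x y hx hy =>
      rw [map_add]
      exact add_mem hx hy

theorem gklo_mk (hQ : Q.Admissible) (x : FreeAlgebra ℂ (Gen I)) :
    (Q.gklo d hQ (RingQuot.mkAlgHom ℂ (Q.ShiftedRel (Q.bPlus d) (Q.bMinus d)) x) : Q.DiffOp d.a) =
      FreeAlgebra.lift ℂ (Q.genImage d) x :=
  RingQuot.liftAlgHom_mkAlgHom_apply ℂ _ _ x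

theorem gklo_of (hQ : Q.Admissible) (g : Gen I) :
    (Q.gklo d hQ (Shifted.of Q _ _ g) : Q.DiffOp d.a) = Q.genImage d g :=
  (Q.gklo_mk d hQ _).trans (FreeAlgebra.lift_ι_apply _ _)

theorem isGKLO_gklo (hQ : Q.Admissible) : Q.IsGKLO d (Q.gklo d hQ) where
  map_e i n := Q.gklo_of d hQ (Gen.e i n)
  map_f i n := Q.gklo_of d hQ (Gen.f i n)
  map_psi ε i n := Q.gklo_of d hQ (Gen.psi ε i n)

theorem phiPos_upsilonPos (hQ : Q.Admissible) {Φ : Q.BigShuffle →ₐ[ℂ] Q.ATildeExt d.a}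
    (hΦ : ∀ k F, (Φ (Q.ofSym k F) : Q.DiffOp d.a) = Q.imagePos d k F) (x : Q.UPos) :
    (Φ (Q.upsilonPos x) : Q.DiffOp d.a) =
      Q.gklo d hQ (Q.posIncl (Q.bPlus d) (Q.bMinus d) x) := by
  obtain ⟨x, rfl⟩ := RingQuot.mkAlgHom_surjective ℂ Q.PosRel x
  have h : Q.posIncl (Q.bPlus d) (Q.bMinus d) (RingQuot.mkAlgHom ℂ Q.PosRel x) =
      RingQuot.mkAlgHom ℂ _ (FreeAlgebra.lift ℂ (fun p : I × ℤ => (Gen.e p.1 p.2).free) x) :=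
    RingQuot.liftAlgHom_mkAlgHom_apply ℂ _ _ x
  rw [upsilonPos_mk, h, gklo_mk, Q.lift_genImage_e d hΦ]

theorem phiNeg_upsilonNeg (hQ : Q.Admissible) {Φ : (Q.BigShuffle)ᵐᵒᵖ →ₐ[ℂ] Q.ATildeExt d.a}
    (hΦ : ∀ k F, (Φ (MulOpposite.op (Q.ofSym k F)) : Q.DiffOp d.a) = Q.imageNeg d k F) (x : Q.UNeg) :
    (Φ (Q.upsilonNeg x) : Q.DiffOp d.a) =
      Q.gklo d hQ (Q.negIncl (Q.bPlus d) (Q.bMinus d) x) := by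
  obtain ⟨x, rfl⟩ := RingQuot.mkAlgHom_surjective ℂ Q.NegRel x
  have h : Q.negIncl (Q.bPlus d) (Q.bMinus d) (RingQuot.mkAlgHom ℂ Q.NegRel x) =
      RingQuot.mkAlgHom ℂ _ (FreeAlgebra.lift ℂ (fun p : I × ℤ => (Gen.f p.1 p.2).free) x) :=
    RingQuot.liftAlgHom_mkAlgHom_apply ℂ _ _ x
  rw [upsilonNeg_mk, h, gklo_mk, Q.lift_genImage_f d hΦ]

end WeightedQuiver

end

theorem theorem5p5 {I E : Type*} [Fintype I] [DecidableEq I] [Fintype E]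
    (Q : WeightedQuiver I E)
    (hq : ∀ n : ℕ, 0 < n → Q.q ^ n ≠ 1)
    (ht : ∀ e, ‖(Q.q : ℂ)‖ < ‖(Q.t e : ℂ)‖ ∧ ‖(Q.t e : ℂ)‖ < 1)
    (d : GKLOData I) :
    ∃ Φ : Q.Shifted (Q.bPlus d) (Q.bMinus d) →ₐ[ℂ] Q.ATilde d.a, Q.IsGKLO d Φ ∧
      (∃ (Φpos : Q.BigShuffle →ₐ[ℂ] Q.ATildeExt d.a) (Υ : Q.UPos →ₐ[ℂ] Q.BigShuffle),
        (∀ (k : I → ℕ) (F : WeightedQuiver.SymLau k),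
          (Φpos (Q.ofSym k F) : Q.DiffOp d.a) = Q.imagePos d k F) ∧
        (∀ x ∈ Q.SmallShuffle, (Φpos x : Q.DiffOp d.a) ∈ Q.ATilde d.a) ∧
        (∀ i r, Υ (WeightedQuiver.UPos.e Q i r) = Q.xPow i r) ∧
        (∀ x, Υ x ∈ Q.SmallShuffle) ∧
        ∀ x, (Φpos (Υ x) : Q.DiffOp d.a) = Φ (Q.posIncl (Q.bPlus d) (Q.bMinus d) x)) ∧
      ∃ (Φneg : (Q.BigShuffle)ᵐᵒᵖ →ₐ[ℂ] Q.ATildeExt d.a)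
        (Υ : Q.UNeg →ₐ[ℂ] (Q.BigShuffle)ᵐᵒᵖ),
        (∀ (k : I → ℕ) (F : WeightedQuiver.SymLau k),
          (Φneg (MulOpposite.op (Q.ofSym k F)) : Q.DiffOp d.a) = Q.imageNeg d k F) ∧
        (∀ x ∈ Q.SmallShuffle, (Φneg (MulOpposite.op x) : Q.DiffOp d.a) ∈ Q.ATilde d.a) ∧
        (∀ i r, Υ (WeightedQuiver.UNeg.f Q i r) = MulOpposite.op (Q.xPow i r)) ∧
        (∀ x, (Υ x).unop ∈ Q.SmallShuffle) ∧
        ∀ x, (Φneg (Υ x) : Q.DiffOp d.a) = Φ (Q.negIncl (Q.bPlus d) (Q.bMinus d) x) := by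
  have hQ : Q.Admissible := ⟨hq, ht⟩
  obtain ⟨Φpos, h1, h2⟩ := Q.exists_phiPos d hQ
  obtain ⟨Φneg, h3, h4⟩ := Q.exists_phiNeg d hQ
  refine ⟨Q.gklo d hQ, Q.isGKLO_gklo d hQ,
    ⟨Φpos, Q.upsilonPos, h1, h2, fun i r => ?_, Q.upsilonPos_mem hQ, Q.phiPos_upsilonPos d hQ h1⟩,
    ⟨Φneg, Q.upsilonNeg, h3, h4, fun i r => ?_, Q.upsilonNeg_mem hQ, Q.phiNeg_upsilonNeg d hQ h3⟩⟩
  · exact (Q.upsilonPos_mk _).trans (FreeAlgebra.lift_ι_apply _ _)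
  · exact (Q.upsilonNeg_mk _).trans (FreeAlgebra.lift_ι_apply _ _)
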